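/- Let $m\ge 0$, $d=3+m$, let $G$ be an $m$-dimensional abelian Lie group, $b=(b_k)$ a basis of its Lie algebra, and let $V_3$ be an oriented smooth 3-manifold. All manifolds are Hausdorff and second countable, all objects are $C^\infty$. A *symmetric spacetime* over an open set $U\subseteq V_3$ is a $d$-dimensional Lorentzian manifold $(V_d,{}^{(d)}g)$ with a free smooth isometric action of $G$ with spacelike orbits, the orbits being the fibres of a submersion $\pi:V_d\to V_3$ with image $U$. Let $K_k$ be the Killing field generated by $b_k$, let $\xi_{kl}={}^{(d)}g(K_k,K_l)$, let $\underline g$ be the metric induced by ${}^{(d)}g$ on the quotient through the orthogonal complements of the orbits, and let $F^k$ be the curvature 2-forms of the connection $A^k=\xi^{kl}\,{}^{(d)}g(K_l,\cdot)$, i.e. $dA^k=\pi^*F^k$; so locally ${}^{(d)}g=\underline g+\xi_{kl}(\theta^k+a^k)(\theta^l+a^l)$, $F^k=da^k$, with $\theta^k$ the invariant 1-forms on $G$ dual to $b$. Put $X=\frac12\log\det\xi$ and $E_k=\underline{*}(e^{X}\xi_{kl}F^l)$, with $\underline *$ the Hodge star of $\underline g$. Let $D=1+\frac{m(m+1)}2+m$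 and let $\mathbb R^D$ have the coordinates $X$, $\xi_{kl}=\xi_{lk}$, $\omega_k$; on the part where $\xi$ is positive definite let $\mathbf G$ be the metric $$\mathbf G=dX^2+\tfrac14\xi^{kp}\xi^{lq}\,d\xi_{kl}\,d\xi_{pq}+\tfrac12e^{-2X}\xi^{kl}\,d\omega_k\,d\omega_l .$$ For a Lorentzian metric $\tilde g$ on $V_3$ and a map $u=(X,\xi,\omega):V_3\to(\mathbb R^D,\mathbf G)$ the *Einstein wave map system* is $$\tilde R_{\alpha\beta}=\partial_\alpha u\cdot\partial_\beta u,\qquad \hat\nabla_\alpha\tilde\partial^\alpha u=0,$$ with the dot the scalar product of $\mathbf G$, $\tilde R_{\alpha\beta}$ the Ricci tensor of $\tilde g$ and $\hat\nabla_\alpha\partial_\beta u^A=\partial_\alpha\partial_\beta u^A-\tilde\Gamma^\lambda_{\alpha\beta}\partial_\lambda u^A+\Gamma^A_{BC}\partial_\alpha u^B\partial_\beta u^C$, where $\tilde\Gamma$ and $\Gamma$ are the connection coefficients of $\tilde g$ and $\mathbf G$. **Theorem.** 1. Every symmetric spacetime over $V_3$ determines unique fields $(\underline g,\xi,F)$ on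 $V_3$ as above, with $\underline g$ Lorentzian, $\xi$ positive definite and all of them smooth. 2. If $\mathrm{Ric}({}^{(d)}g)=0$, the 1-forms $E_k$ are closed, so that $E_k=d\omega_k+H_k$ with $H_k$ a representative of the cohomology class of $E_k$. For a symmetric spacetime over $V_3$ with $H_k=0$, that is with $E_k=d\omega_k$ for functions $\omega_k$ on $V_3$, put $\tilde g=e^{2X}\underline g$ and $u=(X,\xi,\omega)$. Then $\mathrm{Ric}({}^{(d)}g)=0$ if and only if $(\tilde g,u)$ satisfies the Einstein wave map system. 3. Conversely let a Lorentzian metric $\tilde g$ on $V_3$ and a map $u=(X,\xi,\omega)$ with $\xi$ positive definite and $X=\frac12\log\det\xi$ satisfy the Einstein wave map system. Then there are unique fields $(\underline g,\xi,F)$ on $V_3$ with $\tilde g=e^{2X}\underline g$ and $\underline{*}(e^X\xi_{kl}F^l)=d\omega_k$; each point of $V_3$ has an open neighbourhood on which $F^k=da^k$ for some 1-forms $a^k$; and over every open set $U\subseteq V_3$ on which $F^k=da^k$ for some 1-forms $a^k$ there is a symmetric spacetime with $\mathrm{Ric}({}^{(d)}g)=0$ whose fields are the restrictions of $(\underline g,\xi,F)$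 to $U$. -/

import Mathlib

open scoped Manifold ContDiff

universe u

noncomputable section

namespace KaluzaKlein

/-! ### Coordinate formulas on an open set of `ι → ℝ` -/

section Coordinates

variable {ι : Type*} [Fintype ι] [DecidableEq ι]

/-- The partial derivative `∂ᵢ f` at `x`. -/
def pd (i : ι) (f : (ι → ℝ) → ℝ) (x : ι → ℝ) : ℝ :=
  fderiv ℝ f x (Pi.single i 1)

/-- The Christoffel symbol `Γᵏᵢⱼ` of the metric with components `g`. -/
def christoffel (g : (ι → ℝ) → Matrix ι ι ℝ) (k i j : ι) (x : ι → ℝ) : ℝ :=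
  (1 / 2) * ∑ l, (g x)⁻¹ k l *
    (pd i (fun y => g y j l) x + pd j (fun y => g y i l) x - pd l (fun y => g y i j) x)

/-- The component `Rᵢⱼ` of the Ricci tensor of the metric with components `g`
(sign convention: the Ricci tensor of a round sphere is positive). -/
def ricci (g : (ι → ℝ) → Matrix ι ι ℝ) (i j : ι) (x : ι → ℝ) : ℝ :=
  ∑ k, (pd k (christoffel g k i j) x - pd j (christoffel g k i k) x)
    + ∑ k, ∑ l, (christoffel g k k l x * christoffel g l i j x
        - christoffel g k j l x * christoffel g l i k x)

end Coordinates

/-! ### Tensor fields and Lorentzian metrics on a manifold modelled on `ι → ℝ` -/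

section Manifolds

variable {ι : Type*} [Fintype ι]
variable {M : Type*} [TopologicalSpace M] [ChartedSpace (ι → ℝ) M]

/-- The smooth charts of `M`: the members of its maximal smooth atlas. -/
abbrev smoothCharts (ι M : Type*) [Fintype ι] [TopologicalSpace M] [ChartedSpace (ι → ℝ) M] :
    Set (OpenPartialHomeomorph M (ι → ℝ)) :=
  IsManifold.maximalAtlas 𝓘(ℝ, ι → ℝ) ∞ M

/-- Covariant 2-tensor fields (no regularity). -/
abbrev Tensor2 (ι M : Type*) [Fintype ι] [TopologicalSpace M] [ChartedSpace (ι → ℝ) M] :=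
  ∀ x : M, LinearMap.BilinForm ℝ (TangentSpace 𝓘(ℝ, ι → ℝ) x)

/-- Fields of 1-forms (no regularity). -/
abbrev OneForm (ι M : Type*) [Fintype ι] [TopologicalSpace M] [ChartedSpace (ι → ℝ) M] :=
  ∀ x : M, TangentSpace 𝓘(ℝ, ι → ℝ) x →ₗ[ℝ] ℝ

variable [DecidableEq ι]

/-- The coordinate vector `∂/∂yⁱ` of the chart `e`, at the point with coordinates `y`. -/
def coordVec (e : OpenPartialHomeomorph M (ι → ℝ)) (y : ι → ℝ) (i : ι) :
    TangentSpace 𝓘(ℝ, ι → ℝ) (e.symm y) :=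
  mfderiv 𝓘(ℝ, ι → ℝ) 𝓘(ℝ, ι → ℝ) e.symm y (Pi.single i (1 : ℝ) : ι → ℝ)

/-- The components of a 2-tensor field in the chart `e`. -/
def comp2 (T : Tensor2 ι M) (e : OpenPartialHomeomorph M (ι → ℝ)) (y : ι → ℝ) : Matrix ι ι ℝ :=
  Matrix.of fun i j => T (e.symm y) (coordVec e y i) (coordVec e y j)

/-- The components of a 1-form in the chart `e`. -/
def comp1 (a : OneForm ι M) (e : OpenPartialHomeomorph M (ι → ℝ)) (i : ι) (y : ι → ℝ) : ℝ :=
  a (e.symm y) (coordVec e y i)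

/-- Smoothness of a 2-tensor field. -/
def Smooth2 (T : Tensor2 ι M) : Prop :=
  ∀ e ∈ smoothCharts ι M, ∀ i j, ContDiffOn ℝ ∞ (fun y => comp2 T e y i j) e.target

/-- Smooth Lorentzian metrics, of signature `(-, +, …, +)`. -/
structure LorentzMetric (ι M : Type*) [Fintype ι] [DecidableEq ι] [TopologicalSpace M]
    [ChartedSpace (ι → ℝ) M] where
  val : Tensor2 ι M
  symm : ∀ x v w, val x v w = val x w v
  lorentzian : ∀ x, ∃ v, val x v v < 0 ∧ ∀ w, val x v w = 0 → w ≠ 0 → 0 < val x w w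
  smooth : Smooth2 val

/-- The vacuum Einstein equations `Ric(g) = 0`. -/
def LorentzMetric.Vacuum (g : LorentzMetric ι M) : Prop :=
  ∀ e ∈ smoothCharts ι M, ∀ y ∈ e.target, ∀ i j, ricci (comp2 g.val e) i j y = 0

/-- On the open set `U` the 1-form `a` is smooth and `da = F`, that is
`F i j = ∂ᵢ aⱼ - ∂ⱼ aᵢ` in all smooth charts. -/
def IsPotentialOn (U : Set M) (a : OneForm ι M) (F : Tensor2 ι M) : Prop :=
  ∀ e ∈ smoothCharts ι M,
    (∀ i, ContDiffOn ℝ ∞ (comp1 a e i) (e.target ∩ e.symm ⁻¹' U)) ∧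
    ∀ y ∈ e.target, e.symm y ∈ U → ∀ i j,
      pd i (comp1 a e j) y - pd j (comp1 a e i) y = comp2 F e y i j

end Manifolds

/-! ### Lorentzian manifolds with a spacelike abelian isometry group -/

/-- A Lorentzian manifold `P = V_d` of dimension `d = 3 + m`, on which the `m`-dimensional abelian
Lie group `G` acts smoothly and freely by isometries with spacelike orbits, the orbits being the
fibres of a smooth submersion `π` to the 3-manifold `M = V₃`; so `P` is a principal `G`-bundle over
the open set `π(P)` of `M`, which is all of `M` when `π` is onto. -/
structure SymmetricSpacetime (m : ℕ)
    (G : Type u) [CommGroup G] [TopologicalSpace G] [ChartedSpace (Fin m → ℝ) G]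
    (M : Type u) [TopologicalSpace M] [ChartedSpace (Fin 3 → ℝ) M] where
  P : Type u
  [top : TopologicalSpace P]
  [t2 : T2Space P]
  [sc : SecondCountableTopology P]
  [charted : ChartedSpace (Fin (3 + m) → ℝ) P]
  [mfd : IsManifold 𝓘(ℝ, Fin (3 + m) → ℝ) ∞ P]
  /-- the metric of `P` -/
  met : LorentzMetric (Fin (3 + m)) P
  /-- the action of `G` -/
  act : G → P → P
  act_one : ∀ p, act 1 p = p
  act_mul : ∀ a b p, act (a * b) p = act a (act b p)
  act_free : ∀ a p, act a p = p → a = 1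
  act_smooth : ContMDiff (𝓘(ℝ, Fin m → ℝ).prod 𝓘(ℝ, Fin (3 + m) → ℝ)) 𝓘(ℝ, Fin (3 + m) → ℝ) ∞
    (fun q : G × P => act q.1 q.2)
  act_isometry : ∀ a p v w,
    met.val (act a p)
      (mfderiv 𝓘(ℝ, Fin (3 + m) → ℝ) 𝓘(ℝ, Fin (3 + m) → ℝ) (act a) p v)
      (mfderiv 𝓘(ℝ, Fin (3 + m) → ℝ) 𝓘(ℝ, Fin (3 + m) → ℝ) (act a) p w) = met.val p v w
  /-- the orbits are `m`-dimensional and spacelike -/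
  spacelike : ∀ p, ∀ c : TangentSpace 𝓘(ℝ, Fin m → ℝ) (1 : G), c ≠ 0 →
    0 < met.val (act 1 p)
      (mfderiv 𝓘(ℝ, Fin m → ℝ) 𝓘(ℝ, Fin (3 + m) → ℝ) (fun a : G => act a p) 1 c)
      (mfderiv 𝓘(ℝ, Fin m → ℝ) 𝓘(ℝ, Fin (3 + m) → ℝ) (fun a : G => act a p) 1 c)
  /-- the projection to the quotient -/
  proj : P → M
  proj_smooth : ContMDiff 𝓘(ℝ, Fin (3 + m) → ℝ) 𝓘(ℝ, Fin 3 → ℝ) ∞ proj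
  proj_submersion : ∀ p, Function.Surjective
    (mfderiv 𝓘(ℝ, Fin (3 + m) → ℝ) 𝓘(ℝ, Fin 3 → ℝ) proj p)
  proj_eq_iff : ∀ p q, proj p = proj q ↔ ∃ a, act a p = q

attribute [instance] SymmetricSpacetime.top SymmetricSpacetime.t2 SymmetricSpacetime.sc
  SymmetricSpacetime.charted SymmetricSpacetime.mfd

/-- Fields on the 3-manifold `M = V₃`: a Lorentzian metric `g`, a field `xi` of positive definite
symmetric matrices, and 2-forms `F 0, …, F (m - 1)`. -/
structure KKFields (m : ℕ) (M : Type*) [TopologicalSpace M] [ChartedSpace (Fin 3 → ℝ) M] where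
  g : LorentzMetric (Fin 3) M
  xi : M → Matrix (Fin m) (Fin m) ℝ
  xi_smooth : ∀ k l, ContMDiff 𝓘(ℝ, Fin 3 → ℝ) 𝓘(ℝ, ℝ) ∞ (fun x => xi x k l)
  xi_posDef : ∀ x, (xi x).PosDef
  F : Fin m → Tensor2 (Fin 3) M
  F_alt : ∀ k x v, F k x v v = 0
  F_smooth : ∀ k, Smooth2 (F k)

namespace SymmetricSpacetime

variable {m : ℕ}
  {G : Type u} [CommGroup G] [TopologicalSpace G] [ChartedSpace (Fin m → ℝ) G]
  {M : Type u} [TopologicalSpace M] [ChartedSpace (Fin 3 → ℝ) M]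
  (S : SymmetricSpacetime m G M)

/-- The Killing vector at `p` generated by an element of the Lie algebra `T₁G`. -/
def killing (c : TangentSpace 𝓘(ℝ, Fin m → ℝ) (1 : G)) (p : S.P) :
    TangentSpace 𝓘(ℝ, Fin (3 + m) → ℝ) p :=
  mfderiv 𝓘(ℝ, Fin m → ℝ) 𝓘(ℝ, Fin (3 + m) → ℝ) (fun a : G => S.act a p) 1 c

/-- The inner products of the Killing vectors of a basis `b` of the Lie algebra. -/
def gram (b : Module.Basis (Fin m) ℝ (TangentSpace 𝓘(ℝ, Fin m → ℝ) (1 : G))) (p : S.P) :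
    Matrix (Fin m) (Fin m) ℝ :=
  Matrix.of fun k l => S.met.val p (S.killing (b k) p) (S.killing (b l) p)

/-- The connection 1-form on `P` (its component `k` in the basis `b`) whose horizontal spaces are
the orthogonal complements of the orbits; it is `θᵏ + aᵏ` in a local trivialization. -/
def connection (b : Module.Basis (Fin m) ℝ (TangentSpace 𝓘(ℝ, Fin m → ℝ) (1 : G))) (k : Fin m) :
    OneForm (Fin (3 + m)) S.P :=
  fun p => ∑ l, (S.gram b p)⁻¹ k l • S.met.val p (S.killing (b l) p)

/-- The pull-back of a 2-tensor field by the projection `P → M`. -/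
def pullback (T : Tensor2 (Fin 3) M) : Tensor2 (Fin (3 + m)) S.P :=
  fun p => (T (S.proj p)).compl₁₂
    (mfderiv 𝓘(ℝ, Fin (3 + m) → ℝ) 𝓘(ℝ, Fin 3 → ℝ) S.proj p).toLinearMap
    (mfderiv 𝓘(ℝ, Fin (3 + m) → ℝ) 𝓘(ℝ, Fin 3 → ℝ) S.proj p).toLinearMap

/-- `D` consists of the quotient metric, the inner products of the Killing vectors and the
curvature of the connection, so that the metric of `P` is
`g + xiₖₗ (θᵏ + aᵏ) (θˡ + aˡ)` in local trivializations, with `F = da`. -/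
structure HasFields (b : Module.Basis (Fin m) ℝ (TangentSpace 𝓘(ℝ, Fin m → ℝ) (1 : G)))
    (D : KKFields m M) : Prop where
  xi_eq : ∀ p, S.gram b p = D.xi (S.proj p)
  g_eq : ∀ p v w, (∀ k, S.met.val p (S.killing (b k) p) v = 0) →
    (∀ k, S.met.val p (S.killing (b k) p) w = 0) →
    S.met.val p v w = S.pullback D.g.val p v w
  F_eq : ∀ k, IsPotentialOn Set.univ (S.connection b k) (S.pullback (D.F k))

end SymmetricSpacetime

/-! ### Twist forms -/

section Twist

variable {m : ℕ} {M : Type*} [TopologicalSpace M] [ChartedSpace (Fin 3 → ℝ) M]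

/-- An orientation of the 3-manifold `M`, given by a smooth 3-form without zeros. -/
structure OrientationForm (M : Type*) [TopologicalSpace M] [ChartedSpace (Fin 3 → ℝ) M] where
  form : ∀ x : M, (TangentSpace 𝓘(ℝ, Fin 3 → ℝ) x) [⋀^Fin 3]→ₗ[ℝ] ℝ
  ne_zero : ∀ x, form x ≠ 0
  smooth : ∀ e ∈ smoothCharts (Fin 3) M,
    ContDiffOn ℝ ∞ (fun y => form (e.symm y) (coordVec e y)) e.target

/-- The component `α β γ` of the volume form of the metric `g` for the given orientation: the
multiple of the orientation form by a positive function whose component `0 1 2` is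
`± |det g| ^ (1 / 2)`. -/
def volumeComp (o : OrientationForm M) (g : LorentzMetric (Fin 3) M)
    (e : OpenPartialHomeomorph M (Fin 3 → ℝ)) (y : Fin 3 → ℝ) (α β γ : Fin 3) : ℝ :=
  Real.sqrt |(comp2 g.val e y).det| / |o.form (e.symm y) (coordVec e y)| *
    o.form (e.symm y) ![coordVec e y α, coordVec e y β, coordVec e y γ]

/-- The function `X = log (det xi) ^ (1 / 2)`. -/
def KKFields.X (D : KKFields m M) (x : M) : ℝ :=
  (1 / 2) * Real.log (D.xi x).det

/-- The component `γ` of the twist form `Eₖ = ⋆ (e^X Fₖ)`, where `Fₖ = xiₖₗ Fˡ` and `⋆` is the Hodge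
star of `g`: `(⋆ F)_γ = (1 / 2) F^{αβ} η_{αβγ}`, with indices raised by `g`. -/
def KKFields.twist (D : KKFields m M) (o : OrientationForm M) (k : Fin m)
    (e : OpenPartialHomeomorph M (Fin 3 → ℝ)) (γ : Fin 3) (y : Fin 3 → ℝ) : ℝ :=
  Real.exp (D.X (e.symm y)) * ((1 / 2) * ∑ α, ∑ β, ∑ α', ∑ β',
    (comp2 D.g.val e y)⁻¹ α α' * (comp2 D.g.val e y)⁻¹ β β' *
      (∑ l, D.xi (e.symm y) k l * comp2 (D.F l) e y α' β') * volumeComp o D.g e y α β γ)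

/-- All twist forms are closed. -/
def KKFields.TwistClosed (D : KKFields m M) (o : OrientationForm M) : Prop :=
  ∀ e ∈ smoothCharts (Fin 3) M, ∀ y ∈ e.target, ∀ k α β,
    pd α (D.twist o k e β) y = pd β (D.twist o k e α) y

end Twist

/-! ### The target of the wave map -/

section Target

/-- The indices of the coordinates `X`, `ξ_{kl}` (`k`, `l` unordered) and `ω_k` of `ℝ^D`,
`D = 1 + m (m + 1) / 2 + m`. -/
abbrev TargetIndex (m : ℕ) := Unit ⊕ (Sym2 (Fin m) ⊕ Fin m)

/-- The target `ℝ^D`. -/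
abbrev Target (m : ℕ) := TargetIndex m → ℝ

variable {m : ℕ}

/-- The coordinate `X`. -/
def Target.X (u : Target m) : ℝ := u (Sum.inl ())

/-- The coordinates `ξ`, as a symmetric matrix. -/
def Target.xi (u : Target m) : Matrix (Fin m) (Fin m) ℝ :=
  Matrix.of fun k l => u (Sum.inr (Sum.inl s(k, l)))

/-- The coordinates `ω`. -/
def Target.omega (u : Target m) (k : Fin m) : ℝ := u (Sum.inr (Sum.inr k))

/-- The scalar product of `V` and `W` in the metric
`dX² + (1 / 4) ξ^{kp} ξ^{lq} dξ_{kl} dξ_{pq} + (1 / 2) e^{-2X} ξ^{kl} dω_k dω_l` at `u`. -/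
def targetInner (u V W : Target m) : ℝ :=
  V.X * W.X
    + (1 / 4) * ∑ k, ∑ l, ∑ p, ∑ q, u.xi⁻¹ k p * u.xi⁻¹ l q * (V.xi k l * W.xi p q)
    + (1 / 2) * Real.exp (-2 * u.X) * ∑ k, ∑ l, u.xi⁻¹ k l * (V.omega k * W.omega l)

/-- The components of the target metric. -/
def targetMetric (u : Target m) : Matrix (TargetIndex m) (TargetIndex m) ℝ :=
  Matrix.of fun A B => targetInner u (Pi.single A 1) (Pi.single B 1)

end Target

/-! ### The Einstein wave map system -/

section System

variable {m : ℕ} {M : Type*} [TopologicalSpace M] [ChartedSpace (Fin 3 → ℝ) M]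

/-- The partial derivative `∂_α u` of the map `u` in the chart `e`. -/
def mapPd (u : M → Target m) (e : OpenPartialHomeomorph M (Fin 3 → ℝ)) (α : Fin 3)
    (y : Fin 3 → ℝ) : Target m :=
  fun A => pd α (fun z => u (e.symm z) A) y

/-- The second covariant derivative `∇̂_α ∂_β u^A` of the map `u` from `(M, g)` to the target. -/
def mapHess (g : LorentzMetric (Fin 3) M) (u : M → Target m)
    (e : OpenPartialHomeomorph M (Fin 3 → ℝ)) (α β : Fin 3) (A : TargetIndex m)
    (y : Fin 3 → ℝ) : ℝ :=
  pd α (fun z => mapPd u e β z A) y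
    - ∑ l, christoffel (comp2 g.val e) l α β y * mapPd u e l y A
    + ∑ B, ∑ C, christoffel targetMetric A B C (u (e.symm y)) *
        (mapPd u e α y B * mapPd u e β y C)

/-- The Einstein equations `R_{αβ} = ∂_α u · ∂_β u` on `(M, g)` with source the map `u`, together
with the wave map equation `g^{αβ} ∇̂_α ∂_β u = 0`. -/
structure EinsteinWaveMap (g : LorentzMetric (Fin 3) M) (u : M → Target m) : Prop where
  einstein : ∀ e ∈ smoothCharts (Fin 3) M, ∀ y ∈ e.target, ∀ α β,
    ricci (comp2 g.val e) α β y = targetInner (u (e.symm y)) (mapPd u e α y) (mapPd u e β y)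
  wave : ∀ e ∈ smoothCharts (Fin 3) M, ∀ y ∈ e.target, ∀ A,
    ∑ α, ∑ β, (comp2 g.val e y)⁻¹ α β * mapHess g u e α β A y = 0

/-- `gt = e^{2X} g` and `u = (X, ξ, ω)` with `X = log (det ξ) ^ (1 / 2)` and `ω` a smooth family of
twist potentials, `Eₖ = dωₖ` (so that the harmonic parts of the twist forms are chosen zero). -/
structure Corresponds (o : OrientationForm M) (D : KKFields m M) (gt : LorentzMetric (Fin 3) M)
    (u : M → Target m) : Prop where
  smooth : ContMDiff 𝓘(ℝ, Fin 3 → ℝ) 𝓘(ℝ, Target m) ∞ u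
  X_eq : ∀ x, (u x).X = D.X x
  xi_eq : ∀ x, (u x).xi = D.xi x
  metric_eq : ∀ x, gt.val x = Real.exp (2 * (u x).X) • D.g.val x
  twist_eq : ∀ e ∈ smoothCharts (Fin 3) M, ∀ y ∈ e.target, ∀ k α,
    D.twist o k e α y = pd α (fun z => (u (e.symm z)).omega k) y

end System

end KaluzaKlein

end

noncomputable section
set_option linter.unusedSectionVars false
set_option autoImplicit false
set_option linter.unusedSimpArgs false
namespace KaluzaKlein
open Filter Topology Matrix
open Matrix renaming mul_apply → mmul, add_apply → madd, smul_apply → msmul, sum_apply → msum,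
  zero_apply → mzero, one_apply → mone, sub_apply → msub, neg_apply → mneg, mul_assoc → mmul_assoc,
  transpose_apply → tr_apply, nonsing_inv_mul → minv_mul, mul_nonsing_inv → mmul_inv,
  transpose_nonsing_inv → tr_inv
open IsManifold renaming chart_mem_maximalAtlas → chart_mem
open Finset renaming sum_sub_distrib → sum_sub, sum_add_distrib → sum_add,
  sum_neg_distrib → sum_neg, sum_const_zero → sum_zero
open Finset (sum_comm mul_sum sum_mul)
open Fin (castAdd natAdd append addCases addCases_left addCases_right sum_univ_three)
open Sum (inl inr)
open Matrix renaming one_mul → mone_mul, mul_one → mmul_one, mul_add → mmul_add,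
  add_mul → madd_mul, mul_smul → mmul_smul
open Pi renaming single_apply → psingle_apply, single → psingle
open LinearMap (BilinForm)
open LinearMap.BilinForm renaming smul_right → bsmul_r, smul_left → bsmul_l, sum_right → bsum_r,
  sum_left → bsum_l
open Function renaming comp_apply → fcomp_apply
open Function (Surjective surjInv)
open Fintype (sum_sum_type)
open OpenPartialHomeomorph (trans_target trans_source)
open Finset (univ mem_univ sum_eq_zero)
open Real (exp log)

/-- The model with corners of a manifold modelled on `ι → ℝ`. -/
notation:max "𝕀" ι:max => 𝓘(ℝ, ι → ℝ)

/-- Coordinate vectors. -/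
notation:max "ℝ^" ι:max => ι → ℝ

/-- The smooth charts of a manifold. -/
notation "𝒜" => smoothCharts

/-- Smoothness at a point. -/
notation "Smooth" => ContDiffAt ℝ ∞

/-- Differentiability at a point. -/
notation "Diff" => DifferentiableAt ℝ

/-- Christoffel symbols. -/
notation "Chr" => christoffel

/-- The coordinates of a sum of index sets. -/
notation "𝔢" => finSumFinEquiv

/-- The indices of the coordinates of a spacetime. -/
notation:max "𝔽" m:max => Fin (3 + m)

/-- Charts of a manifold modelled on `ι → ℝ`. -/
notation:max "Chart" M:max ι:max => OpenPartialHomeomorph M ℝ^ι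

/-- Bases of the Lie algebra of `G`. -/
notation:max "LieBasis" m:max G:max => Module.Basis (Fin m) ℝ (TangentSpace 𝓘(ℝ, Fin m → ℝ) (1 : G))

/-- The base coordinates. -/
notation:max z:max "♭" => z ∘ Fin.castAdd _

/-- The fibre coordinates. -/
notation:max z:max "♯" => z ∘ Fin.natAdd _

lemma sum_ext {ι R : Type*} [Fintype ι] [AddCommMonoid R] {f g : ι → R} (h : ∀ i, f i = g i) : ∑ i,
    f i = ∑ i, g i := Finset.sum_congr rfl fun i _ => h i

lemma sum_ext₂ {ι κ R : Type*} [Fintype ι] [Fintype κ] [AddCommMonoid R] {f g : ι → κ → R} (h : ∀ i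
    j, f i j = g i j) : ∑ i, ∑ j, f i j = ∑ i, ∑ j, g i j := sum_ext fun i => sum_ext fun j => h i j

section

variable {ι κ ν μ : Type*} [Fintype ι] [DecidableEq ι] [Fintype κ] [DecidableEq κ] [Fintype ν]
  [Fintype μ]

variable {i j : ι} {f g : ℝ^ι → ℝ} {x : ℝ^ι} {A B : ℝ^ι → Matrix κ ν ℝ}

lemma pd_congr (h : f =ᶠ[𝓝 x] g) : pd i f x = pd i g x := by simp only [pd, h.fderiv_eq]

lemma pd_eventuallyEq (h : f =ᶠ[𝓝 x] g) : pd i f =ᶠ[𝓝 x] pd i g := h.eventuallyEq_nhds.mono fun _ hy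
    => pd_congr hy

lemma contDiffAt_pd (hf : Smooth f x) : Smooth (pd i f) x := (hf.fderiv_right (m := ∞) (by exact
    le_rfl)).clm_apply contDiffAt_const

lemma ev_C2 {E F : Type*} [NormedAddCommGroup E] [NormedSpace ℝ E] [NormedAddCommGroup F]
    [NormedSpace ℝ F] {f : E → F} {x : E} (hf : Smooth f x) : ∀ᶠ z in 𝓝 x, ContDiffAt ℝ 2 f z :=
    (hf.of_le (m := 2) (WithTop.coe_le_coe.2 le_top)).eventually (by decide)

lemma ev_diffAt {E F : Type*} [NormedAddCommGroup E] [NormedSpace ℝ E] [NormedAddCommGroup F]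
    [NormedSpace ℝ F] {f : E → F} {x : E} (hf : Smooth f x) : ∀ᶠ z in 𝓝 x, Diff f z := (ev_C2
    hf).mono fun _ h => h.differentiableAt (by decide)

lemma diffAt {E F : Type*} [NormedAddCommGroup E] [NormedSpace ℝ E] [NormedAddCommGroup F]
    [NormedSpace ℝ F] {f : E → F} {x : E} (hf : Smooth f x) : Diff f x := hf.differentiableAt (by
    decide)

lemma pd_const (i : ι) (c : ℝ) (x : ℝ^ι) : pd i (fun _ => c) x = 0 := by simp [pd]

lemma pd_add (hf : Diff f x) (hg : Diff g x) : pd i (fun z => f z + g z) x = pd i f x + pd i g x :=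
    by simp [pd, fderiv_fun_add hf hg]

lemma pd_sub (hf : Diff f x) (hg : Diff g x) : pd i (fun z => f z - g z) x = pd i f x - pd i g x :=
    by simp [pd, fderiv_fun_sub hf hg]

lemma pd_neg : pd i (fun z => -f z) x = -pd i f x := by simp [pd, fderiv_fun_neg]

lemma pd_mul (hf : Diff f x) (hg : Diff g x) : pd i (fun z => f z * g z) x = pd i f x * g x + f x *
    pd i g x := by simp [pd, fderiv_fun_mul hf hg]; ring

lemma pd_const_mul (c : ℝ) (hf : Diff f x) : pd i (fun z => c * f z) x = c * pd i f x := by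
  rw [pd_mul (differentiableAt_const c) hf, pd_const, zero_mul, zero_add]

lemma pd_sum {s : Finset ν} {f : ν → ℝ^ι → ℝ} (hf : ∀ a ∈ s, Diff (f a) x) : pd i (fun z => ∑ a ∈ s,
    f a z) x = ∑ a ∈ s, pd i (f a) x := by simp only [pd, fderiv_fun_sum hf, _root_.sum_apply]

lemma pd_scalar_comp {φ : ℝ^ℝ} {φ' : ℝ} (hφ : HasDerivAt φ φ' (f x)) (hf : Diff f x) : pd i (fun z
    => φ (f z)) x = φ' * pd i f x := by
  have := hφ.comp_hasFDerivAt x hf.hasFDerivAt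
  simp only [pd]
  rw [show (fun z => φ (f z)) = φ ∘ f from rfl, this.fderiv]
  simp

lemma pd_exp (hf : Diff f x) : pd i (fun z => exp (f z)) x = exp (f x) * pd i f x := pd_scalar_comp
    (Real.hasDerivAt_exp _) hf

lemma pd_coord (i a : ι) (x : ℝ^ι) : pd i (fun z => z a) x = if i = a then 1 else 0 := by
  have : (fun z : ι → ℝ => z a) = ContinuousLinearMap.proj (R := ℝ) (φ := fun _ => ℝ) a := rfl
  rw [pd, this, ContinuousLinearMap.fderiv]
  simp [psingle_apply, eq_comm]

lemma fderiv_eq_sum_pd (v : ℝ^ι) : fderiv ℝ f x v = ∑ a, pd a f x * v a := by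
  conv_lhs => rw [pi_eq_sum_univ' v]
  simp [pd, mul_comm]

lemma pd_comp {f : ℝ^κ → ℝ} {τ : ℝ^ι → ℝ^κ} (hf : Diff f (τ x)) (hτ : Diff τ x) : pd i (fun z => f
    (τ z)) x = ∑ a, pd a f (τ x) * pd i (fun z => τ z a) x := by
  have h1 := fderiv_fun_comp x hf hτ
  have h2 : ∀ a, pd i (fun z => τ z a) x = fderiv ℝ τ x (psingle i 1) a := by
    intro a
    have := (hasFDerivAt_pi'.1 hτ.hasFDerivAt a).fderiv
    rw [pd, this]; rfl
  simp only [h2]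
  rw [pd, h1, ContinuousLinearMap.comp_apply, fderiv_eq_sum_pd]

lemma pd_comm (hf : ContDiffAt ℝ 2 f x) : pd i (pd j f) x = pd j (pd i f) x := by
  have hs : IsSymmSndFDerivAt ℝ f x := hf.isSymmSndFDerivAt (by simp)
  have hd : Diff (fderiv ℝ f) x := (hf.fderiv_right (m := 1) (by norm_num
    [one_add_one_eq_two])).differentiableAt (by decide)
  have key : ∀ a b : ι, pd a (pd b f) x = fderiv ℝ (fderiv ℝ f) x (psingle a 1) (psingle b 1) := by
    intro a b
    change fderiv ℝ (fun z => fderiv ℝ f z (psingle b 1)) x (psingle a 1) = _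
    rw [fderiv_clm_apply hd (differentiableAt_const _)]
    simp
  rw [key, key, hs]

/-- Entrywise partial derivative of a matrix-valued function. -/
def mpd (i : ι) (A : ℝ^ι → Matrix κ ν ℝ) (x : ℝ^ι) : Matrix κ ν ℝ :=
  of fun a b => pd i (fun z => A z a b) x

/-- Entrywise differentiability. -/
def EDiff (A : ℝ^ι → Matrix κ ν ℝ) (x : ℝ^ι) : Prop :=
  ∀ a b, Diff (fun z => A z a b) x

/-- Entrywise smoothness. -/
def MSmooth (A : ℝ^ι → Matrix κ ν ℝ) (x : ℝ^ι) : Prop :=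
  ∀ a b, Smooth (fun z => A z a b) x

lemma MSmooth.ediff (h : MSmooth A x) : EDiff A x := fun a b => diffAt (h a b)

lemma MSmooth.eventually_ediff (h : MSmooth A x) : ∀ᶠ z in 𝓝 x, EDiff A z := eventually_all.2 fun a
    => eventually_all.2 fun b => ev_diffAt (h a b)

lemma MSmooth.congr (h : MSmooth A x) (e : B =ᶠ[𝓝 x] A) : MSmooth B x := fun a b => (h a
    b).congr_of_eventuallyEq (e.mono fun z hz => by simp only [hz])

lemma MSmooth.mul {B : ℝ^ι → Matrix ν μ ℝ} (hA : MSmooth A x) (hB : MSmooth B x) : MSmooth (fun z =>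
    A z * B z) x := by
  intro a b
  simp only [mmul]
  exact ContDiffAt.sum fun c _ => (hA a c).mul (hB c b)

lemma MSmooth.add (hA : MSmooth A x) (hB : MSmooth B x) : MSmooth (fun z => A z + B z) x := fun a b
    => (hA a b).add (hB a b)

lemma MSmooth.transpose (hA : MSmooth A x) : MSmooth (fun z => (A z)ᵀ) x := fun a b => hA b a

lemma MSmooth.mpd (hA : MSmooth A x) (i : ι) : MSmooth (mpd i A) x := fun a b => contDiffAt_pd (hA a
    b)

lemma EDiff.mul {B : ℝ^ι → Matrix ν μ ℝ} (hA : EDiff A x) (hB : EDiff B x) : EDiff (fun z => A z * B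
    z) x := by
  intro a b
  simp only [mmul]
  exact DifferentiableAt.fun_sum fun c _ => (hA a c).mul (hB c b)

lemma EDiff.transpose (hA : EDiff A x) : EDiff (fun z => (A z)ᵀ) x := fun a b => hA b a

lemma mpd_congr (h : A =ᶠ[𝓝 x] B) : mpd i A x = mpd i B x := by
  ext a b
  exact pd_congr (h.mono fun z hz => by simp only [hz])

lemma mpd_const (A : Matrix κ ν ℝ) (x : ℝ^ι) : mpd i (fun _ => A) x = 0 := by
  ext a b
  exact pd_const _ _ _

lemma mpd_add (hA : EDiff A x) (hB : EDiff B x) : mpd i (fun z => A z + B z) x = mpd i A x + mpd i B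
    x := by
  ext a b
  exact pd_add (hA a b) (hB a b)

lemma mpd_mul {B : ℝ^ι → Matrix ν μ ℝ} (hA : EDiff A x) (hB : EDiff B x) : mpd i (fun z => A z * B
    z) x = mpd i A x * B x + A x * mpd i B x := by
  ext a b
  simp only [mpd, mmul, of_apply, madd]
  rw [← sum_add]
  refine (pd_sum (f := fun c z => A z a c * B z c b) fun c _ => (hA a c).mul (hB c b)).trans ?_
  exact sum_ext fun c => pd_mul (hA a c) (hB c b)

lemma mpd_transpose : mpd i (fun z => (A z)ᵀ) x = (mpd i A x)ᵀ := rfl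

lemma mpd_comm (hA : MSmooth A x) : mpd i (mpd j A) x = mpd j (mpd i A) x := by
  ext a b
  exact pd_comm (ev_C2 (hA a b)).self_of_nhds

lemma contDiffAt_det {A : ℝ^ι → Matrix κ κ ℝ} (hA : MSmooth A x) : Smooth (fun z => (A z).det) x :=
    by
  simp only [det_apply]
  refine ContDiffAt.sum fun σ _ => ContDiffAt.const_smul _ (contDiffAt_prod fun a _ => hA _ _)

lemma MSmooth.inv {A : ℝ^ι → Matrix κ κ ℝ} (hA : MSmooth A x) (h : (A x).det ≠ 0) : MSmooth (fun z
    => (A z)⁻¹) x := by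
  intro a b
  simp only [inv_def, msmul, Ring.inverse_eq_inv', smul_eq_mul, adjugate_apply]
  refine ((contDiffAt_det hA).inv h).mul (contDiffAt_det fun c d => ?_)
  simp only [updateRow_apply]
  split_ifs
  · exact contDiffAt_const
  · exact hA c d

lemma ev_det {A : ℝ^ι → Matrix κ κ ℝ} (hA : MSmooth A x) (h : (A x).det ≠ 0) : ∀ᶠ z in 𝓝 x, (A
    z).det ≠ 0 := (contDiffAt_det hA).continuousAt.eventually_ne h

lemma mpd_inv {A : ℝ^ι → Matrix κ κ ℝ} (hA : MSmooth A x) (h : (A x).det ≠ 0) : mpd i (fun z => (A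
    z)⁻¹) x = -((A x)⁻¹ * mpd i A x * (A x)⁻¹) := by
  have h1 : (fun z => (A z)⁻¹ * A z) =ᶠ[𝓝 x] fun _ => 1 := (ev_det hA h).mono fun z hz => minv_mul _
    hz.isUnit
  have h2 := mpd_congr (i := i) h1
  rw [mpd_mul (hA.inv h).ediff hA.ediff, mpd_const] at h2
  have h3 : A x * (A x)⁻¹ = 1 := mmul_inv _ h.isUnit
  calc mpd i (fun z => (A z)⁻¹) x = mpd i (fun z => (A z)⁻¹) x * (A x * (A x)⁻¹) := by
        rw [h3, mul_one]
    _ = (mpd i (fun z => (A z)⁻¹) x * A x + (A x)⁻¹ * mpd i A x) * (A x)⁻¹ - (A x)⁻¹ * mpd i A x *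
        (A x)⁻¹ := by noncomm_ring
    _ = _ := by rw [h2]; noncomm_ring

lemma pd_det {A : ℝ^ι → Matrix κ κ ℝ} (hA : MSmooth A x) (h : (A x).det ≠ 0) : pd i (fun z => (A
    z).det) x = (A x).det * ((A x)⁻¹ * mpd i A x).trace := by
  let D : (κ × κ → ℝ) → ℝ := fun v => (of fun a b => v (a, b)).det
  let τ : ℝ^ι → (κ × κ → ℝ) := fun z p => A z p.1 p.2
  have hD : Differentiable ℝ D := by
    intro v
    refine (contDiffAt_det (A := fun v : κ × κ → ℝ => of fun a b => v (a, b)) fun a b =>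
      ?_).differentiableAt (by decide)
    exact (contDiff_apply ℝ ℝ (a, b)).contDiffAt
  have hτ : Diff τ x := differentiableAt_pi.2 fun p => hA.ediff p.1 p.2
  have h1 : pd i (fun z => (A z).det) x = ∑ p, pd p D (τ x) * mpd i A x p.1 p.2 := pd_comp (f := D)
    (τ := τ) (hD _) hτ
  rw [h1, ← fderiv_eq_sum_pd (f := D) (x := τ x) (fun p : κ × κ => mpd i A x p.1 p.2)]
  set w : κ × κ → ℝ := fun p => mpd i A x p.1 p.2
  set B := (A x)⁻¹ * mpd i A x with hB
  have h2 : HasDerivAt (fun t : ℝ => D (τ x + t • w)) (fderiv ℝ D (τ x) w) 0 := by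
    have h3 : HasDerivAt (fun t : ℝ => τ x + t • w) w 0 := by
      simpa using ((hasDerivAt_id (0 : ℝ)).smul_const w).const_add (τ x)
    have h4 : HasFDerivAt D (fderiv ℝ D (τ x)) (τ x + (0 : ℝ) • w) := by
      simpa using (hD (τ x)).hasFDerivAt
    exact h4.comp_hasDerivAt (0 : ℝ) h3
  have h5 : ∀ t : ℝ, D (τ x + t • w) = (A x).det * (1 + t • B).det := by
    intro t
    rw [← det_mul]
    refine congrArg det ?_
    rw [mul_add, mul_one, hB, mmul_smul, ← mul_assoc, mmul_inv _ h.isUnit, one_mul]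
    ext a b
    simp [τ, w]
  have h6 : HasDerivAt (fun t : ℝ => (A x).det * (1 + t • B).det) ((A x).det * B.trace) 0 := by
    refine HasDerivAt.const_mul _ ?_
    rw [funext fun t : ℝ => det_one_add_smul t B]
    have := (((hasDerivAt_id (0 : ℝ)).const_mul B.trace).const_add 1).add ((Polynomial.hasDerivAt
      (det (1 + (Polynomial.X : Polynomial ℝ) • B.map Polynomial.C)).divX.divX 0).mul
      ((hasDerivAt_id (0 : ℝ)).pow 2))
    refine (this.congr_deriv (by simp)).congr_of_eventuallyEq (.of_forall fun t => ?_)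
    simp
  simp only [h5] at h2
  exact h2.unique h6

end

section

variable {ι κ : Type*} [Fintype ι] [DecidableEq ι] [Fintype κ] [DecidableEq κ]

open Matrix

variable {g : ℝ^ι → Matrix ι ι ℝ} {x : ℝ^ι} {θ : ι → ℝ^ι → Matrix κ κ ℝ} {J : ℝ^ι → Matrix κ ι ℝ} {K
  : ℝ^ι → Matrix ι κ ℝ}

lemma christoffel_unique (hs : (g x)ᵀ = g x) (hu : (g x).det ≠ 0) {Γ : ι → Matrix ι ι ℝ} (hΓ : ∀ i j
    k, Γ i k j = Γ j k i) (hc : ∀ k, mpd k g x = (Γ k)ᵀ * g x + g x * Γ k) (k i j : ι) : Chr g k i j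
    x = Γ i k j := by
  have hs' : ∀ a b, g x a b = g x b a := fun a b => congr_fun₂ hs b a
  have hc' : ∀ k a b, pd k (fun y => g y a b) x = ∑ p, (Γ k p a * g x p b + g x a p * Γ k p b) := by
    intro k a b
    have := congrFun (congrFun (hc k) a) b
    rw [sum_add]
    simpa [mpd, mmul] using this
  have h1 : ∀ l, pd i (fun y => g y j l) x + pd j (fun y => g y i l) x - pd l (fun y => g y i j) x =
      2 * ∑ p, g x l p * Γ i p j := by
    intro l
    rw [hc', hc', hc', ← sum_add, ← sum_sub, mul_sum]
    refine sum_ext fun p => ?_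
    rw [hΓ l i p, hΓ l j p, hΓ j i p, hs' p l, hs' p j]
    ring
  simp only [christoffel, h1]
  have h2 : (g x)⁻¹ * (g x * Γ i) = Γ i := by rw [← mul_assoc, minv_mul _ hu.isUnit, one_mul]
  have h3 := congr_fun₂ h2 k j
  rw [mmul] at h3
  rw [← h3, mul_sum]
  refine sum_ext fun l => ?_
  rw [mmul]
  ring

/-- The connection matrices of the Levi-Civita connection. -/
def lc (g : ℝ^ι → Matrix ι ι ℝ) (i : ι) (x : ℝ^ι) : Matrix ι ι ℝ :=
  of fun k j => Chr g k i j x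

lemma lc_apply (g : ℝ^ι → Matrix ι ι ℝ) (i k j : ι) (x : ℝ^ι) : lc g i x k j = Chr g k i j x := rfl

lemma christoffel_symm (hs : ∀ᶠ z in 𝓝 x, (g z)ᵀ = g z) (k i j : ι) : Chr g k i j x = Chr g k j i x
    := by
  have h : ∀ l, pd l (fun y => g y i j) x = pd l (fun y => g y j i) x := fun l => pd_congr (hs.mono
    fun z hz => congr_fun₂ hz j i)
  simp only [christoffel, h]
  congr 1
  exact sum_ext fun l => by ring

lemma mul_christoffel (hu : (g x).det ≠ 0) (l i j : ι) : ∑ k, g x l k * Chr g k i j x = (1 / 2) *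
    (pd i (fun y => g y j l) x + pd j (fun y => g y i l) x - pd l (fun y => g y i j) x) := by
  have h := mmul_inv _ hu.isUnit
  have key : g x *ᵥ ((g x)⁻¹ *ᵥ fun l => (1 / 2) * (pd i (fun y => g y j l) x + pd j (fun y => g y i
      l) x - pd l (fun y => g y i j) x)) = fun l => (1 / 2) * (pd i (fun y => g y j l) x + pd j (fun
      y => g y i l) x - pd l (fun y => g y i j) x) := by rw [mulVec_mulVec, h, one_mulVec]
  rw [← congrFun key l]
  simp only [mulVec, dotProduct, christoffel]
  refine sum_ext fun k => ?_
  rw [mul_sum]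
  congr 1
  exact sum_ext fun l => by ring

lemma lcMatrix_compat (hs : ∀ᶠ z in 𝓝 x, (g z)ᵀ = g z) (hu : (g x).det ≠ 0) (k : ι) : mpd k g x =
    (lc g k x)ᵀ * g x + g x * lc g k x := by
  have h : ∀ l i j, pd l (fun y => g y i j) x = pd l (fun y => g y j i) x := fun l i j => pd_congr
    (hs.mono fun z hz => congr_fun₂ hz j i)
  ext i j
  have h1 : ((lc g k x)ᵀ * g x) i j = ∑ p, g x j p * Chr g p k i x := by
    simp only [mmul, tr_apply, lc_apply]
    refine sum_ext fun p => ?_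
    rw [← congr_fun₂ hs.self_of_nhds j p, tr_apply, mul_comm]
  have h2 : (g x * lc g k x) i j = ∑ p, g x i p * Chr g p k j x := by simp only [mmul, lc_apply]
  rw [madd, h1, h2, mul_christoffel hu, mul_christoffel hu, h k j i, h j k i, h i k j]
  simp only [mpd, of_apply]
  ring

lemma lcMatrix_smooth (hg : MSmooth g x) (hu : (g x).det ≠ 0) (i : ι) : MSmooth (lc g i) x := by
  intro k j
  simp only [lc_apply, christoffel]
  refine contDiffAt_const.mul (ContDiffAt.sum fun l _ => (hg.inv hu k l).mul ?_)
  exact ((contDiffAt_pd (hg _ _)).add (contDiffAt_pd (hg _ _))).sub (contDiffAt_pd (hg _ _))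

/-- The curvature matrices of a connection. -/
def curv (θ : ι → ℝ^ι → Matrix κ κ ℝ) (i j : ι) (x : ℝ^ι) : Matrix κ κ ℝ :=
  mpd i (θ j) x - mpd j (θ i) x + (θ i x * θ j x - θ j x * θ i x)

lemma curv_congr {θ' : ι → ℝ^ι → Matrix κ κ ℝ} (h : ∀ i, θ i =ᶠ[𝓝 x] θ' i) (i j : ι) : curv θ i j x
    = curv θ' i j x := by
  simp only [curv, mpd_congr (h i), mpd_congr (h j), (h i).self_of_nhds, (h j).self_of_nhds]

lemma ricci_eq_sum_curv (hs : ∀ᶠ z in 𝓝 x, (g z)ᵀ = g z) (i j : ι) : ricci g i j x = ∑ k, curv (lc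
    g) k j x k i := by
  have hsym : ∀ᶠ z in 𝓝 x, ∀ k i j, Chr g k i j z = Chr g k j i z := hs.eventually_nhds.mono fun z
    hz => christoffel_symm hz
  simp only [ricci, curv, madd, msub, mmul, mpd, of_apply, lc_apply]
  rw [← sum_add]
  refine sum_ext fun k => ?_
  rw [sum_sub, pd_congr (hsym.mono fun z hz => hz k i j), pd_congr (i := j) (hsym.mono fun z hz =>
    hz k i k)]
  simp only [hsym.self_of_nhds _ i]

lemma mul_curv_of_gauge {Γ : ι → ℝ^ι → Matrix ι ι ℝ} (hJ : MSmooth J x) (hθ : ∀ i, MSmooth (θ i) x)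
    (hΓ : ∀ i, MSmooth (Γ i) x) (h : ∀ᶠ z in 𝓝 x, ∀ i, J z * Γ i z = θ i z * J z + mpd i J z) (i j :
    ι) : J x * curv Γ i j x = curv θ i j x * J x := by
  have h0 := h.self_of_nhds
  have h1 : ∀ i j, mpd j J x * Γ i x + J x * mpd j (Γ i) x = mpd j (θ i) x * J x + θ i x * mpd j J x
      + mpd j (mpd i J) x := by
    intro i j
    rw [← mpd_mul hJ.ediff (hΓ i).ediff, ← mpd_mul (hθ i).ediff hJ.ediff, ← mpd_add ((hθ i).mul
      hJ).ediff (hJ.mpd i).ediff]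
    exact mpd_congr (h.mono fun z hz => hz i)
  have h2 : ∀ i j, J x * mpd j (Γ i) x = mpd j (θ i) x * J x + θ i x * mpd j J x + mpd j (mpd i J) x
      - mpd j J x * Γ i x := fun i j => by rw [← h1 i j]; abel
  have h3 : ∀ i, mpd i J x = J x * Γ i x - θ i x * J x := fun i => by rw [h0 i]; abel
  have hc := mpd_comm (i := i) (j := j) hJ
  simp only [curv, mmul_add, Matrix.mul_sub, madd_mul, Matrix.sub_mul]
  rw [h2 i j, h2 j i, hc]
  have h4 : ∀ i j, mpd i J x * Γ j x = J x * (Γ i x * Γ j x) - θ i x * (J x * Γ j x) := by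
    intro i j
    rw [h3 i, Matrix.sub_mul, mmul_assoc, mmul_assoc]
  have h5 : ∀ i j, θ i x * mpd j J x = θ i x * (J x * Γ j x) - θ i x * θ j x * J x := by
    intro i j
    rw [h3 j, Matrix.mul_sub, mmul_assoc (θ i x)]
  rw [h4, h4, h5, h5]
  abel

theorem ricci_of_coframe {h : ℝ^ι → Matrix κ κ ℝ} (hg : ∀ᶠ z in 𝓝 x, g z = (J z)ᵀ * h z * J z) (hJK
    : ∀ᶠ z in 𝓝 x, J z * K z = 1) (hKJ : ∀ᶠ z in 𝓝 x, K z * J z = 1) (hh : ∀ᶠ z in 𝓝 x, (h z)ᵀ = h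
    z) (hu : (h x).det ≠ 0) (hJs : MSmooth J x) (hKs : MSmooth K x) (hhs : MSmooth h x) (hθ : ∀ i,
    MSmooth (θ i) x) (htor : ∀ᶠ z in 𝓝 x, ∀ i j a, (mpd i J z + θ i z * J z) a j = (mpd j J z + θ j
    z * J z) a i) (hmet : ∀ᶠ z in 𝓝 x, ∀ i, mpd i h z = (θ i z)ᵀ * h z + h z * θ i z) (i j : ι) :
    ricci g i j x = ∑ k, (K x * curv θ k j x * J x) k i := by
  set Γ : ι → ℝ^ι → Matrix ι ι ℝ := fun i z => K z * (θ i z * J z + mpd i J z) with hΓ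
  have hΓs : ∀ i, MSmooth (Γ i) x := fun i => hKs.mul (((hθ i).mul hJs).add (hJs.mpd i))
  have hJΓ : ∀ᶠ z in 𝓝 x, ∀ i, J z * Γ i z = θ i z * J z + mpd i J z := by
    filter_upwards [hJK] with z hz i
    rw [hΓ, ← mmul_assoc, hz, mone_mul]
  have hsym : ∀ᶠ z in 𝓝 x, (g z)ᵀ = g z := by
    filter_upwards [hg, hh] with z hz hz'
    rw [hz, transpose_mul, transpose_mul, hz', transpose_transpose, mmul_assoc]
  have hlc : ∀ᶠ z in 𝓝 x, ∀ i, lc g i z = Γ i z := by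
    filter_upwards [hg.eventually_nhds, hsym, hJΓ, hKJ, hJK, htor, hmet, hJs.eventually_ediff,
      hhs.eventually_ediff, ev_det hhs hu] with z hz hz1 hz2 hz3 hz8 hz4 hz5 hz6 hz7 hz9 i
    have hdet : (g z).det ≠ 0 := by
      rw [← isUnit_iff_ne_zero]
      refine isUnit_det_of_right_inverse (B := K z * ((h z)⁻¹ * (K z)ᵀ)) ?_
      rw [hz.self_of_nhds]
      calc _ = (J z)ᵀ * (h z * ((J z * K z) * ((h z)⁻¹ * (K z)ᵀ))) := by simp only [mmul_assoc]
        _ = (K z * J z)ᵀ := by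
            rw [hz8, mone_mul, ← mmul_assoc (h z), mmul_inv _ hz9.isUnit, mone_mul, transpose_mul]
        _ = 1 := by rw [hz3, transpose_one]
    ext k j
    refine christoffel_unique (Γ := fun i => Γ i z) hz1 hdet ?_ ?_ k i j
    · intro i j k
      simp only [hΓ, mmul (M := K z)]
      refine sum_ext fun a => ?_
      rw [add_comm, hz4 i j a, add_comm]
    · intro k
      rw [mpd_congr hz, mpd_mul (hz6.transpose.mul hz7) hz6, mpd_mul hz6.transpose hz7,
        mpd_transpose, hz5, hz.self_of_nhds]
      have e : mpd k J z = J z * Γ k z - θ k z * J z := by rw [hz2 k]; abel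
      rw [e]
      simp only [transpose_sub, transpose_mul, mmul_add, madd_mul, Matrix.mul_sub, Matrix.sub_mul,
        mmul_assoc]
      abel
  rw [ricci_eq_sum_curv hsym, show (∑ k, curv (lc g) k j x k i) = ∑ k, curv Γ k j x k i from sum_ext
    fun k => by rw [curv_congr (fun i => hlc.mono fun z hz => hz i)]]
  refine sum_ext fun k => ?_
  rw [mmul_assoc, ← mul_curv_of_gauge hJs hθ hΓs hJΓ, ← mmul_assoc, hKJ.self_of_nhds, mone_mul]

lemma ricci_symm (hg : MSmooth g x) (hs : ∀ᶠ z in 𝓝 x, (g z)ᵀ = g z) (hu : (g x).det ≠ 0) (i j : ι)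
    : ricci g i j x = ricci g j i x := by
  have htr : ∀ᶠ z in 𝓝 x, ∀ i, ∑ k, Chr g k i k z = (1 / 2) * ((g z)⁻¹ * mpd i g z).trace := by
    filter_upwards [hs.eventually_nhds, ev_det hg hu] with z hz hz' i
    have h1 : (∑ k, Chr g k i k z) = (lc g i z).trace := rfl
    have h3 : g z * (g z)⁻¹ = 1 := mmul_inv _ (hz'.isUnit)
    have h4 : (g z)⁻¹ * g z = 1 := minv_mul _ (hz'.isUnit)
    rw [h1, lcMatrix_compat hz hz', mmul_add, trace_add, ← mmul_assoc, trace_mul_cycle, h3,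
      mone_mul, trace_transpose, ← mmul_assoc, h4, mone_mul]
    ring
  have hΓ := fun k i j => lcMatrix_smooth hg hu i k j
  have hd : ∀ a b, ∑ k, pd a (Chr g k b k) x = (1 / 2) * (-((g x)⁻¹ * mpd a g x * (g x)⁻¹ * mpd b g
      x).trace + ((g x)⁻¹ * mpd a (mpd b g) x).trace) := by
    intro a b
    have h1 := pd_sum (i := a) (s := univ) (f := fun k => Chr g k b k) (x := x) fun k _ => diffAt
      (hΓ k b k)
    rw [← h1, pd_congr (htr.mono fun z hz => hz b)]
    have hm := (hg.inv hu).mul (hg.mpd b)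
    have h2 : Smooth (fun z => ((g z)⁻¹ * mpd b g z).trace) x := ContDiffAt.sum fun k _ => hm k k
    rw [pd_const_mul _ (diffAt h2)]
    congr 1
    have h3 : pd a (fun z => ((g z)⁻¹ * mpd b g z).trace) x = (mpd a (fun z => (g z)⁻¹ * mpd b g z)
        x).trace := pd_sum fun k _ => hm.ediff k k
    rw [h3, mpd_mul (hg.inv hu).ediff (hg.mpd b).ediff, mpd_inv hg hu, trace_add, Matrix.neg_mul,
      trace_neg]
  have hsym := christoffel_symm hs
  have hsym' : ∀ k i j, pd k (Chr g k i j) x = pd k (Chr g k j i) x := fun k i j => pd_congr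
    (hs.eventually_nhds.mono fun z hz => christoffel_symm hz k i j)
  have hq : ∑ k, ∑ l, Chr g k j l x * Chr g l i k x = ∑ k, ∑ l, Chr g k i l x * Chr g l j k x := by
    rw [sum_comm]
    exact sum_ext₂ fun k l => mul_comm _ _
  simp only [ricci, sum_sub, hd, hsym' _ i j, hsym _ i j, hq]
  rw [mpd_comm hg, mmul_assoc ((g x)⁻¹ * mpd j g x), trace_mul_comm ((g x)⁻¹ * mpd j g x), ←
    mmul_assoc]

lemma sum_conj_eq {J : Matrix κ ι ℝ} {K : Matrix ι κ ℝ} (hJK : J * K = 1) (C : ι → Matrix κ κ ℝ) (R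
    : κ → κ → Matrix κ κ ℝ) (i j : ι) (h : ∀ k, C k = ∑ c, ∑ d, (J c k * J d j) • R c d) : ∑ k, (K *
    C k * J) k i = ∑ b, ∑ d, J b i * J d j * ∑ c, R c d c b := by
  have hK : ∀ c a, ∑ k, K k a * J c k = (1 : Matrix κ κ ℝ) c a := by
    intro c a
    rw [← hJK, mmul]
    exact sum_ext fun k => mul_comm _ _
  calc ∑ k, (K * C k * J) k i = ∑ k, ∑ b, ∑ a, ∑ c, ∑ d, (K k a * J c k) * (J d j * J b i * R c d a
      b) := by
        refine sum_ext fun k => ?_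
        rw [mmul]
        refine sum_ext fun b => ?_
        rw [mmul, sum_mul]
        refine sum_ext fun a => ?_
        rw [h, msum, mul_sum, sum_mul]
        refine sum_ext fun c => ?_
        rw [msum, mul_sum, sum_mul]
        refine sum_ext fun d => ?_
        rw [msmul, smul_eq_mul]
        ring
    _ = ∑ b, ∑ a, ∑ c, ∑ d, (∑ k, K k a * J c k) * (J d j * J b i * R c d a b) := by
        rw [sum_comm]
        refine sum_ext fun b => ?_
        rw [sum_comm]
        refine sum_ext fun a => ?_
        rw [sum_comm]
        refine sum_ext fun c => ?_
        rw [sum_comm]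
        exact sum_ext fun d => by rw [sum_mul]
    _ = ∑ b, ∑ d, J b i * J d j * ∑ c, R c d c b := by
        refine sum_ext fun b => ?_
        simp only [hK, mone, ite_mul, one_mul, zero_mul]
        rw [sum_comm]
        have : ∀ c a, (∑ d, if c = a then J d j * J b i * R c d a b else 0) = if c = a then ∑ d, J d
            j * J b i * R c d a b else 0 := by
          intro c a; split_ifs <;> simp
        simp only [this, Finset.sum_ite_eq, mem_univ, if_true]
        rw [sum_comm]
        refine sum_ext fun d => ?_
        rw [mul_sum]
        exact sum_ext fun c => by ring

lemma sum_conj_eq_zero_iff {J : Matrix κ ι ℝ} {K : Matrix ι κ ℝ} (hJK : J * K = 1) (A : Matrix κ κ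
    ℝ) : (∀ i j, ∑ a, ∑ b, J a i * J b j * A a b = 0) ↔ ∀ a b, A a b = 0 := by
  refine ⟨fun h => ?_, fun h => by simp [h]⟩
  have h1 : J.transpose * A * J = 0 := by
    ext i j
    rw [mzero, ← h i j, mmul, sum_comm]
    refine sum_ext fun b => ?_
    rw [mmul, sum_mul]
    exact sum_ext fun a => by rw [tr_apply]; ring
  have h2 : A = 0 := by
    calc A = (J * K)ᵀ * A * (J * K) := by rw [hJK]; simp
      _ = K.transpose * (J.transpose * A * J) * K := by rw [transpose_mul]; simp only [mmul_assoc]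
      _ = 0 := by rw [h1]; simp
  intro a b
  rw [h2, mzero]

/-- The Jacobian matrix. -/
def jac (τ : ℝ^ι → ℝ^κ) (x : ℝ^ι) : Matrix κ ι ℝ :=
  of fun a i => pd i (fun z => τ z a) x

theorem ricci_comp {h : ℝ^κ → Matrix κ κ ℝ} {τ : ℝ^ι → ℝ^κ} (hτ : Smooth τ x) (hJK : ∀ᶠ z in 𝓝 x,
    jac τ z * K z = 1) (hKJ : ∀ᶠ z in 𝓝 x, K z * jac τ z = 1) (hKs : MSmooth K x) (hg : ∀ᶠ z in 𝓝 x,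
    g z = (jac τ z)ᵀ * h (τ z) * jac τ z) (hh : ∀ᶠ w in 𝓝 (τ x), (h w)ᵀ = h w) (hu : (h (τ x)).det ≠
    0) (hhs : MSmooth h (τ x)) (i j : ι) : ricci g i j x = ∑ a, ∑ b, jac τ x a i * jac τ x b j *
    ricci h a b (τ x) := by
  have hτc : ∀ a, Smooth (fun z => τ z a) x := fun a => contDiffAt_pi.1 hτ a
  have hJs : MSmooth (jac τ) x := fun a i => contDiffAt_pd (hτc a)
  have hΓ := fun i => lcMatrix_smooth hhs hu i
  set θ : ι → ℝ^ι → Matrix κ κ ℝ := fun i z => ∑ c, jac τ z c i • lc h c (τ z) with hθ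
  have hθa : ∀ i z a b, θ i z a b = ∑ c, jac τ z c i * lc h c (τ z) a b := by
    intro i z a b
    simp [hθ, msum]
  have hθs : ∀ i, MSmooth (θ i) x := by
    intro i a b
    simp only [hθa]
    exact ContDiffAt.sum fun c _ => (hJs c i).mul ((hΓ c a b).comp x hτ)
  have hsym : ∀ᶠ w in 𝓝 (τ x), ∀ c a b, lc h c w a b = lc h b w a c := hh.eventually_nhds.mono fun w
    hw c a b => christoffel_symm hw a c b
  have hτ0 := hτ.continuousAt
  have hpdh : ∀ᶠ z in 𝓝 x, ∀ i, mpd i (fun z => h (τ z)) z = ∑ c, jac τ z c i • mpd c h (τ z) := by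
    filter_upwards [hτ0.eventually hhs.eventually_ediff, ev_diffAt hτ] with z hz hz' i
    ext a b
    rw [msum]
    refine (pd_comp (hz a b) hz').trans (sum_ext fun c => ?_)
    rw [msmul, smul_eq_mul, mul_comm]
    rfl
  have hhs' : MSmooth (fun z => h (τ z)) x := fun a b => (hhs a b).comp x hτ
  rw [ricci_of_coframe (h := fun z => h (τ z)) (J := jac τ) (θ := θ) hg hJK hKJ (hτ0.eventually hh)
    hu hJs hKs hhs' hθs]
  · have hcurv : ∀ k, curv θ k j x = ∑ c, ∑ d, (jac τ x c k * jac τ x d j) • curv (lc h) c d (τ x)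
        := by
      intro k
      have hmp : ∀ i j, mpd i (θ j) x = (∑ c, pd i (fun z => jac τ z c j) x • lc h c (τ x)) + ∑ c, ∑
          d, (jac τ x c i * jac τ x d j) • mpd c (lc h d) (τ x) := by
        intro i j
        ext a b
        simp only [mpd, hθa, of_apply, madd, msum, msmul, smul_eq_mul]
        refine (pd_sum (f := fun d z => jac τ z d j * lc h d (τ z) a b) fun d _ => ((hJs d j).mul
          ((hΓ d a b).comp x hτ)).differentiableAt (by decide)).trans ?_
        rw [sum_comm (γ := κ), ← sum_add]
        refine sum_ext fun d => ?_
        have hp := pd_mul (i := i) (hJs.ediff d j) (diffAt ((hΓ d a b).comp x hτ))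
        simp only [Function.comp_def] at hp
        rw [pd_comp (diffAt (hΓ d a b)) (diffAt hτ), mul_sum] at hp
        refine hp.trans ?_
        congr 1
        refine sum_ext fun c => ?_
        simp only [jac, of_apply]
        ring
      have hcomm : ∀ c, pd k (fun z => jac τ z c j) x = pd j (fun z => jac τ z c k) x := fun c =>
        pd_comm (ev_C2 (hτc c)).self_of_nhds
      simp only [curv, hmp, hcomm]
      simp only [hθ, sum_mul, mul_sum, smul_mul, mmul_smul, smul_smul, smul_add, smul_sub, sum_add,
        sum_sub]
      have e1 : ∑ c, ∑ d, (jac τ x c j * jac τ x d k) • mpd c (lc h d) (τ x) = ∑ c, ∑ d, (jac τ x c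
          k * jac τ x d j) • mpd d (lc h c) (τ x) := by
        rw [sum_comm]
        exact sum_ext₂ fun c d => by rw [mul_comm]
      rw [e1]
      have e2 : ∑ c, ∑ d, (jac τ x c j * jac τ x d k) • (lc h d (τ x) * lc h c (τ x)) = ∑ c, ∑ d,
          (jac τ x c k * jac τ x d j) • (lc h c (τ x) * lc h d (τ x)) := by
        rw [sum_comm]
        exact sum_ext₂ fun c d => by rw [mul_comm]
      rw [e2]
      abel
    rw [sum_conj_eq hJK.self_of_nhds (fun k => curv θ k j x) (fun c d => curv (lc h) c d (τ x)) i j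
      hcurv]
    refine sum_ext₂ fun b d => ?_
    rw [ricci_eq_sum_curv hh b d]
  · filter_upwards [hτ0.eventually hsym, ev_C2 hτ] with z hz hz' i j a
    rw [madd, madd]
    congr 1
    · exact pd_comm (contDiffAt_pi.1 hz' a)
    · simp only [mmul, hθa, sum_mul]
      rw [sum_comm]
      refine sum_ext₂ fun c d => ?_
      rw [hz c a d]
      ring
  · filter_upwards [hpdh, hτ0.eventually hh.eventually_nhds, hτ0.eventually (ev_det hhs hu)] with z
      hz hz1 hz2 i
    rw [hz]
    simp only [lcMatrix_compat hz1 hz2, hθ, transpose_sum, transpose_smul, sum_mul, mul_sum,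
      smul_mul, mmul_smul, smul_add, sum_add]

end

section

/-- The fields of a metric on a product of `B → ℝ` with a torus, in coordinates. -/
structure LocalFields (B K : Type*) where
  g : ℝ^B → Matrix B B ℝ
  xi : ℝ^B → Matrix K K ℝ
  a : ℝ^B → Matrix K B ℝ
  F : K → ℝ^B → Matrix B B ℝ

namespace LocalFields

variable {B K : Type*} [Fintype B] [DecidableEq B] [Fintype K] [DecidableEq K] (L : LocalFields B K)

/-- Regularity of the fields `g`, `ξ` and `F` near a point. -/
structure BaseRegular (x : ℝ^B) : Prop where
  g_smooth : MSmooth L.g x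
  xi_smooth : MSmooth L.xi x
  F_smooth : ∀ k, MSmooth (L.F k) x
  g_symm : ∀ᶠ z in 𝓝 x, (L.g z)ᵀ = L.g z
  xi_symm : ∀ᶠ z in 𝓝 x, (L.xi z)ᵀ = L.xi z
  g_det : (L.g x).det ≠ 0
  xi_det : (L.xi x).det ≠ 0
  F_antisymm : ∀ᶠ z in 𝓝 x, ∀ k, (L.F k z)ᵀ = -L.F k z

/-- Regularity of the fields near a point, with `F = da`. -/
structure Regular (x : ℝ^B) : Prop extends L.BaseRegular x where
  a_smooth : MSmooth L.a x
  F_eq : ∀ᶠ z in 𝓝 x, ∀ k α β,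
    pd α (fun y => L.a y k β) z - pd β (fun y => L.a y k α) z = L.F k z α β

variable {L}

variable (L)

/-- The metric `g + ξₖₗ (dyᵏ + aᵏ) (dyˡ + aˡ)`. -/
def metric (x : ℝ^B) : Matrix (B ⊕ K) (B ⊕ K) ℝ :=
  fromBlocks (L.g x + (L.a x)ᵀ * L.xi x * L.a x) ((L.a x)ᵀ * L.xi x)
    (L.xi x * L.a x) (L.xi x)

/-- The coframe `dxᵅ, dyᵏ + aᵏ`. -/
def coframe (x : ℝ^B) : Matrix (B ⊕ K) (B ⊕ K) ℝ := fromBlocks 1 0 (L.a x) 1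

/-- The frame dual to `coframe`. -/
def frame (x : ℝ^B) : Matrix (B ⊕ K) (B ⊕ K) ℝ := fromBlocks 1 0 (-L.a x) 1

/-- The metric in the frame. -/
def frameMetric (x : ℝ^B) : Matrix (B ⊕ K) (B ⊕ K) ℝ := fromBlocks (L.g x) 0 0 (L.xi x)

lemma coframe_mul_frame (x : ℝ^B) : L.coframe x * L.frame x = 1 := by
  simp [coframe, frame, fromBlocks_multiply]

lemma frame_mul_coframe (x : ℝ^B) : L.frame x * L.coframe x = 1 := by
  simp [coframe, frame, fromBlocks_multiply]

lemma metric_eq (x : ℝ^B) : L.metric x = (L.coframe x)ᵀ * L.frameMetric x * L.coframe x := by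
  simp [metric, coframe, frameMetric, fromBlocks_transpose, fromBlocks_multiply]

/-- The 2-forms `Fₖ = ξₖₗ Fˡ`. -/
def Flow (k : K) (x : ℝ^B) : Matrix B B ℝ := ∑ l, L.xi x k l • L.F l x

/-- The endomorphisms `Fₖ` with entries `g^{βγ} (Fₖ)_{αγ}`. -/
def Fend (k : K) (x : ℝ^B) : Matrix B B ℝ := (L.g x)⁻¹ * (L.Flow k x)ᵀ

/-- The matrices `ξ⁻¹ ∂ξ`. -/
def S (α : B) (x : ℝ^B) : Matrix K K ℝ := (L.xi x)⁻¹ * mpd α L.xi x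

/-- The gradient of `ξ`. -/
def Q (β : B) (x : ℝ^B) : Matrix K K ℝ := ∑ γ, (L.g x)⁻¹ β γ • mpd γ L.xi x

/-- The Levi-Civita connection in the frame. -/
def conn : B ⊕ K → ℝ^B → Matrix (B ⊕ K) (B ⊕ K) ℝ
  | inl α, x => fromBlocks (lc L.g α x) (of fun β k => (1 / 2) * L.Fend k x β α)
      (of fun k β => -(1 / 2) * L.F k x α β) (of fun k l => (1 / 2) * L.S α x k l)
  | inr k, x => fromBlocks (of fun β γ => (1 / 2) * L.Fend k x β γ)
      (of fun β l => -(1 / 2) * L.Q β x k l) (of fun l α => (1 / 2) * L.S α x l k) 0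

/-- The connection in coordinates. -/
def connCoord (c : B ⊕ K) (x : ℝ^B) : Matrix (B ⊕ K) (B ⊕ K) ℝ :=
  ∑ d, L.coframe x d c • L.conn d x

/-- Frame derivative of matrices depending on the base point only. -/
def frameD {κ : Type*} (A : ℝ^B → Matrix κ κ ℝ) (x : ℝ^B) : B ⊕ K → Matrix κ κ ℝ
  | inl α => mpd α A x
  | inr _ => 0

/-- The contribution of the brackets of the frame to the curvature. -/
def bracketTerm (x : ℝ^B) : B ⊕ K → B ⊕ K → Matrix (B ⊕ K) (B ⊕ K) ℝ
  | inl α, inl β => ∑ k, L.F k x α β • L.conn (inr k) x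
  | _, _ => 0

/-- The curvature in the frame. -/
def frameCurv (x : ℝ^B) (c d : B ⊕ K) : Matrix (B ⊕ K) (B ⊕ K) ℝ :=
  frameD (L.conn d) x c - frameD (L.conn c) x d
    + (L.conn c x * L.conn d x - L.conn d x * L.conn c x) + L.bracketTerm x c d

/-- The Ricci tensor in the frame. -/
def frameRicci (x : ℝ^B) (b d : B ⊕ K) : ℝ := ∑ c, L.frameCurv x c d c b

variable {L}

variable {f : ℝ^B → ℝ} {z : B ⊕ K → ℝ}

lemma contDiffAt_comp_inl (hf : Smooth f (z ∘ inl)) : Smooth (fun z : B ⊕ K → ℝ => f (z ∘ inl)) z :=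
    ContDiffAt.comp z hf (contDiffAt_pi.2 fun _ => (contDiff_apply ℝ ℝ _).contDiffAt)

lemma continuous_comp_inl : Continuous fun z : B ⊕ K → ℝ => z ∘ inl := continuous_pi fun _ =>
  continuous_apply _

lemma pd_comp_inl (hf : Diff f (z ∘ inl)) (c : B ⊕ K) : pd c (fun z : B ⊕ K → ℝ => f (z ∘ inl)) z =
    Sum.elim (fun α => pd α f (z ∘ inl)) (fun _ => 0) c := by
  have h : Diff (fun z : B ⊕ K → ℝ => z ∘ (inl : B → B ⊕ K)) z := differentiableAt_pi.2 fun _ =>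
    differentiableAt_apply _ _
  rw [pd_comp hf h]
  simp only [fcomp_apply, pd_coord]
  cases c <;> simp

lemma mpd_comp_inl {κ ν : Type*} [Fintype κ] [Fintype ν] {A : ℝ^B → Matrix κ ν ℝ} (hA : EDiff A (z ∘
    inl)) (c : B ⊕ K) : mpd c (fun z : B ⊕ K → ℝ => A (z ∘ inl)) z = Sum.elim (fun α => mpd α A (z ∘
    inl)) (fun _ => 0) c := by
  ext a b
  refine (pd_comp_inl (hA a b) c).trans ?_
  cases c <;> rfl

lemma MSmooth.comp_inl {κ ν : Type*} [Fintype κ] [Fintype ν] {A : ℝ^B → Matrix κ ν ℝ} (hA : MSmooth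
    A (z ∘ inl)) : MSmooth (fun z : B ⊕ K → ℝ => A (z ∘ inl)) z := fun a b => contDiffAt_comp_inl
    (hA a b)

lemma MSmooth.fromBlocks' {ι n m o p : Type*} [Fintype ι] [DecidableEq ι] [Fintype n] [Fintype m]
    [Fintype o] [Fintype p] {A : ℝ^ι → Matrix n m ℝ} {A' : ℝ^ι → Matrix n o ℝ} {C : ℝ^ι → Matrix p m
    ℝ} {D : ℝ^ι → Matrix p o ℝ} {x : ℝ^ι} (hA : MSmooth A x) (hA' : MSmooth A' x) (hC : MSmooth C x)
    (hD : MSmooth D x) : MSmooth (fun z => fromBlocks (A z) (A' z) (C z) (D z)) x := by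
  rintro (i | i) (j | j)
  exacts [hA i j, hA' i j, hC i j, hD i j]

lemma MSmooth.const' {ι n m : Type*} [Fintype ι] [DecidableEq ι] [Fintype n] [Fintype m] (A : Matrix
    n m ℝ) (x : ℝ^ι) : MSmooth (fun _ : ι → ℝ => A) x := fun _ _ => contDiffAt_const

variable {x : ℝ^B}

variable {z : B ⊕ K → ℝ}

lemma BaseRegular.Flow_smooth (h : L.BaseRegular x) (k : K) : MSmooth (L.Flow k) x := by
  intro α β
  simp only [Flow, msum, msmul, smul_eq_mul]
  exact ContDiffAt.sum fun l _ => (h.xi_smooth k l).mul (h.F_smooth l α β)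

lemma Regular.Fend_smooth (h : L.Regular x) (k : K) : MSmooth (L.Fend k) x := (h.g_smooth.inv
  h.g_det).mul (h.Flow_smooth k).transpose

lemma Regular.S_smooth (h : L.Regular x) (α : B) : MSmooth (L.S α) x := (h.xi_smooth.inv
  h.xi_det).mul (h.xi_smooth.mpd α)

lemma Regular.Q_smooth (h : L.Regular x) (β : B) : MSmooth (L.Q β) x := by
  intro k l
  simp only [Q, msum, msmul, smul_eq_mul]
  exact ContDiffAt.sum fun γ _ => (h.g_smooth.inv h.g_det β γ).mul (h.xi_smooth.mpd γ k l)

lemma Regular.conn_smooth (h : L.Regular x) (c : B ⊕ K) : MSmooth (L.conn c) x := by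
  rcases c with α | k
  · exact MSmooth.fromBlocks' (lcMatrix_smooth h.g_smooth h.g_det α) (fun β k =>
      contDiffAt_const.mul (h.Fend_smooth k β α)) (fun k β => contDiffAt_const.mul (h.F_smooth k α
      β)) (fun k l => contDiffAt_const.mul (h.S_smooth α k l))
  · exact MSmooth.fromBlocks' (fun β γ => contDiffAt_const.mul (h.Fend_smooth k β γ)) (fun β l =>
      contDiffAt_const.mul (h.Q_smooth β k l)) (fun l α => contDiffAt_const.mul (h.S_smooth α l k))
      (MSmooth.const' 0 x)

lemma Regular.coframe_smooth (h : L.Regular x) : MSmooth L.coframe x := MSmooth.fromBlocks'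
  (MSmooth.const' _ x) (MSmooth.const' _ x) h.a_smooth (MSmooth.const' _ x)

lemma Regular.frame_smooth (h : L.Regular x) : MSmooth L.frame x := MSmooth.fromBlocks'
  (MSmooth.const' _ x) (MSmooth.const' _ x) (fun k α => (h.a_smooth k α).neg) (MSmooth.const' _ x)

lemma Regular.connCoord_smooth (h : L.Regular x) (c : B ⊕ K) : MSmooth (L.connCoord c) x := by
  intro i j
  simp only [connCoord, msum, msmul, smul_eq_mul]
  exact ContDiffAt.sum fun d _ => (h.coframe_smooth d c).mul (h.conn_smooth d i j)

lemma Regular.frameMetric_smooth (h : L.Regular x) : MSmooth L.frameMetric x := MSmooth.fromBlocks'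
  h.g_smooth (MSmooth.const' _ x) (MSmooth.const' _ x) h.xi_smooth

lemma connCoord_inl (α : B) (x : ℝ^B) : L.connCoord (inl α) x = L.conn (inl α) x + ∑ k, L.a x k α •
    L.conn (inr k) x := by simp [connCoord, coframe, mone]

lemma connCoord_inr (k : K) (x : ℝ^B) : L.connCoord (inr k) x = L.conn (inr k) x := by
  simp [connCoord, coframe, mone]

lemma mul_coframe_inl {n : Type*} (A : Matrix n (B ⊕ K) ℝ) (i : n) (β : B) (x : ℝ^B) : (A *
    L.coframe x) i (inl β) = A i (inl β) + ∑ k, A i (inr k) * L.a x k β := by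
  simp [mmul, coframe, mone]

lemma mul_coframe_inr {n : Type*} (A : Matrix n (B ⊕ K) ℝ) (i : n) (k : K) (x : ℝ^B) : (A *
    L.coframe x) i (inr k) = A i (inr k) := by simp [mmul, coframe, mone]

lemma conn_torsion_lr (α : B) (k : K) (c : B ⊕ K) (x : ℝ^B) : L.conn (inl α) x c (inr k) = L.conn
    (inr k) x c (inl α) := by
  rcases c with c | c <;> simp [conn]

lemma Q_symm (hx : ∀ᶠ z in 𝓝 x, (L.xi z)ᵀ = L.xi z) (β : B) (k l : K) : L.Q β x k l = L.Q β x l k :=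
    by
  simp only [Q, msum, msmul, smul_eq_mul]
  refine sum_ext fun γ => ?_
  congr 1
  exact pd_congr (hx.mono fun z hz => congr_fun₂ hz l k)

lemma conn_torsion_rr (hx : ∀ᶠ z in 𝓝 x, (L.xi z)ᵀ = L.xi z) (k l : K) (c : B ⊕ K) : L.conn (inr k)
    x c (inr l) = L.conn (inr l) x c (inr k) := by
  rcases c with c | c
  · simp [conn, Q_symm hx c k l]
  · simp [conn]

lemma coframe_curl (hF : ∀ k α β, pd α (fun y => L.a y k β) x - pd β (fun y => L.a y k α) x = L.F k
      x α β) (c : B ⊕ K) (α β : B) : mpd α L.coframe x c (inl β) - mpd β L.coframe x c (inl α) =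
      Sum.elim (fun _ => 0) (fun k => L.F k x α β) c := by
  rcases c with c | k
  · simp [mpd, coframe, pd_const]
  · simpa [mpd, coframe] using hF k α β

lemma mpd_coframe_inr (α : B) (c : B ⊕ K) (k : K) : mpd α L.coframe x c (inr k) = 0 := by
  rcases c with c | c <;> simp [mpd, coframe, pd_const]

lemma conn_torsion_ll (hg : ∀ᶠ z in 𝓝 x, (L.g z)ᵀ = L.g z) (hF : ∀ k, (L.F k x)ᵀ = -L.F k x) (α β :
    B) (c : B ⊕ K) : L.conn (inl α) x c (inl β) - L.conn (inl β) x c (inl α) = -Sum.elim (fun _ =>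
    0) (fun k => L.F k x α β) c := by
  rcases c with c | k
  · simp [conn, lc_apply, christoffel_symm hg c α β]
  · have := congrFun (congrFun (hF k) α) β
    simp only [tr_apply, mneg] at this
    simp [conn, this]
    ring

lemma torsion_eq (hJ : EDiff L.coframe (z ∘ inl)) (hg : ∀ᶠ y in 𝓝 (z ∘ inl), (L.g y)ᵀ = L.g y) (hx :
    ∀ᶠ y in 𝓝 (z ∘ inl), (L.xi y)ᵀ = L.xi y) (hF : ∀ k α β, pd α (fun y => L.a y k β) (z ∘ inl) - pd
    β (fun y => L.a y k α) (z ∘ inl) = L.F k (z ∘ inl) α β) (hF' : ∀ k, (L.F k (z ∘ inl))ᵀ = -L.F k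
    (z ∘ inl)) (i j c : B ⊕ K) : (mpd i (fun z : B ⊕ K → ℝ => L.coframe (z ∘ inl)) z + L.connCoord i
    (z ∘ inl) * L.coframe (z ∘ inl)) c j = (mpd j (fun z : B ⊕ K → ℝ => L.coframe (z ∘ inl)) z +
    L.connCoord j (z ∘ inl) * L.coframe (z ∘ inl)) c i := by
  rw [mpd_comp_inl hJ, mpd_comp_inl hJ]
  rcases i with α | k <;> rcases j with β | l
  · rw [← sub_eq_zero]
    have h1 := coframe_curl hF c α β
    have h2 := conn_torsion_ll hg hF' α β c
    have h3 : ∀ α β, ∑ k, ∑ l, L.a (z ∘ inl) k α * L.conn (inr k) (z ∘ inl) c (inr l) * L.a (z ∘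
        inl) l β = ∑ k, ∑ l, L.a (z ∘ inl) k β * L.conn (inr k) (z ∘ inl) c (inr l) * L.a (z ∘ inl)
        l α := by
      intro α β
      rw [sum_comm]
      refine sum_ext₂ fun k l => ?_
      rw [conn_torsion_rr hx k l]
      ring
    have h3' := h3 α β
    have h4 : ∀ α β, ∑ k, L.a (z ∘ inl) k α * L.conn (inr k) (z ∘ inl) c (inl β) = ∑ k, L.conn (inl
        β) (z ∘ inl) c (inr k) * L.a (z ∘ inl) k α := by
      intro α β
      exact sum_ext fun k => by rw [conn_torsion_lr, mul_comm]
    simp only [madd, mul_coframe_inl, connCoord_inl, msum, msmul, smul_eq_mul, Sum.elim_inl,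
      add_mul, sum_add, sum_mul, h4]
    linarith
  · simp only [madd, mul_coframe_inl, mul_coframe_inr, connCoord_inl, connCoord_inr, msum, msmul,
      smul_eq_mul, Sum.elim_inl, Sum.elim_inr, mpd_coframe_inr, mzero, zero_add, conn_torsion_lr,
      conn_torsion_rr hx _ l c]
    congr 1
    exact sum_ext fun k => mul_comm _ _
  · simp only [madd, mul_coframe_inl, mul_coframe_inr, connCoord_inl, connCoord_inr, msum, msmul,
      smul_eq_mul, Sum.elim_inl, Sum.elim_inr, mpd_coframe_inr, mzero, zero_add, conn_torsion_lr,
      conn_torsion_rr hx _ k c]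
    congr 1
    exact sum_ext fun k => mul_comm _ _
  · simp only [madd, mul_coframe_inr, connCoord_inr, Sum.elim_inr, mzero, conn_torsion_rr hx k l c]

lemma g_mul_Fend (hg : (L.g x).det ≠ 0) (k : K) : L.g x * L.Fend k x = (L.Flow k x)ᵀ := by
  rw [Fend, ← mmul_assoc, mmul_inv _ hg.isUnit, mone_mul]

lemma xi_mul_S (hx : (L.xi x).det ≠ 0) (α : B) : L.xi x * L.S α x = mpd α L.xi x := by
  rw [S, ← mmul_assoc, mmul_inv _ hx.isUnit, mone_mul]

lemma g_mul_Q (hg : (L.g x).det ≠ 0) (α : B) (k l : K) : ∑ β, L.g x α β * L.Q β x k l = mpd α L.xi x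
    k l := by
  have h := mmul_inv _ hg.isUnit
  simp only [Q, msum, msmul, smul_eq_mul, mul_sum]
  rw [sum_comm]
  simp only [← mul_assoc, ← sum_mul, ← mmul, h, mone]
  simp

lemma conn_metric (hgs : ∀ᶠ y in 𝓝 x, (L.g y)ᵀ = L.g y) (hxs : ∀ᶠ y in 𝓝 x, (L.xi y)ᵀ = L.xi y) (hg
    : (L.g x).det ≠ 0) (hx : (L.xi x).det ≠ 0) (hF : ∀ k, (L.F k x)ᵀ = -L.F k x) (c : B ⊕ K) :
    Sum.elim (fun α => mpd α L.frameMetric x) (fun _ => 0) c = (L.conn c x)ᵀ * L.frameMetric x +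
    L.frameMetric x * L.conn c x := by
  have hgsym := fun i j => congr_fun₂ hgs.self_of_nhds i j
  have hxsym := fun i j => congr_fun₂ hxs.self_of_nhds i j
  simp only [tr_apply] at hgsym hxsym
  have hFl : ∀ k, (L.Flow k x)ᵀ = -L.Flow k x := by
    intro k
    simp [Flow, transpose_sum, transpose_smul, hF]
  have hP : ∀ k α β, ∑ γ, L.g x α γ * L.Fend k x γ β = L.Flow k x β α := by
    intro k α β
    rw [← mmul, g_mul_Fend hg, tr_apply]
  have hS : ∀ k l α, ∑ p, L.xi x k p * L.S α x p l = mpd α L.xi x k l := by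
    intro k l α
    rw [← mmul, xi_mul_S hx]
  have hdx : ∀ k l α, mpd α L.xi x k l = mpd α L.xi x l k := fun k l α => pd_congr (hxs.mono fun z
    hz => congr_fun₂ hz l k)
  have hQ : ∀ k l α, ∑ β, L.g x α β * L.Q β x k l = mpd α L.xi x k l := fun k l α => g_mul_Q hg α k
    l
  have hF2 : ∀ k α β, ∑ l, L.F l x α β * L.xi x k l = L.Flow k x α β := by
    intro k α β
    simp only [Flow, msum, msmul, smul_eq_mul]
    exact sum_ext fun l => mul_comm _ _
  have hF3 : ∀ k α β, ∑ l, L.F l x α β * L.xi x l k = L.Flow k x α β := by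
    intro k α β
    rw [← hF2]
    exact sum_ext fun l => by rw [hxsym]
  have hFl' : ∀ k α β, L.Flow k x α β = -L.Flow k x β α := fun k α β => congrFun (congrFun (hFl k)
    β) α
  rcases c with α | k
  · have hm : mpd α L.frameMetric x = fromBlocks (mpd α L.g x) 0 0 (mpd α L.xi x) := by
      ext (i | i) (j | j)
      · rfl
      · exact pd_const _ _ _
      · exact pd_const _ _ _
      · rfl
    simp only [Sum.elim_inl, hm, conn, frameMetric, fromBlocks_transpose, fromBlocks_multiply,
      fromBlocks_add, Matrix.mul_zero, Matrix.zero_mul, add_zero, zero_add]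
    congr 1
    · exact lcMatrix_compat hgs hg α
    · ext β k
      simp only [mzero, madd, mmul, tr_apply, of_apply, mul_assoc, mul_left_comm (L.g x _ _), ←
        mul_sum, hP, hF3]
      ring
    · ext k β
      simp only [mzero, madd, mmul, tr_apply, of_apply, mul_assoc, mul_left_comm (L.xi x _ _), ←
        mul_sum, mul_comm (L.Fend _ _ _ _), mul_comm (L.xi x _ _), hF2]
      simp only [hgsym β, hP]
      ring
    · ext k l
      simp only [madd, mmul, tr_apply, of_apply, mul_assoc, mul_left_comm (L.xi x _ _), ← mul_sum,
        hS, mul_comm (L.S _ _ _ _), hxsym l, hdx l k]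
      ring
  · simp only [Sum.elim_inr, conn, frameMetric, fromBlocks_transpose, fromBlocks_multiply,
      fromBlocks_add, Matrix.mul_zero, Matrix.zero_mul, add_zero, zero_add, transpose_zero]
    rw [← fromBlocks_zero]
    congr 1
    · ext α β
      simp only [mzero, madd, mmul, tr_apply, of_apply, mul_assoc, mul_left_comm (L.g x _ _), ←
        mul_sum, hP, mul_comm (L.Fend _ _ _ _), hgsym β, hFl' k α β]
      ring
    · ext α l
      simp only [mzero, madd, mmul, tr_apply, of_apply, mul_assoc, mul_left_comm (L.g x _ _), ←
        mul_sum, hQ, mul_comm (L.S _ _ _ _), hxsym l, hS, hdx l k]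
      ring
    · ext l α
      simp only [mzero, madd, mmul, tr_apply, of_apply, mul_assoc, mul_left_comm (L.xi x _ _), ←
        mul_sum, hS, mul_comm (L.Q _ _ _ _), hgsym α, hQ, hdx l k]
      ring

theorem ricci_metric_eq (h : L.Regular (z ∘ inl)) (i j : B ⊕ K) : ricci (fun z : B ⊕ K → ℝ =>
    L.metric (z ∘ inl)) i j z = ∑ b, ∑ d, L.coframe (z ∘ inl) b i * L.coframe (z ∘ inl) d j *
    L.frameRicci (z ∘ inl) b d := by
  have hev : ∀ {p : ℝ^B → Prop}, (∀ᶠ y in 𝓝 (z ∘ inl), p y) → ∀ᶠ w : B ⊕ K → ℝ in 𝓝 z, p (w ∘ inl)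
      := fun hp => (continuous_comp_inl.tendsto z).eventually hp
  have hm : ∀ᶠ y in 𝓝 (z ∘ inl), ∀ c, Sum.elim (fun α => mpd α L.frameMetric y) (fun _ => 0) c =
      (L.conn c y)ᵀ * L.frameMetric y + L.frameMetric y * L.conn c y := by
    filter_upwards [h.g_symm.eventually_nhds, h.xi_symm.eventually_nhds, ev_det h.g_smooth h.g_det,
      ev_det h.xi_smooth h.xi_det, h.F_antisymm] with y h1 h2 h3 h4 h5 c
    exact conn_metric h1 h2 h3 h4 h5 c
  rw [ricci_of_coframe (h := fun z : B ⊕ K → ℝ => L.frameMetric (z ∘ inl)) (J := fun z : B ⊕ K → ℝ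
    => L.coframe (z ∘ inl)) (K := fun z : B ⊕ K → ℝ => L.frame (z ∘ inl)) (θ := fun c (z : B ⊕ K →
    ℝ) => L.connCoord c (z ∘ inl)) (.of_forall fun w => L.metric_eq _) (.of_forall fun w =>
    L.coframe_mul_frame _) (.of_forall fun w => L.frame_mul_coframe _)]
  rotate_left
  · filter_upwards [hev h.g_symm, hev h.xi_symm] with w h1 h2
    simp [frameMetric, fromBlocks_transpose, h1, h2]
  · simp only [frameMetric, det_fromBlocks_zero₂₁]
    exact mul_ne_zero h.g_det h.xi_det
  · exact MSmooth.comp_inl h.coframe_smooth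
  · exact MSmooth.comp_inl h.frame_smooth
  · exact MSmooth.comp_inl h.frameMetric_smooth
  · exact fun c => MSmooth.comp_inl (h.connCoord_smooth c)
  · filter_upwards [hev h.coframe_smooth.eventually_ediff, hev h.g_symm.eventually_nhds, hev
      h.xi_symm.eventually_nhds, hev h.F_eq, hev h.F_antisymm] with w h1 h2 h3 h4 h5 i j c
    exact torsion_eq h1 h2 h3 h4 h5 i j c
  · filter_upwards [hev hm, hev h.frameMetric_smooth.eventually_ediff] with w h1 h2 c
    rw [mpd_comp_inl h2]
    rcases c with α | k
    · have hs := h1 (inl α)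
      simp only [connCoord_inl, transpose_add, madd_mul, mmul_add] at hs ⊢
      rw [hs]
      have hz : (∑ k, L.a (w ∘ inl) k α • L.conn (inr k) (w ∘ inl))ᵀ * L.frameMetric (w ∘ inl) +
          L.frameMetric (w ∘ inl) * (∑ k, L.a (w ∘ inl) k α • L.conn (inr k) (w ∘ inl)) = 0 := by
        rw [transpose_sum, sum_mul, mul_sum, ← sum_add]
        refine sum_eq_zero fun k _ => ?_
        rw [transpose_smul, smul_mul, mmul_smul, ← smul_add]
        have := h1 (inr k)
        simp only [Sum.elim_inr] at this
        rw [← this, smul_zero]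
      rw [add_add_add_comm, hz, add_zero]
    · simp only [connCoord_inr]
      exact h1 (inr k)
  refine sum_conj_eq (L.coframe_mul_frame _) _ (L.frameCurv (z ∘ inl)) i j fun i => ?_
  set x := z ∘ (inl : B → B ⊕ K) with hx
  have hcs := fun c => (h.conn_smooth c)
  have hmp : ∀ i j, mpd i (fun z : B ⊕ K → ℝ => L.connCoord j (z ∘ inl)) z = (∑ c, mpd i (fun z : B
      ⊕ K → ℝ => L.coframe (z ∘ inl)) z c j • L.conn c x) + ∑ c, ∑ d, (L.coframe x c i * L.coframe x
      d j) • frameD (L.conn d) x c := by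
    intro i j
    rw [mpd_comp_inl (h.connCoord_smooth j).ediff, mpd_comp_inl h.coframe_smooth.ediff]
    rcases i with α | k
    · have hD : ∀ c d, L.coframe x c (inl α) • frameD (L.conn d) x c = if c = inl α then mpd α
          (L.conn d) x else 0 := by
        rintro (c | c) d
        · by_cases hc : c = α
          · subst hc; simp [coframe, frameD]
          · simp [coframe, frameD, hc]
        · simp [frameD]
      have hD' : ∀ c d, (L.coframe x c (inl α) * L.coframe x d j) • frameD (L.conn d) x c = if c =
          inl α then L.coframe x d j • mpd α (L.conn d) x else 0 := by
        intro c d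
        rw [mul_comm, mul_smul, hD]
        split_ifs <;> simp
      simp only [hD', Sum.elim_inl]
      rw [sum_comm]
      simp only [Finset.sum_ite_eq', mem_univ, if_true]
      rw [← sum_add]
      ext p q
      simp only [msum, madd, msmul, smul_eq_mul]
      have h1 := pd_sum (i := α) (s := univ) (f := fun d y => L.coframe y d j * L.conn d y p q) (x
        := x) fun d _ => (h.coframe_smooth.ediff d j).mul ((hcs d).ediff p q)
      have h2 : mpd α (L.connCoord j) x p q = pd α (fun y => ∑ d, L.coframe y d j * L.conn d y p q)
          x := by simp only [mpd, connCoord, of_apply, msum, msmul, smul_eq_mul]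
      rw [h2, h1]
      exact sum_ext fun d => pd_mul (h.coframe_smooth.ediff d j) ((hcs d).ediff p q)
    · have hD : ∀ c d, L.coframe x c (inr k) • frameD (L.conn d) x c = 0 := by
        rintro (c | c) d
        · simp [coframe]
        · simp [frameD]
      have hD' : ∀ c d, (L.coframe x c (inr k) * L.coframe x d j) • frameD (L.conn d) x c = 0 := by
        intro c d
        rw [mul_comm, mul_smul, hD, smul_zero]
      simp [hD']
  have hbr : ∀ i j, (∑ c, mpd i (fun z : B ⊕ K → ℝ => L.coframe (z ∘ inl)) z c j • L.conn c x) - (∑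
      c, mpd j (fun z : B ⊕ K → ℝ => L.coframe (z ∘ inl)) z c i • L.conn c x) = ∑ c, ∑ d, (L.coframe
      x c i * L.coframe x d j) • L.bracketTerm x c d := by
    intro i j
    rw [mpd_comp_inl h.coframe_smooth.ediff, mpd_comp_inl h.coframe_smooth.ediff, ← sum_sub]
    simp only [← sub_smul, ← hx]
    have hcurl := coframe_curl (L := L) (x := x) h.F_eq.self_of_nhds
    rcases i with α | k <;> rcases j with β | l
    · simp only [Sum.elim_inl, hcurl]
      simp [bracketTerm, coframe, mone]
    · simp [bracketTerm, mpd_coframe_inr, coframe]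
    · simp [bracketTerm, mpd_coframe_inr, coframe]
    · simp [bracketTerm, coframe]
  have hexp : ∀ i j, L.connCoord i x * L.connCoord j x = ∑ c, ∑ d, (L.coframe x c i * L.coframe x d
      j) • (L.conn c x * L.conn d x) := by
    intro i j
    simp only [connCoord, sum_mul, mul_sum, smul_mul, mmul_smul, smul_smul]
    rw [sum_comm]
    refine sum_ext₂ fun c d => ?_
    first | rfl | rw [mul_comm]
  have hswap : ∀ (f : B ⊕ K → B ⊕ K → Matrix (B ⊕ K) (B ⊕ K) ℝ) i j, ∑ c, ∑ d, (L.coframe x c j *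
      L.coframe x d i) • f c d = ∑ c, ∑ d, (L.coframe x c i * L.coframe x d j) • f d c := by
    intro f i j
    rw [sum_comm]
    exact sum_ext₂ fun c d => by rw [mul_comm]
  have hb := hbr i j
  simp only [curv, hmp, frameCurv, smul_add, smul_sub, sum_add, sum_sub, ← hb]
  simp only [← hx]
  rw [hexp i j, hexp j i, hswap _ i j, hswap _ i j]
  abel

lemma metric_smooth (h : L.Regular x) : MSmooth L.metric x := MSmooth.fromBlocks' (h.g_smooth.add
  ((h.a_smooth.transpose.mul h.xi_smooth).mul h.a_smooth)) (h.a_smooth.transpose.mul h.xi_smooth)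
  (h.xi_smooth.mul h.a_smooth) h.xi_smooth

theorem ricci_metric_eq_zero_iff (h : L.Regular (z ∘ inl)) : (∀ i j, ricci (fun z : B ⊕ K → ℝ =>
    L.metric (z ∘ inl)) i j z = 0) ↔ ∀ b d, L.frameRicci (z ∘ inl) b d = 0 := by
  simp only [ricci_metric_eq h]
  exact sum_conj_eq_zero_iff (L.coframe_mul_frame _) (of (L.frameRicci (z ∘ inl)))

end LocalFields

end

section

lemma mpd_ginv {ι : Type*} [Fintype ι] [DecidableEq ι] {g : ℝ^ι → Matrix ι ι ℝ} {x : ℝ^ι} (hg :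
    MSmooth g x) (hs : ∀ᶠ z in 𝓝 x, (g z)ᵀ = g z) (hu : (g x).det ≠ 0) (i : ι) : mpd i (fun z => (g
    z)⁻¹) x = -((g x)⁻¹ * (lc g i x)ᵀ + lc g i x * (g x)⁻¹) := by
  have h1 : g x * (g x)⁻¹ = 1 := mmul_inv _ hu.isUnit
  have h2 : (g x)⁻¹ * g x = 1 := minv_mul _ hu.isUnit
  rw [mpd_inv hg hu, lcMatrix_compat hs hu]
  congr 1
  rw [mmul_add, madd_mul, ← mmul_assoc (g x)⁻¹ (g x), h2, mone_mul, mmul_assoc, mmul_assoc, h1,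
    mmul_one]

/-- The wave operator of a function. -/
def box {ι : Type*} [Fintype ι] [DecidableEq ι] (g : ℝ^ι → Matrix ι ι ℝ) (f : ℝ^ι → ℝ)
    (x : ℝ^ι) : ℝ :=
  ∑ α, ∑ β, (g x)⁻¹ α β * (pd α (pd β f) x - ∑ l, Chr g l α β x * pd l f x)

lemma div_grad {ι : Type*} [Fintype ι] [DecidableEq ι] {g : ℝ^ι → Matrix ι ι ℝ} {x : ℝ^ι} (hg :
    MSmooth g x) (hs : ∀ᶠ z in 𝓝 x, (g z)ᵀ = g z) (hu : (g x).det ≠ 0) {v : ι → ℝ^ι → ℝ} (hv : ∀ α,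
    Smooth (v α) x) : ∑ α, pd α (fun y => ∑ β, (g y)⁻¹ α β * v β y) x + ∑ α, ∑ β, Chr g α α β x * ∑
    γ, (g x)⁻¹ β γ * v γ x = ∑ α, ∑ β, (g x)⁻¹ α β * (pd α (v β) x - ∑ l, Chr g l α β x * v l x) :=
    by
  have hi := hg.inv hu
  have h1 : ∀ α, pd α (fun y => ∑ β, (g y)⁻¹ α β * v β y) x = ∑ β, (mpd α (fun y => (g y)⁻¹) x α β *
      v β x + (g x)⁻¹ α β * pd α (v β) x) := by
    intro α
    refine (pd_sum (f := fun β y => (g y)⁻¹ α β * v β y) fun β _ => ((hi α β).mul (hv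
      β)).differentiableAt (by decide)).trans ?_
    exact sum_ext fun β => pd_mul (hi.ediff α β) (diffAt (hv β))
  simp only [h1, mpd_ginv hg hs hu, mneg, madd, mmul, tr_apply, lc_apply, sum_add, neg_add, add_mul,
    neg_mul, sum_neg, sum_mul, mul_sum, mul_sub, sum_sub]
  have e1 : ∑ α, ∑ β, ∑ l, (g x)⁻¹ α l * Chr g β α l x * v β x = ∑ α, ∑ β, ∑ l, (g x)⁻¹ α β * (Chr g
      l α β x * v l x) := by
    refine sum_ext fun α => ?_
    rw [sum_comm]
    exact sum_ext₂ fun β l => by ring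
  have e2 : ∑ α, ∑ β, ∑ l, Chr g α α l x * (g x)⁻¹ l β * v β x = ∑ α, ∑ β, ∑ l, Chr g α α β x * ((g
      x)⁻¹ β l * v l x) := by
    refine sum_ext fun α => ?_
    rw [sum_comm]
    exact sum_ext₂ fun β l => by ring
  rw [e1, e2]
  ring

namespace LocalFields

variable {B K : Type*} [Fintype B] [DecidableEq B] [Fintype K] [DecidableEq K] {L : LocalFields B K}
  {x : ℝ^B}

variable {X : ℝ^B → ℝ}

lemma conn_lll (α γ δ : B) : L.conn (inl α) x (inl γ) (inl δ) = Chr L.g γ α δ x := rfl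
lemma conn_llr (α γ : B) (k : K) : L.conn (inl α) x (inl γ) (inr k) = (1 / 2) * L.Fend k x γ α :=
    rfl
lemma conn_lrl (α γ : B) (k : K) : L.conn (inl α) x (inr k) (inl γ) = -(1 / 2) * L.F k x α γ := rfl
lemma conn_lrr (α : B) (k l : K) : L.conn (inl α) x (inr k) (inr l) = (1 / 2) * L.S α x k l := rfl
lemma conn_rll (k : K) (γ δ : B) : L.conn (inr k) x (inl γ) (inl δ) = (1 / 2) * L.Fend k x γ δ :=
    rfl
lemma conn_rlr (k : K) (γ : B) (l : K) : L.conn (inr k) x (inl γ) (inr l) = -(1 / 2) * L.Q γ x k l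
    := rfl
lemma conn_rrl (k l : K) (γ : B) : L.conn (inr k) x (inr l) (inl γ) = (1 / 2) * L.S γ x l k := rfl
lemma conn_rrr (k l p : K) : L.conn (inr k) x (inr l) (inr p) = 0 := rfl

lemma Regular.Fend_trace (h : L.Regular x) (k : K) : ∑ γ, L.Fend k x γ γ = 0 := by
  have h1 : (L.Flow k x)ᵀ = -L.Flow k x := by
    simp [Flow, transpose_sum, transpose_smul, h.F_antisymm.self_of_nhds]
  have h2 : ((L.g x)⁻¹)ᵀ = (L.g x)⁻¹ := by rw [tr_inv, h.g_symm.self_of_nhds]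
  have h3 : (L.Fend k x).trace = -(L.Fend k x).trace := by
    conv_lhs => rw [Fend, ← trace_transpose, transpose_mul, transpose_transpose, h2, trace_mul_comm]
    rw [Fend, h1, Matrix.mul_neg, trace_neg, neg_neg]
  change (L.Fend k x).trace = 0
  linarith

lemma ginv_symm (h : (L.g x)ᵀ = L.g x) (α β : B) : (L.g x)⁻¹ α β = (L.g x)⁻¹ β α := by
  have h2 : ((L.g x)⁻¹)ᵀ = (L.g x)⁻¹ := by rw [tr_inv, h]
  exact congr_fun₂ h2 β α

lemma Fend_apply (k : K) (γ α : B) : L.Fend k x γ α = ∑ δ, (L.g x)⁻¹ γ δ * ∑ l, L.xi x k l * L.F l x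
    α δ := by simp only [Fend, mmul, tr_apply, Flow, msum, msmul, smul_eq_mul]

/-- The contraction `-F^p_{αγ} F_{pβ}^γ`. -/
def FF (L : LocalFields B K) (x : ℝ^B) (α β : B) : ℝ :=
  ∑ γ, ∑ p, L.F p x γ α * L.Fend p x γ β

lemma Regular.FF_symm (h : L.Regular x) (α β : B) : L.FF x α β = L.FF x β α := by
  have hF : ∀ p γ α, L.F p x α γ = -L.F p x γ α := fun p γ α => congrFun (congrFun
    (h.F_antisymm.self_of_nhds p) γ) α
  have hg := ginv_symm h.g_symm.self_of_nhds
  have hx : ∀ k l, L.xi x k l = L.xi x l k := fun k l => congr_fun₂ h.xi_symm.self_of_nhds l k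
  simp only [FF, Fend_apply, mul_sum]
  calc ∑ γ, ∑ p, ∑ δ, ∑ l, L.F p x γ α * ((L.g x)⁻¹ γ δ * (L.xi x p l * L.F l x β δ)) = ∑ γ, ∑ δ, ∑
      p, ∑ l, L.F p x γ α * ((L.g x)⁻¹ γ δ * (L.xi x p l * L.F l x β δ)) := sum_ext fun γ =>
      sum_comm
    _ = ∑ δ, ∑ γ, ∑ l, ∑ p, L.F p x γ α * ((L.g x)⁻¹ γ δ * (L.xi x p l * L.F l x β δ)) := by
        rw [sum_comm]
        exact sum_ext₂ fun γ γ => sum_comm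
    _ = ∑ δ, ∑ γ, ∑ l, ∑ p, L.F l x δ β * ((L.g x)⁻¹ δ γ * (L.xi x l p * L.F p x α γ)) := by
        refine sum_ext₂ fun δ γ => sum_ext₂ fun l p => ?_
        rw [hF l δ β, hF p γ α, hg γ δ, hx p l]
        ring
    _ = _ := sum_ext fun γ => sum_comm

theorem Regular.frameRicci_fibre (h : L.Regular x) (hX : ∀ᶠ y in 𝓝 x, ∀ α, pd α X y = (1 / 2) * (L.S
    α y).trace) (k l : K) : L.frameRicci x (inr k) (inr l) = -(1 / 2) * box L.g (fun y => L.xi y k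
    l) x + (1 / 2) * (∑ α, ∑ β, (L.g x)⁻¹ α β * (mpd α L.xi x * (L.xi x)⁻¹ * mpd β L.xi x) k l) - (1
    / 2) * (∑ α, ∑ β, (L.g x)⁻¹ α β * (pd α X x * mpd β L.xi x k l)) - (1 / 4) * (L.Fend l x *
    L.Fend k x).trace := by
  have hg := ginv_symm h.g_symm.self_of_nhds
  have hx : ∀ k l, L.xi x k l = L.xi x l k := fun k l => congr_fun₂ h.xi_symm.self_of_nhds l k
  have hxi' : ((L.xi x)⁻¹)ᵀ = (L.xi x)⁻¹ := by rw [tr_inv, h.xi_symm.self_of_nhds]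
  have hdx : ∀ α, (mpd α L.xi x)ᵀ = mpd α L.xi x := fun α => by
    ext k l
    exact pd_congr (h.xi_symm.mono fun z hz => congr_fun₂ hz k l)
  have hdx' : ∀ α k l, mpd α L.xi x k l = mpd α L.xi x l k := fun α k l => congrFun (congrFun (hdx
    α) l) k
  have hQ := Q_symm (L := L) h.xi_symm
  have hd : ∀ γ, mpd γ (L.conn (inr l)) x (inl γ) (inr k) = -(1 / 2) * pd γ (fun y => L.Q γ y k l) x
      := by
    intro γ
    have : pd γ (fun y => L.Q γ y k l) x = pd γ (fun y => L.Q γ y l k) x := pd_congr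
      (h.xi_symm.eventually_nhds.mono fun z hz => Q_symm hz γ k l)
    rw [this]
    exact pd_const_mul _ ((h.Q_smooth γ).ediff l k)
  have h1 : ∀ γ, L.frameCurv x (inl γ) (inr l) (inl γ) (inr k) = -(1 / 2) * pd γ (fun y => L.Q γ y k
      l) x - (1 / 2) * (∑ δ, Chr L.g γ γ δ x * L.Q δ x l k) - (1 / 4) * (∑ δ, L.Fend l x γ δ *
      L.Fend k x δ γ) + (1 / 4) * (∑ p, L.Q γ x l p * L.S γ x p k) := by
    intro γ
    simp only [frameCurv, frameD, bracketTerm, madd, msub, mzero, mmul, sum_sum_type, conn_lll,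
      conn_llr, conn_lrl, conn_lrr, conn_rll, conn_rlr, conn_rrl, conn_rrr, hd, mul_zero, sum_zero,
      mul_sum]
    have e1 : ∀ δ, Chr L.g γ γ δ x * (-(1 / 2) * L.Q δ x l k) = -((1 / 2) * (Chr L.g γ γ δ x * L.Q δ
        x l k)) := fun δ => by ring
    have e2 : ∀ δ, 1 / 2 * L.Fend l x γ δ * (1 / 2 * L.Fend k x δ γ) = (1 / 4) * (L.Fend l x γ δ *
        L.Fend k x δ γ) := fun δ => by ring
    have e3 : ∀ p, -(1 / 2) * L.Q γ x l p * (1 / 2 * L.S γ x p k) = -((1 / 4) * (L.Q γ x l p * L.S γ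
        x p k)) := fun δ => by ring
    simp only [e1, e2, e3, sum_neg]
    ring
  have h2 : ∀ p, L.frameCurv x (inr p) (inr l) (inr p) (inr k) = -(1 / 4) * (∑ δ, L.S δ x p p * L.Q
      δ x l k) + (1 / 4) * (∑ δ, L.S δ x p l * L.Q δ x p k) := by
    intro p
    simp only [frameCurv, frameD, bracketTerm, madd, msub, mzero, mmul, sum_sum_type, conn_rll,
      conn_rlr, conn_rrl, conn_rrr, mul_zero, sum_zero, mul_sum]
    have e1 : ∀ δ, 1 / 2 * L.S δ x p p * (-(1 / 2) * L.Q δ x l k) = -(1 / 4) * (L.S δ x p p * L.Q δ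
        x l k) := fun δ => by ring
    have e2 : ∀ δ, 1 / 2 * L.S δ x p l * (-(1 / 2) * L.Q δ x p k) = -(1 / 4 * (L.S δ x p l * L.Q δ x
        p k)) := fun δ => by ring
    simp only [e1, e2, sum_neg]
    ring
  have h3 : L.frameRicci x (inr k) (inr l) = -(1 / 2) * (∑ γ, pd γ (fun y => L.Q γ y k l) x + ∑ γ, ∑
      δ, Chr L.g γ γ δ x * L.Q δ x l k) - (1 / 4) * (∑ γ, ∑ δ, L.Fend l x γ δ * L.Fend k x δ γ) + (1
      / 4) * (∑ γ, ∑ p, L.Q γ x l p * L.S γ x p k) - (1 / 4) * (∑ p, ∑ δ, L.S δ x p p * L.Q δ x l k)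
      + (1 / 4) * (∑ p, ∑ δ, L.S δ x p l * L.Q δ x p k) := by
    simp only [frameRicci, sum_sum_type, h1, h2, sum_add, sum_sub, ← mul_sum]
    ring
  have hbox : ∑ γ, pd γ (fun y => L.Q γ y k l) x + ∑ γ, ∑ δ, Chr L.g γ γ δ x * L.Q δ x l k = box L.g
      (fun y => L.xi y k l) x := by
    have := div_grad h.g_smooth h.g_symm h.g_det (v := fun α => pd α (fun y => L.xi y k l)) (fun α
      => contDiffAt_pd (h.xi_smooth k l))
    rw [box, ← this]
    simp only [hQ _ l k]
    simp only [Q, msum, msmul, smul_eq_mul, mpd, of_apply]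
  have hN1 : ∑ γ, ∑ p, L.Q γ x l p * L.S γ x p k = ∑ α, ∑ β, (L.g x)⁻¹ α β * (mpd α L.xi x * (L.xi
      x)⁻¹ * mpd β L.xi x) k l := by
    have e : ∀ γ, ∑ p, L.Q γ x l p * L.S γ x p k = ∑ β, (L.g x)⁻¹ γ β * (mpd γ L.xi x * (L.xi x)⁻¹ *
        mpd β L.xi x) k l := by
      intro γ
      rw [← mmul, Q, S, sum_mul, msum]
      refine sum_ext fun β => ?_
      rw [smul_mul, msmul, smul_eq_mul]
      congr 1
      have e : (mpd γ L.xi x * (L.xi x)⁻¹ * mpd β L.xi x)ᵀ = mpd β L.xi x * ((L.xi x)⁻¹ * mpd γ L.xi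
          x) := by rw [transpose_mul, transpose_mul, hxi', hdx, hdx]
      exact (congr_fun₂ e l k).symm
    simp only [e]
  have hN2 : ∑ p, ∑ δ, L.S δ x p l * L.Q δ x p k = ∑ α, ∑ β, (L.g x)⁻¹ α β * (mpd α L.xi x * (L.xi
      x)⁻¹ * mpd β L.xi x) k l := by
    rw [← hN1, sum_comm]
    have e : ∀ γ, ∑ p, L.S γ x p l * L.Q γ x p k = ((L.Q γ x) * L.S γ x) k l := by
      intro γ
      rw [mmul]
      exact sum_ext fun p => by rw [hQ γ p k, mul_comm]
    simp only [e]
    simp only [← mmul]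
    simp only [Q, S, sum_mul, msum, smul_mul, msmul]
    rw [sum_comm]
    refine sum_ext₂ fun α β => ?_
    rw [hg β α]
    congr 1
    have e : (mpd α L.xi x * ((L.xi x)⁻¹ * mpd β L.xi x))ᵀ = mpd β L.xi x * ((L.xi x)⁻¹ * mpd α L.xi
        x) := by rw [transpose_mul, transpose_mul, hxi', hdx, hdx, mmul_assoc]
    exact congr_fun₂ e l k
  have hXX : ∑ p, ∑ δ, L.S δ x p p * L.Q δ x l k = 2 * ∑ α, ∑ β, (L.g x)⁻¹ α β * (pd α X x * mpd β
      L.xi x k l) := by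
    rw [sum_comm, mul_sum]
    refine sum_ext fun α => ?_
    rw [hX.self_of_nhds, ← sum_mul, show ∑ p, L.S α x p p = (L.S α x).trace from rfl]
    simp only [Q, msum, msmul, smul_eq_mul, mul_sum, hdx' _ l k]
    exact sum_ext fun β => by ring
  have hT : ∑ γ, ∑ δ, L.Fend l x γ δ * L.Fend k x δ γ = (L.Fend l x * L.Fend k x).trace := by
    simp only [trace, diag_apply, mmul]
  rw [h3, hbox, hN1, hN2, hXX, hT]
  ring

theorem Regular.frameRicci_mixed (h : L.Regular x) (hX : ∀ᶠ y in 𝓝 x, ∀ α, pd α X y = (1 / 2) * (L.S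
    α y).trace) (α : B) (k : K) : L.frameRicci x (inl α) (inr k) = (1 / 2) * (∑ γ, pd γ (fun y =>
    L.Fend k y γ α) x + (∑ γ, ∑ δ, Chr L.g γ γ δ x * L.Fend k x δ α) - (∑ γ, ∑ δ, L.Fend k x γ δ *
    Chr L.g δ γ α x) + ∑ γ, pd γ X x * L.Fend k x γ α) := by
  have hd : ∀ γ, mpd γ (L.conn (inr k)) x (inl γ) (inl α) = (1 / 2) * pd γ (fun y => L.Fend k y γ α)
      x := fun γ => pd_const_mul _ ((h.Fend_smooth k).ediff γ α)
  have h1 : ∀ γ, L.frameCurv x (inl γ) (inr k) (inl γ) (inl α) = (1 / 2) * pd γ (fun y => L.Fend k y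
      γ α) x + (1 / 2) * (∑ δ, Chr L.g γ γ δ x * L.Fend k x δ α) + (1 / 4) * (∑ p, L.Fend p x γ γ *
      L.S α x p k) - (1 / 2) * (∑ δ, L.Fend k x γ δ * Chr L.g δ γ α x) - (1 / 4) * (∑ p, L.Q γ x k p
      * L.F p x γ α) := by
    intro γ
    simp only [frameCurv, frameD, bracketTerm, madd, msub, mzero, mmul, sum_sum_type, conn_lll,
      conn_llr, conn_lrl, conn_lrr, conn_rll, conn_rlr, conn_rrl, conn_rrr, hd, mul_sum]
    have e1 : ∀ δ, Chr L.g γ γ δ x * (1 / 2 * L.Fend k x δ α) = 1 / 2 * (Chr L.g γ γ δ x * L.Fend k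
        x δ α) := fun δ => by ring
    have e2 : ∀ p, 1 / 2 * L.Fend p x γ γ * (1 / 2 * L.S α x p k) = 1 / 4 * (L.Fend p x γ γ * L.S α
        x p k) := fun p => by ring
    have e3 : ∀ p, -(1 / 2) * L.Q γ x k p * (-(1 / 2) * L.F p x γ α) = 1 / 4 * (L.Q γ x k p * L.F p
        x γ α) := fun p => by ring
    simp only [e1, e2, e3, mul_assoc]
    ring
  have h2 : ∀ p, L.frameCurv x (inr p) (inr k) (inr p) (inl α) = (1 / 4) * (∑ δ, L.S δ x p p *
      L.Fend k x δ α) - (1 / 4) * (∑ δ, L.S δ x p k * L.Fend p x δ α) := by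
    intro p
    simp only [frameCurv, frameD, bracketTerm, madd, msub, mzero, mmul, sum_sum_type, conn_rll,
      conn_rlr, conn_rrl, conn_rrr, zero_mul, sum_zero, mul_sum]
    have e1 : ∀ δ q, 1 / 2 * L.S δ x p q * (1 / 2 * L.Fend k x δ α) = 1 / 4 * (L.S δ x p q * L.Fend
        k x δ α) := fun δ q => by ring
    have e2 : ∀ δ, 1 / 2 * L.S δ x p k * (1 / 2 * L.Fend p x δ α) = 1 / 4 * (L.S δ x p k * L.Fend p
        x δ α) := fun δ => by ring
    simp only [e1, e2]
    ring
  have hxx : ∀ k l, L.xi x k l = L.xi x l k := fun k l => congr_fun₂ h.xi_symm.self_of_nhds l k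
  have hdx : ∀ α k l, mpd α L.xi x k l = mpd α L.xi x l k := fun α k l => pd_congr (h.xi_symm.mono
    fun z hz => congr_fun₂ hz l k)
  have hF : ∀ p γ α, L.F p x α γ = -L.F p x γ α := fun p γ α => congrFun (congrFun
    (h.F_antisymm.self_of_nhds p) γ) α
  have hg := ginv_symm h.g_symm.self_of_nhds
  have hc1 : ∑ γ, ∑ p, L.Fend p x γ γ * L.S α x p k = 0 := by
    rw [sum_comm]
    refine sum_eq_zero fun p _ => ?_
    rw [← sum_mul, h.Fend_trace, zero_mul]
  have hc2 : ∑ p, ∑ δ, L.S δ x p k * L.Fend p x δ α = -∑ γ, ∑ p, L.Q γ x k p * L.F p x γ α := by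
    have e : ∀ δ, ∑ p, L.S δ x p k * L.Fend p x δ α = ∑ ε, ∑ q, (L.g x)⁻¹ δ ε * (mpd δ L.xi x k q *
        L.F q x α ε) := by
      intro δ
      simp only [Fend_apply, mul_sum]
      rw [sum_comm]
      refine sum_ext fun ε => ?_
      rw [sum_comm]
      refine sum_ext fun q => ?_
      have := congrFun (congrFun (xi_mul_S h.xi_det δ) q) k
      rw [hdx, ← this, mmul, sum_mul, mul_sum]
      refine sum_ext fun p => ?_
      rw [hxx p q]
      ring
    rw [sum_comm]
    simp only [e, Q, msum, msmul, smul_eq_mul, sum_mul]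
    rw [sum_comm, ← sum_neg]
    refine sum_ext fun ε => ?_
    rw [← sum_neg, sum_comm]
    refine sum_ext fun q => ?_
    rw [← sum_neg]
    refine sum_ext fun δ => ?_
    rw [hg δ ε, hF q ε α]
    ring
  have hXX : ∑ p, ∑ δ, L.S δ x p p * L.Fend k x δ α = 2 * ∑ γ, pd γ X x * L.Fend k x γ α := by
    rw [sum_comm, mul_sum]
    refine sum_ext fun γ => ?_
    rw [hX.self_of_nhds, ← sum_mul, trace]
    simp only [diag_apply]
    ring
  simp only [frameRicci, sum_sum_type, h1, h2, sum_add, sum_sub, ← mul_sum, hc1, hc2, hXX]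
  ring

theorem Regular.frameRicci_base (h : L.Regular x) (hX : ∀ᶠ y in 𝓝 x, ∀ α, pd α X y = (1 / 2) * (L.S
    α y).trace) (α β : B) : L.frameRicci x (inl α) (inl β) = ricci L.g α β x + (1 / 2) * L.FF x α β
    - (pd β (pd α X) x - ∑ γ, Chr L.g γ β α x * pd γ X x) - (1 / 4) * (L.S β x * L.S α x).trace :=
    by
  have h1 : ∀ γ, L.frameCurv x (inl γ) (inl β) (inl γ) (inl α) = curv (lc L.g) γ β x γ α - (1 / 4) *
      (∑ p, L.Fend p x γ γ * L.F p x β α) + (1 / 4) * (∑ p, L.Fend p x γ β * L.F p x γ α) + (1 / 2)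
      * (∑ p, L.F p x γ β * L.Fend p x γ α) := by
    intro γ
    have hd : ∀ δ ε, mpd δ (L.conn (inl ε)) x (inl γ) (inl α) = mpd δ (lc L.g ε) x γ α := fun δ ε =>
        rfl
    simp only [frameCurv, frameD, bracketTerm, madd, msub, msum, msmul, smul_eq_mul, curv, mzero,
      mmul, sum_sum_type, conn_lll, conn_llr, conn_lrl, conn_lrr, conn_rll, conn_rlr, conn_rrl,
      conn_rrr, hd, mul_sum, lc_apply]
    have e1 : ∀ p δ, 1 / 2 * L.Fend p x γ δ * (-(1 / 2) * L.F p x β α) = -(1 / 4 * (L.Fend p x γ δ *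
        L.F p x β α)) := fun p δ => by ring
    have e2 : ∀ p, 1 / 2 * L.Fend p x γ β * (-(1 / 2) * L.F p x γ α) = -(1 / 4 * (L.Fend p x γ β *
        L.F p x γ α)) := fun p => by ring
    have e3 : ∀ p, L.F p x γ β * (1 / 2 * L.Fend p x γ α) = 1 / 2 * (L.F p x γ β * L.Fend p x γ α)
        := fun p => by ring
    simp only [e1, e2, e3, sum_neg]
    ring
  have hd2 : ∀ p, mpd β (L.conn (inr p)) x (inr p) (inl α) = (1 / 2) * pd β (fun y => L.S α y p p) x
      := fun p => pd_const_mul _ ((h.S_smooth α).ediff p p)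
  have h2 : ∀ p, L.frameCurv x (inr p) (inl β) (inr p) (inl α) = -((1 / 2) * pd β (fun y => L.S α y
      p p) x) + (1 / 4) * (∑ γ, L.F p x β γ * L.Fend p x γ α) - (1 / 4) * (∑ l, L.S β x p l * L.S α
      x l p) + (1 / 2) * (∑ γ, L.S γ x p p * Chr L.g γ β α x) := by
    intro p
    simp only [frameCurv, frameD, bracketTerm, madd, msub, mzero, mmul, sum_sum_type, conn_lll,
      conn_llr, conn_lrl, conn_lrr, conn_rll, conn_rlr, conn_rrl, conn_rrr, hd2, zero_mul, sum_zero,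
      mul_sum]
    have e1 : ∀ γ, -(1 / 2) * L.F p x β γ * (1 / 2 * L.Fend p x γ α) = -(1 / 4 * (L.F p x β γ *
        L.Fend p x γ α)) := fun γ => by ring
    have e2 : ∀ l, 1 / 2 * L.S β x p l * (1 / 2 * L.S α x l p) = 1 / 4 * (L.S β x p l * L.S α x l p)
        := fun l => by ring
    simp only [e1, e2, mul_assoc, sum_neg]
    ring
  have hF : ∀ p γ α, L.F p x α γ = -L.F p x γ α := fun p γ α => congrFun (congrFun
    (h.F_antisymm.self_of_nhds p) γ) α
  have hc1 : ∑ γ, ∑ p, L.Fend p x γ γ * L.F p x β α = 0 := by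
    rw [sum_comm]
    refine sum_eq_zero fun p _ => ?_
    rw [← sum_mul, h.Fend_trace, zero_mul]
  have hc2 : ∑ γ, ∑ p, L.Fend p x γ β * L.F p x γ α = L.FF x α β := sum_ext₂ fun γ p => mul_comm _ _
  have hc3 : ∑ γ, ∑ p, L.F p x γ β * L.Fend p x γ α = L.FF x α β := h.FF_symm β α
  have hc4 : ∑ p, ∑ γ, L.F p x β γ * L.Fend p x γ α = -L.FF x α β := by
    rw [← hc3, sum_comm, ← sum_neg]
    refine sum_ext fun γ => ?_
    rw [← sum_neg]
    exact sum_ext fun p => by rw [hF p γ β]; ring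
  have hdX : ∑ p, pd β (fun y => L.S α y p p) x = 2 * pd β (pd α X) x := by
    rw [pd_congr (hX.mono fun y hy => hy α), pd_const_mul, ← mul_assoc]
    · norm_num
      exact (pd_sum (f := fun p y => L.S α y p p) fun p _ => (h.S_smooth α).ediff p p).symm
    · exact DifferentiableAt.fun_sum (A := fun p y => L.S α y p p) fun p _ => (h.S_smooth α).ediff p
        p
  have hGX : ∑ p, ∑ γ, L.S γ x p p * Chr L.g γ β α x = 2 * ∑ γ, Chr L.g γ β α x * pd γ X x := by
    rw [sum_comm, mul_sum]
    refine sum_ext fun γ => ?_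
    rw [hX.self_of_nhds, ← sum_mul, trace]
    simp only [diag_apply]
    ring
  have hT : ∑ p, ∑ l, L.S β x p l * L.S α x l p = (L.S β x * L.S α x).trace := by
    simp only [trace, diag_apply, mmul]
  simp only [frameRicci, sum_sum_type, h1, h2, sum_add, sum_sub, sum_neg, ← mul_sum, hc1, hc2, hc3,
    hc4, hdX, hGX, hT, ← ricci_eq_sum_curv h.g_symm]
  ring

end LocalFields

end

section

variable {ι : Type*} [Fintype ι] [DecidableEq ι]

variable {g : ℝ^ι → Matrix ι ι ℝ} {x : ℝ^ι}

lemma trace_lcMatrix (hs : ∀ᶠ z in 𝓝 x, (g z)ᵀ = g z) (hu : (g x).det ≠ 0) (i : ι) : ((g x)⁻¹ * mpd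
    i g x).trace = 2 * (lc g i x).trace := by
  have h3 : g x * (g x)⁻¹ = 1 := mmul_inv _ hu.isUnit
  have h4 : (g x)⁻¹ * g x = 1 := minv_mul _ hu.isUnit
  rw [lcMatrix_compat hs hu, mmul_add, trace_add, ← mmul_assoc, trace_mul_cycle, h3, mone_mul,
    trace_transpose, ← mmul_assoc, h4, mone_mul]
  ring

lemma sum_delta_mul (a : ι) (f : ℝ^ι) : ∑ b, (1 : Matrix ι ι ℝ) a b * f b = f a := by simp [mone]

lemma sum_delta_mul' (a : ι) (f : ℝ^ι) : ∑ b, (1 : Matrix ι ι ℝ) b a * f b = f a := by simp [mone]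

/-- The contravariant gradient. -/
def grad (g : ℝ^ι → Matrix ι ι ℝ) (f : ℝ^ι → ℝ) (k : ι) (x : ℝ^ι) : ℝ :=
  ∑ l, (g x)⁻¹ k l * pd l f x

lemma g_mul_grad (hu : (g x).det ≠ 0) (f : ℝ^ι → ℝ) (i : ι) : ∑ k, g x i k * grad g f k x = pd i f x
    := by
  have h3 : g x * (g x)⁻¹ = 1 := mmul_inv _ hu.isUnit
  simp only [grad, mul_sum]
  rw [sum_comm]
  simp only [← mul_assoc, ← sum_mul, ← mmul, h3]
  exact sum_delta_mul _ _

/-- The scalar product of the differentials of two functions. -/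
def gip (g : ℝ^ι → Matrix ι ι ℝ) (f f' : ℝ^ι → ℝ) (x : ℝ^ι) : ℝ :=
  ∑ α, ∑ β, (g x)⁻¹ α β * (pd α f x * pd β f' x)

lemma gradInner_eq_sum_grad (f f' : ℝ^ι → ℝ) : gip g f f' x = ∑ α, pd α f x * grad g f' α x := by
  simp only [gip, grad, mul_sum]
  exact sum_ext₂ fun α β => by ring

/-- The metric `e^{2X} g`. -/
def conf (X : ℝ^ι → ℝ) (g : ℝ^ι → Matrix ι ι ℝ) (x : ℝ^ι) : Matrix ι ι ℝ :=
  exp (2 * X x) • g x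

variable {X : ℝ^ι → ℝ} {g : ℝ^ι → Matrix ι ι ℝ} {x : ℝ^ι}

lemma conf_symm (hs : ∀ᶠ z in 𝓝 x, (g z)ᵀ = g z) : ∀ᶠ z in 𝓝 x, (conf X g z)ᵀ = conf X g z :=
    hs.mono fun z hz => by rw [conf, transpose_smul, hz]

lemma conf_det (hu : (g x).det ≠ 0) : (conf X g x).det ≠ 0 := by
  rw [conf, det_smul]
  exact mul_ne_zero (pow_ne_zero _ (Real.exp_pos _).ne') hu

lemma conf_inv (hu : (g x).det ≠ 0) : (conf X g x)⁻¹ = exp (-(2 * X x)) • (g x)⁻¹ := by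
  refine inv_eq_right_inv ?_
  rw [conf, smul_mul, mmul_smul, smul_smul, ← Real.exp_add, add_neg_cancel, Real.exp_zero, one_smul,
    mmul_inv _ hu.isUnit]

lemma christoffel_conf (hX : Diff X x) (hg : EDiff g x) (hs : ∀ᶠ z in 𝓝 x, (g z)ᵀ = g z) (hu : (g
    x).det ≠ 0) (k i j : ι) : Chr (conf X g) k i j x = Chr g k i j x + (1 : Matrix ι ι ℝ) k i * pd j
    X x + (1 : Matrix ι ι ℝ) k j * pd i X x - g x i j * grad g X k x := by
  have hsym := fun i j => congr_fun₂ hs.self_of_nhds i j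
  simp only [tr_apply] at hsym
  refine christoffel_unique (Γ := fun i => of fun k j => Chr g k i j x + (1 : Matrix ι ι ℝ) k i * pd
      j X x + (1 : Matrix ι ι ℝ) k j * pd i X x - g x i j * grad g X k x) (conf_symm
      hs).self_of_nhds (conf_det hu) ?_ ?_ k i j
  · intro i j k
    simp only [of_apply, christoffel_symm hs k i j, hsym j i]
    ring
  · intro p
    ext a b
    have h1 : mpd p (conf X g) x a b = exp (2 * X x) * (2 * pd p X x) * g x a b + exp (2 * X x) *
        mpd p g x a b := by
      have := pd_mul (i := p) (f := fun z => exp (2 * X z)) (g := fun z => g z a b) (x := x)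
        (hX.const_mul 2).exp (hg a b)
      rw [pd_exp (hX.const_mul 2), pd_const_mul _ hX] at this
      exact this
    rw [h1, lcMatrix_compat hs hu]
    have e1 : ∀ a b, ∑ q, (Chr g q p a x + (1 : Matrix ι ι ℝ) q p * pd a X x + (1 : Matrix ι ι ℝ) q
        a * pd p X x - g x p a * grad g X q x) * g x b q = ∑ q, Chr g q p a x * g x b q + pd a X x *
        g x b p + pd p X x * g x b a - g x p a * pd b X x := by
      intro a b
      rw [← g_mul_grad hu X b]
      simp only [sub_mul, add_mul, sum_sub, sum_add, mul_assoc, sum_delta_mul', mul_sum]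
      congr 1
      exact sum_ext fun q => by ring
    have e2 : ∀ q, g x q b = g x b q := fun q => hsym b q
    simp only [conf, madd, mmul, tr_apply, of_apply, msmul, smul_eq_mul, lc_apply, e2]
    have e3 := e1 a b
    have e4 := e1 b a
    have e5 : ∀ q, g x a q * Chr g q p b x = Chr g q p b x * g x a q := fun q => mul_comm _ _
    simp only [e2] at e4
    simp only [e5]
    have e6 : ∀ (f : ℝ^ι) (c : ι), ∑ q, f q * (exp (2 * X x) * g x c q) = exp (2 * X x) * ∑ q, f q *
        g x c q := by
      intro f c
      rw [mul_sum]
      exact sum_ext fun q => by ring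
    have e7 : ∀ (f : ℝ^ι) (c : ι), ∑ q, (exp (2 * X x) * g x c q) * f q = exp (2 * X x) * ∑ q, f q *
        g x c q := by
      intro f c
      rw [mul_sum]
      exact sum_ext fun q => by ring
    rw [e6, e7, e3, e4, hsym a b, hsym p a]
    ring

lemma box_conf (hX : Diff X x) (hg : EDiff g x) (hs : ∀ᶠ z in 𝓝 x, (g z)ᵀ = g z) (hu : (g x).det ≠
    0) (f : ℝ^ι → ℝ) : box (conf X g) f x = exp (-(2 * X x)) * (box g f x + ((Fintype.card ι : ℝ) -
    2) * gip g X f x) := by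
  have hsym := fun i j => congr_fun₂ hs.self_of_nhds i j
  simp only [tr_apply] at hsym
  have hgi : ((g x)⁻¹)ᵀ = (g x)⁻¹ := by rw [tr_inv, hs.self_of_nhds]
  have hgi' : ∀ α β, (g x)⁻¹ β α = (g x)⁻¹ α β := fun α β => congr_fun₂ hgi α β
  have h1 : ∀ α β, ∑ l, Chr (conf X g) l α β x * pd l f x = ∑ l, Chr g l α β x * pd l f x + pd β X x
      * pd α f x + pd α X x * pd β f x - g x α β * gip g X f x := by
    intro α β
    have e : gip g X f x = ∑ l, grad g X l x * pd l f x := by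
      simp only [gip, grad, sum_mul]
      rw [sum_comm]
      refine sum_ext₂ fun l q => ?_
      rw [hgi']
      ring
    simp only [christoffel_conf hX hg hs hu, sub_mul, add_mul, sum_sub, sum_add, mul_assoc,
      sum_delta_mul', ← mul_sum, ← e]
  have h2 : ∑ α, ∑ β, (g x)⁻¹ α β * g x α β = (Fintype.card ι : ℝ) := by
    have h4 : (g x)⁻¹ * g x = 1 := minv_mul _ hu.isUnit
    have e : ∀ α, ∑ β, (g x)⁻¹ α β * g x α β = 1 := by
      intro α
      have := congr_fun₂ h4 α α
      rw [mmul, one_apply_eq] at this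
      rw [← this]
      exact sum_ext fun β => by rw [hsym β α]
    simp [e]
  have h3 : ∑ α, ∑ β, (g x)⁻¹ α β * (pd β X x * pd α f x) = gip g X f x := by
    rw [gip, sum_comm]
    exact sum_ext₂ fun α β => by rw [hgi']
  have h4 : box (conf X g) f x = exp (-(2 * X x)) * ∑ α, ∑ β, ((g x)⁻¹ α β * (pd α (pd β f) x - ∑ l,
      Chr g l α β x * pd l f x) - (g x)⁻¹ α β * (pd β X x * pd α f x) - (g x)⁻¹ α β * (pd α X x * pd
      β f x) + (g x)⁻¹ α β * g x α β * gip g X f x) := by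
    simp only [box, conf_inv hu, h1, msmul, smul_eq_mul, mul_sum]
    refine sum_ext₂ fun α β => ?_
    ring
  rw [h4]
  simp only [sum_add, sum_sub, ← sum_mul, h2, h3]
  rw [← gip, ← box]
  ring

theorem ricci_conf (hX : Smooth X x) (hg : MSmooth g x) (hs : ∀ᶠ z in 𝓝 x, (g z)ᵀ = g z) (hu : (g
    x).det ≠ 0) (i j : ι) : ricci (conf X g) i j x = ricci g i j x - ((Fintype.card ι : ℝ) - 2) *
    (pd j (pd i X) x - ∑ l, Chr g l j i x * pd l X x - pd i X x * pd j X x) - (box g X x +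
    ((Fintype.card ι : ℝ) - 2) * gip g X X x) * g x i j := by
  have hsym := fun i j => congr_fun₂ hs.self_of_nhds i j
  simp only [tr_apply] at hsym
  have hY : ∀ k, Smooth (grad g X k) x := fun k => ContDiffAt.sum fun l _ => (hg.inv hu k l).mul
    (contDiffAt_pd hX)
  have hX1 : ∀ k, Smooth (pd k X) x := fun k => contDiffAt_pd hX
  have hlc := fun i k j => lcMatrix_smooth hg hu i k j
  set A : ι → ℝ^ι → Matrix ι ι ℝ := fun i z => of fun k j => (1 : Matrix ι ι ℝ) k i * pd j X z - g z
    i j * grad g X k z with hA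
  have hAa : ∀ i z k j, A i z k j = (1 : Matrix ι ι ℝ) k i * pd j X z - g z i j * grad g X k z :=
    fun _ _ _ _ => rfl
  have hAs : ∀ i, MSmooth (A i) x := fun i k j => (contDiffAt_const.mul (hX1 j)).sub ((hg i j).mul
    (hY k))
  have hconf : ∀ᶠ z in 𝓝 x, ∀ i, lc (conf X g) i z = lc g i z + A i z + pd i X z • (1 : Matrix ι ι
      ℝ) := by
    filter_upwards [ev_diffAt hX, hg.eventually_ediff, hs.eventually_nhds, ev_det hg hu] with z h1
      h2 h3 h4 i
    ext k j
    simp only [lc_apply, madd, msmul, smul_eq_mul, hAa, christoffel_conf h1 h2 h3 h4]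
    ring
  have hm : ∀ i j k l, mpd i (lc (conf X g) j) x k l = mpd i (lc g j) x k l + mpd i (A j) x k l + pd
      i (pd j X) x * (1 : Matrix ι ι ℝ) k l := by
    intro i j k l
    rw [mpd_congr (hconf.mono fun z hz => hz j)]
    have h1 := pd_add (i := i) (f := fun z => lc g j z k l + A j z k l) (g := fun z => pd j X z * (1
      : Matrix ι ι ℝ) k l) (x := x) (((hlc j k l).add (hAs j k l)).differentiableAt (by decide))
      (((hX1 j).mul contDiffAt_const).differentiableAt (by decide))
    rw [pd_add (diffAt (hlc j k l)) (diffAt (hAs j k l)), pd_mul (diffAt (hX1 j))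
      (differentiableAt_const _), pd_const, mul_zero, add_zero] at h1
    exact h1
  have hcomm : ∀ i j, pd i (pd j X) x = pd j (pd i X) x := fun i j => pd_comm (ev_C2
    hX).self_of_nhds
  have hcurv : ∀ k, curv (lc (conf X g)) k j x k i = curv (lc g) k j x k i + mpd k (A j) x k i - mpd
      j (A k) x k i + ∑ l, lc g k x k l * A j x l i - ∑ l, A j x k l * lc g k x l i + ∑ l, A k x k l
      * lc g j x l i - ∑ l, lc g j x k l * A k x l i + ∑ l, A k x k l * A j x l i - ∑ l, A j x k l *
      A k x l i := by
    intro k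
    have hp : lc (conf X g) k x * lc (conf X g) j x - lc (conf X g) j x * lc (conf X g) k x = lc g k
        x * lc g j x - lc g j x * lc g k x + (lc g k x * A j x - A j x * lc g k x + (A k x * lc g j
        x - lc g j x * A k x) + (A k x * A j x - A j x * A k x)) := by
      rw [hconf.self_of_nhds, hconf.self_of_nhds]
      simp only [madd_mul, mmul_add, smul_mul, mmul_smul, mone_mul, mmul_one, smul_add, smul_smul,
        mul_comm (pd k X x) (pd j X x)]
      abel
    simp only [curv, hp, madd, msub, hm, hcomm k j]
    simp only [mmul]
    ring
  have hgY := g_mul_grad hu X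
  have hgY' : ∀ i, ∑ k, grad g X k x * g x i k = pd i X x := fun i => by
    rw [← hgY]; exact sum_ext fun k => mul_comm _ _
  have hgY2 : ∀ i, ∑ k, g x k i * grad g X k x = pd i X x := fun i => by
    rw [← hgY]; exact sum_ext fun k => by rw [hsym i k]
  have hXY : ∑ k, pd k X x * grad g X k x = gip g X X x := (gradInner_eq_sum_grad X X).symm
  have hAtr : ∀ᶠ z in 𝓝 x, ∀ l, ∑ k, A k z k l = ((Fintype.card ι : ℝ) - 1) * pd l X z := by
    filter_upwards [ev_det hg hu, hs] with z hz hz' l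
    have hsz : ∀ k, g z k l = g z l k := fun k => congr_fun₂ hz' l k
    simp only [hAa, sum_sub, one_apply_eq, one_mul, hsz, g_mul_grad hz]
    simp
    ring
  have hAtr0 := hAtr.self_of_nhds
  have t1 : ∑ k, mpd k (A j) x k i = pd j (pd i X) x - g x j i * ∑ k, pd k (grad g X k) x - ∑ k, mpd
      k g x j i * grad g X k x := by
    have e : ∀ k, mpd k (A j) x k i = (1 : Matrix ι ι ℝ) k j * pd k (pd i X) x - (mpd k g x j i *
        grad g X k x + g x j i * pd k (grad g X k) x) := by
      intro k
      have h1 := pd_sub (i := k) (f := fun z => (1 : Matrix ι ι ℝ) k j * pd i X z) (g := fun z => g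
        z j i * grad g X k z) (x := x) ((contDiffAt_const.mul (hX1 i)).differentiableAt (by decide))
        (((hg j i).mul (hY k)).differentiableAt (by decide))
      rw [pd_const_mul _ (diffAt (hX1 i)), pd_mul (hg.ediff j i) (diffAt (hY k))] at h1
      exact h1
    simp only [e, sum_sub, sum_add, sum_delta_mul', ← mul_sum]
    ring
  have t2 : ∑ k, mpd j (A k) x k i = ((Fintype.card ι : ℝ) - 1) * pd j (pd i X) x := by
    have h1 := pd_sum (i := j) (s := univ) (f := fun k z => A k z k i) (x := x) fun k _ => (hAs
      k).ediff k i
    rw [pd_congr (hAtr.mono fun z hz => hz i), pd_const_mul _ (diffAt (hX1 i))] at h1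
    exact h1.symm
  set tr := fun l => ∑ k, Chr g k k l x with htr
  have t3 : ∑ k, ∑ l, lc g k x k l * A j x l i = tr j * pd i X x - g x j i * ∑ l, tr l * grad g X l
      x := by
    rw [sum_comm]
    simp only [← sum_mul, hAa, lc_apply]
    change ∑ l, tr l * _ = _
    simp only [mul_sub, sum_sub, mul_sum]
    congr 1
    · rw [← sum_delta_mul' j fun l => tr l * pd i X x]
      exact sum_ext fun l => by ring
    · exact sum_ext fun l => by ring
  have t4 : ∑ k, ∑ l, A j x k l * lc g k x l i = ∑ l, Chr g l j i x * pd l X x - ∑ k, ∑ l, g x j l *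
      Chr g l k i x * grad g X k x := by
    simp only [hAa, lc_apply, sub_mul, sum_sub]
    congr 1
    · rw [sum_comm]
      refine sum_ext fun l => ?_
      rw [← sum_delta_mul' j fun k => Chr g l k i x * pd l X x]
      exact sum_ext fun l => by ring
    · exact sum_ext₂ fun k l => by ring
  have t5 : ∑ k, ∑ l, A k x k l * lc g j x l i = ((Fintype.card ι : ℝ) - 1) * ∑ l, Chr g l j i x *
      pd l X x := by
    rw [sum_comm, mul_sum]
    refine sum_ext fun l => ?_
    rw [← sum_mul, hAtr0, lc_apply]
    ring
  have t6 : ∑ k, ∑ l, lc g j x k l * A k x l i = tr j * pd i X x - ∑ l, ∑ k, g x k i * Chr g k j l x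
      * grad g X l x := by
    have e : tr j = ∑ k, Chr g k j k x := sum_ext fun k => christoffel_symm hs k k j
    simp only [hAa, lc_apply, mul_sub, sum_sub]
    congr 1
    · rw [e, sum_mul]
      refine sum_ext fun k => ?_
      rw [← sum_delta_mul' k fun l => Chr g k j l x * pd i X x]
      exact sum_ext fun l => by ring
    · rw [sum_comm]
      exact sum_ext₂ fun k l => by ring
  have t7 : ∑ k, ∑ l, A k x k l * A j x l i = ((Fintype.card ι : ℝ) - 1) * (pd j X x * pd i X x - g
      x j i * gip g X X x) := by
    rw [sum_comm]
    simp only [← sum_mul, hAtr0, hAa j, mul_sub, sum_sub]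
    congr 1
    · rw [← sum_delta_mul' j fun l => ((Fintype.card ι : ℝ) - 1) * (pd l X x * pd i X x)]
      exact sum_ext fun l => by ring
    · rw [← hXY, mul_sum, mul_sum]
      exact sum_ext fun l => by ring
  have t8 : ∑ k, ∑ l, A j x k l * A k x l i = pd j X x * pd i X x - g x j i * gip g X X x := by
    have e1 : ∀ k, ∑ l, A j x k l * A k x l i = A j x k k * pd i X x - g x k i * ∑ l, A j x k l *
        grad g X l x := by
      intro k
      simp only [hAa (i := k), mul_sub, sum_sub, mul_sum]
      congr 1
      · rw [← sum_delta_mul' k fun l => A j x k l * pd i X x]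
        exact sum_ext fun l => by ring
      · exact sum_ext fun l => by ring
    have e2 : ∀ k, ∑ l, A j x k l * grad g X l x = (1 : Matrix ι ι ℝ) k j * gip g X X x - grad g X k
        x * pd j X x := by
      intro k
      simp only [hAa, sub_mul, sum_sub, ← hXY, mul_sum, mul_assoc]
      congr 1
      rw [← hgY j, mul_sum]
      exact sum_ext fun l => by ring
    have e3 : ∑ k, A j x k k = 0 := by simp only [hAa, sum_sub, sum_delta_mul', hgY, sub_self]
    simp only [e1, e2, sum_sub, ← sum_mul, e3, mul_sub]
    have e4 : ∑ k, g x k i * ((1 : Matrix ι ι ℝ) k j * gip g X X x) = g x j i * gip g X X x := by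
      rw [← sum_delta_mul' j fun l => g x l i * gip g X X x]
      exact sum_ext fun l => by ring
    have e5 : ∑ k, g x k i * (grad g X k x * pd j X x) = pd i X x * pd j X x := by
      rw [← hgY2 i, sum_mul]
      exact sum_ext fun l => by ring
    rw [e4, e5]
    ring
  have hdiv : ∑ k, pd k (grad g X k) x + ∑ l, tr l * grad g X l x = box g X x := by
    have h1 := div_grad hg hs hu (v := fun l => pd l X) hX1
    rw [box, ← h1]
    congr 1
    rw [sum_comm]
    refine sum_ext fun l => ?_
    rw [← sum_mul]
    rfl
  have hdg : ∑ k, mpd k g x j i * grad g X k x = ∑ k, ∑ l, g x j l * Chr g l k i x * grad g X k x +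
      ∑ l, ∑ k, g x k i * Chr g k j l x * grad g X l x := by
    rw [← sum_add]
    refine sum_ext fun k => ?_
    rw [lcMatrix_compat hs hu, madd, mmul, mmul, add_mul, sum_mul, sum_mul, add_comm]
    congr 1
    refine sum_ext fun l => ?_
    rw [tr_apply, lc_apply, christoffel_symm hs l k j]
    ring
  rw [ricci_eq_sum_curv (conf_symm hs), ricci_eq_sum_curv hs]
  simp only [hcurv, sum_add, sum_sub]
  rw [t1, t2, t3, t4, t5, t6, t7, t8, hdg, ← hdiv, hsym j i]
  ring

end

section

variable {h : Matrix (Fin 3) (Fin 3) ℝ}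

/-- The Levi-Civita symbol. -/
def eps (α β γ : Fin 3) : ℝ :=
  (((β : ℕ) : ℝ) - ((α : ℕ) : ℝ)) * (((γ : ℕ) : ℝ) - ((α : ℕ) : ℝ))
    * (((γ : ℕ) : ℝ) - ((β : ℕ) : ℝ)) / 2

/-- The antisymmetric matrix dual to a vector. -/
def skew (f : ℝ^(Fin 3)) : Matrix (Fin 3) (Fin 3) ℝ :=
  !![0, f 2, -f 1; -f 2, 0, f 0; f 1, -f 0, 0]

/-- The vector dual to an antisymmetric matrix. -/
def dualVec (M : Matrix (Fin 3) (Fin 3) ℝ) : Fin 3 → ℝ := ![M 1 2, M 2 0, M 0 1]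

lemma skew_dualVec {M : Matrix (Fin 3) (Fin 3) ℝ} (hM : M.transpose = -M) : skew (dualVec M) = M :=
    by
  have h : ∀ α β, M β α = -M α β := fun α β => congr_fun₂ hM α β
  have h0 : ∀ α, M α α = 0 := fun α => by have := h α α; linarith
  ext α β
  fin_cases α <;> fin_cases β <;> simp [skew, dualVec, h0]
  · exact (h 2 0).symm
  · exact (h 0 1).symm
  · exact (h 1 2).symm

lemma dualVec_skew (f : ℝ^(Fin 3)) : dualVec (skew f) = f := by
  ext μ
  fin_cases μ <;> simp [skew, dualVec]

lemma skew_conj_adjugate {g : Matrix (Fin 3) (Fin 3) ℝ} (hs : g.transpose = g) (f f' : ℝ^(Fin 3)) (α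
    β : Fin 3) : ∑ γ, ∑ δ, skew f γ α * g.adjugate γ δ * skew f' β δ = (g *ᵥ f') α * (g *ᵥ f) β - g
    α β * (f ⬝ᵥ g *ᵥ f') := by
  have h : ∀ α β, g β α = g α β := fun α β => congr_fun₂ hs α β
  have h1 := h 0 1
  have h2 := h 0 2
  have h3 := h 1 2
  rw [adjugate_fin_three]
  fin_cases α <;> fin_cases β <;> simp [skew, sum_univ_three, mulVec, dotProduct, h1, h2, h3] <;>
    ring

lemma trace_skew_adjugate (hs : h.transpose = h) (f f' : ℝ^(Fin 3)) : (h * (skew f)ᵀ * (h * (skew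
    f')ᵀ)).trace = -2 * (f ⬝ᵥ h.adjugate *ᵥ f') := by
  have h0 : ∀ α β, h β α = h α β := fun α β => congr_fun₂ hs α β
  have h1 := h0 0 1
  have h2 := h0 0 2
  have h3 := h0 1 2
  rw [adjugate_fin_three]
  simp [skew, sum_univ_three, mulVec, dotProduct, trace, mmul, h1, h2, h3]
  ring

lemma hodge_skew_adjugate (hs : h.transpose = h) (f : ℝ^(Fin 3)) (γ : Fin 3) : (1 / 2) * ∑ α, ∑ β, ∑
    α', ∑ β', h α α' * h β β' * skew f α' β' * eps α β γ = (h.adjugate *ᵥ f) γ := by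
  have h0 : ∀ α β, h β α = h α β := fun α β => congr_fun₂ hs α β
  have h1 := h0 0 1
  have h2 := h0 0 2
  have h3 := h0 1 2
  rw [adjugate_fin_three]
  fin_cases γ <;> simp [skew, eps, sum_univ_three, mulVec, dotProduct, h1, h2, h3] <;> ring

lemma div_skew_adjugate (hs : h.transpose = h) (S : Matrix (Fin 3) (Fin 3) ℝ) (α : Fin 3) : ∑ γ, ∑
    β, h γ β * skew (fun μ => ∑ ν, h μ ν * S ν γ) α β = (h.adjugate *ᵥ dualVec (S.transpose - S)) α
    := by
  have h0 : ∀ α β, h β α = h α β := fun α β => congr_fun₂ hs α β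
  have h1 := h0 0 1
  have h2 := h0 0 2
  have h3 := h0 1 2
  rw [adjugate_fin_three]
  fin_cases α <;> simp [skew, dualVec, sum_univ_three, mulVec, dotProduct, h1, h2, h3] <;> ring

lemma skew_covariance (A : Matrix (Fin 3) (Fin 3) ℝ) (f : ℝ^(Fin 3)) : skew f * A + A.transpose *
    skew f = skew (fun μ => A.trace * f μ - (A *ᵥ f) μ) := by
  ext α β
  simp only [madd, mmul, tr_apply, sum_univ_three, mulVec, dotProduct, trace, diag_apply, skew]
  fin_cases α <;> fin_cases β <;> simp <;> ring

lemma skew_add (f f' : ℝ^(Fin 3)) : skew (fun μ => f μ + f' μ) = skew f + skew f' := by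
  ext α β
  fin_cases α <;> fin_cases β <;> simp [skew] <;> ring

lemma skew_smul (c : ℝ) (f : ℝ^(Fin 3)) : skew (fun μ => c * f μ) = c • skew f := by
  ext α β
  fin_cases α <;> fin_cases β <;> simp [skew]

lemma adjugate_inv {ι : Type*} [Fintype ι] [DecidableEq ι] {g : Matrix ι ι ℝ} (hu : g.det ≠ 0) :
    (g⁻¹).adjugate = (g.det)⁻¹ • g := by
  have h4 : g⁻¹ * g = 1 := minv_mul _ hu.isUnit
  calc (g⁻¹).adjugate = (g⁻¹).adjugate * (g⁻¹ * g) := by rw [h4, mmul_one]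
    _ = (g⁻¹.det • (1 : Matrix ι ι ℝ)) * g := by rw [← mmul_assoc, adjugate_mul]
    _ = _ := by rw [det_nonsing_inv, Ring.inverse_eq_inv', smul_mul, mone_mul]

namespace LocalFields

variable {K : Type*} [Fintype K] [DecidableEq K] (L : LocalFields (Fin 3) K)

/-- The vector densities dual to `Fₖ`. -/
def dual (k : K) (x : ℝ^(Fin 3)) : Fin 3 → ℝ := dualVec (L.Flow k x)

/-- The components of the twist forms, `s` being the sign of the orientation. -/
def twistForm (s : ℝ) (X : ℝ^(Fin 3) → ℝ) (k : K) (γ : Fin 3) (x : ℝ^(Fin 3)) : ℝ :=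
  exp (X x) * ((1 / 2) * ∑ α, ∑ β, ∑ α', ∑ β', (L.g x)⁻¹ α α' * (L.g x)⁻¹ β β' *
    (∑ l, L.xi x k l * L.F l x α' β') * (s * Real.sqrt |(L.g x).det| * eps α β γ))

/-- The factor between the twist form and the dual of `Fₖ`. -/
def factor (s : ℝ) (X : ℝ^(Fin 3) → ℝ) (x : ℝ^(Fin 3)) : ℝ :=
  -s * exp (X x - (1 / 2) * log (L.g x).det)

variable {L} {x : ℝ^(Fin 3)} {s : ℝ} {X : ℝ^(Fin 3) → ℝ}

lemma Flow_antisymm (hF : ∀ k, (L.F k x)ᵀ = -L.F k x) (k : K) : (L.Flow k x)ᵀ = -L.Flow k x := by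
  simp [Flow, transpose_sum, transpose_smul, hF]

lemma Flow_eq_skew (hF : ∀ k, (L.F k x)ᵀ = -L.F k x) (k : K) : L.Flow k x = skew (L.dual k x) :=
    (skew_dualVec (Flow_antisymm hF k)).symm

lemma sqrt_abs_det (hd : (L.g x).det < 0) : Real.sqrt |(L.g x).det| = exp ((1 / 2) * log (L.g
    x).det) := by
  rw [← Real.log_abs, Real.sqrt_eq_rpow, Real.rpow_def_of_pos (abs_pos.2 hd.ne), mul_comm]

lemma exp_log_det (hd : (L.g x).det < 0) : exp (log (L.g x).det) = -(L.g x).det := by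
  rw [← Real.log_abs, Real.exp_log (abs_pos.2 hd.ne), abs_of_neg hd]

lemma twistForm_eq (hg : (L.g x)ᵀ = L.g x) (hd : (L.g x).det < 0) (hF : ∀ k, (L.F k x)ᵀ = -L.F k x)
    (k : K) (γ : Fin 3) : L.twistForm s X k γ x = L.factor s X x * (L.g x *ᵥ L.dual k x) γ := by
  have hgi : ((L.g x)⁻¹)ᵀ = (L.g x)⁻¹ := by rw [tr_inv, hg]
  have h1 := hodge_skew_adjugate hgi (L.dual k x) γ
  rw [← Flow_eq_skew hF, adjugate_inv hd.ne, smul_mulVec, Pi.smul_apply, smul_eq_mul] at h1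
  have hfl : ∀ α β, ∑ l, L.xi x k l * L.F l x α β = L.Flow k x α β := by
    intro α β
    simp [Flow, msum]
  have h2 : L.twistForm s X k γ x = exp (X x) * (s * Real.sqrt |(L.g x).det|) * ((1 / 2) * ∑ α, ∑ β,
      ∑ α', ∑ β', (L.g x)⁻¹ α α' * (L.g x)⁻¹ β β' * L.Flow k x α' β' * eps α β γ) := by
    simp only [twistForm, hfl, mul_sum]
    refine sum_ext₂ fun α β => sum_ext₂ fun α' β' => ?_
    ring
  have h3 : exp (X x - (1 / 2) * log (L.g x).det) * -(L.g x).det = exp (X x) * Real.sqrt |(L.g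
      x).det| := by
    rw [sqrt_abs_det hd, ← exp_log_det hd, ← Real.exp_add, ← Real.exp_add]
    congr 1
    ring
  have h4 : exp (X x - (1 / 2) * log (L.g x).det) = -(exp (X x) * Real.sqrt |(L.g x).det| * ((L.g
      x).det)⁻¹) := by
    rw [← h3]
    have := hd.ne
    field_simp
  rw [h2, h1, factor, h4]
  ring

lemma factor_ne_zero (hs : s * s = 1) : L.factor s X x ≠ 0 := by
  have : s ≠ 0 := by rintro rfl; simp at hs
  exact mul_ne_zero (neg_ne_zero.2 this) (Real.exp_pos _).ne'

lemma factor_sq (hs : s * s = 1) (hd : (L.g x).det < 0) : L.factor s X x * L.factor s X x * (L.g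
    x).det = -exp (2 * X x) := by
  have h : exp (X x - (1 / 2) * log (L.g x).det) * exp (X x - (1 / 2) * log (L.g x).det) * -(L.g
      x).det = exp (2 * X x) := by
    rw [← exp_log_det hd, ← Real.exp_add, ← Real.exp_add]
    congr 1
    ring
  calc _ = -((s * s) * (exp (X x - (1 / 2) * log (L.g x).det) * exp (X x - (1 / 2) * log (L.g
      x).det) * -(L.g x).det)) := by rw [factor]; ring
    _ = _ := by rw [hs, h]; ring

lemma factor_smooth (h : L.BaseRegular x) (hX : Smooth X x) : Smooth (L.factor s X) x :=
    contDiffAt_const.mul ((hX.sub (contDiffAt_const.mul ((contDiffAt_det h.g_smooth).log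
    h.g_det))).exp)

lemma pd_factor (h : L.BaseRegular x) (hX : Smooth X x) (α : Fin 3) : pd α (L.factor s X) x =
    L.factor s X x * (pd α X x - (lc L.g α x).trace) := by
  have hD := diffAt (contDiffAt_det h.g_smooth)
  have hl : Diff (fun z => log (L.g z).det) x := hD.log h.g_det
  have hX' := diffAt hX
  have h1 : pd α (fun z => log (L.g z).det) x = 2 * (lc L.g α x).trace := by
    rw [pd_scalar_comp (Real.hasDerivAt_log h.g_det) hD, pd_det h.g_smooth h.g_det, trace_lcMatrix
      h.g_symm h.g_det, ← mul_assoc, inv_mul_cancel₀ h.g_det, one_mul]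
  change pd α (fun z => -s * exp (X z - (1 / 2) * log (L.g z).det)) x = _
  have hs : Diff (fun z => X z - (1 / 2) * log (L.g z).det) x := hX'.sub (hl.const_mul _)
  have h2 : pd α (fun z => X z - (1 / 2) * log (L.g z).det) x = pd α X x - (1 / 2) * pd α (fun z =>
      log (L.g z).det) x := (pd_sub hX' (hl.const_mul _)).trans (by rw [pd_const_mul _ hl])
  rw [pd_const_mul _ hs.exp, pd_exp hs, h2, h1, factor]
  ring

lemma dual_smooth (h : L.BaseRegular x) (k : K) (μ : Fin 3) : Smooth (fun z => L.dual k z μ) x := by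
  fin_cases μ
  exacts [h.Flow_smooth k 1 2, h.Flow_smooth k 2 0, h.Flow_smooth k 0 1]

section

variable {E : K → ℝ^(Fin 3)}

lemma dual_eq (hs : s * s = 1) (hd : (L.g x).det < 0) (hE : ∀ k γ, E k γ = L.factor s X x * (L.g x
    *ᵥ L.dual k x) γ) (k : K) (μ : Fin 3) : L.dual k x μ = (L.factor s X x)⁻¹ * ∑ γ, (L.g x)⁻¹ μ γ *
    E k γ := by
  have h4 : (L.g x)⁻¹ * L.g x = 1 := minv_mul _ hd.ne.isUnit
  have h1 : ∑ γ, (L.g x)⁻¹ μ γ * E k γ = L.factor s X x * ((L.g x)⁻¹ *ᵥ (L.g x *ᵥ L.dual k x)) μ :=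
      by
    rw [show ((L.g x)⁻¹ *ᵥ (L.g x *ᵥ L.dual k x)) μ = ∑ γ, (L.g x)⁻¹ μ γ * (L.g x *ᵥ L.dual k x) γ
      from rfl, mul_sum]
    simp only [hE]
    exact sum_ext fun γ => by ring
  rw [h1, mulVec_mulVec, h4, one_mulVec, ← mul_assoc, inv_mul_cancel₀ (factor_ne_zero hs), one_mul]

lemma dual_inner (hs : s * s = 1) (hd : (L.g x).det < 0) (hE : ∀ k γ, E k γ = L.factor s X x * (L.g
    x *ᵥ L.dual k x) γ) (k l : K) : ((L.g x).det)⁻¹ * (L.dual l x ⬝ᵥ L.g x *ᵥ L.dual k x) = -exp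
    (-(2 * X x)) * ∑ α, ∑ β, (L.g x)⁻¹ α β * (E l β * E k α) := by
  have hf := factor_ne_zero (L := L) (x := x) (X := X) hs
  have h1 : L.dual l x ⬝ᵥ L.g x *ᵥ L.dual k x = (L.factor s X x)⁻¹ * (L.factor s X x)⁻¹ * ∑ α, ∑ β,
      (L.g x)⁻¹ α β * (E l β * E k α) := by
    have e : ∀ α, (L.g x *ᵥ L.dual k x) α = (L.factor s X x)⁻¹ * E k α := by
      intro α
      rw [hE]
      field_simp
    simp only [dotProduct, e, dual_eq hs hd hE l, mul_sum, sum_mul]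
    exact sum_ext₂ fun α β => by ring
  have h2 := factor_sq (X := X) hs hd
  have h3 : ((L.g x).det)⁻¹ * ((L.factor s X x)⁻¹ * (L.factor s X x)⁻¹) = -exp (-(2 * X x)) := by
    rw [Real.exp_neg, ← mul_inv, ← mul_inv, mul_comm, h2, inv_neg]
  rw [h1, ← mul_assoc, h3]

lemma trace_Fend (hs : s * s = 1) (hg : (L.g x)ᵀ = L.g x) (hd : (L.g x).det < 0) (hF : ∀ k, (L.F k
    x)ᵀ = -L.F k x) (hE : ∀ k γ, E k γ = L.factor s X x * (L.g x *ᵥ L.dual k x) γ) (k l : K) :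
    (L.Fend l x * L.Fend k x).trace = 2 * exp (-(2 * X x)) * ∑ α, ∑ β, (L.g x)⁻¹ α β * (E l β * E k
    α) := by
  have hgi : ((L.g x)⁻¹)ᵀ = (L.g x)⁻¹ := by rw [tr_inv, hg]
  rw [Fend, Fend, Flow_eq_skew hF, Flow_eq_skew hF, trace_skew_adjugate hgi, adjugate_inv hd.ne,
    smul_mulVec, dotProduct_smul, smul_eq_mul, dual_inner hs hd hE]
  ring

lemma F_eq_sum_Flow (hx : (L.xi x).det ≠ 0) (p : K) (α β : Fin 3) : L.F p x α β = ∑ q, (L.xi x)⁻¹ p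
    q * L.Flow q x α β := by
  have h4 : (L.xi x)⁻¹ * L.xi x = 1 := minv_mul _ hx.isUnit
  simp only [Flow, msum, msmul, smul_eq_mul, mul_sum]
  rw [sum_comm]
  simp only [← mul_assoc, ← sum_mul, ← mmul, h4]
  exact (sum_delta_mul p fun q => L.F q x α β).symm

lemma FF_eq (hs : s * s = 1) (hg : (L.g x)ᵀ = L.g x) (hd : (L.g x).det < 0) (hx : (L.xi x).det ≠ 0)
    (hF : ∀ k, (L.F k x)ᵀ = -L.F k x) (hE : ∀ k γ, E k γ = L.factor s X x * (L.g x *ᵥ L.dual k x) γ)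
    (α β : Fin 3) : L.FF x α β = exp (-(2 * X x)) * ((∑ p, ∑ q, (L.xi x)⁻¹ p q * ∑ γ, ∑ δ, (L.g x)⁻¹
    γ δ * (E q δ * E p γ)) * L.g x α β - ∑ p, ∑ q, (L.xi x)⁻¹ p q * (E p α * E q β)) := by
  have hf := factor_ne_zero (L := L) (x := x) (X := X) hs
  have hadj : ∀ γ δ, (L.g x)⁻¹ γ δ = ((L.g x).det)⁻¹ * (L.g x).adjugate γ δ := by
    intro γ δ
    rw [inv_def, Ring.inverse_eq_inv', msmul, smul_eq_mul]
  have e : ∀ α, ∀ k, (L.g x *ᵥ L.dual k x) α = (L.factor s X x)⁻¹ * E k α := by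
    intro α k
    rw [hE]
    field_simp
  have h2 := factor_sq (X := X) hs hd
  have h3 : ((L.g x).det)⁻¹ * ((L.factor s X x)⁻¹ * (L.factor s X x)⁻¹) = -exp (-(2 * X x)) := by
    rw [Real.exp_neg, ← mul_inv, ← mul_inv, mul_comm, h2, inv_neg]
  have h1 : ∀ p q, ∑ γ, ∑ δ, L.Flow q x γ α * ((L.g x)⁻¹ γ δ * L.Flow p x β δ) = exp (-(2 * X x)) *
      ((∑ γ, ∑ δ, (L.g x)⁻¹ γ δ * (E q δ * E p γ)) * L.g x α β - E p α * E q β) := by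
    intro p q
    have h4 := skew_conj_adjugate hg (L.dual q x) (L.dual p x) α β
    have h5 := dual_inner hs hd hE p q
    calc _ = ((L.g x).det)⁻¹ * ∑ γ, ∑ δ, skew (L.dual q x) γ α * (L.g x).adjugate γ δ * skew (L.dual
          p x) β δ := by
          simp only [← Flow_eq_skew hF, hadj, mul_sum]
          exact sum_ext₂ fun γ δ => by ring
      _ = (((L.g x).det)⁻¹ * ((L.factor s X x)⁻¹ * (L.factor s X x)⁻¹)) * (E p α * E q β) - (((L.g
          x).det)⁻¹ * (L.dual q x ⬝ᵥ L.g x *ᵥ L.dual p x)) * L.g x α β := by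
          rw [h4, e, e]
          ring
      _ = _ := by rw [h3, h5]; ring
  calc L.FF x α β = ∑ p, ∑ γ, L.F p x γ α * L.Fend p x γ β := by rw [FF, sum_comm]
    _ = ∑ p, ∑ q, (L.xi x)⁻¹ p q * ∑ γ, ∑ δ, L.Flow q x γ α * ((L.g x)⁻¹ γ δ * L.Flow p x β δ) := by
        refine sum_ext fun p => ?_
        simp only [F_eq_sum_Flow hx, sum_mul]
        rw [sum_comm]
        refine sum_ext fun q => ?_
        rw [mul_sum]
        refine sum_ext fun γ => ?_
        simp only [Fend, mmul, tr_apply, mul_sum]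
        exact sum_ext fun δ => by ring
    _ = _ := by
        simp only [h1]
        rw [sum_mul, ← sum_sub, mul_sum]
        refine sum_ext fun p => ?_
        rw [sum_mul, ← sum_sub, mul_sum]
        exact sum_ext fun q => by ring

end

/-- The covariant derivative of `e^X` times the vector densities dual to `Fₖ`, up to a factor. -/
def covDual (L : LocalFields (Fin 3) K) (X : ℝ^(Fin 3) → ℝ) (k : K) (γ μ : Fin 3)
    (x : ℝ^(Fin 3)) : ℝ :=
  pd γ (fun z => L.dual k z μ) x + (lc L.g γ x *ᵥ L.dual k x) μ
    + (pd γ X x - (lc L.g γ x).trace) * L.dual k x μ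

lemma Regular.div_Fend (h : L.Regular x) (α : Fin 3) (k : K) : ∑ γ, pd γ (fun y => L.Fend k y γ α) x
    + (∑ γ, ∑ δ, Chr L.g γ γ δ x * L.Fend k x δ α) - (∑ γ, ∑ δ, L.Fend k x γ δ * Chr L.g δ γ α x) +
    ∑ γ, pd γ X x * L.Fend k x γ α = ∑ γ, ∑ β, (L.g x)⁻¹ γ β * skew (fun μ => L.covDual X k γ μ x) α
    β := by
  have hF := h.F_antisymm
  have hdf := fun μ => dual_smooth h.toBaseRegular k μ
  have h1 := div_grad h.g_smooth h.g_symm h.g_det (v := fun β z => L.Flow k z α β) (fun β =>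
    h.Flow_smooth k α β)
  have e1 : ∀ γ, pd γ (fun y => L.Fend k y γ α) x = pd γ (fun y => ∑ β, (L.g y)⁻¹ γ β * L.Flow k y α
      β) x := fun γ => rfl
  have e2 : ∀ γ β, L.Fend k x γ β = ∑ δ, (L.g x)⁻¹ γ δ * L.Flow k x β δ := fun γ β => rfl
  have e3 : ∀ γ, ∑ δ, L.Fend k x γ δ * Chr L.g δ γ α x = ∑ β, (L.g x)⁻¹ γ β * ((lc L.g γ x)ᵀ *
      L.Flow k x) α β := by
    intro γ
    simp only [e2, sum_mul, mmul, mul_sum, tr_apply, lc_apply]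
    rw [sum_comm]
    exact sum_ext₂ fun β δ => by ring
  have e4 : ∀ γ, pd γ X x * L.Fend k x γ α = ∑ β, (L.g x)⁻¹ γ β * (pd γ X x * L.Flow k x α β) := by
    intro γ
    rw [e2, mul_sum]
    exact sum_ext fun β => by ring
  have e5 : ∀ γ β, ∑ l, Chr L.g l γ β x * L.Flow k x α l = (L.Flow k x * lc L.g γ x) α β := by
    intro γ β
    rw [mmul]
    exact sum_ext fun l => mul_comm _ _
  have e6 : ∀ γ, skew (fun μ => pd γ (fun z => L.dual k z μ) x) = mpd γ (L.Flow k) x := by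
    intro γ
    rw [mpd_congr (hF.mono fun z hz => Flow_eq_skew hz k)]
    ext α β
    have hn : ∀ μ, pd γ (fun z => -L.dual k z μ) x = -pd γ (fun z => L.dual k z μ) x := fun μ =>
      pd_neg
    fin_cases α <;> fin_cases β <;> simp [skew, mpd, pd_const, hn]
  have e7 : ∀ γ, skew (fun μ => L.covDual X k γ μ x) = mpd γ (L.Flow k) x - (L.Flow k x * lc L.g γ x
      + (lc L.g γ x)ᵀ * L.Flow k x) + pd γ X x • L.Flow k x := by
    intro γ
    have h2 : (fun μ => L.covDual X k γ μ x) = fun μ => (pd γ (fun z => L.dual k z μ) x + -1 * ((lc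
        L.g γ x).trace * L.dual k x μ - (lc L.g γ x *ᵥ L.dual k x) μ)) + pd γ X x * L.dual k x μ :=
        by
      ext μ
      simp only [covDual]
      ring
    rw [h2, skew_add, skew_add, skew_smul, skew_smul, e6, Flow_eq_skew hF.self_of_nhds,
      skew_covariance, neg_one_smul, sub_eq_add_neg]
  simp only [e1, e3, e4, e7]
  simp only [e2]
  rw [h1, ← sum_sub, ← sum_add]
  refine sum_ext fun γ => ?_
  rw [← sum_sub, ← sum_add]
  refine sum_ext fun β => ?_
  simp only [e5, madd, msub, msmul, smul_eq_mul]
  rw [show mpd γ (L.Flow k) x α β = pd γ (fun z => L.Flow k z α β) x from rfl]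
  ring

lemma Regular.pd_twist (h : L.Regular x) (hX : Smooth X x) (k : K) (α β : Fin 3) : pd α (fun z =>
    L.factor s X z * (L.g z *ᵥ L.dual k z) β) x = L.factor s X x * ((∑ ν, L.g x β ν * L.covDual X k
    α ν x) + ∑ l, Chr L.g l α β x * (L.g x *ᵥ L.dual k x) l) := by
  have hdf := fun μ => dual_smooth h.toBaseRegular k μ
  have hgf : Smooth (fun z => (L.g z *ᵥ L.dual k z) β) x := show Smooth (fun z => ∑ ν, L.g z β ν *
    L.dual k z ν) x from ContDiffAt.sum fun ν _ => (h.g_smooth β ν).mul (hdf ν)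
  have hsym := fun i j => congr_fun₂ h.g_symm.self_of_nhds i j
  simp only [tr_apply] at hsym
  have h1 : pd α (fun z => (L.g z *ᵥ L.dual k z) β) x = ∑ ν, (mpd α L.g x β ν * L.dual k x ν + L.g x
      β ν * pd α (fun z => L.dual k z ν) x) := by
    change pd α (fun z => ∑ ν, L.g z β ν * L.dual k z ν) x = _
    refine (pd_sum (f := fun ν z => L.g z β ν * L.dual k z ν) fun ν _ => ((h.g_smooth β ν).mul (hdf
      ν)).differentiableAt (by decide)).trans ?_
    exact sum_ext fun ν => pd_mul (h.g_smooth.ediff β ν) (diffAt (hdf ν))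
  rw [pd_mul (diffAt (factor_smooth h.toBaseRegular hX)) (diffAt hgf), pd_factor h.toBaseRegular hX,
    h1, lcMatrix_compat h.g_symm h.g_det]
  have e1 : ∑ ν, ((lc L.g α x)ᵀ * L.g x) β ν * L.dual k x ν = ∑ l, Chr L.g l α β x * (L.g x *ᵥ
      L.dual k x) l := by
    simp only [mmul, mulVec, dotProduct, sum_mul, mul_sum, tr_apply, lc_apply]
    rw [sum_comm]
    exact sum_ext₂ fun _ _ => by ring
  have e2 : ∑ ν, (L.g x * lc L.g α x) β ν * L.dual k x ν = ∑ ν, L.g x β ν * (lc L.g α x *ᵥ L.dual k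
      x) ν := by
    simp only [mmul, mulVec, dotProduct, sum_mul, mul_sum]
    rw [sum_comm]
    exact sum_ext₂ fun _ _ => by ring
  have e3 : (L.g x *ᵥ L.dual k x) β = ∑ ν, L.g x β ν * L.dual k x ν := rfl
  simp only [madd, add_mul, sum_add, covDual, mul_add, e1, e2]
  rw [e3]
  have e4 : ∑ ν, L.g x β ν * ((pd α X x - (lc L.g α x).trace) * L.dual k x ν) = (pd α X x - (lc L.g
      α x).trace) * ∑ ν, L.g x β ν * L.dual k x ν := by
    rw [mul_sum]
    exact sum_ext fun _ => by ring
  rw [e4]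
  ring

theorem Regular.mixed_eq_zero_iff (h : L.Regular x) (hX : Smooth X x) (hs : s * s = 1) (hXd : ∀ᶠ y
    in 𝓝 x, ∀ α, pd α X y = (1 / 2) * (L.S α y).trace) (hd : (L.g x).det < 0) (k : K) : (∀ α,
    L.frameRicci x (inl α) (inr k) = 0) ↔ ∀ α β, pd α (L.twistForm s X k β) x = pd β (L.twistForm s
    X k α) x := by
  have hgi : ((L.g x)⁻¹)ᵀ = (L.g x)⁻¹ := by rw [tr_inv, h.g_symm.self_of_nhds]
  have h4 : (L.g x)⁻¹ * L.g x = 1 := minv_mul _ hd.ne.isUnit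
  have hdn : ∀ᶠ z in 𝓝 x, (L.g z).det < 0 := (contDiffAt_det h.g_smooth).continuousAt.eventually_lt
    continuousAt_const hd
  have htw : ∀ β, L.twistForm s X k β =ᶠ[𝓝 x] fun z => L.factor s X z * (L.g z *ᵥ L.dual k z) β :=
      by
    intro β
    filter_upwards [h.g_symm, hdn, h.F_antisymm] with z h1 h2 h3
    exact twistForm_eq h1 h2 h3 k β
  set S : Matrix (Fin 3) (Fin 3) ℝ := of fun ν γ => ∑ μ, L.g x ν μ * L.covDual X k γ μ x with hS
  have hT : ∀ γ, (fun μ => L.covDual X k γ μ x) = fun μ => ∑ ν, (L.g x)⁻¹ μ ν * S ν γ := by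
    intro γ
    ext μ
    simp only [hS, of_apply, mul_sum]
    rw [sum_comm]
    simp only [← mul_assoc, ← sum_mul, ← mmul, h4]
    exact (sum_delta_mul μ fun μ => L.covDual X k γ μ x).symm
  have hc : ∀ α β, pd α (L.twistForm s X k β) x - pd β (L.twistForm s X k α) x = L.factor s X x * (S
      β α - S α β) := by
    intro α β
    rw [pd_congr (htw β), pd_congr (htw α), h.pd_twist hX, h.pd_twist hX]
    simp only [christoffel_symm h.g_symm _ α β]
    simp only [hS, of_apply]
    ring
  have hM : ∀ α, L.frameRicci x (inl α) (inr k) = (1 / 2) * ((((L.g x).det)⁻¹ • L.g x) *ᵥ dualVec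
      (S.transpose - S)) α := by
    intro α
    rw [h.frameRicci_mixed hXd, h.div_Fend]
    simp only [hT]
    rw [div_skew_adjugate hgi, adjugate_inv hd.ne]
  constructor
  · intro h0 α β
    rw [← sub_eq_zero, hc]
    have h1 : (((L.g x).det)⁻¹ • L.g x) *ᵥ dualVec (S.transpose - S) = 0 := by
      ext α
      have := h0 α
      rw [hM] at this
      simpa using this
    have h2 : dualVec (S.transpose - S) = 0 := by
      rw [smul_mulVec, smul_eq_zero] at h1
      have h3 := h1.resolve_left (inv_ne_zero hd.ne)
      rw [← one_mulVec (dualVec _), ← h4, ← mulVec_mulVec, h3, mulVec_zero]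
    have h5 : S.transpose - S = 0 := by
      rw [← skew_dualVec (M := S.transpose - S) (by simp), h2]
      ext α β
      fin_cases α <;> fin_cases β <;> simp [skew]
    have h6 := congr_fun₂ h5 α β
    simp only [msub, tr_apply, mzero] at h6
    rw [h6, mul_zero]
  · intro h0 α
    have h5 : S.transpose - S = 0 := by
      ext α β
      have h1 := hc α β
      rw [h0 α β, sub_self] at h1
      exact (mul_eq_zero.1 h1.symm).resolve_left (factor_ne_zero hs)
    rw [hM, h5]
    simp [dualVec, mulVec, dotProduct, sum_univ_three]

theorem BaseRegular.div_dual_eq (h : L.BaseRegular x) (hX : Smooth X x) (hs : s * s = 1) (hd : (L.g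
    x).det < 0) {w : K → ℝ^(Fin 3) → ℝ} (hw : ∀ k, Smooth (w k) x) (hE : ∀ᶠ y in 𝓝 x, ∀ k γ,
    L.twistForm s X k γ y = pd γ (w k) y) (k : K) : ∑ μ, pd μ (fun y => ∑ l, (L.xi y)⁻¹ k l * L.dual
    l y μ) x = (L.factor s X x)⁻¹ * ∑ l, ((L.xi x)⁻¹ k l * (box L.g (w l) x - gip L.g X (w l) x) - ∑
    α, ∑ β, (L.g x)⁻¹ α β * (((L.xi x)⁻¹ * mpd α L.xi x * (L.xi x)⁻¹) k l * pd β (w l) x)) := by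
  have hf := factor_ne_zero (L := L) (x := x) (X := X) hs
  have hdn : ∀ᶠ z in 𝓝 x, (L.g z).det < 0 := (contDiffAt_det h.g_smooth).continuousAt.eventually_lt
    continuousAt_const hd
  have hxi := h.xi_smooth.inv h.xi_det
  have hfi : Smooth (fun z => (L.factor s X z)⁻¹) x := (factor_smooth h hX).inv hf
  have hpfi : ∀ α, pd α (fun z => (L.factor s X z)⁻¹) x = (L.factor s X x)⁻¹ * ((lc L.g α x).trace -
      pd α X x) := by
    intro α
    rw [pd_scalar_comp (hasDerivAt_inv hf) (diffAt (factor_smooth h hX)), pd_factor h hX]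
    field_simp
    ring
  have hgr : ∀ l μ, Smooth (fun z => ∑ γ, (L.g z)⁻¹ μ γ * pd γ (w l) z) x := fun l μ =>
    ContDiffAt.sum fun γ _ => (h.g_smooth.inv h.g_det μ γ).mul (contDiffAt_pd (hw l))
  have h1 : ∀ μ, (fun y => ∑ l, (L.xi y)⁻¹ k l * L.dual l y μ) =ᶠ[𝓝 x] fun y => ∑ l, (L.xi y)⁻¹ k l
      * ((L.factor s X y)⁻¹ * ∑ γ, (L.g y)⁻¹ μ γ * pd γ (w l) y) := by
    intro μ
    filter_upwards [h.g_symm, hdn, h.F_antisymm, hE] with z h1 h2 h3 h5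
    refine sum_ext fun l => ?_
    rw [dual_eq hs h2 (E := fun k γ => pd γ (w k) z) (X := X) fun k γ => by
      rw [← h5]; exact twistForm_eq h1 h2 h3 k γ]
  have h2 : ∀ μ, pd μ (fun y => ∑ l, (L.xi y)⁻¹ k l * L.dual l y μ) x = ∑ l, (-((L.xi x)⁻¹ * mpd μ
      L.xi x * (L.xi x)⁻¹) k l * ((L.factor s X x)⁻¹ * ∑ γ, (L.g x)⁻¹ μ γ * pd γ (w l) x) + (L.xi
      x)⁻¹ k l * ((L.factor s X x)⁻¹ * ((lc L.g μ x).trace - pd μ X x) * (∑ γ, (L.g x)⁻¹ μ γ * pd γ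
      (w l) x) + (L.factor s X x)⁻¹ * pd μ (fun z => ∑ γ, (L.g z)⁻¹ μ γ * pd γ (w l) z) x)) := by
    intro μ
    rw [pd_congr (h1 μ)]
    refine (pd_sum (f := fun l y => (L.xi y)⁻¹ k l * ((L.factor s X y)⁻¹ * ∑ γ, (L.g y)⁻¹ μ γ * pd γ
      (w l) y)) fun l _ => ((hxi k l).mul (hfi.mul (hgr l μ))).differentiableAt (by decide)).trans
      ?_
    refine sum_ext fun l => ?_
    have hmi := congrFun (congrFun (mpd_inv (i := μ) h.xi_smooth h.xi_det) k) l
    rw [mneg] at hmi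
    rw [← hmi, ← hpfi μ]
    have := pd_mul (i := μ) (diffAt (hxi k l)) ((hfi.mul (hgr l μ)).differentiableAt (by decide))
    have e := pd_mul (i := μ) (diffAt hfi) (diffAt (hgr l μ))
    rw [e] at this
    exact this
  have h3 : ∀ l, ∑ μ, pd μ (fun z => ∑ γ, (L.g z)⁻¹ μ γ * pd γ (w l) z) x + ∑ μ, (lc L.g μ x).trace
      * ∑ γ, (L.g x)⁻¹ μ γ * pd γ (w l) x = box L.g (w l) x := by
    intro l
    rw [box, ← div_grad h.g_smooth h.g_symm h.g_det (v := fun γ => pd γ (w l)) fun γ =>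
      contDiffAt_pd (hw l)]
    congr 1
    rw [sum_comm]
    refine sum_ext fun μ => ?_
    rw [← sum_mul]
    congr 1
    exact sum_ext fun γ => christoffel_symm h.g_symm γ μ γ
  have h5 : ∀ l, ∑ μ, pd μ X x * ∑ γ, (L.g x)⁻¹ μ γ * pd γ (w l) x = gip L.g X (w l) x := fun l =>
      (gradInner_eq_sum_grad X (w l)).symm
  simp only [h2]
  rw [sum_comm, mul_sum]
  refine sum_ext fun l => ?_
  rw [← h3, ← h5]
  simp only [mul_sub, mul_add, mul_sum, sum_add, sum_sub, sub_mul, add_mul, neg_mul, sum_neg]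
  have r1 : ∑ μ, ∑ γ, ((L.xi x)⁻¹ * mpd μ L.xi x * (L.xi x)⁻¹) k l * ((L.factor s X x)⁻¹ * ((L.g
      x)⁻¹ μ γ * pd γ (w l) x)) = ∑ μ, ∑ γ, (L.factor s X x)⁻¹ * ((L.g x)⁻¹ μ γ * (((L.xi x)⁻¹ * mpd
      μ L.xi x * (L.xi x)⁻¹) k l * pd γ (w l) x)) := sum_ext₂ fun _ _ => by ring
  have r2 : ∀ c : Fin 3 → ℝ, ∑ μ, ∑ γ, (L.xi x)⁻¹ k l * ((L.factor s X x)⁻¹ * c μ * ((L.g x)⁻¹ μ γ *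
      pd γ (w l) x)) = ∑ μ, ∑ γ, (L.factor s X x)⁻¹ * ((L.xi x)⁻¹ k l * (c μ * ((L.g x)⁻¹ μ γ * pd γ
      (w l) x))) := fun c => sum_ext₂ fun _ _ => by ring
  have r3 : ∑ μ, (L.xi x)⁻¹ k l * ((L.factor s X x)⁻¹ * pd μ (fun z => ∑ γ, (L.g z)⁻¹ μ γ * pd γ (w
      l) z) x) = ∑ μ, (L.factor s X x)⁻¹ * ((L.xi x)⁻¹ k l * pd μ (fun z => ∑ γ, (L.g z)⁻¹ μ γ * pd
      γ (w l) z) x) := sum_ext fun _ => by ring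
  rw [r1, r2, r2 fun μ => pd μ X x, r3]
  ring

theorem Regular.div_dual_eq_zero (h : L.Regular x) (k : K) : ∑ μ, pd μ (fun y => ∑ l, (L.xi y)⁻¹ k l
    * L.dual l y μ) x = 0 := by
  have h1 : ∀ μ, (fun y => ∑ l, (L.xi y)⁻¹ k l * L.dual l y μ) =ᶠ[𝓝 x] fun y => dualVec (L.F k y) μ
      := by
    intro μ
    filter_upwards [ev_det h.xi_smooth h.xi_det] with z hz
    fin_cases μ
    exacts [(F_eq_sum_Flow hz k 1 2).symm, (F_eq_sum_Flow hz k 2 0).symm, (F_eq_sum_Flow hz k 0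
      1).symm]
  have hF : ∀ α β, (fun z => L.F k z α β) =ᶠ[𝓝 x] fun z => pd α (fun y => L.a y k β) z - pd β (fun y
      => L.a y k α) z := fun α β => h.F_eq.mono fun z hz => (hz k α β).symm
  have hd : ∀ μ α β, pd μ (fun z => L.F k z α β) x = pd μ (pd α (fun y => L.a y k β)) x - pd μ (pd β
      (fun y => L.a y k α)) x := by
    intro μ α β
    rw [pd_congr (hF α β)]
    exact pd_sub (diffAt (contDiffAt_pd (h.a_smooth k β))) (diffAt (contDiffAt_pd (h.a_smooth k α)))
  have hcomm : ∀ μ α β, pd μ (pd α (fun y => L.a y k β)) x = pd α (pd μ (fun y => L.a y k β)) x :=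
    fun μ α β => pd_comm (ev_C2 (h.a_smooth k β)).self_of_nhds
  simp only [fun μ => pd_congr (i := μ) (h1 μ)]
  rw [sum_univ_three]
  change pd 0 (fun z => L.F k z 1 2) x + pd 1 (fun z => L.F k z 2 0) x + pd 2 (fun z => L.F k z 0 1)
    x = 0
  rw [hd, hd, hd, hcomm 0 1, hcomm 0 2, hcomm 1 2]
  ring

end LocalFields

end

section

variable {m : ℕ}

variable {u : Target m}

lemma Target.xi_transpose (u : Target m) : u.xiᵀ = u.xi := by
  ext k l
  simp [Target.xi, Sym2.eq_swap]

lemma Target.ext' {v : Target m} (hX : u.X = v.X) (hxi : u.xi = v.xi) (hω : u.omega = v.omega) : u =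
    v := by
  funext A
  rcases A with ⟨⟩ | p | k
  · exact hX
  · induction p with
    | _ k l => exact congr_fun₂ hxi k l
  · exact congrFun hω k

/-- The point of the target with given coordinates (`ξ` being symmetrized). -/
def Target.mk (X : ℝ) (Ξ : Matrix (Fin m) (Fin m) ℝ) (w : ℝ^(Fin m)) : Target m
  | inl _ => X
  | inr (inl p) => Sym2.lift ⟨fun k l => (1 / 2) * (Ξ k l + Ξ l k), fun k l => by ring⟩ p
  | inr (inr k) => w k

@[simp] lemma Target.mk_X (X : ℝ) (Ξ : Matrix (Fin m) (Fin m) ℝ) (w : ℝ^(Fin m)) : (Target.mk X Ξ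
    w).X = X := rfl

@[simp] lemma Target.mk_omega (X : ℝ) (Ξ : Matrix (Fin m) (Fin m) ℝ) (w : ℝ^(Fin m)) : (Target.mk X
    Ξ w).omega = w := rfl

lemma Target.mk_xi (X : ℝ) {Ξ : Matrix (Fin m) (Fin m) ℝ} (h : Ξ.transpose = Ξ) (w : ℝ^(Fin m)) :
    (Target.mk X Ξ w).xi = Ξ := by
  ext k l
  have : Ξ l k = Ξ k l := congr_fun₂ h k l
  change (1 / 2) * (Ξ k l + Ξ l k) = _
  rw [this]
  ring

lemma Target.X_add (u v : Target m) : (u + v).X = u.X + v.X := rfl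
lemma Target.xi_add (u v : Target m) : (u + v).xi = u.xi + v.xi := rfl
lemma Target.omega_add (u v : Target m) : (u + v).omega = u.omega + v.omega := rfl
lemma Target.X_smul (c : ℝ) (u : Target m) : (c • u).X = c * u.X := rfl
lemma Target.xi_smul (c : ℝ) (u : Target m) : (c • u).xi = c • u.xi := rfl
lemma Target.omega_smul (c : ℝ) (u : Target m) : (c • u).omega = c • u.omega := rfl

lemma targetInner_eq (u V W : Target m) : targetInner u V W = V.X * W.X + (1 / 4) * (V.xi * u.xi⁻¹ *
    (W.xi * u.xi⁻¹)).trace + (1 / 2) * exp (-2 * u.X) * (V.omega ⬝ᵥ u.xi⁻¹ *ᵥ W.omega) := by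
  have hi : ∀ k p, u.xi⁻¹ p k = u.xi⁻¹ k p := fun k p => by
    have : (u.xi⁻¹)ᵀ = u.xi⁻¹ := by rw [tr_inv, u.xi_transpose]
    exact congr_fun₂ this k p
  have hW : ∀ k p, W.xi p k = W.xi k p := fun k p => congr_fun₂ W.xi_transpose k p
  have h1 : ∑ k, ∑ l, ∑ p, ∑ q, u.xi⁻¹ k p * u.xi⁻¹ l q * (V.xi k l * W.xi p q) = (V.xi * u.xi⁻¹ *
      (W.xi * u.xi⁻¹)).trace := by
    rw [mmul_assoc]
    simp only [trace, diag_apply, mmul (M := V.xi), mmul (M := u.xi⁻¹), mmul (M := W.xi), mul_sum]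
    refine sum_ext₂ fun k l => ?_
    rw [sum_comm]
    refine sum_ext₂ fun q p => ?_
    rw [hi k p, hW q p]
    ring
  have h2 : ∑ k, ∑ l, u.xi⁻¹ k l * (V.omega k * W.omega l) = V.omega ⬝ᵥ u.xi⁻¹ *ᵥ W.omega := by
    simp only [dotProduct, mulVec, mul_sum]
    exact sum_ext₂ fun k l => by ring
  rw [targetInner, h1, h2]

/-- The target metric as a bilinear form. -/
def targetForm (u : Target m) : Target m →ₗ[ℝ] Target m →ₗ[ℝ] ℝ :=
  LinearMap.mk₂ ℝ (targetInner u)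
    (fun V V' W => by
      simp only [targetInner_eq, Target.X_add, Target.xi_add, Target.omega_add, madd_mul,
        trace_add, add_dotProduct]
      ring)
    (fun c V W => by
      simp only [targetInner_eq, Target.X_smul, Target.xi_smul, Target.omega_smul, smul_mul,
        trace_smul, smul_dotProduct, smul_eq_mul]
      ring)
    (fun V W W' => by
      simp only [targetInner_eq, Target.X_add, Target.xi_add, Target.omega_add, madd_mul,
        mmul_add, trace_add, mulVec_add, dotProduct_add]
      ring)
    (fun c V W => by
      simp only [targetInner_eq, Target.X_smul, Target.xi_smul, Target.omega_smul, smul_mul,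
        mmul_smul, trace_smul, mulVec_smul, dotProduct_smul, smul_eq_mul]
      ring)

lemma bilin_eq_sum {ι E : Type*} [Fintype ι] [DecidableEq ι] [AddCommGroup E] [Module ℝ E] (f : ℝ^ι
    →ₗ[ℝ] ℝ^ι →ₗ[ℝ] E) (v w : ℝ^ι) : f v w = ∑ i, ∑ j, (v i * w j) • f (psingle i 1) (psingle j 1)
    := by
  have hs : ∀ v : ι → ℝ, v = ∑ i, v i • psingle i (1 : ℝ) := fun v => by
    ext j
    simp [Finset.sum_apply, psingle_apply]
  conv_lhs => rw [hs v, hs w]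
  simp only [map_sum, LinearMap.sum_apply, map_smul, LinearMap.smul_apply, Finset.smul_sum,
    smul_smul]
  rw [sum_comm]
  exact sum_ext₂ fun i j => by rw [mul_comm]

lemma targetInner_eq_sum (u V W : Target m) : targetInner u V W = ∑ A, ∑ B, V A * targetMetric u A B
    * W B := by
  refine (bilin_eq_sum (targetForm u) V W).trans ?_
  refine sum_ext₂ fun A B => ?_
  change _ * targetInner u (psingle A 1) (psingle B 1) = _
  rw [targetMetric, of_apply]
  ring

lemma targetInner_symm (u V W : Target m) : targetInner u V W = targetInner u W V := by
  have hi : (u.xi⁻¹)ᵀ = u.xi⁻¹ := by rw [tr_inv, u.xi_transpose]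
  rw [targetInner_eq, targetInner_eq, trace_mul_comm, mul_comm V.X]
  congr 2
  rw [dotProduct_mulVec, ← mulVec_transpose, hi, dotProduct_comm]

lemma targetMetric_symm (u : Target m) : (targetMetric u)ᵀ = targetMetric u := by
  ext A B
  exact targetInner_symm u _ _

lemma targetInner_nondegenerate {V : Target m} (hu : u.xi.det ≠ 0) (h : ∀ W, targetInner u V W = 0)
    : V = 0 := by
  have h1 : u.xi * u.xi⁻¹ = 1 := mmul_inv _ hu.isUnit
  have h2 : u.xi⁻¹ * u.xi = 1 := minv_mul _ hu.isUnit
  have hs : (u.xi * V.xi * u.xi)ᵀ = u.xi * V.xi * u.xi := by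
    simp only [transpose_mul, u.xi_transpose, V.xi_transpose, mmul_assoc]
  have h3 := h (Target.mk V.X (u.xi * V.xi * u.xi) (u.xi *ᵥ V.omega))
  rw [targetInner_eq, Target.mk_X, Target.mk_xi _ hs, Target.mk_omega, mulVec_mulVec, h2,
    one_mulVec] at h3
  have h4 : V.xi * u.xi⁻¹ * (u.xi * V.xi * u.xi * u.xi⁻¹) = V.xi * V.xiᵀ := by
    rw [mmul_assoc (u.xi * V.xi), h1, mmul_one, mmul_assoc V.xi, ← mmul_assoc u.xi⁻¹, h2, mone_mul,
      V.xi_transpose]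
  rw [h4] at h3
  have h5 : (V.xi * V.xiᵀ).trace = ∑ k, ∑ l, V.xi k l * V.xi k l := by simp [trace, mmul]
  have n1 : 0 ≤ ∑ k, ∑ l, V.xi k l * V.xi k l := Finset.sum_nonneg fun k _ => Finset.sum_nonneg fun
    l _ => mul_self_nonneg _
  have n2 : 0 ≤ V.omega ⬝ᵥ V.omega := Finset.sum_nonneg fun k _ => mul_self_nonneg _
  have n3 := Real.exp_pos (-2 * u.X)
  have n4 := mul_self_nonneg V.X
  have n5 : 0 ≤ (1 / 2) * exp (-2 * u.X) * (V.omega ⬝ᵥ V.omega) := by positivity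
  rw [h5] at h3
  have hX : V.X * V.X = 0 := by linarith
  have hxi : ∑ k, ∑ l, V.xi k l * V.xi k l = 0 := by linarith
  have hω : (1 / 2) * exp (-2 * u.X) * (V.omega ⬝ᵥ V.omega) = 0 := by linarith
  refine Target.ext' (mul_self_eq_zero.1 hX) ?_ ?_
  · ext k l
    have := (Finset.sum_eq_zero_iff_of_nonneg fun k _ => Finset.sum_nonneg fun l _ =>
      mul_self_nonneg _).1 hxi k (mem_univ _)
    exact mul_self_eq_zero.1 ((Finset.sum_eq_zero_iff_of_nonneg fun l _ => mul_self_nonneg _).1 this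
      l (mem_univ _))
  · exact dotProduct_self_eq_zero.1 ((mul_eq_zero.1 hω).resolve_left (by positivity))

lemma targetMetric_det (hu : u.xi.det ≠ 0) : (targetMetric u).det ≠ 0 := by
  intro h0
  obtain ⟨V, hV, h1⟩ := exists_mulVec_eq_zero_iff.2 h0
  refine hV (targetInner_nondegenerate hu fun W => ?_)
  rw [targetInner_symm, targetInner_eq_sum]
  refine sum_eq_zero fun A _ => ?_
  have h2 : ∑ B, targetMetric u A B * V B = 0 := congrFun h1 A
  simp only [mul_assoc, ← mul_sum, h2, mul_zero]

/-- The Christoffel symbols of the target metric, contracted with two vectors. -/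
def targetConn (u V W : Target m) : Target m :=
  Target.mk ((1 / 2) * exp (-2 * u.X) * (V.omega ⬝ᵥ u.xi⁻¹ *ᵥ W.omega))
    (-(1 / 2 : ℝ) • (V.xi * u.xi⁻¹ * W.xi + W.xi * u.xi⁻¹ * V.xi)
      + ((1 / 2) * exp (-2 * u.X)) • (vecMulVec V.omega W.omega + vecMulVec W.omega V.omega))
    (-(V.X • W.omega + W.X • V.omega)
      - (1 / 2 : ℝ) • (V.xi *ᵥ (u.xi⁻¹ *ᵥ W.omega) + W.xi *ᵥ (u.xi⁻¹ *ᵥ V.omega)))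

lemma targetConn_X (u V W : Target m) : (targetConn u V W).X = (1 / 2) * exp (-2 * u.X) * (V.omega
    ⬝ᵥ u.xi⁻¹ *ᵥ W.omega) := rfl

lemma targetConn_omega (u V W : Target m) : (targetConn u V W).omega = -(V.X • W.omega + W.X •
    V.omega) - (1 / 2 : ℝ) • (V.xi *ᵥ (u.xi⁻¹ *ᵥ W.omega) + W.xi *ᵥ (u.xi⁻¹ *ᵥ V.omega)) := rfl

lemma targetConn_xi (u V W : Target m) : (targetConn u V W).xi = -(1 / 2 : ℝ) • (V.xi * u.xi⁻¹ *
    W.xi + W.xi * u.xi⁻¹ * V.xi) + ((1 / 2) * exp (-2 * u.X)) • (vecMulVec V.omega W.omega +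
    vecMulVec W.omega V.omega) := by
  have hi : (u.xi⁻¹)ᵀ = u.xi⁻¹ := by rw [tr_inv, u.xi_transpose]
  refine Target.mk_xi _ ?_ _
  simp only [transpose_add, transpose_smul, transpose_mul, hi, Target.xi_transpose,
    transpose_vecMulVec, mmul_assoc]
  congr 2
  · exact add_comm _ _
  · exact add_comm _ _

lemma targetConn_symm (u V W : Target m) : targetConn u V W = targetConn u W V := by
  have hi : (u.xi⁻¹)ᵀ = u.xi⁻¹ := by rw [tr_inv, u.xi_transpose]
  refine Target.ext' ?_ ?_ ?_
  · rw [targetConn_X, targetConn_X]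
    congr 1
    rw [dotProduct_mulVec, ← mulVec_transpose, hi, dotProduct_comm]
  · rw [targetConn_xi, targetConn_xi, add_comm (V.xi * _ * _), add_comm (vecMulVec V.omega _)]
  · rw [targetConn_omega, targetConn_omega, add_comm (V.X • _), add_comm (V.xi *ᵥ _)]

/-- `targetConn` as a bilinear map. -/
def targetConnForm (u : Target m) : Target m →ₗ[ℝ] Target m →ₗ[ℝ] Target m :=
  have h1 : ∀ V V' W, targetConn u (V + V') W = targetConn u V W + targetConn u V' W := by
    intro V V' W
    refine Target.ext' ?_ ?_ ?_
    · simp only [targetConn_X, Target.X_add, Target.omega_add, add_dotProduct]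
      ring
    · simp only [targetConn_xi, Target.xi_add, Target.omega_add, madd_mul, mmul_add,
        add_vecMulVec, vecMulVec_add, smul_add]
      abel
    · simp only [targetConn_omega, Target.X_add, Target.xi_add, Target.omega_add,
        add_mulVec, mulVec_add, smul_add, add_smul]
      abel
  have h2 : ∀ (c : ℝ) (V W), targetConn u (c • V) W = c • targetConn u V W := by
    intro c V W
    refine Target.ext' ?_ ?_ ?_
    · simp only [targetConn_X, Target.X_smul, Target.omega_smul, smul_dotProduct, smul_eq_mul]
      ring
    · simp only [targetConn_xi, Target.xi_smul, Target.omega_smul, smul_mul, mmul_smul,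
        smul_vecMulVec, vecMulVec_smul, smul_add]
      module
    · simp only [targetConn_omega, Target.X_smul, Target.xi_smul, Target.omega_smul,
        smul_mulVec, mulVec_smul, smul_add, smul_sub]
      module
  LinearMap.mk₂ ℝ (targetConn u) h1 h2
    (fun V W W' => by
      rw [targetConn_symm, h1, targetConn_symm u W, targetConn_symm u W'])
    (fun c V W => by rw [targetConn_symm, h2, targetConn_symm u W])

lemma trace_vecMulVec_mul {n : Type*} [Fintype n] (x y : ℝ^n) (M : Matrix n n ℝ) : (vecMulVec x y *
    M).trace = y ⬝ᵥ M *ᵥ x := by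
  rw [trace_mul_comm, mul_vecMulVec, trace_vecMulVec, dotProduct_comm]

lemma pd_targetInner (hu : u.xi.det ≠ 0) (B : TargetIndex m) (V W : Target m) : pd B (fun z =>
    targetInner z V W) u = targetInner u (targetConn u (psingle B 1) V) W + targetInner u V
    (targetConn u (psingle B 1) W) := by
  have hi : (u.xi⁻¹)ᵀ = u.xi⁻¹ := by rw [tr_inv, u.xi_transpose]
  set β : Target m := psingle B 1 with hβ
  have hsm : MSmooth (fun z : Target m => z.xi) u := fun k l => contDiffAt_apply (𝕜 := ℝ) (E := ℝ)
    (inr (inl s(k, l)) : TargetIndex m) u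
  have hxi : mpd B (fun z : Target m => z.xi) u = β.xi := by
    ext k l
    refine (pd_coord B _ u).trans ?_
    simp [hβ, Target.xi, psingle_apply, eq_comm]
  have hX : pd B (fun z : Target m => z.X) u = β.X := by
    refine (pd_coord B _ u).trans ?_
    simp [hβ, Target.X, psingle_apply, eq_comm]
  have hXs : Diff (fun z : Target m => z.X) u := differentiableAt_apply _ _
  have hN := hsm.inv hu
  have hNd := mpd_inv (i := B) hsm hu
  rw [hxi] at hNd
  have hc : ∀ A : Matrix (Fin m) (Fin m) ℝ, EDiff (fun _ : Target m => A) u := fun A a b =>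
    differentiableAt_const _
  have hm : ∀ A : Matrix (Fin m) (Fin m) ℝ, mpd B (fun z : Target m => A * z.xi⁻¹) u = -(A * (u.xi⁻¹
      * β.xi * u.xi⁻¹)) := by
    intro A
    rw [mpd_mul (hc A) hN.ediff, mpd_const, hNd, Matrix.zero_mul, zero_add, Matrix.mul_neg]
  have hme : ∀ A : Matrix (Fin m) (Fin m) ℝ, EDiff (fun z : Target m => A * z.xi⁻¹) u := fun A =>
    (hc A).mul hN.ediff
  have h1 : pd B (fun z : Target m => (V.xi * z.xi⁻¹ * (W.xi * z.xi⁻¹)).trace) u = -(V.xi * (u.xi⁻¹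
      * β.xi * u.xi⁻¹) * (W.xi * u.xi⁻¹)).trace - (V.xi * u.xi⁻¹ * (W.xi * (u.xi⁻¹ * β.xi *
      u.xi⁻¹))).trace := by
    have h2 := mpd_mul (i := B) (hme V.xi) (hme W.xi)
    have h3 : pd B (fun z : Target m => (V.xi * z.xi⁻¹ * (W.xi * z.xi⁻¹)).trace) u = (mpd B (fun z :
        Target m => V.xi * z.xi⁻¹ * (W.xi * z.xi⁻¹)) u).trace := pd_sum (f := fun k (z : Target m)
        => (V.xi * z.xi⁻¹ * (W.xi * z.xi⁻¹)) k k) fun k _ => ((hme V.xi).mul (hme W.xi)) k k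
    rw [h3, h2, hm, hm, trace_add, Matrix.neg_mul, Matrix.mul_neg, trace_neg, trace_neg,
      sub_eq_add_neg]
  have htd : DifferentiableAt ℝ (fun z : Target m => (V.xi * z.xi⁻¹ * (W.xi * z.xi⁻¹)).trace) u :=
      DifferentiableAt.fun_sum fun k _ => ((hme V.xi).mul (hme W.xi)) k k
  have hqd : Diff (fun z : Target m => V.omega ⬝ᵥ z.xi⁻¹ *ᵥ W.omega) u := DifferentiableAt.fun_sum
    fun k _ => DifferentiableAt.const_mul (show Diff (fun z : Target m => ∑ l, z.xi⁻¹ k l * W.omega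
    l) u from DifferentiableAt.fun_sum fun l _ => (hN.ediff k l).mul_const _) _
  have h4 : pd B (fun z : Target m => V.omega ⬝ᵥ z.xi⁻¹ *ᵥ W.omega) u = -(V.omega ⬝ᵥ (u.xi⁻¹ * β.xi
      * u.xi⁻¹) *ᵥ W.omega) := by
    have e : (fun z : Target m => V.omega ⬝ᵥ z.xi⁻¹ *ᵥ W.omega) = fun z => ∑ k, ∑ l, (V.omega k *
        W.omega l) * z.xi⁻¹ k l := by
      funext z
      simp only [dotProduct, mulVec, mul_sum]
      exact sum_ext₂ fun k l => by ring
    have e2 : V.omega ⬝ᵥ (-(u.xi⁻¹ * β.xi * u.xi⁻¹)) *ᵥ W.omega = ∑ k, ∑ l, (V.omega k * W.omega l)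
        * (-(u.xi⁻¹ * β.xi * u.xi⁻¹)) k l := by
      simp only [dotProduct, mulVec, mul_sum]
      exact sum_ext₂ fun k l => by ring
    rw [e, ← dotProduct_neg, ← neg_mulVec, e2, ← hNd]
    refine (pd_sum (f := fun k (z : Target m) => ∑ l, (V.omega k * W.omega l) * z.xi⁻¹ k l) fun k _
      => DifferentiableAt.fun_sum fun l _ => (hN.ediff k l).const_mul _).trans ?_
    refine sum_ext fun k => ?_
    refine (pd_sum (f := fun l (z : Target m) => (V.omega k * W.omega l) * z.xi⁻¹ k l) fun l _ =>
      (hN.ediff k l).const_mul _).trans ?_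
    exact sum_ext fun l => pd_const_mul _ (hN.ediff k l)
  have h5 : pd B (fun z : Target m => exp (-2 * z.X)) u = exp (-2 * u.X) * (-2 * β.X) := by
    rw [pd_exp (hXs.const_mul _), pd_const_mul _ hXs, hX]
  have hed : Diff (fun z : Target m => exp (-2 * z.X)) u := (hXs.const_mul _).exp
  have h6 : pd B (fun z => targetInner z V W) u = (1 / 4) * pd B (fun z : Target m => (V.xi * z.xi⁻¹
      * (W.xi * z.xi⁻¹)).trace) u + (1 / 2) * (pd B (fun z : Target m => exp (-2 * z.X)) u *
      (V.omega ⬝ᵥ u.xi⁻¹ *ᵥ W.omega) + exp (-2 * u.X) * pd B (fun z : Target m => V.omega ⬝ᵥ z.xi⁻¹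
      *ᵥ W.omega) u) := by
    have e : (fun z => targetInner z V W) = fun z => (V.X * W.X + (1 / 4) * (V.xi * z.xi⁻¹ * (W.xi *
        z.xi⁻¹)).trace) + (1 / 2) * (exp (-2 * z.X) * (V.omega ⬝ᵥ z.xi⁻¹ *ᵥ W.omega)) := by
      funext z
      rw [targetInner_eq, mul_assoc (1 / 2 : ℝ)]
    have hp : Diff (fun z : Target m => exp (-2 * z.X) * (V.omega ⬝ᵥ z.xi⁻¹ *ᵥ W.omega)) u :=
      hed.mul hqd
    rw [e, pd_add (i := B) (f := fun z : Target m => V.X * W.X + (1 / 4) * (V.xi * z.xi⁻¹ * (W.xi *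
        z.xi⁻¹)).trace) ((htd.const_mul _).const_add _) (hp.const_mul _), pd_add (i := B) (f := fun
        _ : Target m => V.X * W.X) (differentiableAt_const _) (htd.const_mul _), pd_const,
        pd_const_mul _ htd, pd_const_mul _ hp, pd_mul hed hqd, zero_add]
  have hq : ∀ x y : Fin m → ℝ, x ⬝ᵥ u.xi⁻¹ *ᵥ y = y ⬝ᵥ u.xi⁻¹ *ᵥ x := fun x y => by
    rw [dotProduct_mulVec, ← mulVec_transpose, hi, dotProduct_comm]
  have hq3 : ∀ M : Matrix (Fin m) (Fin m) ℝ, M.transpose = M → ∀ x y : Fin m → ℝ, x ⬝ᵥ (u.xi⁻¹ * (M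
      * u.xi⁻¹)) *ᵥ y = y ⬝ᵥ (u.xi⁻¹ * (M * u.xi⁻¹)) *ᵥ x := by
    intro M hM x y
    rw [dotProduct_mulVec, ← mulVec_transpose, dotProduct_comm]
    simp only [transpose_mul, hM, hi, mmul_assoc]
  have hq4 : ∀ (M : Matrix (Fin m) (Fin m) ℝ) (x y : ℝ^(Fin m)), M.transpose = M → (M *ᵥ (u.xi⁻¹ *ᵥ
      x)) ⬝ᵥ u.xi⁻¹ *ᵥ y = x ⬝ᵥ (u.xi⁻¹ * (M * u.xi⁻¹)) *ᵥ y := by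
    intro M x y hM
    rw [hq, mulVec_mulVec, mulVec_mulVec, mmul_assoc, hq3 _ hM]
  have ht : ∀ A B' C : Matrix (Fin m) (Fin m) ℝ, (A * (u.xi⁻¹ * (B' * (u.xi⁻¹ * (C *
      u.xi⁻¹))))).trace = (B' * (u.xi⁻¹ * (C * (u.xi⁻¹ * (A * u.xi⁻¹))))).trace := by
    intro A B' C
    rw [← mmul_assoc A, trace_mul_comm]
    simp only [mmul_assoc]
  have ht' : ∀ (A : Matrix (Fin m) (Fin m) ℝ) (x y : ℝ^(Fin m)), (A * (u.xi⁻¹ * (vecMulVec x y *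
      u.xi⁻¹))).trace = y ⬝ᵥ (u.xi⁻¹ * (A * u.xi⁻¹)) *ᵥ x := by
    intro A x y
    rw [← mmul_assoc A, trace_mul_comm, mmul_assoc, trace_vecMulVec_mul]
  rw [h6, h1, h4, h5, targetInner_eq, targetInner_eq]
  simp only [targetConn_X, targetConn_xi, targetConn_omega, madd_mul, mmul_add, smul_mul, mmul_smul,
    trace_add, trace_smul, mmul_assoc, trace_vecMulVec_mul, smul_eq_mul, sub_dotProduct,
    neg_dotProduct, add_dotProduct, smul_dotProduct, mulVec_sub, mulVec_neg, mulVec_add,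
    mulVec_smul, dotProduct_sub, dotProduct_neg, dotProduct_add, dotProduct_smul]
  rw [hq4 _ _ _ β.xi_transpose, hq4 _ _ _ V.xi_transpose]
  simp only [mulVec_mulVec, mmul_assoc, ht']
  rw [ht β.xi V.xi W.xi]
  simp only [hq β.omega V.omega, hq β.omega W.omega, hq3 _ W.xi_transpose β.omega V.omega, hq3 _
    V.xi_transpose β.omega W.omega]
  ring

theorem sum_christoffel_targetMetric (hu : u.xi.det ≠ 0) (V W : Target m) (A : TargetIndex m) : ∑ B,
    ∑ C, Chr targetMetric A B C u * (V B * W C) = targetConn u V W A := by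
  have h : ∀ B C, Chr targetMetric A B C u = targetConn u (psingle B 1) (psingle C 1) A := by
    intro B C
    refine christoffel_unique (Γ := fun B => of fun A C => targetConn u (psingle B 1) (psingle C 1)
      A) (targetMetric_symm u) (targetMetric_det hu) (fun i j k => by rw [of_apply, of_apply,
      targetConn_symm]) (fun D => ?_) A B C
    have hc : ∀ (V : Target m) (i : TargetIndex m), ∑ j, targetMetric u i j * V j = targetInner u
        (psingle i 1) V := by
      intro V i
      have hz : ∀ b, b ≠ i → (psingle i 1 : Target m) b = 0 := fun b hb => Pi.single_eq_of_ne (M :=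
        fun _ : TargetIndex m => ℝ) hb 1
      have ho : (psingle i 1 : Target m) i = 1 := Pi.single_eq_same (M := fun _ : TargetIndex m =>
        ℝ) i 1
      rw [targetInner_eq_sum]
      refine Eq.trans ?_ (Finset.sum_eq_single i (fun b _ hb => sum_eq_zero fun j _ => ?_) fun h =>
        absurd (mem_univ i) h).symm
      · exact sum_ext fun j => by rw [ho, one_mul]
      · rw [hz b hb, zero_mul, zero_mul]
    ext i j
    refine (pd_targetInner hu D _ _).trans ?_
    rw [targetInner_symm, ← hc, ← hc, madd, mmul, mmul]
    congr 1
    refine sum_ext fun k => ?_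
    rw [show targetMetric u j k = targetMetric u k j from congrFun (congrFun (targetMetric_symm u)
      k) j, mul_comm]
    rfl
  have h2 := congrFun (bilin_eq_sum (targetConnForm u) V W) A
  refine Eq.trans ?_ h2.symm
  simp only [Finset.sum_apply, Pi.smul_apply, smul_eq_mul, h]
  exact sum_ext₂ fun B C => mul_comm _ _

section

variable {B : Type*} [Fintype B] [DecidableEq B]

/-- The derivative of a map to the target, in coordinates. -/
def tpd (α : B) (U : ℝ^B → Target m) (x : ℝ^B) : Target m :=
  fun A => pd α (fun z => U z A) x

/-- The wave map operator in coordinates. -/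
def waveMap (g : ℝ^B → Matrix B B ℝ) (U : ℝ^B → Target m) (A : TargetIndex m)
    (x : ℝ^B) : ℝ :=
  ∑ α, ∑ β, (g x)⁻¹ α β * (pd α (fun z => tpd β U z A) x
    - ∑ l, Chr g l α β x * tpd l U x A
    + ∑ D, ∑ C, Chr targetMetric A D C (U x) * (tpd α U x D * tpd β U x C))

variable {g : ℝ^B → Matrix B B ℝ} {U : ℝ^B → Target m} {x : ℝ^B}

lemma waveMap_eq (hu : (U x).xi.det ≠ 0) (A : TargetIndex m) : waveMap g U A x = box g (fun z => U z
    A) x + ∑ α, ∑ β, (g x)⁻¹ α β * targetConn (U x) (tpd α U x) (tpd β U x) A := by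
  simp only [waveMap, box, sum_christoffel_targetMetric hu, ← sum_add, ← mul_add]
  rfl

theorem waveMap_eq_zero_iff (hg : (g x)ᵀ = g x) (hu : (U x).xi.det ≠ 0) : (∀ A, waveMap g U A x = 0)
    ↔ (box g (fun z => (U z).X) x + (1 / 2) * exp (-2 * (U x).X) * ∑ k, ∑ l, (U x).xi⁻¹ k l * gip g
    (fun z => (U z).omega k) (fun z => (U z).omega l) x = 0) ∧ (∀ k l, box g (fun z => (U z).xi k l)
    x - ∑ α, ∑ β, (g x)⁻¹ α β * ((tpd α U x).xi * (U x).xi⁻¹ * (tpd β U x).xi) k l + exp (-2 * (U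
    x).X) * gip g (fun z => (U z).omega k) (fun z => (U z).omega l) x = 0) ∧ (∀ k, box g (fun z =>
    (U z).omega k) x - 2 * gip g (fun z => (U z).X) (fun z => (U z).omega k) x - ∑ α, ∑ β, (g x)⁻¹ α
    β * ((tpd α U x).xi *ᵥ ((U x).xi⁻¹ *ᵥ (tpd β U x).omega)) k = 0) := by
  have hgi : ∀ α β, (g x)⁻¹ β α = (g x)⁻¹ α β := fun α β => by
    have : ((g x)⁻¹)ᵀ = (g x)⁻¹ := by rw [tr_inv, hg]
    exact congr_fun₂ this α β
  have hswap : ∀ f : B → B → ℝ, ∑ α, ∑ β, (g x)⁻¹ α β * f β α = ∑ α, ∑ β, (g x)⁻¹ α β * f α β := by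
    intro f
    rw [sum_comm]
    simp only [hgi]
  have hX : waveMap g U (inl ()) x = box g (fun z => (U z).X) x + (1 / 2) * exp (-2 * (U x).X) * ∑
      k, ∑ l, (U x).xi⁻¹ k l * gip g (fun z => (U z).omega k) (fun z => (U z).omega l) x := by
    rw [waveMap_eq hu]
    congr 1
    change ∑ α, ∑ β, (g x)⁻¹ α β * (targetConn (U x) (tpd α U x) (tpd β U x)).X = _
    have e : ∀ α β, (tpd α U x).omega ⬝ᵥ (U x).xi⁻¹ *ᵥ (tpd β U x).omega = ∑ k, ∑ l, (U x).xi⁻¹ k l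
        * (pd α (fun z => (U z).omega k) x * pd β (fun z => (U z).omega l) x) := by
      intro α β
      simp only [dotProduct, mulVec, mul_sum]
      refine sum_ext₂ fun k l => ?_
      change pd α (fun z => (U z).omega k) x * ((U x).xi⁻¹ k l * pd β (fun z => (U z).omega l) x) = _
      ring
    simp only [targetConn_X, e, gip, mul_sum]
    refine Eq.trans (sum_ext fun α => Finset.sum_comm_cycle.symm) ?_
    refine Eq.trans sum_comm (sum_ext fun k => ?_)
    refine Eq.trans sum_comm (sum_ext fun l => ?_)
    exact sum_ext₂ fun α β => by ring
  have hxi : ∀ k l, waveMap g U (inr (inl s(k, l))) x = box g (fun z => (U z).xi k l) x - ∑ α, ∑ β,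
        (g x)⁻¹ α β * ((tpd α U x).xi * (U x).xi⁻¹ * (tpd β U x).xi) k l + exp (-2 * (U x).X) * gip
        g (fun z => (U z).omega k) (fun z => (U z).omega l) x := by
    intro k l
    rw [waveMap_eq hu]
    change box g (fun z => (U z).xi k l) x + ∑ α, ∑ β, (g x)⁻¹ α β * (targetConn (U x) (tpd α U x)
      (tpd β U x)).xi k l = _
    have e : ∀ α β, (targetConn (U x) (tpd α U x) (tpd β U x)).xi k l = -(1 / 2) * ((tpd α U x).xi *
        (U x).xi⁻¹ * (tpd β U x).xi) k l - (1 / 2) * ((tpd β U x).xi * (U x).xi⁻¹ * (tpd α U x).xi)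
        k l + (1 / 2) * exp (-2 * (U x).X) * ((tpd α U x).omega k * (tpd β U x).omega l) + (1 / 2) *
        exp (-2 * (U x).X) * ((tpd β U x).omega k * (tpd α U x).omega l) := by
      intro α β
      rw [targetConn_xi]
      simp only [madd, msmul, smul_eq_mul, vecMulVec_apply]
      ring
    simp only [e, mul_add, mul_sub, sum_add, sum_sub]
    have s1 := hswap fun α β => (1 / 2) * ((tpd α U x).xi * (U x).xi⁻¹ * (tpd β U x).xi) k l
    have s2 := hswap fun α β => (1 / 2) * exp (-2 * (U x).X) * ((tpd α U x).omega k * (tpd β U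
      x).omega l)
    beta_reduce at s1 s2
    have p1 : ∀ (c : ℝ) (f : B → ℝ^B), ∑ α, ∑ β, (g x)⁻¹ α β * (c * f α β) = c * ∑ α, ∑ β, (g x)⁻¹ α
        β * f α β := by
      intro c f
      simp only [mul_sum]
      exact sum_ext₂ fun _ _ => by ring
    rw [s1, s2, p1, p1, p1 _ fun α β => (tpd α U x).omega k * (tpd β U x).omega l]
    change _ = _ - _ + exp (-2 * (U x).X) * ∑ α, ∑ β, (g x)⁻¹ α β * ((tpd α U x).omega k * (tpd β U
      x).omega l)
    ring
  have hω : ∀ k, waveMap g U (inr (inr k)) x = box g (fun z => (U z).omega k) x - 2 * gip g (fun z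
        => (U z).X) (fun z => (U z).omega k) x - ∑ α, ∑ β, (g x)⁻¹ α β * ((tpd α U x).xi *ᵥ ((U
        x).xi⁻¹ *ᵥ (tpd β U x).omega)) k := by
    intro k
    rw [waveMap_eq hu]
    change box g (fun z => (U z).omega k) x + ∑ α, ∑ β, (g x)⁻¹ α β * (targetConn (U x) (tpd α U x)
      (tpd β U x)).omega k = _
    have e : ∀ α β, (targetConn (U x) (tpd α U x) (tpd β U x)).omega k = -((tpd α U x).X * (tpd β U
        x).omega k) - (tpd β U x).X * (tpd α U x).omega k - (1 / 2) * ((tpd α U x).xi *ᵥ ((U x).xi⁻¹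
        *ᵥ (tpd β U x).omega)) k - (1 / 2) * ((tpd β U x).xi *ᵥ ((U x).xi⁻¹ *ᵥ (tpd α U x).omega)) k
        := by
      intro α β
      rw [targetConn_omega]
      simp only [Pi.sub_apply, Pi.add_apply, Pi.neg_apply, Pi.smul_apply, smul_eq_mul]
      ring
    simp only [e, mul_add, mul_sub, mul_neg, sum_add, sum_sub, sum_neg]
    have s1 := hswap fun α β => (1 / 2) * ((tpd α U x).xi *ᵥ ((U x).xi⁻¹ *ᵥ (tpd β U x).omega)) k
    have s2 := hswap fun α β => (tpd α U x).X * (tpd β U x).omega k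
    beta_reduce at s1 s2
    have p1 : ∀ (c : ℝ) (f : B → ℝ^B), ∑ α, ∑ β, (g x)⁻¹ α β * (c * f α β) = c * ∑ α, ∑ β, (g x)⁻¹ α
        β * f α β := by
      intro c f
      simp only [mul_sum]
      exact sum_ext₂ fun _ _ => by ring
    rw [s1, s2, p1]
    change _ = _ - 2 * ∑ α, ∑ β, (g x)⁻¹ α β * ((tpd α U x).X * (tpd β U x).omega k) - _
    ring
  constructor
  · intro h
    exact ⟨hX ▸ h _, fun k l => hxi k l ▸ h _, fun k => hω k ▸ h _⟩
  · rintro ⟨h1, h2, h3⟩ A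
    rcases A with ⟨⟩ | p | k
    · exact hX.trans h1
    · induction p with
      | _ k l => exact (hxi k l).trans (h2 k l)
    · exact (hω k).trans (h3 k)

end

end

section

lemma gradInner_conf {ι : Type*} [Fintype ι] [DecidableEq ι] {g : ℝ^ι → Matrix ι ι ℝ} {x : ℝ^ι} {X :
    ℝ^ι → ℝ} (hu : (g x).det ≠ 0) (f f' : ℝ^ι → ℝ) : gip (conf X g) f f' x = exp (-(2 * X x)) * gip
    g f f' x := by simp only [gip, conf_inv hu, msmul, smul_eq_mul, mul_sum, mul_assoc]

namespace LocalFields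

section

variable {B K : Type*} [Fintype B] [DecidableEq B] [Fintype K] [DecidableEq K] {L : LocalFields B K}
  {x : ℝ^B}

lemma metric_transpose {x : ℝ^B} (hg : (L.g x)ᵀ = L.g x) (hx : (L.xi x)ᵀ = L.xi x) : (L.metric x)ᵀ =
    L.metric x := by simp [metric, fromBlocks_transpose, transpose_mul, hg, hx, mmul_assoc]

lemma metric_det (x : ℝ^B) : (L.metric x).det = (L.g x).det * (L.xi x).det := by
  rw [metric_eq, det_mul, det_mul, det_transpose, coframe, det_fromBlocks_zero₁₂, frameMetric,
    det_fromBlocks_zero₁₂]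
  simp

lemma Regular.frameRicci_symm {x : ℝ^B} (h : L.Regular x) (b d : B ⊕ K) : L.frameRicci x b d =
    L.frameRicci x d b := by
  have hz : (Sum.elim x (fun _ => 0) : B ⊕ K → ℝ) ∘ inl = x := Sum.elim_comp_inl _ _
  set z : B ⊕ K → ℝ := Sum.elim x fun _ => 0
  have h' : L.Regular (z ∘ inl) := hz.symm ▸ h
  have hsy := (continuous_comp_inl.tendsto z).eventually (h'.g_symm.and h'.xi_symm)
  have h1 : ∀ i j, ∑ b, ∑ d, L.coframe (z ∘ inl) b i * L.coframe (z ∘ inl) d j * (of fun b d =>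
      L.frameRicci (z ∘ inl) b d - L.frameRicci (z ∘ inl) d b : Matrix (B ⊕ K) (B ⊕ K) ℝ) b d = 0 :=
      by
    intro i j
    simp only [of_apply, mul_sub, sum_sub]
    rw [← ricci_metric_eq h' i j, ricci_symm (MSmooth.comp_inl (metric_smooth h')) (hsy.mono fun w
      hw => metric_transpose hw.1 hw.2) (by rw [metric_det]; exact mul_ne_zero h'.g_det h'.xi_det),
      ricci_metric_eq h' j i, sum_comm, sub_eq_zero]
    exact sum_ext₂ fun b d => by ring
  have h2 := (sum_conj_eq_zero_iff (L.coframe_mul_frame _) _).1 h1 b d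
  rw [of_apply, sub_eq_zero, hz] at h2
  exact h2

lemma Regular.box_X (h : L.Regular x) {X : ℝ^B → ℝ} (hX : ∀ᶠ y in 𝓝 x, ∀ α, pd α X y = (1 / 2) *
    (L.S α y).trace) : 2 * box L.g X x = ∑ k, ∑ l, (L.xi x)⁻¹ k l * (box L.g (fun y => L.xi y l k) x
    - ∑ α, ∑ β, (L.g x)⁻¹ α β * (mpd α L.xi x * (L.xi x)⁻¹ * mpd β L.xi x) l k) := by
  have h1 : ∀ α, pd α X x = (1 / 2) * ∑ k, ∑ l, (L.xi x)⁻¹ k l * mpd α L.xi x l k := by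
    intro α
    rw [hX.self_of_nhds]
    simp [S, trace, mmul]
  have h2 : ∀ α β, pd α (pd β X) x = (1 / 2) * ∑ k, ∑ l, (L.xi x)⁻¹ k l * (pd α (fun y => pd β (fun
      z => L.xi z l k) y) x - (mpd α L.xi x * (L.xi x)⁻¹ * mpd β L.xi x) l k) := by
    intro α β
    have hi := h.xi_smooth.inv h.xi_det
    have hm := h.xi_smooth.mpd β
    have e : pd α (pd β X) x = (1 / 2) * (mpd α (L.S β) x).trace := by
      rw [pd_congr (hX.mono fun y hy => hy β)]
      have hS : EDiff (L.S β) x := (hi.mul hm).ediff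
      have hT : Diff (fun y => (L.S β y).trace) x := DifferentiableAt.fun_sum fun k _ => hS k k
      rw [pd_const_mul _ hT]
      congr 1
      exact pd_sum (f := fun k y => L.S β y k k) fun k _ => hS k k
    have e2 : mpd α (L.S β) x = -((L.xi x)⁻¹ * mpd α L.xi x * (L.xi x)⁻¹) * mpd β L.xi x + (L.xi
        x)⁻¹ * mpd α (mpd β L.xi) x := by
      rw [← mpd_inv h.xi_smooth h.xi_det]
      exact mpd_mul hi.ediff hm.ediff
    have e3 : mpd α (L.S β) x = (L.xi x)⁻¹ * (mpd α (mpd β L.xi) x - mpd α L.xi x * (L.xi x)⁻¹ * mpd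
        β L.xi x) := by
      rw [e2]
      noncomm_ring
    rw [e, e3]
    simp only [trace, diag_apply, mmul (M := (L.xi x)⁻¹)]
    rfl
  have h3 : ∀ α β, 2 * ((L.g x)⁻¹ α β * (pd α (pd β X) x - ∑ γ, Chr L.g γ α β x * pd γ X x)) = ∑ k,
      ∑ l, (L.xi x)⁻¹ k l * ((L.g x)⁻¹ α β * (pd α (pd β fun y => L.xi y l k) x - ∑ γ, Chr L.g γ α β
      x * pd γ (fun y => L.xi y l k) x) - (L.g x)⁻¹ α β * (mpd α L.xi x * (L.xi x)⁻¹ * mpd β L.xi x)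
      l k) := by
    intro α β
    have h4 : ∑ γ, Chr L.g γ α β x * pd γ X x = (1 / 2) * ∑ k, ∑ l, (L.xi x)⁻¹ k l * ∑ γ, Chr L.g γ
        α β x * pd γ (fun y => L.xi y l k) x := by
      simp only [h1, mul_sum]
      rw [Finset.sum_comm_cycle.symm]
      refine sum_ext₂ fun k l => sum_ext fun γ => ?_
      change _ = 1 / 2 * ((L.xi x)⁻¹ k l * (_ * mpd γ L.xi x l k))
      ring
    rw [h2, h4, ← mul_sub, ← sum_sub]
    simp only [← sum_sub, mul_sum]
    refine sum_ext₂ fun k l => ?_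
    rw [← mul_sum]
    ring
  rw [box, mul_sum]
  simp only [mul_sum (s := univ) (a := (2 : ℝ)), h3]
  simp only [box, ← sum_sub, mul_sum]
  refine Eq.trans (sum_ext fun α => Finset.sum_comm_cycle.symm) ?_
  refine Eq.trans sum_comm (sum_ext fun k => ?_)
  exact sum_comm

end

variable {m : ℕ} {L : LocalFields (Fin 3) (Fin m)} {U : ℝ^(Fin 3) → Target m} {x : ℝ^(Fin 3)} {s :
  ℝ}

/-- The map `U` represents the fields near `x`. -/
structure Represented (L : LocalFields (Fin 3) (Fin m)) (U : ℝ^(Fin 3) → Target m) (s : ℝ)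
    (x : ℝ^(Fin 3)) : Prop where
  smooth : Smooth U x
  sign : s * s = 1
  g_det : (L.g x).det < 0
  xi_smooth : ∀ᶠ y in 𝓝 x, MSmooth L.xi y
  X_eq : ∀ᶠ y in 𝓝 x, (U y).X = (1 / 2) * log (L.xi y).det
  xi_eq : ∀ᶠ y in 𝓝 x, (U y).xi = L.xi y
  twist_eq : ∀ᶠ y in 𝓝 x, ∀ k γ,
    L.twistForm s (fun z => (U z).X) k γ y = pd γ (fun z => (U z).omega k) y

lemma pd_half_log_det (hxi : ∀ᶠ y in 𝓝 x, MSmooth L.xi y) (hdet : (L.xi x).det ≠ 0) {X : ℝ^(Fin 3) →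
    ℝ} (hX : ∀ᶠ y in 𝓝 x, X y = (1 / 2) * log (L.xi y).det) : ∀ᶠ y in 𝓝 x, ∀ α, pd α X y = (1 / 2) *
    (L.S α y).trace := by
  filter_upwards [hX.eventually_nhds, hxi, ev_det hxi.self_of_nhds hdet] with y h1 h2 h3 α
  have hd := diffAt (contDiffAt_det h2)
  rw [pd_congr h1, pd_const_mul _ (hd.log h3), pd_scalar_comp (Real.hasDerivAt_log h3) hd, pd_det h2
    h3, ← mul_assoc (_⁻¹), inv_mul_cancel₀ h3, one_mul, S]

/-- The left-hand side of the wave equation for `X`. -/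
def waveX (L : LocalFields (Fin 3) (Fin m)) (U : ℝ^(Fin 3) → Target m) (x : ℝ^(Fin 3)) : ℝ :=
  box L.g (fun z => (U z).X) x + gip L.g (fun z => (U z).X) (fun z => (U z).X) x
    + (1 / 2) * exp (-(2 * (U x).X)) * ∑ k, ∑ l, (L.xi x)⁻¹ k l *
      gip L.g (fun z => (U z).omega k) (fun z => (U z).omega l) x

/-- The left-hand side of the wave equation for `ξ`. -/
def waveXi (L : LocalFields (Fin 3) (Fin m)) (U : ℝ^(Fin 3) → Target m) (x : ℝ^(Fin 3))
    (k l : Fin m) : ℝ :=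
  box L.g (fun z => L.xi z k l) x + gip L.g (fun z => (U z).X) (fun z => L.xi z k l) x
    - (∑ α, ∑ β, (L.g x)⁻¹ α β * (mpd α L.xi x * (L.xi x)⁻¹ * mpd β L.xi x) k l)
    + exp (-(2 * (U x).X))
      * gip L.g (fun z => (U z).omega k) (fun z => (U z).omega l) x

/-- The left-hand side of the wave equation for `ω`. -/
def waveOmega (L : LocalFields (Fin 3) (Fin m)) (U : ℝ^(Fin 3) → Target m) (x : ℝ^(Fin 3))
    (k : Fin m) : ℝ :=
  box L.g (fun z => (U z).omega k) x - gip L.g (fun z => (U z).X) (fun z => (U z).omega k) x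
    - ∑ α, ∑ β, (L.g x)⁻¹ α β * (mpd α L.xi x *ᵥ ((L.xi x)⁻¹ *ᵥ (tpd β U x).omega)) k

theorem BaseRegular.waves_eq_zero_iff (h : L.BaseRegular x) (r : L.Represented U s x) :
    (∀ A, waveMap (conf (fun z => (U z).X) L.g) U A x = 0) ↔
      L.waveX U x = 0 ∧ (∀ k l, L.waveXi U x k l = 0) ∧ ∀ k, L.waveOmega U x k = 0 := by
  set X : ℝ^(Fin 3) → ℝ := fun z => (U z).X with hXdef
  have hXs : Smooth X x := contDiffAt_pi.1 r.smooth _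
  have hsym := h.g_symm.self_of_nhds
  set c := exp (-(2 * X x)) with hc
  have hcpos : 0 < c := Real.exp_pos _
  have hc' : exp (-2 * (U x).X) = c := by rw [hc, hXdef, neg_mul]
  have hxi0 := r.xi_eq.self_of_nhds
  have hpx : ∀ α, (tpd α U x).xi = mpd α L.xi x := by
    intro α
    rw [← mpd_congr r.xi_eq]
    rfl
  have hbx : ∀ k l, box L.g (fun z => (U z).xi k l) x = box L.g (fun z => L.xi z k l) x := by
    intro k l
    have e : (fun z => (U z).xi k l) =ᶠ[𝓝 x] fun z => L.xi z k l := r.xi_eq.mono fun z hz => by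
      change (U z).xi k l = _
      rw [hz]
    simp only [box]
    simp only [fun β => pd_congr (i := β) e, fun α β => pd_congr (i := α) (pd_eventuallyEq (i := β) e)]
  have hpx' : ∀ k l α, pd α (fun z => (U z).xi k l) x = mpd α L.xi x k l := fun k l α => by
    rw [← hpx]; rfl
  have hudet : (U x).xi.det ≠ 0 := by rw [hxi0]; exact h.xi_det
  have hcg : (conf X L.g x)ᵀ = conf X L.g x := by
    rw [conf, transpose_smul, hsym]
  have hcard : ((Fintype.card (Fin 3) : ℝ) - 2) = 1 := by norm_num
  have hXd := diffAt hXs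
  have hbc : ∀ f, box (conf X L.g) f x = c * (box L.g f x + gip L.g X f x) := fun f => by
    rw [box_conf hXd h.g_smooth.ediff h.g_symm h.g_det, hcard, one_mul]
  have hci : ∀ α β, (conf X L.g x)⁻¹ α β = c * (L.g x)⁻¹ α β := fun α β => by
    rw [conf_inv h.g_det, msmul, smul_eq_mul]
  have hgc := fun f f₁ => gradInner_conf (X := X) h.g_det f f₁
  have hW := waveMap_eq_zero_iff (U := U) hcg hudet
  have hsum : ∀ f : Fin 3 → Fin 3 → ℝ, ∑ α, ∑ β, (conf X L.g x)⁻¹ α β * f α β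
      = c * ∑ α, ∑ β, (L.g x)⁻¹ α β * f α β := by
    intro f
    simp only [hci, mul_sum, mul_assoc]
  simp only [hsum, hbc, hgc, ← hc, hc', hpx, hbx, hxi0] at hW
  set Sg := ∑ k, ∑ l, (L.xi x)⁻¹ k l *
    gip L.g (fun z => (U z).omega k) (fun z => (U z).omega l) x with hSg
  set WX := L.waveX U x
  set Wxi := L.waveXi U x
  set Wω := L.waveOmega U x
  have hWX : WX = box L.g X x + gip L.g X X x + (1 / 2) * c * Sg := rfl
  have hWxi : Wxi = fun k l => box L.g (fun z => L.xi z k l) x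
    + gip L.g X (fun z => L.xi z k l) x
    - (∑ α, ∑ β, (L.g x)⁻¹ α β * (mpd α L.xi x * (L.xi x)⁻¹ * mpd β L.xi x) k l)
    + c * gip L.g (fun z => (U z).omega k) (fun z => (U z).omega l) x := rfl
  have hWω : Wω = fun k => box L.g (fun z => (U z).omega k) x
    - gip L.g X (fun z => (U z).omega k) x
    - ∑ α, ∑ β, (L.g x)⁻¹ α β * (mpd α L.xi x *ᵥ
          ((L.xi x)⁻¹ *ᵥ (tpd β U x).omega)) k := rfl
  have hgx : ∀ k l, gip L.g X (fun z => (U z).xi k l) x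
      = gip L.g X (fun z => L.xi z k l) x := fun k l => by
    simp only [gip, hpx']
    rfl
  rw [hW]
  have e1 : ∀ a : ℝ, c * a = 0 ↔ a = 0 := fun a => by simp [hcpos.ne']
  refine and_congr ?_ (and_congr ?_ ?_)
  · rw [← e1 WX]
    have : ∑ k, ∑ l, (L.xi x)⁻¹ k l *
        (c * gip L.g (fun z => (U z).omega k) (fun z => (U z).omega l) x) = c * Sg := by
      simp only [hSg, mul_sum]
      exact sum_ext₂ fun _ _ => by ring
    rw [this]
    refine Eq.congr_left ?_
    rw [hWX]
    ring
  · refine forall_congr' fun k => forall_congr' fun l => ?_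
    rw [← e1 (Wxi k l), hgx]
    refine Eq.congr_left ?_
    simp only [hWxi]
    ring
  · refine forall_congr' fun k => ?_
    rw [← e1 (Wω k)]
    refine Eq.congr_left ?_
    simp only [hWω]
    change c * (_ + _) - 2 * (c * gip L.g X _ x) - _ = _
    ring

theorem BaseRegular.div_dual_eq_zero_iff (h : L.BaseRegular x) (r : L.Represented U s x) : (∀ k, ∑
    μ, pd μ (fun y => ∑ l, (L.xi y)⁻¹ k l * L.dual l y μ) x = 0) ↔ ∀ k, L.waveOmega U x k = 0 := by
  set X : ℝ^(Fin 3) → ℝ := fun z => (U z).X with hXdef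
  have hXs : Smooth X x := contDiffAt_pi.1 r.smooth _
  have hw : ∀ k, Smooth (fun z => (U z).omega k) x := fun k => contDiffAt_pi.1 r.smooth _
  set E : Fin m → Fin 3 → ℝ := fun k γ => pd γ (fun z => (U z).omega k) x with hEdef
  set Wω := L.waveOmega U x
  have hWω : Wω = fun k => box L.g (fun z => (U z).omega k) x - gip L.g X (fun z => (U z).omega k) x
    - ∑ α, ∑ β, (L.g x)⁻¹ α β * (mpd α L.xi x *ᵥ ((L.xi x)⁻¹ *ᵥ (tpd β U x).omega)) k := rfl
  have hf := factor_ne_zero (L := L) (x := x) (X := X) r.sign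
  have h2 : ∀ k, ∑ μ, pd μ (fun y => ∑ l, (L.xi y)⁻¹ k l * L.dual l y μ) x = (L.factor s X x)⁻¹ *
      ((L.xi x)⁻¹ *ᵥ Wω) k := by
    intro k
    rw [h.div_dual_eq hXs r.sign r.g_det hw r.twist_eq k, sum_sub]
    congr 1
    symm
    change ∑ l, (L.xi x)⁻¹ k l * Wω l = _
    simp only [hWω, mul_sub, sum_sub]
    congr 1
    have e1 : ∀ α β, ∑ l, ((L.xi x)⁻¹ * mpd α L.xi x * (L.xi x)⁻¹) k l * E l β = ∑ l, (L.xi x)⁻¹ k l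
        * (mpd α L.xi x *ᵥ ((L.xi x)⁻¹ *ᵥ (tpd β U x).omega)) l := by
      intro α β
      have e2 : ((L.xi x)⁻¹ * mpd α L.xi x * (L.xi x)⁻¹) *ᵥ (tpd β U x).omega = (L.xi x)⁻¹ *ᵥ (mpd α
          L.xi x *ᵥ ((L.xi x)⁻¹ *ᵥ (tpd β U x).omega)) := by
        rw [mulVec_mulVec, mulVec_mulVec, mmul_assoc]
      exact congrFun e2 k
    have e3 : ∀ α β, (L.g x)⁻¹ α β * ∑ l, ((L.xi x)⁻¹ * mpd α L.xi x * (L.xi x)⁻¹) k l * E l β = ∑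
        l, (L.xi x)⁻¹ k l * ((L.g x)⁻¹ α β * (mpd α L.xi x *ᵥ ((L.xi x)⁻¹ *ᵥ (tpd β U x).omega)) l)
        := by
      intro α β
      rw [e1, mul_sum]
      exact sum_ext fun _ => by ring
    simp only [mul_sum]
    refine Eq.trans ?_ (Finset.sum_comm_cycle (s := univ) (t := univ) (u := univ) (f := fun α β l =>
      (L.g x)⁻¹ α β * (((L.xi x)⁻¹ * mpd α L.xi x * (L.xi x)⁻¹) k l * E l β)))
    refine Eq.trans (Finset.sum_comm_cycle (s := univ) (t := univ) (u := univ) (f := fun α β l =>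
      (L.xi x)⁻¹ k l * ((L.g x)⁻¹ α β * (mpd α L.xi x *ᵥ ((L.xi x)⁻¹ *ᵥ (tpd β U x).omega))
      l))).symm ?_
    refine sum_ext₂ fun α β => ?_
    rw [← e3, mul_sum]
  simp only [h2, mul_eq_zero, inv_eq_zero, hf, false_or]
  refine ⟨fun h3 => congrFun (?_ : Wω = 0), fun h3 k => ?_⟩
  · rw [← one_mulVec Wω, ← mmul_inv _ h.xi_det.isUnit, ← mulVec_mulVec, show (L.xi x)⁻¹ *ᵥ Wω = 0
      from funext h3, mulVec_zero]
  · rw [show Wω = 0 from funext h3, mulVec_zero]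
    rfl

theorem Regular.frameRicci_eq_zero_iff (h : L.Regular x) (r : L.Represented U s x) :
    (∀ b d, L.frameRicci x b d = 0) ↔
      (∀ α β, ricci (conf (fun z => (U z).X) L.g) α β x
        = targetInner (U x) (tpd α U x) (tpd β U x)) ∧
      ∀ A, waveMap (conf (fun z => (U z).X) L.g) U A x = 0 := by
  set X : ℝ^(Fin 3) → ℝ := fun z => (U z).X with hXdef
  have hXs : Smooth X x := contDiffAt_pi.1 r.smooth _
  have hX := pd_half_log_det r.xi_smooth h.xi_det r.X_eq
  have hd := r.g_det
  have hsym := h.g_symm.self_of_nhds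
  have hw : ∀ k, Smooth (fun z => (U z).omega k) x := fun k => contDiffAt_pi.1 r.smooth _
  set E : Fin m → Fin 3 → ℝ := fun k γ => pd γ (fun z => (U z).omega k) x with hEdef
  have hE : ∀ k γ, E k γ = L.factor s X x * (L.g x *ᵥ L.dual k x) γ := fun k γ => by
    rw [hEdef, ← twistForm_eq hsym hd h.F_antisymm.self_of_nhds, r.twist_eq.self_of_nhds]
  set c := exp (-(2 * X x)) with hc
  have hc' : exp (-2 * (U x).X) = c := by rw [hc, hXdef, neg_mul]
  have hxi0 := r.xi_eq.self_of_nhds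
  have hpx : ∀ α, (tpd α U x).xi = mpd α L.xi x := by
    intro α
    rw [← mpd_congr r.xi_eq]
    rfl
  have hcard : ((Fintype.card (Fin 3) : ℝ) - 2) = 1 := by norm_num
  set Sg := ∑ k, ∑ l, (L.xi x)⁻¹ k l *
    gip L.g (fun z => (U z).omega k) (fun z => (U z).omega l) x with hSg
  set WX := L.waveX U x
  set Wxi := L.waveXi U x
  set Wω := L.waveOmega U x
  have hWX : WX = box L.g X x + gip L.g X X x + (1 / 2) * c * Sg := rfl
  have hWxi : Wxi = fun k l => box L.g (fun z => L.xi z k l) x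
    + gip L.g X (fun z => L.xi z k l) x
    - (∑ α, ∑ β, (L.g x)⁻¹ α β * (mpd α L.xi x * (L.xi x)⁻¹ * mpd β L.xi x) k l)
    + c * gip L.g (fun z => (U z).omega k) (fun z => (U z).omega l) x := rfl
  -- the fibre components
  have hfib : ∀ k l, L.frameRicci x (inr k) (inr l) = -(1 / 2) * Wxi k l := by
    intro k l
    rw [h.frameRicci_fibre hX, trace_Fend r.sign hsym hd h.F_antisymm.self_of_nhds hE]
    have e1 : ∑ α, ∑ β, (L.g x)⁻¹ α β * (E l β * E k α)
        = gip L.g (fun z => (U z).omega k) (fun z => (U z).omega l) x :=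
      sum_ext₂ fun _ _ => by rw [mul_comm (E l _)]
    have e2 : ∑ α, ∑ β, (L.g x)⁻¹ α β * (pd α X x * mpd β L.xi x k l)
        = gip L.g X (fun z => L.xi z k l) x := rfl
    rw [e1, e2]
    simp only [hWxi]
    ring
  have htr : ∑ k, ∑ l, (L.xi x)⁻¹ k l * Wxi l k = 2 * WX := by
    have hgX : ∑ k, ∑ l, (L.xi x)⁻¹ k l * gip L.g X (fun z => L.xi z l k) x
        = 2 * gip L.g X X x := by
      have e : ∀ β, ∑ k, ∑ l, (L.xi x)⁻¹ k l * mpd β L.xi x l k = 2 * pd β X x := by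
        intro β
        rw [hX.self_of_nhds]
        simp [S, trace, mmul]
      have e2 : ∀ α β, 2 * ((L.g x)⁻¹ α β * (pd α X x * pd β X x)) = ∑ k, ∑ l, (L.xi x)⁻¹ k l *
          ((L.g x)⁻¹ α β * (pd α X x * mpd β L.xi x l k)) := by
        intro α β
        have e3 : 2 * ((L.g x)⁻¹ α β * (pd α X x * pd β X x))
            = (L.g x)⁻¹ α β * pd α X x * (2 * pd β X x) := by ring
        rw [e3, ← e]
        simp only [mul_sum]
        exact sum_ext₂ fun _ _ => by ring
      simp only [gip, mul_sum, e2]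
      symm
      refine Eq.trans (sum_ext fun α => Finset.sum_comm_cycle.symm) ?_
      refine Eq.trans sum_comm (sum_ext fun k => ?_)
      exact sum_comm
    have hs2 : ∑ k, ∑ l, (L.xi x)⁻¹ k l *
        gip L.g (fun z => (U z).omega l) (fun z => (U z).omega k) x = Sg := by
      have hx : ∀ k l, (L.xi x)⁻¹ k l = (L.xi x)⁻¹ l k := fun k l => by
        have : ((L.xi x)⁻¹)ᵀ = (L.xi x)⁻¹ := by
          rw [tr_inv, h.xi_symm.self_of_nhds]
        exact congr_fun₂ this l k
      rw [hSg, sum_comm]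
      exact sum_ext₂ fun k l => by rw [hx]
    have hb := h.box_X hX
    simp only [hWxi, mul_add, mul_sub, sum_add, sum_sub] at hb ⊢
    rw [hgX]
    have e : ∑ k, ∑ l, (L.xi x)⁻¹ k l *
        (c * gip L.g (fun z => (U z).omega l) (fun z => (U z).omega k) x) = c * Sg := by
      rw [← hs2]
      simp only [mul_sum]
      exact sum_ext₂ fun _ _ => by ring
    rw [e, hWX]
    linarith
  -- the base components
  have hbase : ∀ α β, L.frameRicci x (inl α) (inl β) = ricci (conf X L.g) α β x
      - targetInner (U x) (tpd α U x) (tpd β U x) + WX * L.g x α β := by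
    intro α β
    rw [h.frameRicci_base hX, FF_eq r.sign hsym hd h.xi_det h.F_antisymm.self_of_nhds hE,
      ricci_conf hXs h.g_smooth h.g_symm h.g_det, hcard, targetInner_eq, hpx, hpx, hxi0, hc']
    have e1 : ∑ p, ∑ q, (L.xi x)⁻¹ p q * ∑ γ, ∑ δ, (L.g x)⁻¹ γ δ * (E q δ * E p γ) = Sg := by
      refine sum_ext₂ fun p q => ?_
      congr 1
      exact sum_ext₂ fun _ _ => by
        rw [mul_comm (E q _)]
    have e2 : (tpd α U x).omega ⬝ᵥ (L.xi x)⁻¹ *ᵥ (tpd β U x).omega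
        = ∑ p, ∑ q, (L.xi x)⁻¹ p q * (E p α * E q β) := by
      simp only [dotProduct, mulVec, mul_sum]
      refine sum_ext₂ fun k l => ?_
      change E k α * ((L.xi x)⁻¹ k l * E l β) = _
      ring
    have e3 : (L.S β x * L.S α x).trace
        = (mpd α L.xi x * (L.xi x)⁻¹ * (mpd β L.xi x * (L.xi x)⁻¹)).trace := by
      rw [S, S, mmul_assoc (mpd α L.xi x), trace_mul_comm]
      rw [mmul_assoc, trace_mul_comm]
      simp only [mmul_assoc]
    have e4 : (tpd α U x).X * (tpd β U x).X = pd α X x * pd β X x := rfl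
    have e5 : pd β (pd α X) x = pd β (pd α X) x := rfl
    rw [e1, e2, e3, e4, hWX]
    ring
  have hωz : ∀ k, Wω k = 0 := (h.toBaseRegular.div_dual_eq_zero_iff r).1 h.div_dual_eq_zero
  have hmix : ∀ k α, L.frameRicci x (inl α) (inr k) = 0 := by
    intro k
    refine (h.mixed_eq_zero_iff hXs r.sign hX hd k).2 fun α β => ?_
    have e : ∀ γ, L.twistForm s X k γ =ᶠ[𝓝 x] pd γ (fun z => (U z).omega k) := fun γ =>
      r.twist_eq.mono fun y hy => hy k γ
    rw [pd_congr (e β), pd_congr (e α)]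
    exact pd_comm (ev_C2 (hw k)).self_of_nhds
  rw [h.toBaseRegular.waves_eq_zero_iff r]
  constructor
  · intro h0
    have h1 : ∀ k l, Wxi k l = 0 := fun k l => by
      have := hfib k l
      rw [h0] at this
      linarith
    have h2 : WX = 0 := by
      simp only [h1, mul_zero, sum_zero] at htr
      linarith
    refine ⟨fun α β => ?_, h2, h1, hωz⟩
    have := hbase α β
    rw [h0, h2] at this
    linarith
  · rintro ⟨h1, (h2 : WX = 0), (h3 : ∀ k l, Wxi k l = 0), -⟩ b d
    rcases b with α | k <;> rcases d with β | l
    · rw [hbase, h1, h2]; ring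
    · exact hmix _ _
    · rw [h.frameRicci_symm]; exact hmix _ _
    · rw [hfib, h3]; ring

end LocalFields

end

section

variable {ι κ : Type*} [Fintype ι] [DecidableEq ι] [Fintype κ] [DecidableEq κ] {M : Type*}
  [TopologicalSpace M] [ChartedSpace ℝ^ι M] [IsManifold 𝕀 ι ∞ M] {N : Type*} [TopologicalSpace N]
  [ChartedSpace ℝ^κ N] [IsManifold 𝕀 κ ∞ N] {e : Chart M ι} {e' : Chart N κ} {y : ℝ^ι} {f : M → N}

variable {x x' : M}

lemma smooth_chart (he : e ∈ 𝒜 ι M) (hx : x ∈ e.source) : ContMDiffAt 𝕀 ι 𝕀 ι ∞ e x :=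
    contMDiffAt_of_mem_maximalAtlas he hx

lemma smooth_symm (he : e ∈ 𝒜 ι M) (hy : y ∈ e.target) : ContMDiffAt 𝕀 ι 𝕀 ι ∞ e.symm y :=
    contMDiffAt_symm_of_mem_maximalAtlas he hy

lemma ContMDiffAt.mdiff (hf : ContMDiffAt 𝕀 ι 𝕀 κ ∞ f x) : MDifferentiableAt 𝕀 ι 𝕀 κ f x :=
    hf.mdifferentiableAt (by decide)

/-- The expression of a map in charts. -/
def rep (e : Chart M ι) (e' : Chart N κ)
    (f : M → N) (z : ℝ^ι) : κ → ℝ := e' (f (e.symm z))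

lemma contDiffAt_inCharts (he : e ∈ 𝒜 ι M) (he' : e' ∈ 𝒜 κ N) (hy : y ∈ e.target) (hf : ContMDiffAt
    𝕀 ι 𝕀 κ ∞ f (e.symm y)) (hfy : f (e.symm y) ∈ e'.source) : Smooth (rep e e' f) y :=
    contMDiffAt_iff_contDiffAt.1 <| (smooth_chart he' hfy).comp y <| hf.comp y (smooth_symm he hy)

lemma mfderiv_coordVec (he : e ∈ 𝒜 ι M) (hy : y ∈ e.target) {E H : Type*} [NormedAddCommGroup E]
    [NormedSpace ℝ E] [TopologicalSpace H] {I : ModelWithCorners ℝ E H} {N : Type*}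
    [TopologicalSpace N] [ChartedSpace H N] {f : M → N} (hf : MDifferentiableAt 𝕀 ι I f (e.symm y))
    (i : ι) : (mfderiv 𝕀 ι I f (e.symm y) (coordVec e y i) : E) = mfderiv 𝕀 ι I (f ∘ e.symm) y
    (psingle i (1 : ℝ) : ℝ^ι) := by
  rw [mfderiv_comp y hf ((smooth_symm he hy).mdifferentiableAt (by decide))]
  rfl

lemma mfderiv_coordVec_eq_sum (he : e ∈ 𝒜 ι M) (he' : e' ∈ 𝒜 κ N) (hy : y ∈ e.target) (hf :
    ContMDiffAt 𝕀 ι 𝕀 κ ∞ f (e.symm y)) (hfy : f (e.symm y) ∈ e'.source) (i : ι) : (mfderiv 𝕀 ι 𝕀 κ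
    f (e.symm y) (coordVec e y i) : ℝ^κ) = ∑ a, jac (rep e e' f) y a i • (coordVec e' (rep e e' f y)
    a : ℝ^κ) := by
  have hτ := contDiffAt_inCharts he he' hy hf hfy
  have hfe : ContinuousAt (fun z => f (e.symm z)) y := (hf.comp y (smooth_symm he hy)).continuousAt
  have h1 : f ∘ e.symm =ᶠ[𝓝 y] e'.symm ∘ rep e e' f := by
    filter_upwards [hfe.eventually (e'.open_source.mem_nhds hfy)] with z hz
    exact (e'.left_inv hz).symm
  have hτd : Diff (rep e e' f) y := hτ.differentiableAt (by decide)
  have hin : rep e e' f y ∈ e'.target := e'.map_source hfy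
  rw [mfderiv_coordVec he hy (ContMDiffAt.mdiff hf)]
  refine (congrArg (fun T : ℝ^ι →L[ℝ] ℝ^κ => T (psingle i (1 : ℝ))) h1.mfderiv_eq).trans ?_
  refine (congrArg (fun T : ℝ^ι →L[ℝ] ℝ^κ => T (psingle i (1 : ℝ))) (mfderiv_comp (I := 𝕀 ι) (I' :=
    𝕀 κ) (I'' := 𝕀 κ) y ((smooth_symm he' hin).mdifferentiableAt (by decide))
    hτd.mdifferentiableAt)).trans ?_
  rw [mfderiv_eq_fderiv]
  set T : ℝ^κ →L[ℝ] ℝ^κ := mfderiv 𝕀 κ 𝕀 κ e'.symm (rep e e' f y)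
  change T (fderiv ℝ (rep e e' f) y (psingle i 1)) = ∑ a, _ • T (psingle a 1)
  have h2 : fderiv ℝ (rep e e' f) y (psingle i 1) = ∑ a, jac (rep e e' f) y a i • (psingle a 1 :
      ℝ^κ) := by
    ext b
    rw [Finset.sum_apply, Finset.sum_eq_single b]
    · simp only [Pi.smul_apply, Pi.single_eq_same, smul_eq_mul, mul_one, jac, of_apply, pd]
      rw [(hasFDerivAt_pi'.1 hτd.hasFDerivAt b).fderiv]
      rfl
    · intro a _ hab
      simp [Pi.single_eq_of_ne hab.symm]
    · simp
  rw [h2, map_sum]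
  simp only [map_smul]

lemma tensor2_congr {T : Tensor2 ι M} (h : x = x') (v w : ℝ^ι) :
    T x v w = T x' v w := by subst h; rfl

lemma oneForm_congr {a : OneForm ι M} (h : x = x') (v : ℝ^ι) : a x v = a x' v := by subst h; rfl

lemma pullback_comp1 (a : OneForm κ N) (he : e ∈ 𝒜 ι M) (he' : e' ∈ 𝒜 κ N) (hy : y ∈ e.target) (hf :
    ContMDiffAt 𝕀 ι 𝕀 κ ∞ f (e.symm y)) (hfy : f (e.symm y) ∈ e'.source) (i : ι) : a (f (e.symm y))
    (mfderiv 𝕀 ι 𝕀 κ f (e.symm y) (coordVec e y i)) = ∑ b, jac (rep e e' f) y b i * comp1 a e' b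
    (rep e e' f y) := by
  have h1 := mfderiv_coordVec_eq_sum he he' hy hf hfy i
  refine (congrArg (fun v : κ → ℝ => a (f (e.symm y)) v) h1).trans ?_
  have h2 : e'.symm (rep e e' f y) = f (e.symm y) := e'.left_inv hfy
  refine (oneForm_congr (a := a) h2.symm _).trans ?_
  refine (map_sum (a (e'.symm (rep e e' f y))) _ _).trans ?_
  exact sum_ext fun b => map_smul _ _ _

lemma pullback_comp2 (T : Tensor2 κ N) (he : e ∈ 𝒜 ι M) (he' : e' ∈ 𝒜 κ N) (hy : y ∈ e.target) (hf :
    ContMDiffAt 𝕀 ι 𝕀 κ ∞ f (e.symm y)) (hfy : f (e.symm y) ∈ e'.source) (i j : ι) : T (f (e.symm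
    y)) (mfderiv 𝕀 ι 𝕀 κ f (e.symm y) (coordVec e y i)) (mfderiv 𝕀 ι 𝕀 κ f (e.symm y) (coordVec e y
    j)) = ((jac (rep e e' f) y)ᵀ * comp2 T e' (rep e e' f y) * jac (rep e e' f) y) i j := by
  have h1 := mfderiv_coordVec_eq_sum he he' hy hf hfy
  refine (congrArg₂ (fun v w : κ → ℝ => T (f (e.symm y)) v w) (h1 i) (h1 j)).trans ?_
  have h2 : e'.symm (rep e e' f y) = f (e.symm y) := e'.left_inv hfy
  refine (tensor2_congr (T := T) h2.symm _ _).trans ?_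
  refine (bsum_l _ _ _ _).trans ?_
  rw [mmul]
  simp only [mmul, sum_mul, tr_apply]
  rw [sum_comm]
  refine sum_ext fun a => ?_
  refine (bsum_r _ _ _ _).trans ?_
  refine sum_ext fun b => ?_
  refine (bsmul_l _ _ _).trans ?_
  refine (congrArg _ (bsmul_r _ _ _)).trans ?_
  change _ * (_ * comp2 T e' (rep e e' f y) a b) = _
  ring

section

variable {e' : Chart M ι}

variable {τ : ℝ^ι → ℝ^κ}

lemma comp1_change (a : OneForm ι M) (he : e ∈ 𝒜 ι M) (he' : e' ∈ 𝒜 ι M) (hy : y ∈ e.target) (hy' :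
    e.symm y ∈ e'.source) (i : ι) : comp1 a e i y = ∑ b, jac (rep e e' id) y b i * comp1 a e' b (rep
    e e' id y) := by
  rw [← pullback_comp1 a he he' hy contMDiffAt_id hy' i, mfderiv_id]
  rfl

lemma comp2_change (T : Tensor2 ι M) (he : e ∈ 𝒜 ι M) (he' : e' ∈ 𝒜 ι M) (hy : y ∈ e.target) (hy' :
    e.symm y ∈ e'.source) : comp2 T e y = (jac (rep e e' id) y)ᵀ * comp2 T e' (rep e e' id y) * jac
    (rep e e' id) y := by
  ext i j
  rw [← pullback_comp2 T he he' hy contMDiffAt_id hy' i j, mfderiv_id]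
  rfl

lemma coordVec_change (he : e ∈ 𝒜 ι M) (he' : e' ∈ 𝒜 ι M) (hy : y ∈ e.target) (hy' : e.symm y ∈
    e'.source) (i : ι) : (coordVec e y i : ℝ^ι) = ∑ a, jac (rep e e' id) y a i • (coordVec e' (rep e
    e' id y) a : ℝ^ι) := by
  rw [← mfderiv_coordVec_eq_sum he he' hy contMDiffAt_id hy' i, mfderiv_id]
  rfl

lemma smooth_change (he : e ∈ 𝒜 ι M) (he' : e' ∈ 𝒜 ι M) (hy : y ∈ e.target) (hy' : e.symm y ∈
    e'.source) : Smooth (rep e e' id) y := contDiffAt_inCharts he he' hy contMDiffAt_id hy'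

lemma ev_change (hy : y ∈ e.target) (hy' : e.symm y ∈ e'.source) : ∀ᶠ z in 𝓝 y, z ∈ e.target ∧
    e.symm z ∈ e'.source := Filter.Eventually.and (e.open_target.mem_nhds hy) ((e.symm.continuousAt
    hy).eventually (e'.open_source.mem_nhds hy'))

lemma jac_change_mul (he : e ∈ 𝒜 ι M) (he' : e' ∈ 𝒜 ι M) (hy : y ∈ e.target) (hy' : e.symm y ∈
    e'.source) : jac (rep e' e id) (rep e e' id y) * jac (rep e e' id) y = 1 := by
  have hin : rep e e' id y ∈ e'.target := e'.map_source hy'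
  have hb : e'.symm (rep e e' id y) ∈ e.source := by
    rw [show e'.symm (rep e e' id y) = e.symm y from e'.left_inv hy']
    exact e.map_target hy
  have h1 := smooth_change he he' hy hy'
  have h2 := smooth_change he' he hin hb
  have h3 : (fun z => rep e' e id (rep e e' id z)) =ᶠ[𝓝 y] fun z => z := by
    filter_upwards [ev_change hy hy'] with z hz
    change e (e'.symm (e' (e.symm z))) = z
    rw [e'.left_inv hz.2, e.right_inv hz.1]
  ext a i
  rw [mmul]
  have h4 : pd i (fun z => rep e' e id (rep e e' id z) a) y = (1 : Matrix ι ι ℝ) a i := by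
    rw [pd_congr (h3.mono fun z hz => congrFun hz a), pd_coord, mone]
    simp only [eq_comm]
  rw [← h4]
  exact (pd_comp (f := fun w => rep e' e id w a) (differentiableAt_pi.1 (h2.differentiableAt (by
    decide)) a) (h1.differentiableAt (by decide))).symm

lemma jac_mul_change (he : e ∈ 𝒜 ι M) (he' : e' ∈ 𝒜 ι M) (hy : y ∈ e.target) (hy' : e.symm y ∈
    e'.source) : jac (rep e e' id) y * jac (rep e' e id) (rep e e' id y) = 1 := mul_eq_one_comm.1
    (jac_change_mul he he' hy hy')

lemma MSmooth.jac (h : Smooth τ y) : MSmooth (jac τ) y := fun a _ => contDiffAt_pd (contDiffAt_pi.1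
  h a)

lemma MSmooth.comp {ν μ : Type*} [Fintype ν] [Fintype μ] {A : ℝ^κ → Matrix ν μ ℝ} (hA : MSmooth A (τ
    y)) (h : Smooth τ y) : MSmooth (fun z => A (τ z)) y := fun a b => ContDiffAt.comp y (hA a b) h

lemma comp2_change_smooth (T : Tensor2 ι M) (he : e ∈ 𝒜 ι M) (he' : e' ∈ 𝒜 ι M) (hy : y ∈ e.target)
    (hy' : e.symm y ∈ e'.source) (h : MSmooth (comp2 T e') (rep e e' id y)) : MSmooth (comp2 T e) y
    := by
  have hτ := smooth_change he he' hy hy'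
  refine MSmooth.congr (((MSmooth.jac hτ).transpose.mul (MSmooth.comp h hτ)).mul (MSmooth.jac hτ))
    ?_
  filter_upwards [ev_change hy hy'] with z hz
  exact comp2_change T he he' hz.1 hz.2

lemma comp1_change_smooth (a : OneForm ι M) (he : e ∈ 𝒜 ι M) (he' : e' ∈ 𝒜 ι M) (hy : y ∈ e.target)
    (hy' : e.symm y ∈ e'.source) (h : ∀ i, Smooth (comp1 a e' i) (rep e e' id y)) (i : ι) : Smooth
    (comp1 a e i) y := by
  have hτ := smooth_change he he' hy hy'
  have h1 : Smooth (fun z => ∑ b, jac (rep e e' id) z b i * comp1 a e' b (rep e e' id z)) y :=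
      ContDiffAt.sum fun b _ => (MSmooth.jac hτ b i).mul (ContDiffAt.comp y (h b) hτ)
  refine h1.congr_of_eventuallyEq ?_
  filter_upwards [ev_change hy hy'] with z hz
  exact comp1_change a he he' hz.1 hz.2 i

/-- The components of the exterior derivative of a 1-form. -/
def extComp (a : OneForm ι M) (e : Chart M ι) (y : ℝ^ι) : Matrix ι ι ℝ :=
  of fun i j => pd i (comp1 a e j) y - pd j (comp1 a e i) y

lemma extComp_change (a : OneForm ι M) (he : e ∈ 𝒜 ι M) (he' : e' ∈ 𝒜 ι M) (hy : y ∈ e.target) (hy'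
    : e.symm y ∈ e'.source) (h : ∀ i, Smooth (comp1 a e' i) (rep e e' id y)) : extComp a e y = (jac
    (rep e e' id) y)ᵀ * extComp a e' (rep e e' id y) * jac (rep e e' id) y := by
  have hτ := smooth_change he he' hy hy'
  set τ := rep e e' id
  have hd : ∀ i j, pd i (comp1 a e j) y = ∑ b, (pd i (fun z => jac τ z b j) y * comp1 a e' b (τ y) +
      jac τ y b j * ∑ c, pd c (comp1 a e' b) (τ y) * jac τ y c i) := by
    intro i j
    rw [pd_congr (f := comp1 a e j) (g := fun z => ∑ b, jac τ z b j * comp1 a e' b (τ z))]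
    · have hs : ∀ b, Diff (fun z => comp1 a e' b (τ z)) y := fun b => diffAt (ContDiffAt.comp y (h
        b) hτ)
      refine (pd_sum (f := fun b z => jac τ z b j * comp1 a e' b (τ z)) fun b _ => ((MSmooth.jac
        hτ).ediff b j).mul (hs b)).trans ?_
      refine sum_ext fun b => ?_
      refine (pd_mul ((MSmooth.jac hτ).ediff b j) (hs b)).trans ?_
      rw [pd_comp (diffAt (h b)) (hτ.differentiableAt (by decide))]
      rfl
    · filter_upwards [ev_change hy hy'] with z hz
      exact comp1_change a he he' hz.1 hz.2 j
  have hc : ∀ i j b, pd i (fun z => jac τ z b j) y = pd j (fun z => jac τ z b i) y := fun i j b =>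
    pd_comm (ev_C2 (contDiffAt_pi.1 hτ b)).self_of_nhds
  ext i j
  rw [extComp, of_apply, hd, hd, ← sum_sub, mmul]
  simp only [hc i j, mmul, sum_mul, tr_apply, extComp, of_apply, mul_sub, sub_mul, sum_sub, sum_add,
    mul_sum, add_sub_add_left_eq_sub]
  congr 1
  · exact sum_ext₂ fun b c => by ring
  · rw [sum_comm]
    exact sum_ext₂ fun b c => by ring

end

end

section

variable {ι : Type*} [Fintype ι] [DecidableEq ι]

lemma det_neg_of_lorentzian {A : Matrix ι ι ℝ} (hA : A.transpose = A) {v : ℝ^ι} (hv : v ⬝ᵥ A *ᵥ v <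
    0) (hp : ∀ w, v ⬝ᵥ A *ᵥ w = 0 → w ≠ 0 → 0 < w ⬝ᵥ A *ᵥ w) : A.det < 0 := by
  set c := -(v ⬝ᵥ A *ᵥ v) with hc
  have hc0 : 0 < c := by linarith
  set q := A *ᵥ v with hq
  have hsym : ∀ x y : ι → ℝ, x ⬝ᵥ A *ᵥ y = y ⬝ᵥ A *ᵥ x := fun x y => by
    rw [dotProduct_mulVec, ← mulVec_transpose, hA, dotProduct_comm]
  set B := A + (2 / c) • vecMulVec q q with hB
  have hBq : ∀ w, w ⬝ᵥ B *ᵥ w = w ⬝ᵥ A *ᵥ w + (2 / c) * (v ⬝ᵥ A *ᵥ w) ^ 2 := by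
    intro w
    rw [hB, add_mulVec, dotProduct_add, smul_mulVec, dotProduct_smul, vecMulVec_mulVec, smul_eq_mul,
      hsym v w]
    simp only [op_smul_eq_smul, dotProduct_smul, smul_eq_mul]
    rw [← hq, dotProduct_comm q w]
    ring
  have hBpos : B.PosDef := by
    refine posDef_iff_dotProduct_mulVec.2 ⟨?_, fun {w} hw => ?_⟩
    · rw [IsHermitian, conjTranspose_eq_transpose_of_trivial, hB, transpose_add, transpose_smul,
        transpose_vecMulVec, hA]
    · rw [star_trivial, hBq]
      set s := -(v ⬝ᵥ A *ᵥ w) / c with hs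
      set w' := w - s • v with hw'
      have h1 : v ⬝ᵥ A *ᵥ w' = 0 := by
        rw [hw', mulVec_sub, dotProduct_sub, mulVec_smul, dotProduct_smul, smul_eq_mul, show v ⬝ᵥ A
          *ᵥ v = -c by rw [hc, neg_neg], hs]
        field_simp
        ring
      have h2 : w = w' + s • v := by rw [hw', sub_add_cancel]
      have h3 : v ⬝ᵥ A *ᵥ w = -(s * c) := by
        rw [hs]
        field_simp
      have h4 : w ⬝ᵥ A *ᵥ w = w' ⬝ᵥ A *ᵥ w' - c * s ^ 2 := by
        rw [h2, mulVec_add, dotProduct_add, add_dotProduct, add_dotProduct, mulVec_smul,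
          dotProduct_smul, dotProduct_smul, smul_dotProduct, smul_dotProduct, hsym w' v, h1, show v
          ⬝ᵥ A *ᵥ v = -c by rw [hc, neg_neg]]
        simp only [smul_eq_mul]
        ring
      rw [h4, h3]
      have h5 : (2 / c) * (-(s * c)) ^ 2 = 2 * c * s ^ 2 := by field_simp
      rw [h5]
      by_cases hw0 : w' = 0
      · have hs0 : s ≠ 0 := by
          rintro h0
          rw [hw0, h0] at h2
          exact hw (by simpa using h2)
        have := mul_pos hc0 (pow_pos (abs_pos.2 hs0) 2)
        rw [sq_abs] at this
        rw [hw0]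
        simp only [zero_dotProduct]
        linarith
      · have := hp w' h1 hw0
        have := mul_nonneg hc0.le (sq_nonneg s)
        linarith
  have hdet : B.det = -A.det := by
    have e : B = A * (1 + replicateCol Unit ((2 / c) • v) * replicateRow Unit q) := by
      ext i j
      rw [mmul_add, mmul_one, hB, madd, madd, msmul, vecMulVec_apply, ← mmul_assoc, mmul (M := A *
        _)]
      simp only [mmul, replicateCol_apply, replicateRow_apply, Finset.univ_unique,
        Finset.sum_singleton, Pi.smul_apply, smul_eq_mul, hq, mulVec, dotProduct, sum_mul, mul_sum]
      congr 1
      exact sum_ext₂ fun a b => by ring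
    rw [e, det_mul, det_one_add_replicateCol_mul_replicateRow, dotProduct_smul, dotProduct_comm,
      smul_eq_mul, show v ⬝ᵥ q = -c by rw [hc, neg_neg]]
    field_simp
    ring
  have := hBpos.det_pos
  linarith

end

section

variable {ι : Type*} [Fintype ι] [DecidableEq ι] {M : Type*} [TopologicalSpace M] [ChartedSpace ℝ^ι
  M] [IsManifold 𝕀 ι ∞ M] {e : Chart M ι} {y : ℝ^ι}

variable {T T' F : Tensor2 ι M} {U : Set M} {a : OneForm ι M}

lemma chart_mdifferentiable (he : e ∈ 𝒜 ι M) : e.MDifferentiable 𝕀 ι 𝕀 ι :=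
    ⟨(contMDiffOn_of_mem_maximalAtlas he).mdifferentiableOn (by decide),
    (contMDiffOn_symm_of_mem_maximalAtlas he).mdifferentiableOn (by decide)⟩

/-- The coordinate vectors form a basis of the tangent space. -/
def coordBasis (he : e ∈ 𝒜 ι M) (hy : y ∈ e.target) :
    Module.Basis ι ℝ (TangentSpace 𝕀 ι (e.symm y)) :=
  (Pi.basisFun ℝ ι).map ((chart_mdifferentiable he).symm.mfderiv hy).toLinearEquiv

lemma coordBasis_apply (he : e ∈ 𝒜 ι M) (hy : y ∈ e.target) (i : ι) : coordBasis he hy i = coordVec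
    e y i := by
  refine (Module.Basis.map_apply _ _ i).trans ?_
  rw [Pi.basisFun_apply]
  rfl

lemma eq_sum_coordVec (he : e ∈ 𝒜 ι M) (hy : y ∈ e.target) (v : TangentSpace 𝕀 ι (e.symm y)) : ∃ c :
    ι → ℝ, v = ∑ i, c i • coordVec e y i := ⟨(coordBasis he hy).repr v, by
    simp only [← coordBasis_apply he hy]
    exact ((coordBasis he hy).sum_repr v).symm⟩

lemma sum_coordVec_eq_zero (he : e ∈ 𝒜 ι M) (hy : y ∈ e.target) {c : ℝ^ι} (h : ∑ i, c i • coordVec e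
    y i = 0) : c = 0 := by
  simp only [← coordBasis_apply he hy] at h
  exact funext (Fintype.linearIndependent_iff.1 (coordBasis he hy).linearIndependent c h)

lemma comp2_sum (T : Tensor2 ι M) (c d : ℝ^ι) : T (e.symm y) (∑ i, c i • coordVec e y i) (∑ i, d i •
    coordVec e y i) = c ⬝ᵥ comp2 T e y *ᵥ d := by
  rw [bsum_l]
  simp only [bsum_r, bsmul_l, bsmul_r, dotProduct, mulVec, mul_sum]
  refine sum_ext₂ fun i j => ?_
  rw [comp2, of_apply]
  ring

lemma tensor2_ext_coord (he : e ∈ 𝒜 ι M) (hy : y ∈ e.target) (h : comp2 T e y = comp2 T' e y) : T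
    (e.symm y) = T' (e.symm y) := by
  refine LinearMap.ext fun v => LinearMap.ext fun w => ?_
  obtain ⟨c, rfl⟩ := eq_sum_coordVec he hy v
  obtain ⟨d, rfl⟩ := eq_sum_coordVec he hy w
  rw [comp2_sum, comp2_sum, h]

lemma tensor2_ext (h : ∀ e ∈ 𝒜 ι M, ∀ y ∈ e.target, comp2 T e y = comp2 T' e y) : T = T' := by
  funext x
  have h1 := chart_mem (I := 𝕀 ι) (n := ∞) x
  have h2 := (chartAt ℝ^ι x).map_source (mem_chart_source ℝ^ι x)
  have := tensor2_ext_coord h1 h2 (h _ h1 _ h2)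
  rwa [(chartAt ℝ^ι x).left_inv (mem_chart_source ℝ^ι x)] at this

lemma Smooth2.msmooth (h : Smooth2 T) (he : e ∈ 𝒜 ι M) (hy : y ∈ e.target) : MSmooth (comp2 T e) y
    := fun i j => (h e he i j).contDiffAt (e.open_target.mem_nhds hy)

lemma smooth2_of_local (h : ∀ x : M, ∃ e ∈ 𝒜 ι M, x ∈ e.source ∧ MSmooth (comp2 T e) (e x)) :
    Smooth2 T := by
  intro e he i j y hy
  obtain ⟨e', he', hx, hs⟩ := h (e.symm y)
  exact (comp2_change_smooth T he he' hy hx hs i j).contDiffWithinAt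

lemma isPotentialOn_of_local (h : ∀ x ∈ U, ∃ e ∈ 𝒜 ι M, x ∈ e.source ∧ (∀ i, Smooth (comp1 a e i) (e
    x)) ∧ extComp a e (e x) = comp2 F e (e x)) : IsPotentialOn U a F := by
  intro e he
  refine ⟨fun i y hy => ?_, fun y hy hyU i j => ?_⟩
  · obtain ⟨e', he', hx, hs, -⟩ := h (e.symm y) hy.2
    exact (comp1_change_smooth a he he' hy.1 hx hs i).contDiffWithinAt
  · obtain ⟨e', he', hx, hs, hF⟩ := h (e.symm y) hyU
    have h1 := extComp_change a he he' hy hx hs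
    have h2 := comp2_change F he he' hy hx
    have hF' : extComp a e' (rep e e' id y) = comp2 F e' (rep e e' id y) := hF
    rw [hF', ← h2] at h1
    exact congr_fun₂ h1 i j

lemma IsPotentialOn.smoothAt (hU : IsOpen U) (h : IsPotentialOn U a F) (he : e ∈ 𝒜 ι M) (hy : y ∈
    e.target) (hyU : e.symm y ∈ U) (i : ι) : Smooth (comp1 a e i) y := ((h e he).1 i).contDiffAt
    (Filter.inter_mem (e.open_target.mem_nhds hy) ((e.symm.continuousAt hy).preimage_mem_nhds
    (hU.mem_nhds hyU)))

lemma IsPotentialOn.extComp_eq (h : IsPotentialOn U a F) (he : e ∈ 𝒜 ι M) (hy : y ∈ e.target) (hyU :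
    e.symm y ∈ U) : extComp a e y = comp2 F e y := by
  ext i j
  exact (h e he).2 y hy hyU i j

namespace LorentzMetric

variable (g : LorentzMetric ι M)

lemma comp2_transpose (e : Chart M ι) (y : ℝ^ι) : (comp2 g.val e y)ᵀ = comp2 g.val e y := by
  ext i j
  exact g.symm _ _ _

lemma det_comp2_neg (he : e ∈ 𝒜 ι M) (hy : y ∈ e.target) : (comp2 g.val e y).det < 0 := by
  obtain ⟨v, hv, hp⟩ := g.lorentzian (e.symm y)
  obtain ⟨c, rfl⟩ := eq_sum_coordVec he hy v
  rw [comp2_sum] at hv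
  refine det_neg_of_lorentzian (g.comp2_transpose e y) hv fun d hd hd0 => ?_
  rw [← comp2_sum] at hd ⊢
  exact hp _ hd fun h => hd0 (sum_coordVec_eq_zero he hy h)

lemma det_comp2_ne_zero (he : e ∈ 𝒜 ι M) (hy : y ∈ e.target) : (comp2 g.val e y).det ≠ 0 :=
    (g.det_comp2_neg he hy).ne

lemma msmooth (he : e ∈ 𝒜 ι M) (hy : y ∈ e.target) : MSmooth (comp2 g.val e) y := g.smooth.msmooth
  he hy

lemma ricci_eq_zero_change {e' : Chart M ι} (he : e ∈ 𝒜 ι M) (he' : e' ∈ 𝒜 ι M) (hy : y ∈ e.target)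
    (hy' : e.symm y ∈ e'.source) : (∀ i j, ricci (comp2 g.val e) i j y = 0) ↔ ∀ i j, ricci (comp2
    g.val e') i j (rep e e' id y) = 0 := by
  have hin : rep e e' id y ∈ e'.target := e'.map_source hy'
  have hτ := smooth_change he he' hy hy'
  have hb : e'.symm (rep e e' id y) ∈ e.source := by
    rw [show e'.symm (rep e e' id y) = e.symm y from e'.left_inv hy']
    exact e.map_target hy
  have h1 := fun i j => ricci_comp (g := comp2 g.val e) (h := comp2 g.val e') (K := fun z => jac
    (rep e' e id) (rep e e' id z)) hτ ((ev_change hy hy').mono fun z hz => jac_mul_change he he'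
    hz.1 hz.2) ((ev_change hy hy').mono fun z hz => jac_change_mul he he' hz.1 hz.2) (MSmooth.comp
    (MSmooth.jac (smooth_change he' he hin hb)) hτ) ((ev_change hy hy').mono fun z hz =>
    comp2_change g.val he he' hz.1 hz.2) (.of_forall fun w => g.comp2_transpose e' w)
    (g.det_comp2_ne_zero he' hin) (g.msmooth he' hin) i j
  simp only [h1]
  exact sum_conj_eq_zero_iff (jac_mul_change he he' hy hy') (of fun a b => ricci (comp2 g.val e') a
    b (rep e e' id y))

end LorentzMetric

variable {O : Set ℝ^ι}

lemma exists_smooth_homeomorph {f : ℝ^ι → ℝ^ι} (hO : IsOpen O) (hy : y ∈ O) (hf : ContDiffOn ℝ ∞ f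
    O) (hdet : (fderiv ℝ f y).det ≠ 0) : ∃ η : Chart ℝ^ι ι, y ∈ η.source ∧ η.source ⊆ O ∧ (∀ z, η z
    = f z) ∧ ContDiffOn ℝ ∞ η η.source ∧ ContDiffOn ℝ ∞ η.symm η.target := by
  have hfy : ∀ z ∈ O, Smooth f z := fun z hz => hf.contDiffAt (hO.mem_nhds hz)
  have hder : ∀ z (hz : z ∈ O) (hd : (fderiv ℝ f z).det ≠ 0), HasFDerivAt f ((fderiv ℝ f
      z).toContinuousLinearEquivOfDetNeZero hd : ℝ^ι →L[ℝ] ℝ^ι) z := by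
    intro z hz hd
    rw [ContinuousLinearMap.coe_toContinuousLinearEquivOfDetNeZero]
    exact ((hfy z hz).differentiableAt (by decide)).hasFDerivAt
  set O' := O ∩ {z | (fderiv ℝ f z).det ≠ 0} with hO'
  have hO'o : IsOpen O' := by
    have hc : ContinuousOn (fun z => (fderiv ℝ f z).det) O :=
      ContinuousLinearMap.continuous_det.comp_continuousOn (hf.continuousOn_fderiv_of_isOpen hO (by
      decide))
    exact hc.isOpen_inter_preimage hO isOpen_ne
  have hn : (∞ : WithTop ℕ∞) ≠ 0 := by decide
  set η := ((hfy y hy).toOpenPartialHomeomorph f (hder y hy hdet) hn).restrOpen O' hO'o with hη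
  have hsub : η.source ⊆ O' := fun z hz => hz.2
  have hcoe : ∀ z, η z = f z := fun z => rfl
  refine ⟨η, ⟨(hfy y hy).mem_toOpenPartialHomeomorph_source (hder y hy hdet) hn, hy, hdet⟩, fun z hz
    => (hsub hz).1, hcoe, fun z hz => (hfy z (hsub hz).1).contDiffWithinAt, fun w hw => ?_⟩
  have hz := hsub (η.map_target hw)
  exact (η.contDiffAt_symm hw (hder _ hz.1 hz.2) (hfy _ hz.1)).contDiffWithinAt

lemma det_ne_zero_of_injective {T : ℝ^ι →L[ℝ] ℝ^ι} (h : ∀ v, T v = 0 → v = 0) : T.det ≠ 0 := by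
  intro h0
  have : LinearMap.ker (T : ℝ^ι →ₗ[ℝ] ℝ^ι) ≠ ⊥ := ((LinearMap.bot_lt_ker_of_det_eq_zero h0).ne')
  exact this (LinearMap.ker_eq_bot'.2 fun v hv => h v hv)

lemma mem_smoothCharts {Ψ : Chart M ι} (h : ∀ x ∈ Ψ.source, ContMDiffAt 𝕀 ι 𝕀 ι ∞ Ψ x) (h' : ∀ z ∈
    Ψ.target, ContMDiffAt 𝕀 ι 𝕀 ι ∞ Ψ.symm z) : Ψ ∈ 𝒜 ι M := Ψ.mem_maximalAtlas_of_contMDiffOn (fun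
    x hx => (h x hx).contMDiffWithinAt) fun z hz => (h' z hz).contMDiffWithinAt

lemma exists_chart {f : M → ℝ^ι} {O : Set M} (hO : IsOpen O) {p : M} (hp : p ∈ O) (hf : ∀ x ∈ O,
    ContMDiffAt 𝕀 ι 𝕀 ι ∞ f x) (hinj : ∀ v, mfderiv 𝕀 ι 𝕀 ι f p v = 0 → v = 0) : ∃ Ψ ∈ 𝒜 ι M, p ∈
    Ψ.source ∧ Ψ.source ⊆ O ∧ ∀ x ∈ Ψ.source, Ψ x = f x := by
  set χ := chartAt ℝ^ι p
  have hχ : χ ∈ 𝒜 ι M := chart_mem p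
  have hpχ : p ∈ χ.source := mem_chart_source _ p
  have hO' : IsOpen (χ.target ∩ χ.symm ⁻¹' O) := χ.symm.isOpen_inter_preimage hO
  have hsm : ∀ z ∈ χ.target ∩ χ.symm ⁻¹' O, Smooth (f ∘ χ.symm) z := fun z hz =>
    contMDiffAt_iff_contDiffAt.1 ((hf _ hz.2).comp z (smooth_symm hχ hz.1))
  have hmem : χ p ∈ χ.target ∩ χ.symm ⁻¹' O := ⟨χ.map_source hpχ, by rwa [Set.mem_preimage,
    χ.left_inv hpχ]⟩
  have hdet : (fderiv ℝ (f ∘ χ.symm) (χ p)).det ≠ 0 := by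
    refine det_ne_zero_of_injective fun v hv => ?_
    rw [← mfderiv_eq_fderiv] at hv
    have h1 := mfderiv_comp (I := 𝕀 ι) (I' := 𝕀 ι) (I'' := 𝕀 ι) (χ p) (g := f) (f := χ.symm)
      (ContMDiffAt.mdiff (hf _ hmem.2)) ((smooth_symm hχ hmem.1).mdifferentiableAt (by decide))
    have h2 : mfderiv 𝕀 ι 𝕀 ι f (χ.symm (χ p)) (mfderiv 𝕀 ι 𝕀 ι χ.symm (χ p) v) = 0 := (congrArg
        (fun T : ℝ^ι →L[ℝ] ℝ^ι => T v) h1).symm.trans hv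
    have h3 : ∀ q, q = p → ∀ v, mfderiv 𝕀 ι 𝕀 ι f q v = 0 → v = 0 := by
      rintro q rfl
      exact hinj
    have h4 := h3 _ (χ.left_inv hpχ) _ h2
    exact ((chart_mdifferentiable hχ).symm.mfderiv_injective hmem.1) (h4.trans (map_zero (mfderiv 𝕀
      ι 𝕀 ι χ.symm (χ p))).symm)
  obtain ⟨η, h1, h2, h3, h4, h5⟩ := exists_smooth_homeomorph hO' hmem (fun z hz => (hsm z
    hz).contDiffWithinAt) hdet
  refine ⟨χ.trans η, mem_smoothCharts (fun x hx => ?_) (fun z hz => ?_), ?_, fun x hx => ?_, fun x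
    hx => ?_⟩
  · rw [trans_source] at hx
    exact ((h4.contDiffAt (η.open_source.mem_nhds hx.2)).contMDiffAt).comp x (smooth_chart hχ hx.1)
  · rw [trans_target] at hz
    exact (smooth_symm hχ hz.2).comp z (h5.contDiffAt (η.open_target.mem_nhds hz.1)).contMDiffAt
  · rw [trans_source]
    exact ⟨hpχ, h1⟩
  · rw [trans_source] at hx
    have := (h2 hx.2).2
    rwa [Set.mem_preimage, χ.left_inv hx.1] at this
  · rw [trans_source] at hx
    rw [OpenPartialHomeomorph.trans_apply, h3, fcomp_apply, χ.left_inv hx.1]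

lemma exists_chart_of_param {Θ : ℝ^ι → M} (hO : IsOpen O) (hy : y ∈ O) (hΘ : ∀ z ∈ O, ContMDiffAt 𝕀
    ι 𝕀 ι ∞ Θ z) (hinj : ∀ v, mfderiv 𝕀 ι 𝕀 ι Θ y v = 0 → v = 0) : ∃ Ψ ∈ 𝒜 ι M, y ∈ Ψ.target ∧
    Ψ.target ⊆ O ∧ ∀ z ∈ Ψ.target, Ψ.symm z = Θ z := by
  set χ := chartAt ℝ^ι (Θ y)
  have hχ : χ ∈ 𝒜 ι M := chart_mem (Θ y)
  have hpχ : Θ y ∈ χ.source := mem_chart_source _ (Θ y)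
  have hO' : IsOpen (O ∩ Θ ⁻¹' χ.source) := ContinuousOn.isOpen_inter_preimage (fun z hz => (hΘ z
    hz).continuousAt.continuousWithinAt) hO χ.open_source
  have hsm : ∀ z ∈ O ∩ Θ ⁻¹' χ.source, Smooth (χ ∘ Θ) z := fun z hz => contMDiffAt_iff_contDiffAt.1
    ((smooth_chart hχ hz.2).comp z (hΘ z hz.1))
  have hdet : (fderiv ℝ (χ ∘ Θ) y).det ≠ 0 := by
    refine det_ne_zero_of_injective fun v hv => ?_
    rw [← mfderiv_eq_fderiv] at hv
    have h1 := mfderiv_comp (I := 𝕀 ι) (I' := 𝕀 ι) (I'' := 𝕀 ι) y (g := χ) (f := Θ) ((smooth_chart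
      hχ hpχ).mdifferentiableAt (by decide)) (ContMDiffAt.mdiff (hΘ y hy))
    have h2 : mfderiv 𝕀 ι 𝕀 ι χ (Θ y) (mfderiv 𝕀 ι 𝕀 ι Θ y v) = 0 := (congrArg (fun T : ℝ^ι →L[ℝ]
        ℝ^ι => T v) h1).symm.trans hv
    exact hinj _ ((chart_mdifferentiable hχ).mfderiv_injective hpχ (h2.trans (map_zero (mfderiv 𝕀 ι
      𝕀 ι χ (Θ y))).symm))
  obtain ⟨η, h1, h2, h3, h4, h5⟩ := exists_smooth_homeomorph hO' ⟨hy, hpχ⟩ (fun z hz => (hsm z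
    hz).contDiffWithinAt) hdet
  have hs : ∀ z ∈ η.source, η z ∈ χ.target := fun z hz => by
    rw [h3]
    exact χ.map_source (h2 hz).2
  refine ⟨χ.trans η.symm, mem_smoothCharts (fun x hx => ?_) (fun z hz => ?_), ?_, fun z hz => ?_,
    fun z hz => ?_⟩
  · rw [trans_source] at hx
    exact ((h5.contDiffAt (η.open_target.mem_nhds hx.2)).contMDiffAt).comp x (smooth_chart hχ hx.1)
  · rw [trans_target] at hz
    exact (smooth_symm hχ hz.2).comp z (h4.contDiffAt (η.open_source.mem_nhds hz.1)).contMDiffAt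
  · rw [trans_target]
    exact ⟨h1, hs _ h1⟩
  · rw [trans_target] at hz
    exact (h2 hz.1).1
  · rw [trans_target] at hz
    have hz1 : z ∈ η.source := hz.1
    change χ.symm (η z) = Θ z
    rw [h3, fcomp_apply, χ.left_inv (h2 hz1).2]

end

section

variable {E F : Type*} [NormedAddCommGroup E] [NormedSpace ℝ E] [NormedAddCommGroup F] [NormedSpace
  ℝ F]

lemma fderiv_fderiv_inl_symm {f : E × E → F} {a : E} (hf : Smooth f (a, a))
    (hs : ∀ᶠ p in 𝓝 (a, a), f p.swap = f p) (v w : E) :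
    fderiv ℝ (fun x => fderiv ℝ f (a, x)) a v (w, 0)
      = fderiv ℝ (fun x => fderiv ℝ f (a, x)) a w (v, 0) := by
  have h2 : ContDiffAt ℝ 1 (fderiv ℝ f) (a, a) := hf.fderiv_right (by decide)
  have hd : Diff (fderiv ℝ f) (a, a) := h2.differentiableAt one_ne_zero
  have hsym : IsSymmSndFDerivAt ℝ f (a, a) :=
    hf.isSymmSndFDerivAt (by rw [minSmoothness_of_isRCLikeNormedField]; decide)
  have h1 : ∀ v w : E, fderiv ℝ (fun x => fderiv ℝ f (a, x)) a v (w, 0)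
      = fderiv ℝ (fderiv ℝ f) (a, a) (0, v) (w, 0) := by
    intro v w
    have : HasFDerivAt (fun x => fderiv ℝ f (a, x)) _ a :=
      hd.hasFDerivAt.comp (f := fun x => (a, x)) a ((hasFDerivAt_const a a).prodMk (hasFDerivAt_id a))
    rw [this.fderiv]
    rfl
  set σ := ContinuousLinearEquiv.prodComm ℝ E E
  have h3 : ∀ᶠ p in 𝓝 (a, a), fderiv ℝ f p = (fderiv ℝ f (σ p)).comp (σ : E × E →L[ℝ] E × E) := by
    filter_upwards [hs.eventually_nhds] with p hp
    have e : f =ᶠ[𝓝 p] f ∘ σ := hp.mono fun q hq => hq.symm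
    rw [e.fderiv_eq, ContinuousLinearEquiv.comp_right_fderiv]
  have h4 : fderiv ℝ (fderiv ℝ f) (a, a) (0, v) (w, 0)
      = fderiv ℝ (fderiv ℝ f) (a, a) (v, 0) (0, w) := by
    have hc : HasFDerivAt (fun p => (fderiv ℝ f (σ p)).comp (σ : E × E →L[ℝ] E × E)) _ (a, a) :=
      HasFDerivAt.comp (a, a) (g := ContinuousLinearMap.precomp F (σ : E × E →L[ℝ] E × E))
        (ContinuousLinearMap.hasFDerivAt _)
        (HasFDerivAt.comp (a, a) (f := σ) (show HasFDerivAt (fderiv ℝ f) _ (σ (a, a)) from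
          hd.hasFDerivAt) σ.hasFDerivAt)
    exact congrArg (fun A : E × E →L[ℝ] E × E →L[ℝ] F => A (0, v) (w, 0))
      ((Filter.EventuallyEq.fderiv_eq h3).trans hc.fderiv)
  rw [h1, h1, h4, hsym]

end

section

variable {E : Type*} [NormedAddCommGroup E] [NormedSpace ℝ E] [CompleteSpace E]

lemma exists_local_log {μ : E × E → E} {T : Set E} (hT : IsOpen T) {x₀ : E} (hx₀ : x₀ ∈ T) (hμ : ∀ y
    ∈ T, Smooth μ (x₀, y)) (hone : ∀ y ∈ T, μ (x₀, y) = y) (hone' : ∀ᶠ x in 𝓝 x₀, μ (x, x₀) = x)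
    (hcomm : ∀ y ∈ T, ∀ᶠ p : E × E in 𝓝 (x₀, x₀), μ (p.2, μ (p.1, y)) = μ (p.1, μ (p.2, y))) : ∃ (f
    : E → E) (s : Set E), IsOpen s ∧ x₀ ∈ s ∧ s ⊆ T ∧ ContDiffOn ℝ ∞ f s ∧ ∀ y ∈ s, HasFDerivAt (fun
    x => f (μ (x, y))) (ContinuousLinearMap.id ℝ E) x₀ := by
  set inl := ContinuousLinearMap.inl ℝ E E
  set R : E → E →L[ℝ] E := fun y => (fderiv ℝ μ (x₀, y)).comp inl with hR
  have hRs : ∀ y ∈ T, Smooth R y := fun y hy => by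
    have h1 : Smooth (fderiv ℝ μ) (x₀, y) := (hμ y hy).fderiv_right (by decide)
    exact (h1.comp y (contDiffAt_const.prodMk contDiffAt_id)).clm_comp contDiffAt_const
  have hRd : ∀ y ∈ T, HasFDerivAt (fun x => μ (x, y)) (R y) x₀ := fun y hy => (((hμ y
    hy).differentiableAt (by decide)).hasFDerivAt).comp x₀ (f := fun x => (x, y)) ((hasFDerivAt_id
    x₀).prodMk (hasFDerivAt_const y x₀))
  have hR1 : R x₀ = 1 := (hRd x₀ hx₀).unique ((hasFDerivAt_id x₀).congr_of_eventuallyEq hone')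
  have hsym : ∀ y ∈ T, ∀ v w, fderiv ℝ R y (R y v) w = fderiv ℝ R y (R y w) v := by
    intro y hy
    set f : E × E → E := fun p => μ (p.1, μ (p.2, y)) with hf
    have hin : Smooth (fun x => μ (x, y)) x₀ := (show Smooth μ (x₀, y) from hμ y hy).comp x₀ (f :=
      fun x => (x, y)) (contDiffAt_id.prodMk contDiffAt_const)
    have hy1 : μ (x₀, y) = y := hone y hy
    have hfs : Smooth f (x₀, x₀) := by
      refine ContDiffAt.comp (x₀, x₀) (g := μ) (f := fun p : E × E => (p.1, μ (p.2, y))) ?_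
        (contDiffAt_fst.prodMk (ContDiffAt.comp (x₀, x₀) (g := fun x => μ (x, y)) (f := Prod.snd)
        hin contDiffAt_snd))
      change Smooth μ (x₀, μ (x₀, y))
      rw [hy1]
      exact hμ y hy
    have hev : ∀ᶠ x in 𝓝 x₀, μ (x, y) ∈ T := hin.continuousAt.eventually (by
        change ∀ᶠ z in 𝓝 (μ (x₀, y)), z ∈ T
        rw [hy1]; exact hT.mem_nhds hy)
    have hfR : ∀ᶠ x in 𝓝 x₀, (fderiv ℝ f (x₀, x)).comp inl = R (μ (x, y)) := by
      have hpt : Tendsto (fun x => (x₀, x)) (𝓝 x₀) (𝓝 (x₀, x₀)) := (continuous_const.prodMk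
        continuous_id).continuousAt
      filter_upwards [hev, hpt.eventually ((hfs.of_le (show (1 : WithTop ℕ∞) ≤ ∞ by
        decide)).eventually (by simp))] with x hx hfx
      have h1 : HasFDerivAt (fun z => f (z, x)) ((fderiv ℝ f (x₀, x)).comp inl) x₀ :=
        ((hfx.differentiableAt one_ne_zero).hasFDerivAt).comp x₀ (f := fun z => (z, x))
        ((hasFDerivAt_id x₀).prodMk (hasFDerivAt_const x x₀))
      exact h1.unique (hRd _ hx)
    have key : ∀ v w, fderiv ℝ (fun x => fderiv ℝ f (x₀, x)) x₀ v (w, 0) = fderiv ℝ R y (R y v) w :=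
        by
      intro v w
      have hd1 : Diff (fun x => fderiv ℝ f (x₀, x)) x₀ := by
        have h1 : ContDiffAt ℝ 1 (fderiv ℝ f) (x₀, x₀) := hfs.fderiv_right (by decide)
        exact (h1.comp x₀ (contDiffAt_const.prodMk contDiffAt_id)).differentiableAt one_ne_zero
      have h1 := (((ContinuousLinearMap.precomp E inl).hasFDerivAt).comp x₀
        hd1.hasFDerivAt).congr_of_eventuallyEq (hfR.mono fun x hx => hx.symm)
      have h2 : HasFDerivAt (fun x => R (μ (x, y))) ((fderiv ℝ R y).comp (R y)) x₀ := by
        refine HasFDerivAt.comp x₀ (g := R) ?_ (hRd y hy)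
        rw [hy1]
        exact ((hRs y hy).differentiableAt (by decide)).hasFDerivAt
      have h3 := congrArg (fun A : E →L[ℝ] E →L[ℝ] E => A v w) (h1.unique h2)
      exact h3
    intro v w
    rw [← key, ← key]
    exact fderiv_fderiv_inl_symm hfs (hcomm y hy) v w
  have hopen : IsOpen (T ∩ R ⁻¹' {A | IsUnit A}) := ContinuousOn.isOpen_inter_preimage (fun y hy =>
    (hRs y hy).continuousAt.continuousWithinAt) hT Units.isOpen
  have hmem : x₀ ∈ T ∩ R ⁻¹' {A | IsUnit A} := ⟨hx₀, by
    rw [Set.mem_preimage, hR1]; exact isUnit_one⟩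
  obtain ⟨r, hr, hball⟩ := Metric.isOpen_iff.1 hopen x₀ hmem
  set s := Metric.ball x₀ r
  set θ : E → E →L[ℝ] E := fun y => Ring.inverse (R y) with hθ
  have hθs : ∀ y ∈ s, Smooth θ y := fun y hy => by
    obtain ⟨u, hu⟩ := (hball hy).2
    refine ContDiffAt.comp y (g := Ring.inverse) ?_ (hRs y (hball hy).1)
    rw [← hu]
    exact contDiffAt_ringInverse ℝ u
  have hθR : ∀ y ∈ s, ∀ v, R y (θ y v) = v := fun y hy v => by
    have := Ring.mul_inverse_cancel _ (hball hy).2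
    exact congrArg (fun A : E →L[ℝ] E => A v) this
  have hθR' : ∀ y ∈ s, ∀ v, θ y (R y v) = v := fun y hy v => by
    have := Ring.inverse_mul_cancel _ (hball hy).2
    exact congrArg (fun A : E →L[ℝ] E => A v) this
  have hclosed : ∀ y ∈ s, ∀ v w, fderiv ℝ θ y v w = fderiv ℝ θ y w v := by
    intro y hy v w
    obtain ⟨u, hu⟩ := (hball hy).2
    have hinv : (↑u⁻¹ : E →L[ℝ] E) = θ y := by simp only [hθ]; rw [← hu, Ring.inverse_unit]
    have h1 : HasFDerivAt θ _ y := HasFDerivAt.comp y (g := Ring.inverse) (show HasFDerivAt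
      Ring.inverse _ (R y) by rw [← hu]; exact hasFDerivAt_ringInverse u) (((hRs y (hball
      hy).1).differentiableAt (by decide)).hasFDerivAt)
    have h2 : ∀ v w, fderiv ℝ θ y v w = -θ y (fderiv ℝ R y v (θ y w)) := by
      intro v w
      rw [h1.fderiv, hinv]
      rfl
    have h3 := hsym y (hball hy).1 (θ y v) (θ y w)
    rw [hθR y hy, hθR y hy] at h3
    rw [h2, h2, h3]
  obtain ⟨f, hf⟩ := (convex_ball x₀ r).exists_forall_hasFDerivAt_of_fderiv_symmetric
    Metric.isOpen_ball (fun y hy => ((hθs y hy).differentiableAt (by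
    decide)).differentiableWithinAt) hclosed
  refine ⟨f, s, Metric.isOpen_ball, Metric.mem_ball_self hr, fun y hy => (hball hy).1, ?_, ?_⟩
  · rw [contDiffOn_infty_iff_fderiv_of_isOpen Metric.isOpen_ball]
    exact ⟨fun y hy => (hf y hy).differentiableAt.differentiableWithinAt, fun y hy => ((hθs y
      hy).congr_of_eventuallyEq (mem_of_superset (Metric.isOpen_ball.mem_nhds hy) fun z hz => (hf z
      hz).fderiv)).contDiffWithinAt⟩
  · intro y hy
    have h1 : HasFDerivAt (fun x => f (μ (x, y))) ((θ y).comp (R y)) x₀ := by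
      refine HasFDerivAt.comp x₀ (g := f) ?_ (hRd y (hball hy).1)
      rw [hone y (hball hy).1]
      exact hf y hy
    have h2 : (θ y).comp (R y) = ContinuousLinearMap.id ℝ E := by
      ext v
      exact hθR' y hy v
    rwa [h2] at h1

end

section

variable {m : ℕ} {G : Type*} [CommGroup G] [TopologicalSpace G] [ChartedSpace ℝ^(Fin m) G] [LieGroup
  𝕀 (Fin m) ∞ G] (b : LieBasis m G)

/-- Right translation of the vector `c` of the Lie algebra. -/
def translate (g : G) (c : TangentSpace 𝕀 (Fin m) (1 : G)) : Fin m → ℝ :=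
  mfderiv 𝕀 (Fin m) 𝕀 (Fin m) (fun a : G => a * g) 1 c

lemma exists_log_chart (g₀ : G) : ∃ φ ∈ 𝒜 (Fin m) G, g₀ ∈ φ.source ∧ ∀ y ∈ φ.target, ∀ k, coordVec φ
    y k = translate (φ.symm y) (b k) := by
  set ψ := chartAt ℝ^(Fin m) (1 : G) with hψ
  have hψm : ψ ∈ 𝒜 (Fin m) G := chart_mem 1
  have h1s : (1 : G) ∈ ψ.source := mem_chart_source _ 1
  set x₀ := ψ 1 with hx₀
  have hx₀t : x₀ ∈ ψ.target := ψ.map_source h1s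
  have hψ1 : ψ.symm x₀ = 1 := ψ.left_inv h1s
  set μ : ℝ^(Fin m) × ℝ^(Fin m) → Fin m → ℝ := fun p => ψ (ψ.symm p.1 * ψ.symm p.2) with hμ
  have hμs : ∀ y ∈ ψ.target, Smooth μ (x₀, y) := by
    intro y hy
    have hm : ContMDiffAt ((𝕀 (Fin m)).prod 𝕀 (Fin m)) 𝕀 (Fin m) ∞ (fun p : ℝ^(Fin m) × ℝ^(Fin m) =>
        ψ.symm p.1 * ψ.symm p.2) (x₀, y) := ContMDiffAt.mul ((smooth_symm hψm hx₀t).comp (x₀, y)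
        contMDiffAt_fst) ((smooth_symm hψm hy).comp (x₀, y) contMDiffAt_snd)
    have hs : ψ.symm x₀ * ψ.symm y ∈ ψ.source := by
      rw [hψ1, one_mul]
      exact ψ.map_target hy
    have hm' := ContMDiffAt.comp (x₀, y) (smooth_chart hψm hs) hm
    rw [← contMDiffAt_iff_contDiffAt, modelWithCornersSelf_prod, ← chartedSpaceSelf_prod]
    exact hm'
  have hone : ∀ y ∈ ψ.target, μ (x₀, y) = y := fun y hy => by
    simp only [hμ]
    rw [hψ1, one_mul, ψ.right_inv hy]
  have hone' : ∀ᶠ x in 𝓝 x₀, μ (x, x₀) = x := by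
    filter_upwards [ψ.open_target.mem_nhds hx₀t] with x hx
    simp only [hμ]
    rw [hψ1, mul_one, ψ.right_inv hx]
  have hsymm : ∀ y ∈ ψ.target, ∀ᶠ x in 𝓝 x₀, ψ.symm (μ (x, y)) = ψ.symm x * ψ.symm y := by
    intro y hy
    have hc : ContinuousAt (fun x => ψ.symm x * ψ.symm y) x₀ := ContMDiffAt.continuousAt (I := 𝕀
      (Fin m)) (I' := 𝕀 (Fin m)) (n := ∞) (ContMDiffAt.mul (smooth_symm hψm hx₀t) contMDiffAt_const)
    filter_upwards [hc.eventually (ψ.open_source.mem_nhds (by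
      change ψ.symm x₀ * ψ.symm y ∈ ψ.source
      rw [hψ1, one_mul]; exact ψ.map_target hy))] with x hx
    exact ψ.left_inv hx
  have hcomm : ∀ y ∈ ψ.target, ∀ᶠ p : ℝ^(Fin m) × ℝ^(Fin m) in 𝓝 (x₀, x₀), μ (p.2, μ (p.1, y)) = μ
      (p.1, μ (p.2, y)) := by
    intro y hy
    have h1 : Tendsto Prod.fst (𝓝 (x₀, x₀)) (𝓝 x₀) := continuousAt_fst
    have h2 : Tendsto Prod.snd (𝓝 (x₀, x₀)) (𝓝 x₀) := continuousAt_snd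
    filter_upwards [h1.eventually (hsymm y hy), h2.eventually (hsymm y hy)] with p hp hp'
    simp only [hμ] at hp hp' ⊢
    rw [hp, hp', mul_left_comm]
  obtain ⟨f, s, hso, hxs, hsT, hfs, hf⟩ := exists_local_log ψ.open_target hx₀t hμs hone hone' hcomm
  set L : ℝ^(Fin m) ≃L[ℝ] ℝ^(Fin m) := LinearEquiv.toContinuousLinearEquiv (E := Fin m → ℝ) (F :=
    Fin m → ℝ) (b.equivFun.symm.trans ((chart_mdifferentiable hψm).mfderiv h1s).toLinearEquiv) with
    hL
  have hLk : ∀ k, L.symm (mfderiv 𝕀 (Fin m) 𝕀 (Fin m) ψ 1 (b k)) = psingle k 1 := by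
    intro k
    have h1 : L (psingle k 1) = mfderiv 𝕀 (Fin m) 𝕀 (Fin m) ψ 1 (b k) := by
      have h2 : b.equivFun.symm (psingle k 1) = b k := by
        rw [Module.Basis.equivFun_symm_apply]
        simp [psingle_apply]
      exact congrArg (mfderiv 𝕀 (Fin m) 𝕀 (Fin m) ψ 1) h2
    rw [← h1, L.symm_apply_apply]
  set F : G → Fin m → ℝ := fun g => L.symm (f (ψ g)) with hF
  set O := ψ.source ∩ ψ ⁻¹' s with hO
  have hOo : IsOpen O := ψ.isOpen_inter_preimage hso
  have hFs : ∀ g ∈ O, ContMDiffAt 𝕀 (Fin m) 𝕀 (Fin m) ∞ F g := fun g hg =>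
    ((L.symm.contDiff.contDiffAt.comp (ψ g) (hfs.contDiffAt (hso.mem_nhds hg.2))).contMDiffAt).comp
    g (smooth_chart hψm hg.1)
  have hFd : ∀ g ∈ O, ∀ k, mfderiv 𝕀 (Fin m) 𝕀 (Fin m) (fun a => F (a * g)) 1 (b k) = (psingle k 1 :
      ℝ^(Fin m)) := by
    intro g hg k
    have hy := ψ.map_source hg.1
    have e1 : (fun a => F (a * g)) =ᶠ[𝓝 1] (fun x => L.symm (f (μ (x, ψ g)))) ∘ ψ := by
      filter_upwards [ψ.open_source.mem_nhds h1s] with a ha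
      simp only [hF, hμ, fcomp_apply]
      rw [ψ.left_inv ha, ψ.left_inv hg.1]
    have hd : HasFDerivAt (fun x => L.symm (f (μ (x, ψ g)))) ((L.symm : ℝ^(Fin m) →L[ℝ] ℝ^(Fin
        m)).comp (ContinuousLinearMap.id ℝ _)) x₀ := HasFDerivAt.comp x₀ (g := L.symm)
        L.symm.hasFDerivAt (hf _ hg.2)
    refine (congrArg (fun A : ℝ^(Fin m) →L[ℝ] ℝ^(Fin m) => A (b k)) e1.mfderiv_eq).trans ?_
    refine (congrArg (fun A : ℝ^(Fin m) →L[ℝ] ℝ^(Fin m) => A (b k)) (mfderiv_comp (I := 𝕀 (Fin m))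
      (I' := 𝕀 (Fin m)) (I'' := 𝕀 (Fin m)) 1 hd.differentiableAt.mdifferentiableAt
      (ContMDiffAt.mdiff (smooth_chart hψm h1s)))).trans ?_
    have h2 : mfderiv 𝕀 (Fin m) 𝕀 (Fin m) (fun x => L.symm (f (μ (x, ψ g)))) x₀ = _ :=
      mfderiv_eq_fderiv.trans hd.fderiv
    exact (congrArg (fun A : ℝ^(Fin m) →L[ℝ] ℝ^(Fin m) => A (mfderiv 𝕀 (Fin m) 𝕀 (Fin m) ψ 1 (b k)))
      h2).trans (hLk k)
  have htr : ∀ g, ContMDiff 𝕀 (Fin m) 𝕀 (Fin m) ∞ (fun a : G => a * g) := fun g =>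
    contMDiff_mul_right
  have hO₀ : IsOpen ((fun g => g₀⁻¹ * g) ⁻¹' O) := hOo.preimage (contMDiff_mul_left (I := 𝕀 (Fin m))
    (n := ∞) (a := g₀⁻¹)).continuous
  have hF₀s : ∀ g ∈ (fun g => g₀⁻¹ * g) ⁻¹' O, ContMDiffAt 𝕀 (Fin m) 𝕀 (Fin m) ∞ (fun g => F (g₀⁻¹ *
      g)) g := fun g hg => (hFs _ hg).comp g contMDiff_mul_left.contMDiffAt
  have hF₀d : ∀ g ∈ (fun g => g₀⁻¹ * g) ⁻¹' O, ∀ k, mfderiv 𝕀 (Fin m) 𝕀 (Fin m) (fun g => F (g₀⁻¹ *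
      g)) g (translate g (b k)) = (psingle k 1 : ℝ^(Fin m)) := by
    intro g hg k
    have hk := hFd _ hg k
    have e1 : (fun a => F (a * (g₀⁻¹ * g))) = (fun g => F (g₀⁻¹ * g)) ∘ fun a => a * g := by
      funext a
      simp only [fcomp_apply]
      rw [mul_left_comm]
    rw [e1] at hk
    have h1g : (1 : G) * g = g := one_mul g
    have h2 := mfderiv_comp (I := 𝕀 (Fin m)) (I' := 𝕀 (Fin m)) (I'' := 𝕀 (Fin m)) (1 : G) (g := fun
      g => F (g₀⁻¹ * g)) (f := fun a => a * g) (ContMDiffAt.mdiff (by rw [h1g]; exact hF₀s g hg))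
      (ContMDiffAt.mdiff (htr g).contMDiffAt)
    have h3 := (congrArg (fun A : ℝ^(Fin m) →L[ℝ] ℝ^(Fin m) => A (b k)) h2).symm.trans hk
    have h4 : ∀ q, q = g → ∀ v : Fin m → ℝ, mfderiv 𝕀 (Fin m) 𝕀 (Fin m) (fun g => F (g₀⁻¹ * g)) q v
        = mfderiv 𝕀 (Fin m) 𝕀 (Fin m) (fun g => F (g₀⁻¹ * g)) g v := by rintro q rfl v; rfl
    exact (h4 _ h1g _).symm.trans h3
  have hsurj : ∀ g ∈ (fun g => g₀⁻¹ * g) ⁻¹' O, ∀ v : Fin m → ℝ, mfderiv 𝕀 (Fin m) 𝕀 (Fin m) (fun g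
      => F (g₀⁻¹ * g)) g v = 0 → v = 0 := by
    intro g hg v hv
    set A : ℝ^(Fin m) →L[ℝ] ℝ^(Fin m) := mfderiv 𝕀 (Fin m) 𝕀 (Fin m) (fun g => F (g₀⁻¹ * g)) g with
      hA
    have hs : Surjective (A : ℝ^(Fin m) →ₗ[ℝ] ℝ^(Fin m)) := by
      intro w
      refine ⟨∑ k, w k • translate g (b k), ?_⟩
      rw [map_sum]
      refine (sum_ext fun k => ((A : ℝ^(Fin m) →ₗ[ℝ] ℝ^(Fin m)).map_smul _ _ ).trans (congrArg _
        (hF₀d g hg k))).trans ?_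
      ext j
      simp [Finset.sum_apply, psingle_apply]
    exact (LinearMap.injective_iff_surjective.2 hs) (hv.trans (map_zero A).symm)
  have hg₀ : g₀ ∈ (fun g => g₀⁻¹ * g) ⁻¹' O := by
    rw [Set.mem_preimage, inv_mul_cancel]
    exact ⟨h1s, hxs⟩
  obtain ⟨φ, hφ, hgφ, hφO, hφF⟩ := exists_chart hO₀ hg₀ hF₀s (hsurj g₀ hg₀)
  refine ⟨φ, hφ, hgφ, fun y hy k => ?_⟩
  have hgs := φ.map_target hy
  have e1 : (fun g => F (g₀⁻¹ * g)) =ᶠ[𝓝 (φ.symm y)] φ := mem_of_superset (φ.open_source.mem_nhds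
    hgs) fun x hx => (hφF x hx).symm
  have h1 := hF₀d _ (hφO hgs) k
  have h2 : mfderiv 𝕀 (Fin m) 𝕀 (Fin m) φ (φ.symm y) (translate (φ.symm y) (b k)) = (psingle k 1 :
      ℝ^(Fin m)) := (congrArg (fun A : ℝ^(Fin m) →L[ℝ] ℝ^(Fin m) => A (translate (φ.symm y) (b k)))
      e1.mfderiv_eq).symm.trans h1
  have h3 := (chart_mdifferentiable hφ).symm_comp_deriv hgs
  have h4 := congrArg (fun A : ℝ^(Fin m) →L[ℝ] ℝ^(Fin m) => A (translate (φ.symm y) (b k))) h3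
  have h5 : mfderiv 𝕀 (Fin m) 𝕀 (Fin m) φ.symm (φ (φ.symm y)) (psingle k 1 : ℝ^(Fin m)) = translate
      (φ.symm y) (b k) := (congrArg (fun v : Fin m → ℝ => mfderiv 𝕀 (Fin m) 𝕀 (Fin m) φ.symm (φ
      (φ.symm y)) v) h2).symm.trans h4
  have h6 : ∀ q, q = y → ∀ v : Fin m → ℝ, (mfderiv 𝕀 (Fin m) 𝕀 (Fin m) φ.symm q v : ℝ^(Fin m)) =
      mfderiv 𝕀 (Fin m) 𝕀 (Fin m) φ.symm y v := by rintro q rfl v; rfl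
  exact (h6 _ (φ.right_inv hy) _).symm.trans h5

end

section

variable {ι κ ν : Type*} [Fintype ι] [Fintype κ] [Fintype ν] {M : Type*} [TopologicalSpace M]
  [ChartedSpace ℝ^ι M] {N : Type*} [TopologicalSpace N] [ChartedSpace ℝ^κ N] {Q : Type*}
  [TopologicalSpace Q] [ChartedSpace ℝ^ν Q]

/-- The derivative of a map of manifolds, as a linear map of the model spaces. -/
def tder (ι κ : Type*) [Fintype ι] [Fintype κ] {M : Type*} [TopologicalSpace M]
    [ChartedSpace ℝ^ι M] {N : Type*} [TopologicalSpace N] [ChartedSpace ℝ^κ N]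
    (f : M → N) (x : M) : ℝ^ι →L[ℝ] ℝ^κ :=
  mfderiv 𝕀 ι 𝕀 κ f x

lemma tder_comp {g : N → Q} {f : M → N} {x : M} (hg : ContMDiffAt 𝕀 κ 𝕀 ν ∞ g (f x)) (hf :
    ContMDiffAt 𝕀 ι 𝕀 κ ∞ f x) (v : ℝ^ι) : tder ι ν (fun x => g (f x)) x v = tder κ ν g (f x) (tder
    ι κ f x v) := congrArg (fun A : ℝ^ι →L[ℝ] ℝ^ν => A v) (mfderiv_comp (I' := 𝕀 κ) x
    (hg.mdifferentiableAt (by decide)) (hf.mdifferentiableAt (by decide)))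

lemma tder_congr {f g : M → N} {x : M} (h : f =ᶠ[𝓝 x] g) : tder ι κ f x = tder ι κ g x := h.mfderiv_eq

lemma tder_const (y : N) (x : M) : tder ι κ (fun _ : M => y) x = 0 := mfderiv_const

lemma tder_id (x : M) (v : ℝ^ι) : tder ι ι (fun x : M => x) x v = v := congrArg (fun A : ℝ^ι →L[ℝ]
  ℝ^ι => A v) (mfderiv_id (I := 𝕀 ι) (x := x))

lemma tder_eq_fderiv (f : ℝ^ι → ℝ^κ) (x : ℝ^ι) : tder ι κ f x = fderiv ℝ f x := mfderiv_eq_fderiv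

variable [DecidableEq ι] [IsManifold 𝕀 ι ∞ M] {e : Chart M ι} {y : ℝ^ι}

lemma tder_symm_chart (he : e ∈ 𝒜 ι M) {x : M} (hx : x ∈ e.source) (v : ℝ^ι) : tder ι ι e.symm (e x)
    (tder ι ι e x v) = v := by
  rw [← tder_comp (smooth_symm he (e.map_source hx)) (smooth_chart he hx), tder_congr (g := fun x =>
    x) ((e.open_source.mem_nhds hx) |> mem_of_superset <| fun z hz => e.left_inv hz), tder_id]

lemma tder_chart_symm (he : e ∈ 𝒜 ι M) (hy : y ∈ e.target) (v : ℝ^ι) : tder ι ι e (e.symm y) (tder ι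
    ι e.symm y v) = v := by
  rw [← tder_comp (smooth_chart he (e.map_target hy)) (smooth_symm he hy), tder_congr (g := fun x =>
    x) ((e.open_target.mem_nhds hy) |> mem_of_superset <| fun z hz => e.right_inv hz), tder_id]

end

variable {m : ℕ} {G : Type u} [CommGroup G] [TopologicalSpace G] [ChartedSpace ℝ^(Fin m) G]
  [LieGroup 𝕀 (Fin m) ∞ G] {M : Type u} [TopologicalSpace M] [ChartedSpace ℝ^(Fin 3) M] [IsManifold
  𝕀 (Fin 3) ∞ M] {S : SymmetricSpacetime m G M} {b : LieBasis m G} {e e' : Chart M (Fin 3)} {x y :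
  ℝ^(Fin 3)} {Ψ : Chart S.P 𝔽 m} {t : ℝ^(Fin m)} {z : ℝ^(𝔽 m)} {D : KKFields m M} {o :
  OrientationForm M} {g gt : LorentzMetric (Fin 3) M} {u : M → Target m}

namespace SymmetricSpacetime

variable (S b)

/-- The metric, as a bilinear form on the model space. -/
def bil (p : S.P) : BilinForm ℝ ℝ^(𝔽 m) := S.met.val p

/-- The Killing vector of the basis element `b k`. -/
def kill (k : Fin m) (p : S.P) : 𝔽 m → ℝ := S.killing (b k) p

/-- The basis element `b k` of the Lie algebra, as a vector of the model space. -/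
def basisVec (k : Fin m) : Fin m → ℝ := b k

lemma contMDiff_act (a : G) : ContMDiff 𝕀 𝔽 m 𝕀 𝔽 m ∞ (S.act a) := S.act_smooth.comp
    (contMDiff_const.prodMk contMDiff_id)

lemma contMDiff_orbit (p : S.P) : ContMDiff 𝕀 (Fin m) 𝕀 𝔽 m ∞ (fun a : G => S.act a p) :=
    S.act_smooth.comp (contMDiff_id.prodMk contMDiff_const)

lemma proj_act (a : G) (p : S.P) : S.proj (S.act a p) = S.proj p := ((S.proj_eq_iff p _).2 ⟨a,
  rfl⟩).symm

lemma bil_symm (p : S.P) (v w : ℝ^(𝔽 m)) : S.bil p v w = S.bil p w v := S.met.symm p v w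

lemma bil_act (a : G) (p : S.P) (v w : ℝ^(𝔽 m)) : S.bil (S.act a p) (tder 𝔽 m 𝔽 m (S.act a) p v)
    (tder 𝔽 m 𝔽 m (S.act a) p w) = S.bil p v w := S.act_isometry a p v w

lemma kill_eq (k : Fin m) (p : S.P) : S.kill b k p = tder (Fin m) 𝔽 m (fun a : G => S.act a p) 1
    (basisVec b k) := rfl

lemma tder_act_kill (a : G) (k : Fin m) (p : S.P) : tder 𝔽 m 𝔽 m (S.act a) p (S.kill b k p) = S.kill
    b k (S.act a p) := by
  have h1 : (fun c : G => S.act c (S.act a p)) = fun c => S.act a (S.act c p) := by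
    funext c
    rw [← S.act_mul, ← S.act_mul, mul_comm]
  rw [kill_eq, kill_eq, h1, tder_comp (S.contMDiff_act a).contMDiffAt (S.contMDiff_orbit
    p).contMDiffAt, S.act_one]

lemma tder_proj_kill (k : Fin m) (p : S.P) : tder 𝔽 m (Fin 3) S.proj p (S.kill b k p) = 0 := by
  have h := tder_comp (g := S.proj) (f := fun a : G => S.act a p) (x := 1) S.proj_smooth.contMDiffAt
    (S.contMDiff_orbit p).contMDiffAt (basisVec b k)
  rw [S.act_one] at h
  rw [kill_eq, ← h, show (fun a : G => S.proj (S.act a p)) = fun _ => S.proj p from funext fun a =>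
    S.proj_act a p, tder_const]
  rfl

lemma tder_proj_act (a : G) (p : S.P) (v : ℝ^(𝔽 m)) : tder 𝔽 m (Fin 3) S.proj (S.act a p) (tder 𝔽 m
    𝔽 m (S.act a) p v) = tder 𝔽 m (Fin 3) S.proj p v := by
  rw [← tder_comp S.proj_smooth.contMDiffAt (S.contMDiff_act a).contMDiffAt, show (fun p => S.proj
    (S.act a p)) = S.proj from funext fun p => S.proj_act a p]

lemma tder_proj_surjective (p : S.P) : Surjective (tder 𝔽 m (Fin 3) S.proj p) := S.proj_submersion p

lemma kill_pos {c : ℝ^(Fin m)} (hc : c ≠ 0) (p : S.P) : 0 < S.bil p (∑ k, c k • S.kill b k p) (∑ k,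
    c k • S.kill b k p) := by
  have h1 : (∑ k, c k • b k) ≠ 0 := fun h => hc (funext (Fintype.linearIndependent_iff.1
    b.linearIndependent c h))
  have h2 := S.spacelike p _ h1
  have h3 : (tder (Fin m) 𝔽 m (fun a : G => S.act a p) 1) (∑ k, c k • b k) = ∑ k, c k • S.kill b k p
      := (map_sum (mfderiv 𝕀 (Fin m) 𝕀 𝔽 m (fun a : G => S.act a p) 1) _ _).trans (sum_ext fun k =>
      map_smul (mfderiv 𝕀 (Fin m) 𝕀 𝔽 m (fun a : G => S.act a p) 1) _ _)
  have h4 : 0 < S.bil (S.act 1 p) ((tder (Fin m) 𝔽 m (fun a : G => S.act a p) 1) (∑ k, c k • b k))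
      ((tder (Fin m) 𝔽 m (fun a : G => S.act a p) 1) (∑ k, c k • b k)) := h2
  rwa [h3, S.act_one] at h4

lemma gram_apply (p : S.P) (k l : Fin m) : S.gram b p k l = S.bil p (S.kill b k p) (S.kill b l p) :=
    rfl

lemma gram_posDef (p : S.P) : (S.gram b p).PosDef := by
  refine posDef_iff_dotProduct_mulVec.2 ⟨?_, fun {c} hc => ?_⟩
  · ext k l
    rw [conjTranspose_apply, star_trivial, gram_apply, gram_apply, bil_symm]
  · have := S.kill_pos b hc p
    rw [bsum_l] at this
    simpa only [bsum_r, bsmul_l, bsmul_r, dotProduct, mulVec, mul_sum, star_trivial, gram_apply,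
      mul_left_comm, mul_comm] using this

lemma gram_act (a : G) (p : S.P) : S.gram b (S.act a p) = S.gram b p := by
  ext k l
  rw [gram_apply, gram_apply, ← tder_act_kill, ← tder_act_kill, bil_act]

lemma exists_section (he : e ∈ 𝒜 (Fin 3) M) {p : S.P} (hp : S.proj p ∈ e.source) : ∃ (W : Set ℝ^(Fin
    3)) (s : ℝ^(Fin 3) → S.P), IsOpen W ∧ e (S.proj p) ∈ W ∧ s (e (S.proj p)) = p ∧ ∀ x ∈ W,
    ContMDiffAt 𝕀 (Fin 3) 𝕀 𝔽 m ∞ s x ∧ S.proj (s x) ∈ e.source ∧ e (S.proj (s x)) = x := by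
  set χ := chartAt ℝ^(𝔽 m) p
  have hχ : χ ∈ 𝒜 𝔽 m S.P := chart_mem p
  have hpχ : p ∈ χ.source := mem_chart_source _ p
  have hχp : χ.symm (χ p) = p := χ.left_inv hpχ
  set x₀ := e (S.proj p) with hx₀
  set q : ℝ^(𝔽 m) → Fin 3 → ℝ := fun z => e (S.proj (χ.symm z)) with hq
  have hqs : ∀ z ∈ χ.target, S.proj (χ.symm z) ∈ e.source → Smooth q z := fun z hz hz' =>
    contMDiffAt_iff_contDiffAt.1 ((smooth_chart he hz').comp z (S.proj_smooth.contMDiffAt.comp z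
    (smooth_symm hχ hz)))
  have hp' : S.proj (χ.symm (χ p)) ∈ e.source := by rwa [hχp]
  have hpt := χ.map_source hpχ
  have hsurj : Surjective (fderiv ℝ q (χ p)) := by
    intro w
    obtain ⟨v, hv⟩ := S.tder_proj_surjective (χ.symm (χ p)) (tder (Fin 3) (Fin 3) e.symm x₀ w)
    refine ⟨tder 𝔽 m 𝔽 m χ (χ.symm (χ p)) v, ?_⟩
    rw [← tder_eq_fderiv, hq, tder_comp (f := fun z => S.proj (χ.symm z)) (smooth_chart he hp')
      (S.proj_smooth.contMDiffAt.comp (χ p) (smooth_symm hχ hpt)), tder_comp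
      S.proj_smooth.contMDiffAt (smooth_symm hχ hpt)]
    have h1 := tder_symm_chart hχ (χ.map_target hpt) v
    rw [χ.right_inv hpt] at h1
    rw [h1]
    rw [hv, hχp]
    have h2 := tder_chart_symm he (e.map_source hp) w
    rwa [e.left_inv hp] at h2
  obtain ⟨R, hR⟩ := (fderiv ℝ q (χ p) : ℝ^(𝔽 m) →ₗ[ℝ] ℝ^(Fin 3)).exists_rightInverse_of_surjective
    (LinearMap.range_eq_top.2 hsurj)
  set T := LinearMap.toContinuousLinearMap R
  set j : ℝ^(Fin 3) → 𝔽 m → ℝ := fun x => χ p + T (x - x₀) with hj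
  have hjs : ContDiff ℝ ∞ j := contDiff_const.add (T.contDiff.comp (contDiff_id.sub contDiff_const))
  have hjx : j x₀ = χ p := by simp [hj]
  have hjd : HasFDerivAt j T x₀ := by
    have := (T.hasFDerivAt.comp x₀ ((hasFDerivAt_id x₀).sub_const x₀)).const_add (χ p)
    exact this
  have hO' : IsOpen (χ.target ∩ χ.symm ⁻¹' (S.proj ⁻¹' e.source)) := χ.symm.isOpen_inter_preimage
    (e.open_source.preimage S.proj_smooth.continuous)
  have hO : IsOpen (j ⁻¹' (χ.target ∩ χ.symm ⁻¹' (S.proj ⁻¹' e.source))) := hO'.preimage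
    hjs.continuous
  have hmem : x₀ ∈ j ⁻¹' (χ.target ∩ χ.symm ⁻¹' (S.proj ⁻¹' e.source)) := by
    rw [Set.mem_preimage, hjx]
    exact ⟨hpt, hp'⟩
  have hdet : (fderiv ℝ (fun x => q (j x)) x₀).det ≠ 0 := by
    have h1 : HasFDerivAt (fun x => q (j x)) ((fderiv ℝ q (χ p)).comp T) x₀ := by
      refine HasFDerivAt.comp x₀ (g := q) ?_ hjd
      rw [hjx]
      exact ((hqs _ hpt hp').differentiableAt (by decide)).hasFDerivAt
    rw [h1.fderiv]
    refine det_ne_zero_of_injective fun v hv => ?_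
    exact (LinearMap.congr_fun hR v).symm.trans hv
  obtain ⟨η, h1, h2, h3, h4, h5⟩ := exists_smooth_homeomorph hO hmem (fun x hx => ((hqs _ hx.1
    hx.2).comp x hjs.contDiffAt).contDiffWithinAt) hdet
  have hηx : η x₀ = x₀ := by
    rw [h3]
    change q (j x₀) = x₀
    rw [hjx, hq, hx₀]
    change e (S.proj (χ.symm (χ p))) = _
    rw [hχp]
  refine ⟨η.target, fun x => χ.symm (j (η.symm x)), η.open_target, ?_, ?_, fun x hx => ?_⟩
  · rw [← hηx]
    exact η.map_source h1
  · change χ.symm (j (η.symm x₀)) = p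
    rw [show η.symm x₀ = x₀ by conv_lhs => rw [← hηx, η.left_inv h1], hjx, hχp]
  · have hx' := h2 (η.map_target hx)
    refine ⟨?_, hx'.2, ?_⟩
    · exact (smooth_symm hχ hx'.1).comp x ((hjs.contDiffAt.comp x (h5.contDiffAt
        (η.open_target.mem_nhds hx))).contMDiffAt)
    · exact (h3 _).symm.trans (η.right_inv hx)

end SymmetricSpacetime

section

variable {n m : ℕ}

/-- The inclusion of the first factor. -/
def inclLeft (n m : ℕ) : ℝ^(Fin n) →L[ℝ] (Fin (n + m) → ℝ) :=
  LinearMap.toContinuousLinearMap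
    { toFun := fun x => append x 0
      map_add' := fun x y => by ext i; refine addCases (fun a => ?_) (fun k => ?_) i <;> simp
      map_smul' := fun c x => by ext i; refine addCases (fun a => ?_) (fun k => ?_) i <;> simp }

/-- The inclusion of the second factor. -/
def inclRight (n m : ℕ) : ℝ^(Fin m) →L[ℝ] (Fin (n + m) → ℝ) :=
  LinearMap.toContinuousLinearMap
    { toFun := fun x => append 0 x
      map_add' := fun x y => by ext i; refine addCases (fun a => ?_) (fun k => ?_) i <;> simp
      map_smul' := fun c x => by ext i; refine addCases (fun a => ?_) (fun k => ?_) i <;> simp }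

lemma append_eq_add (x : ℝ^(Fin n)) (t : ℝ^(Fin m)) : append x t = inclLeft n m x + inclRight n m t
    := by
  ext i
  change _ = append x 0 i + append 0 t i
  refine addCases (fun a => ?_) (fun k => ?_) i <;> simp

lemma inclLeft_single (a : Fin n) : inclLeft n m (psingle a 1) = psingle (castAdd m a) 1 := by
  ext i
  change append (psingle a 1 : ℝ^(Fin n)) 0 i = _
  refine addCases (fun c => ?_) (fun k => ?_) i
  · simp [psingle_apply]
  · simp [psingle_apply, Fin.ext_iff]
    omega

lemma inclRight_single (k : Fin m) : inclRight n m (psingle k 1) = psingle (natAdd n k) 1 := by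
  ext i
  change append 0 (psingle k 1 : ℝ^(Fin m)) i = _
  refine addCases (fun c => ?_) (fun k => ?_) i
  · simp [psingle_apply, Fin.ext_iff]
    omega
  · simp [psingle_apply]

lemma append_comp (z : Fin (n + m) → ℝ) : append z♭ z♯ = z := by
  ext i
  refine addCases (fun c => ?_) (fun k => ?_) i <;> simp

lemma append_base (x : ℝ^(Fin n)) (t : ℝ^(Fin m)) : (append x t)♭ = x := by ext i; simp

lemma append_fib (x : ℝ^(Fin n)) (t : ℝ^(Fin m)) : (append x t)♯ = t := by ext i; simp

lemma contDiff_append_left (t : ℝ^(Fin m)) : ContDiff ℝ ∞ fun x : Fin n → ℝ => append x t := by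
  simp only [append_eq_add]
  exact (inclLeft n m).contDiff.add contDiff_const

lemma contDiff_append_right (x : ℝ^(Fin n)) : ContDiff ℝ ∞ fun t : Fin m → ℝ => append x t := by
  simp only [append_eq_add]
  exact contDiff_const.add (inclRight n m).contDiff

lemma tder_append_left (x : ℝ^(Fin n)) (t : ℝ^(Fin m)) (a : Fin n) : tder (Fin n) (Fin (n + m)) (fun
    x => append x t) x (psingle a 1) = psingle (castAdd m a) 1 := by
  rw [tder_eq_fderiv, ← inclLeft_single]
  simp only [append_eq_add]
  rw [((inclLeft n m).hasFDerivAt.add_const _).fderiv]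

lemma tder_append_right (x : ℝ^(Fin n)) (t : ℝ^(Fin m)) (k : Fin m) : tder (Fin m) (Fin (n + m))
    (fun t => append x t) t (psingle k 1) = psingle (natAdd n k) 1 := by
  rw [tder_eq_fderiv, ← inclRight_single]
  simp only [append_eq_add]
  rw [((inclRight n m).hasFDerivAt.const_add _).fderiv]

lemma smooth_base : ContDiff ℝ ∞ fun z : Fin (n + m) → ℝ => z♭ := contDiff_pi.2 fun _ =>
  contDiff_apply _ _ _

lemma smooth_fib : ContDiff ℝ ∞ fun z : Fin (n + m) → ℝ => z♯ := contDiff_pi.2 fun _ =>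
  contDiff_apply _ _ _

lemma fderiv_comp_castAdd (z v : Fin (n + m) → ℝ) : fderiv ℝ (fun z : Fin (n + m) → ℝ => z♭) z v =
    v♭ := by
  have h : HasFDerivAt (fun z : Fin (n + m) → ℝ => z♭) (ContinuousLinearMap.pi fun a =>
      ContinuousLinearMap.proj (castAdd m a)) z := (ContinuousLinearMap.pi (R := ℝ) fun a =>
      ContinuousLinearMap.proj (φ := fun _ => ℝ) (castAdd m a : Fin (n + m))).hasFDerivAt
  rw [h.fderiv]
  rfl

end

namespace SymmetricSpacetime

variable (S b)

/-- A chart of the spacetime in which the projection is the projection to the first three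
coordinates in the chart `e`, the Killing vectors are coordinate vectors and the components of the
metric depend on the first three coordinates only. -/
structure IsAdapted (e : Chart M (Fin 3))
    (Ψ : Chart S.P 𝔽 m) : Prop where
  mem : Ψ ∈ 𝒜 𝔽 m S.P
  proj_mem : ∀ z ∈ Ψ.target, S.proj (Ψ.symm z) ∈ e.source
  proj_eq : ∀ z ∈ Ψ.target, e (S.proj (Ψ.symm z)) = z♭
  kill_eq : ∀ z ∈ Ψ.target, ∀ k,
    tder 𝔽 m 𝔽 m Ψ.symm z (psingle (natAdd 3 k) 1)
      = S.kill b k (Ψ.symm z)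
  comp2_eq : ∀ z ∈ Ψ.target, ∀ z' ∈ Ψ.target, z♭ = z' ∘ castAdd m →
    comp2 S.met.val Ψ z = comp2 S.met.val Ψ z'

lemma comp2_eq_bil (Ψ : Chart S.P 𝔽 m) (z : ℝ^(𝔽 m)) (i j : 𝔽 m) : comp2 S.met.val Ψ z i j = S.bil
    (Ψ.symm z) (tder 𝔽 m 𝔽 m Ψ.symm z (psingle i 1)) (tder 𝔽 m 𝔽 m Ψ.symm z (psingle j 1)) := rfl

theorem exists_adapted (he : e ∈ 𝒜 (Fin 3) M) {p : S.P} (hp : S.proj p ∈ e.source) :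
    ∃ Ψ, S.IsAdapted b e Ψ ∧ p ∈ Ψ.source := by
  obtain ⟨W, s, hW, hxW, hsp, hs⟩ := S.exists_section he hp
  obtain ⟨φ, hφ, h1φ, hφk⟩ := exists_log_chart b (1 : G)
  set Θ : ℝ^(𝔽 m) → S.P :=
    fun z => S.act (φ.symm z♯) (s z♭) with hΘ
  set O : Set ℝ^(𝔽 m) := {z | z♭ ∈ W ∧ z♯ ∈ φ.target}
  have hO : IsOpen O :=
    (hW.preimage smooth_base.continuous).inter
      (φ.open_target.preimage smooth_fib.continuous)
  have hΘs : ∀ z ∈ O, ContMDiffAt 𝕀 𝔽 m 𝕀 𝔽 m ∞ Θ z := fun z hz =>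
    S.act_smooth.contMDiffAt.comp z
      (((smooth_symm hφ hz.2).comp z smooth_fib.contMDiff.contMDiffAt).prodMk
        ((hs _ hz.1).1.comp z smooth_base.contMDiff.contMDiffAt))
  have hΘl : ∀ z ∈ O, ∀ α, tder 𝔽 m 𝔽 m Θ z (psingle (castAdd m α) 1)
      = tder 𝔽 m 𝔽 m (S.act (φ.symm z♯))
          (s z♭)
          (tder (Fin 3) 𝔽 m s z♭ (psingle α 1)) := by
    intro z hz α
    have h1 := tder_comp (g := Θ) (f := fun x => append x z♯)
      (x := z♭) (by rw [append_comp]; exact hΘs z hz)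
      (contDiff_append_left _).contMDiff.contMDiffAt (psingle α 1)
    rw [append_comp, tder_append_left] at h1
    rw [← h1, ← tder_comp (S.contMDiff_act _).contMDiffAt (hs _ hz.1).1]
    simp only [hΘ, append_fib, append_base]
  have hΘr : ∀ z ∈ O, ∀ k, tder 𝔽 m 𝔽 m Θ z (psingle (natAdd 3 k) 1)
      = tder 𝔽 m 𝔽 m (S.act (φ.symm z♯))
          (s z♭) (S.kill b k (s z♭)) := by
    intro z hz k
    have h1 := tder_comp (g := Θ) (f := fun t => append z♭ t)
      (x := z♯) (by rw [append_comp]; exact hΘs z hz)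
      (contDiff_append_right _).contMDiff.contMDiffAt (psingle k 1)
    rw [append_comp, tder_append_right] at h1
    set g := φ.symm z♯
    set q := s z♭
    have h2 : tder (Fin m) (Fin m) φ.symm z♯ (psingle k 1)
        = tder (Fin m) (Fin m) (fun a : G => a * g) 1 (basisVec b k) := hφk _ hz.2 k
    have h3 : (fun t => Θ (append z♭ t))
        = fun t => (fun a => S.act a q) (φ.symm t) := by
      simp only [hΘ, append_fib, append_base]
      rfl
    have hm : ContMDiff 𝕀 (Fin m) 𝕀 (Fin m) ∞ (fun a : G => a * g) :=
      contMDiff_mul_right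
    have h4 := tder_comp (g := fun a => S.act a q) (f := fun a : G => a * g) (x := 1)
      (S.contMDiff_orbit q).contMDiffAt hm.contMDiffAt (basisVec b k)
    rw [one_mul] at h4
    rw [← h1, h3, tder_comp (S.contMDiff_orbit q).contMDiffAt (smooth_symm hφ hz.2), h2,
      ← h4, tder_act_kill, kill_eq]
    simp only [S.act_mul]
  set y := append (e (S.proj p)) (φ 1) with hy
  have hyO : y ∈ O := by
    constructor
    · rw [hy, append_base]
      exact hxW
    · rw [hy, append_fib]
      exact φ.map_source h1φ
  have hΘy : Θ y = p := by
    simp only [hΘ, hy, append_base, append_fib]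
    rw [hsp, φ.left_inv h1φ, S.act_one]
  have hproj : ∀ z ∈ O, S.proj (Θ z) ∈ e.source ∧ e (S.proj (Θ z)) = z♭ := by
    intro z hz
    simp only [hΘ, S.proj_act]
    exact (hs _ hz.1).2
  have hinj : ∀ v : 𝔽 m → ℝ, tder 𝔽 m 𝔽 m Θ y v = 0 → v = 0 := by
    intro v hv
    have h1 : v♭ = 0 := by
      have h2 := tder_comp (g := fun p => e (S.proj p)) (f := Θ)
        ((smooth_chart he (hproj y hyO).1).comp (Θ y) S.proj_smooth.contMDiffAt)
        (hΘs y hyO) v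
      rw [hv, map_zero, tder_congr (g := fun z : 𝔽 m → ℝ => z♭)
        (mem_of_superset (hO.mem_nhds hyO) fun z hz => (hproj z hz).2), tder_eq_fderiv,
        fderiv_comp_castAdd] at h2
      exact h2
    have h2 : v = ∑ k, v (natAdd 3 k) • (psingle (natAdd 3 k) 1 : ℝ^(𝔽 m)) := by
      ext i
      rw [Finset.sum_apply]
      refine addCases (fun a => ?_) (fun k => ?_) i
      · rw [show v (castAdd m a) = 0 from congrFun h1 a, sum_eq_zero]
        intro k _
        have : (castAdd m a : 𝔽 m) ≠ natAdd 3 k := by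
          rw [Ne, Fin.ext_iff]; simp; omega
        simp [Pi.single_eq_of_ne this]
      · simp [psingle_apply]
    rw [h2, map_sum] at hv
    simp only [map_smul, hΘr y hyO, tder_act_kill] at hv
    by_contra h3
    have h4 : (fun k => v (natAdd 3 k)) ≠ 0 := fun h => h3 (by
      rw [h2]
      exact sum_eq_zero fun k _ => by rw [show v (natAdd 3 k) = 0 from congrFun h k,
        zero_smul])
    have h5 := S.kill_pos b h4 (Θ y)
    rw [show ∑ k, v (natAdd 3 k) • S.kill b k (Θ y) = 0 from hv] at h5
    simp at h5
  obtain ⟨Ψ, hΨ, hyΨ, hΨO, hΨΘ⟩ := exists_chart_of_param hO hyO hΘs hinj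
  have hev : ∀ z ∈ Ψ.target, Ψ.symm =ᶠ[𝓝 z] Θ := fun z hz =>
    mem_of_superset (Ψ.open_target.mem_nhds hz) hΨΘ
  have hd : ∀ z ∈ Ψ.target, tder 𝔽 m 𝔽 m Ψ.symm z
      = tder 𝔽 m 𝔽 m Θ z := fun z hz => tder_congr (hev z hz)
  refine ⟨Ψ, ⟨hΨ, fun z hz => ?_, fun z hz => ?_, fun z hz k => ?_, fun z hz z' hz' hzz => ?_⟩, ?_⟩
  · rw [hΨΘ z hz]
    exact (hproj z (hΨO hz)).1
  · rw [hΨΘ z hz]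
    exact (hproj z (hΨO hz)).2
  · rw [hd z hz, hΘr z (hΨO hz), hΨΘ z hz, tder_act_kill]
  · have key : ∀ z ∈ Ψ.target, ∀ i j, comp2 S.met.val Ψ z i j = S.bil (s z♭)
        (addCases (motive := fun _ => 𝔽 m → ℝ)
          (fun α => tder (Fin 3) 𝔽 m s z♭ (psingle α 1))
          (fun k => S.kill b k (s z♭)) i)
        (addCases (motive := fun _ => 𝔽 m → ℝ)
          (fun α => tder (Fin 3) 𝔽 m s z♭ (psingle α 1))
          (fun k => S.kill b k (s z♭)) j) := by
      intro z hz i j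
      rw [comp2_eq_bil, hd z hz, hΨΘ z hz]
      have hi : ∀ i, tder 𝔽 m 𝔽 m Θ z (psingle i 1)
          = tder 𝔽 m 𝔽 m (S.act (φ.symm z♯))
              (s z♭) (addCases (motive := fun _ => 𝔽 m → ℝ)
          (fun α => tder (Fin 3) 𝔽 m s z♭ (psingle α 1))
          (fun k => S.kill b k (s z♭)) i) := fun i => by
        refine addCases (fun α => ?_) (fun k => ?_) i
        · rw [addCases_left, hΘl z (hΨO hz)]
        · rw [addCases_right, hΘr z (hΨO hz)]
      rw [hi, hi]
      exact S.bil_act _ _ _ _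
    ext i j
    rw [key z hz, key z' hz', hzz]
  · have := Ψ.map_target hyΨ
    rwa [hΨΘ y hyΨ, hΘy] at this

end SymmetricSpacetime

namespace SymmetricSpacetime

variable (S b)

section

variable (Ψ t)

/-- The components of the metric in the chart `Ψ`, as functions of the first three coordinates. -/
def blockMet (x : ℝ^(Fin 3)) : Matrix (Fin 3 ⊕ Fin m) (Fin 3 ⊕ Fin m) ℝ :=
  (comp2 S.met.val Ψ (append x t)).submatrix 𝔢 𝔢

/-- The inner products of the Killing vectors, in an adapted chart. -/
def adXi (x : ℝ^(Fin 3)) : Matrix (Fin m) (Fin m) ℝ := (S.blockMet Ψ t x).toBlocks₂₂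

/-- The connection, in an adapted chart. -/
def adA (x : ℝ^(Fin 3)) : Matrix (Fin m) (Fin 3) ℝ :=
  (S.adXi Ψ t x)⁻¹ * (S.blockMet Ψ t x).toBlocks₂₁

/-- The quotient metric, in an adapted chart. -/
def adG (x : ℝ^(Fin 3)) : Matrix (Fin 3) (Fin 3) ℝ :=
  (S.blockMet Ψ t x).toBlocks₁₁ - (S.adA Ψ t x)ᵀ * S.adXi Ψ t x * S.adA Ψ t x

/-- The coordinate vectors of the chart `Ψ`. -/
def coordV (z : ℝ^(𝔽 m)) (i : 𝔽 m) : 𝔽 m → ℝ :=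
  tder 𝔽 m 𝔽 m Ψ.symm z (psingle i 1)

end

namespace IsAdapted

variable {S b}

lemma comp2_eq_blockMet (h : S.IsAdapted b e Ψ) (hz : z ∈ Ψ.target) (hzt : append z♭ t ∈ Ψ.target)
    (i j : Fin 3 ⊕ Fin m) : comp2 S.met.val Ψ z (𝔢 i) (𝔢 j) = S.blockMet Ψ t z♭ i j := by
  rw [h.comp2_eq z hz _ hzt (append_base _ _).symm]
  rfl

lemma gram_eq (h : S.IsAdapted b e Ψ) (hz : z ∈ Ψ.target) (hzt : append z♭ t ∈ Ψ.target) : S.gram b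
    (Ψ.symm z) = S.adXi Ψ t z♭ := by
  ext k l
  rw [gram_apply, ← h.kill_eq z hz, ← h.kill_eq z hz, ← comp2_eq_bil]
  exact h.comp2_eq_blockMet hz hzt (inr k) (inr l)

lemma adXi_det (h : S.IsAdapted b e Ψ) (hz : z ∈ Ψ.target) (hzt : append z♭ t ∈ Ψ.target) : 0 <
    (S.adXi Ψ t z♭).det := by
  rw [← h.gram_eq hz hzt]
  exact (S.gram_posDef b _).det_pos

lemma xi_mul_adA (h : S.IsAdapted b e Ψ) (hz : z ∈ Ψ.target) (hzt : append z♭ t ∈ Ψ.target) : S.adXi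
    Ψ t z♭ * S.adA Ψ t z♭ = (S.blockMet Ψ t z♭).toBlocks₂₁ := mul_nonsing_inv_cancel_left _ _
    (h.adXi_det hz hzt).ne'.isUnit

lemma blockMet_transpose (x : ℝ^(Fin 3)) : (S.blockMet Ψ t x)ᵀ = S.blockMet Ψ t x := by
  rw [blockMet, transpose_submatrix, S.met.comp2_transpose]

lemma adXi_transpose (x : ℝ^(Fin 3)) : (S.adXi Ψ t x)ᵀ = S.adXi Ψ t x := by
  ext k l
  exact congrFun (congrFun (blockMet_transpose (S := S) (Ψ := Ψ) (t := t) x) (inr k)) (inr l)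

lemma blockMet_eq (h : S.IsAdapted b e Ψ) (hz : z ∈ Ψ.target) (hzt : append z♭ t ∈ Ψ.target) :
    S.blockMet Ψ t z♭ = fromBlocks (S.adG Ψ t z♭ + (S.adA Ψ t z♭)ᵀ * S.adXi Ψ t z♭ * S.adA Ψ t z♭)
    ((S.adA Ψ t z♭)ᵀ * S.adXi Ψ t z♭) (S.adXi Ψ t z♭ * S.adA Ψ t z♭) (S.adXi Ψ t z♭) := by
  conv_lhs => rw [← fromBlocks_toBlocks (S.blockMet Ψ t z♭)]
  have h1 := h.xi_mul_adA hz hzt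
  congr 1
  · rw [adG, sub_add_cancel]
  · rw [← adXi_transpose, ← transpose_mul, h1]
    ext α k
    exact congrFun (congrFun (blockMet_transpose (S := S) (Ψ := Ψ) (t := t) z♭).symm (inl α)) (inr
      k)
  · exact h1.symm

lemma comp1_connection (h : S.IsAdapted b e Ψ) (hz : z ∈ Ψ.target) (hzt : append z♭ t ∈ Ψ.target) (k
    : Fin m) (i : Fin 3 ⊕ Fin m) : comp1 (S.connection b k) Ψ (𝔢 i) z = Sum.elim (fun α => S.adA Ψ t
    z♭ k α) (fun l => (1 : Matrix (Fin m) (Fin m) ℝ) k l) i := by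
  have h1 : comp1 (S.connection b k) Ψ (𝔢 i) z = ∑ l, (S.gram b (Ψ.symm z))⁻¹ k l * S.bil (Ψ.symm z)
      (S.kill b l (Ψ.symm z)) (S.coordV Ψ z (𝔢 i)) := by
    rw [comp1, connection, LinearMap.sum_apply]
    rfl
  have h2 : ∀ l, S.bil (Ψ.symm z) (S.kill b l (Ψ.symm z)) (S.coordV Ψ z (𝔢 i)) = S.blockMet Ψ t z♭
      (inr l) i := by
    intro l
    rw [← h.kill_eq z hz, ← h.comp2_eq_blockMet hz hzt]
    rfl
  rw [h1, h.gram_eq hz hzt]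
  simp only [h2]
  cases i with
  | inl α => rw [Sum.elim_inl, adA, mmul]; rfl
  | inr l =>
    rw [Sum.elim_inr, ← minv_mul _ (h.adXi_det hz hzt).ne'.isUnit, mmul]
    rfl

lemma tder_proj_coordV (h : S.IsAdapted b e Ψ) (he : e ∈ 𝒜 (Fin 3) M) (hz : z ∈ Ψ.target) (i : 𝔽 m)
    : tder 𝔽 m (Fin 3) S.proj (Ψ.symm z) (S.coordV Ψ z i) = tder (Fin 3) (Fin 3) e.symm z♭ ((psingle
    i 1 : ℝ^(𝔽 m)) ∘ castAdd m) := by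
  have hzx : z♭ ∈ e.target := by
    rw [← h.proj_eq z hz]
    exact e.map_source (h.proj_mem z hz)
  rw [coordV, ← tder_comp S.proj_smooth.contMDiffAt (smooth_symm h.mem hz), tder_congr (g := fun z :
    𝔽 m → ℝ => e.symm z♭), tder_comp (f := fun z : 𝔽 m → ℝ => z♭) (smooth_symm he hzx)
    smooth_base.contMDiff.contMDiffAt, tder_eq_fderiv, fderiv_comp_castAdd]
  filter_upwards [Ψ.open_target.mem_nhds hz] with w hw
  rw [← h.proj_eq w hw, e.left_inv (h.proj_mem w hw)]

lemma single_castAdd_comp (α : Fin 3) : (psingle (castAdd m α) 1 : ℝ^(𝔽 m)) ∘ castAdd m = psingle α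
    1 := by
  ext β
  simp [psingle_apply]

lemma proj_symm (h : S.IsAdapted b e Ψ) (hz : z ∈ Ψ.target) : S.proj (Ψ.symm z) = e.symm z♭ := by
  rw [← h.proj_eq z hz, e.left_inv (h.proj_mem z hz)]

lemma base_mem (h : S.IsAdapted b e Ψ) (hz : z ∈ Ψ.target) : z♭ ∈ e.target := by
  rw [← h.proj_eq z hz]
  exact e.map_source (h.proj_mem z hz)

lemma exists_lift (h : S.IsAdapted b e Ψ) (he : e ∈ 𝒜 (Fin 3) M) (hz : z ∈ Ψ.target) (hzt : append
    z♭ t ∈ Ψ.target) : ∃ v : Fin 3 → 𝔽 m → ℝ, (∀ k α, S.bil (Ψ.symm z) (S.kill b k (Ψ.symm z)) (v α)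
    = 0) ∧ (∀ α, tder 𝔽 m (Fin 3) S.proj (Ψ.symm z) (v α) = tder (Fin 3) (Fin 3) e.symm z♭ (psingle
    α 1)) ∧ ∀ α β, S.bil (Ψ.symm z) (v α) (v β) = S.adG Ψ t z♭ α β := by
  set a := S.adA Ψ t z♭ with ha
  set p := Ψ.symm z with hp
  set x := z♭ with hx
  have hc : ∀ i j : Fin 3 ⊕ Fin m, S.bil p (S.coordV Ψ z (𝔢 i)) (S.coordV Ψ z (𝔢 j)) = S.blockMet Ψ
      t x i j := fun i j => h.comp2_eq_blockMet hz hzt i j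
  have hk : ∀ k, S.kill b k p = S.coordV Ψ z (𝔢 (inr k)) := fun k => (h.kill_eq z hz k).symm
  have hN := h.blockMet_eq hz hzt
  set v : Fin 3 → 𝔽 m → ℝ := fun α => S.coordV Ψ z (𝔢 (inl α)) - ∑ k, a k α • S.kill b k p with hv
  have hr : ∀ w α, S.bil p w (v α) = S.bil p w (S.coordV Ψ z (𝔢 (inl α))) - ∑ k, a k α * S.bil p w
      (S.kill b k p) := by
    intro w α
    rw [hv, map_sub, map_sum]
    simp only [map_smul, smul_eq_mul]
  have h0 : ∀ k α, S.bil p (S.kill b k p) (v α) = 0 := by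
    intro k α
    rw [hr]
    simp only [hk, hc]
    rw [hN]
    simp only [fromBlocks_apply₂₁, fromBlocks_apply₂₂, mmul, sub_eq_zero]
    exact sum_ext fun l => mul_comm _ _
  refine ⟨v, h0, fun α => ?_, fun α β => ?_⟩
  · rw [hv, map_sub, map_sum]
    simp only [map_smul, S.tder_proj_kill, smul_zero, sum_zero, sub_zero]
    exact (h.tder_proj_coordV he hz _).trans (congrArg _ (single_castAdd_comp α))
  · have h1 : S.bil p (v α) (v β) = S.bil p (S.coordV Ψ z (𝔢 (inl α))) (v β) := by
      rw [S.bil_symm, hr]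
      simp only [S.bil_symm p (v β), h0, mul_zero, sum_zero, sub_zero]
    rw [h1, hr]
    simp only [hk, hc]
    rw [hN]
    simp only [fromBlocks_apply₁₁, fromBlocks_apply₁₂, madd, mmul, sum_mul]
    rw [add_sub_assoc, add_eq_left, sub_eq_zero]
    refine sum_ext fun k => ?_
    rw [mul_sum]
    exact sum_ext fun l => by ring

lemma msmooth_blockMet (h : S.IsAdapted b e Ψ) (hx : append x t ∈ Ψ.target) : MSmooth (S.blockMet Ψ
    t) x := fun i j => ContDiffAt.comp x (g := fun z => comp2 S.met.val Ψ z (𝔢 i) (𝔢 j))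
    (S.met.msmooth h.mem hx _ _) (contDiff_append_left t).contDiffAt

lemma msmooth_adXi (h : S.IsAdapted b e Ψ) (hx : append x t ∈ Ψ.target) : MSmooth (S.adXi Ψ t) x :=
    fun k l => h.msmooth_blockMet hx (inr k) (inr l)

lemma msmooth_adA (h : S.IsAdapted b e Ψ) (hx : append x t ∈ Ψ.target) : MSmooth (S.adA Ψ t) x := by
  have hd := h.adXi_det hx (t := t) (by rwa [append_base])
  rw [append_base] at hd
  exact ((h.msmooth_adXi hx).inv hd.ne').mul fun k α => h.msmooth_blockMet hx (inr k) (inl α)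

lemma msmooth_adG (h : S.IsAdapted b e Ψ) (hx : append x t ∈ Ψ.target) : MSmooth (S.adG Ψ t) x := by
  have h1 := ((h.msmooth_adA hx).transpose.mul (h.msmooth_adXi hx)).mul (h.msmooth_adA hx)
  exact fun α β => (h.msmooth_blockMet hx (inl α) (inl β)).sub (h1 α β)

lemma eventually_append_mem (hx : append x t ∈ Ψ.target) : ∀ᶠ y in 𝓝 x, append y t ∈ Ψ.target :=
    (contDiff_append_left (n := 3) t).continuous.continuousAt.eventually (Ψ.open_target.mem_nhds hx)

lemma ev_append_mem (hx : append z♭ t ∈ Ψ.target) : ∀ᶠ w in 𝓝 z, append w♭ t ∈ Ψ.target :=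
    smooth_base.continuous.continuousAt.eventually (eventually_append_mem (S := S) (Ψ := Ψ) hx)

end IsAdapted

end SymmetricSpacetime

namespace SymmetricSpacetime

variable (S b)

lemma pullback_apply (T : Tensor2 (Fin 3) M) (p : S.P) (v w : ℝ^(𝔽 m)) : S.pullback T p v w = T
    (S.proj p) (tder 𝔽 m (Fin 3) S.proj p v) (tder 𝔽 m (Fin 3) S.proj p w) := rfl

/-- The fields of a spacetime in the chart `e`, with the connection given by the adapted
chart `Ψ`. -/
def localFields (D : KKFields m M) (e : Chart M (Fin 3))
    (Ψ : Chart S.P 𝔽 m) (t : ℝ^(Fin m)) :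
    LocalFields (Fin 3) (Fin m) where
  g := comp2 D.g.val e
  xi := fun x => D.xi (e.symm x)
  a := S.adA Ψ t
  F := fun k => comp2 (D.F k) e

end SymmetricSpacetime

section

lemma KKFields.F_antisymm (D : KKFields m M) (k : Fin m) (e : Chart M (Fin 3)) (y : ℝ^(Fin 3)) :
    (comp2 (D.F k) e y)ᵀ = -comp2 (D.F k) e y := by
  ext α β
  have h := D.F_alt k (e.symm y) (coordVec e y α + coordVec e y β)
  simp only [map_add, LinearMap.add_apply, D.F_alt, zero_add, add_zero] at h
  exact eq_neg_of_add_eq_zero_left h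

lemma KKFields.xi_msmooth (D : KKFields m M) {e : Chart M (Fin 3)} (he : e ∈ 𝒜 (Fin 3) M) {y :
    ℝ^(Fin 3)} (hy : y ∈ e.target) : MSmooth (fun x => D.xi (e.symm x)) y := fun k l =>
    contMDiffAt_iff_contDiffAt.1 (((D.xi_smooth k l).contMDiffAt).comp y (smooth_symm he hy))

lemma KKFields.xi_transpose (D : KKFields m M) (x : M) : (D.xi x)ᵀ = D.xi x := by
  have := (D.xi_posDef x).isHermitian
  rwa [IsHermitian, conjTranspose_eq_transpose_of_trivial] at this

end

namespace SymmetricSpacetime.IsAdapted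

lemma extComp_connection (h : S.IsAdapted b e Ψ) (hz : z ∈ Ψ.target) (hzt : append z♭ t ∈ Ψ.target)
    (k : Fin m) (α β : Fin 3) : extComp (S.connection b k) Ψ z (castAdd m α) (castAdd m β) = pd α
    (fun y => S.adA Ψ t y k β) z♭ - pd β (fun y => S.adA Ψ t y k α) z♭ := by
  have key : ∀ α β : Fin 3, pd (castAdd m α) (comp1 (S.connection b k) Ψ (castAdd m β)) z = pd α
      (fun y => S.adA Ψ t y k β) z♭ := by
    intro α β
    have h1 : ∀ᶠ w in 𝓝 z, comp1 (S.connection b k) Ψ (castAdd m β) w = S.adA Ψ t w♭ k β := by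
      filter_upwards [Ψ.open_target.mem_nhds hz, ev_append_mem (S := S) (Ψ := Ψ) hzt] with w hw hwt
      exact h.comp1_connection hw hwt k (inl β)
    rw [pd_congr h1]
    refine (pd_comp (f := fun y => S.adA Ψ t y k β) (τ := fun w => w♭) (diffAt (h.msmooth_adA hzt k
      β)) (smooth_base.differentiable (by decide)).differentiableAt).trans ?_
    rw [Finset.sum_eq_single α]
    · simp only [fcomp_apply, pd_coord, if_true, mul_one]
    · intro γ _ hγ
      simp only [fcomp_apply, pd_coord]
      rw [if_neg (by simpa [Fin.ext_iff] using fun h => hγ (Fin.ext h.symm)), mul_zero]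
    · simp
  rw [extComp, of_apply, key, key]

lemma pullback_comp2_castAdd (h : S.IsAdapted b e Ψ) (he : e ∈ 𝒜 (Fin 3) M) (hz : z ∈ Ψ.target) (T :
    Tensor2 (Fin 3) M) (α β : Fin 3) : comp2 (S.pullback T) Ψ z (castAdd m α) (castAdd m β) = comp2
    T e z♭ α β := by
  change S.pullback T (Ψ.symm z) (S.coordV Ψ z _) (S.coordV Ψ z _) = _
  rw [S.pullback_apply, h.tder_proj_coordV he hz, h.tder_proj_coordV he hz, single_castAdd_comp,
    single_castAdd_comp]
  exact tensor2_congr (h.proj_symm hz) _ _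

lemma comp2_g_eq (h : S.IsAdapted b e Ψ) (he : e ∈ 𝒜 (Fin 3) M) (hD : S.HasFields b D) (hx : append
    x t ∈ Ψ.target) : comp2 D.g.val e x = S.adG Ψ t x := by
  obtain ⟨v, hv1, hv2, hv3⟩ := h.exists_lift he hx (t := t) (by rwa [append_base])
  rw [append_base] at hv2 hv3
  ext α β
  rw [← hv3]
  have h1 : S.bil (Ψ.symm (append x t)) (v α) (v β) = S.pullback D.g.val _ (v α) (v β) := hD.g_eq _
    _ _ (fun k => hv1 k α) (fun k => hv1 k β)
  rw [h1, S.pullback_apply, hv2, hv2]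
  refine tensor2_congr ?_ _ _
  rw [h.proj_symm hx, append_base]

lemma xi_eq (h : S.IsAdapted b e Ψ) (hD : S.HasFields b D) (hx : append x t ∈ Ψ.target) : D.xi
    (e.symm x) = S.adXi Ψ t x := by
  have h1 := h.gram_eq hx (t := t) (by rwa [append_base])
  rw [hD.xi_eq, h.proj_symm hx, append_base] at h1
  exact h1

lemma regular (h : S.IsAdapted b e Ψ) (he : e ∈ 𝒜 (Fin 3) M) (hD : S.HasFields b D)
    (hx : append x t ∈ Ψ.target) : (S.localFields D e Ψ t).Regular x := by
  have hxe : x ∈ e.target := by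
    have := h.base_mem hx
    rwa [append_base] at this
  exact {
    g_smooth := D.g.msmooth he hxe
    xi_smooth := D.xi_msmooth he hxe
    F_smooth := fun k => (D.F_smooth k).msmooth he hxe
    g_symm := .of_forall fun y => D.g.comp2_transpose e y
    xi_symm := .of_forall fun y => D.xi_transpose _
    g_det := D.g.det_comp2_ne_zero he hxe
    xi_det := (D.xi_posDef _).det_pos.ne'
    F_antisymm := .of_forall fun y k => D.F_antisymm k e y
    a_smooth := h.msmooth_adA hx
    F_eq := by
      filter_upwards [eventually_append_mem (S := S) (Ψ := Ψ) hx] with y hy k α β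
      have h1 := h.extComp_connection hy (t := t) (by rwa [append_base]) k α β
      rw [(hD.F_eq k).extComp_eq h.mem hy (Set.mem_univ _), h.pullback_comp2_castAdd he hy,
        append_base] at h1
      exact h1.symm }

lemma comp2_met_eq (h : S.IsAdapted b e Ψ) (he : e ∈ 𝒜 (Fin 3) M) (hD : S.HasFields b D) (hz : z ∈
    Ψ.target) (hzt : append z♭ t ∈ Ψ.target) (i j : Fin 3 ⊕ Fin m) : comp2 S.met.val Ψ z (𝔢 i) (𝔢 j)
    = (S.localFields D e Ψ t).metric z♭ i j := by
  rw [h.comp2_eq_blockMet hz hzt, h.blockMet_eq hz hzt, LocalFields.metric]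
  simp only [localFields]
  rw [h.comp2_g_eq he hD hzt, h.xi_eq hD hzt]

theorem ricci_eq_zero_iff (h : S.IsAdapted b e Ψ) (he : e ∈ 𝒜 (Fin 3) M) (hD : S.HasFields b D) (hx
    : append x t ∈ Ψ.target) : (∀ i j, ricci (comp2 S.met.val Ψ) i j (append x t) = 0) ↔ ∀ c d,
    (S.localFields D e Ψ t).frameRicci x c d = 0 := by
  set L := S.localFields D e Ψ t
  set τ : ℝ^(𝔽 m) → Fin 3 ⊕ Fin m → ℝ := fun w => w ∘ 𝔢 with hτ
  set w₀ := append x t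
  have hτs : Smooth τ w₀ := contDiffAt_pi.2 fun _ => (contDiff_apply ℝ ℝ _).contDiffAt
  have hτl : ∀ w, τ w ∘ inl = w♭ := fun w => rfl
  have hτx : τ w₀ ∘ inl = x := append_base x t
  have hJ : ∀ w, jac τ w = (1 : Matrix 𝔽 m 𝔽 m ℝ).submatrix 𝔢 id := by
    intro w
    ext a i
    rw [jac, of_apply]
    simp only [hτ, fcomp_apply, pd_coord, submatrix_apply, mone, id_eq, eq_comm]
  have hreg : L.Regular (τ w₀ ∘ inl) := by
    rw [hτx]
    exact h.regular he hD hx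
  have hJK : ∀ w, jac τ w * (jac τ w)ᵀ = 1 := by
    intro w
    rw [hJ, transpose_submatrix, transpose_one, ← submatrix_mul _ _ _ _ _ Function.bijective_id,
      mul_one]
    exact submatrix_one_equiv 𝔢
  have hKJ : ∀ w, (jac τ w)ᵀ * jac τ w = 1 := by
    intro w
    rw [hJ, transpose_submatrix, transpose_one, submatrix_mul_equiv, mul_one, submatrix_id_id]
  have hzt : append w₀♭ t ∈ Ψ.target := by rwa [append_base]
  have hg : ∀ᶠ w in 𝓝 w₀, comp2 S.met.val Ψ w = (jac τ w)ᵀ * L.metric (τ w ∘ inl) * jac τ w := by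
    filter_upwards [Ψ.open_target.mem_nhds hx, ev_append_mem (S := S) (Ψ := Ψ) hzt] with w hw hwt
    have h1 : (comp2 S.met.val Ψ w).submatrix 𝔢 𝔢 = L.metric (τ w ∘ inl) := by
      ext i j
      exact h.comp2_met_eq he hD hw hwt i j
    have h2 : jac τ w * comp2 S.met.val Ψ w * (jac τ w)ᵀ = L.metric (τ w ∘ inl) := by
      rw [← h1, hJ]
      ext i j
      simp [mmul, mone]
    rw [← h2, ← mmul_assoc, ← mmul_assoc, hKJ, one_mul, mmul_assoc, hKJ, mul_one]
  have hsymm : ∀ᶠ w : Fin 3 ⊕ Fin m → ℝ in 𝓝 (τ w₀), (L.metric (w ∘ inl))ᵀ = L.metric (w ∘ inl) :=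
      .of_forall fun w => LocalFields.metric_transpose (D.g.comp2_transpose e _) (D.xi_transpose _)
  have hdet : (L.metric (τ w₀ ∘ inl)).det ≠ 0 := by
    rw [LocalFields.metric_det]
    exact mul_ne_zero hreg.g_det hreg.xi_det
  have h1 := fun i j => ricci_comp (g := comp2 S.met.val Ψ) (h := fun w => L.metric (w ∘ inl)) (K :=
    fun w => (jac τ w)ᵀ) hτs (.of_forall hJK) (.of_forall hKJ) (MSmooth.jac hτs).transpose hg hsymm
    hdet (LocalFields.MSmooth.comp_inl (LocalFields.metric_smooth hreg)) i j
  rw [← hτx, ← LocalFields.ricci_metric_eq_zero_iff hreg]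
  simp only [h1]
  exact sum_conj_eq_zero_iff (hJK w₀) (of fun a b => ricci (fun w : Fin 3 ⊕ Fin m → ℝ => L.metric (w
    ∘ inl)) a b (τ w₀))

end SymmetricSpacetime.IsAdapted

section

namespace OrientationForm

variable (o)

/-- The component of the orientation form. -/
def comp (e : Chart M (Fin 3)) (y : ℝ^(Fin 3)) : ℝ :=
  o.form (e.symm y) (coordVec e y)

/-- The sign of the orientation of a chart. -/
def sign (e : Chart M (Fin 3)) (y : ℝ^(Fin 3)) : ℝ :=
  o.comp e y / |o.comp e y|

lemma comp_ne_zero (he : e ∈ 𝒜 (Fin 3) M) (hy : y ∈ e.target) : o.comp e y ≠ 0 := by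
  have h := (AlternatingMap.map_basis_ne_zero_iff (coordBasis he hy) (o.form (e.symm y))).2
    (o.ne_zero _)
  rwa [show ⇑(coordBasis he hy) = coordVec e y from funext (coordBasis_apply he hy)] at h

lemma sign_mul_self (he : e ∈ 𝒜 (Fin 3) M) (hy : y ∈ e.target) : o.sign e y * o.sign e y = 1 := by
  have h := o.comp_ne_zero he hy
  rw [sign, div_mul_div_comm, abs_mul_abs_self, div_self (mul_ne_zero h h)]

lemma eventually_sign_eq (he : e ∈ 𝒜 (Fin 3) M) (hy : y ∈ e.target) : ∀ᶠ z in 𝓝 y, o.sign e z =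
    o.sign e y := by
  have hc : ContinuousAt (o.comp e) y := ((o.smooth e he).contDiffAt (e.open_target.mem_nhds
    hy)).continuousAt
  rcases lt_or_gt_of_ne (o.comp_ne_zero he hy) with h | h
  · filter_upwards [hc.eventually_lt continuousAt_const h] with z hz
    rw [sign, sign, abs_of_neg h, abs_of_neg hz, div_neg_self h.ne, div_neg_self hz.ne]
  · filter_upwards [continuousAt_const.eventually_lt hc h] with z hz
    rw [sign, sign, abs_of_pos h, abs_of_pos hz, div_self h.ne', div_self hz.ne']

lemma form_coordVec (e : Chart M (Fin 3)) (y : ℝ^(Fin 3)) (α β γ : Fin 3) : o.form (e.symm y)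
    ![coordVec e y α, coordVec e y β, coordVec e y γ] = eps α β γ * o.comp e y := by
  set f := o.form (e.symm y)
  set v := coordVec e y
  have h0 : o.comp e y = f ![v 0, v 1, v 2] := by
    rw [comp]
    congr 1
    ext i
    fin_cases i <;> rfl
  have h01 : ∀ a b c, f ![b, a, c] = -f ![a, b, c] := fun a b c => by
    rw [← f.map_swap ![a, b, c] (show (0 : Fin 3) ≠ 1 by decide)]
    congr 1
    ext i
    fin_cases i <;> rfl
  have h12 : ∀ a b c, f ![a, c, b] = -f ![a, b, c] := fun a b c => by
    rw [← f.map_swap ![a, b, c] (show (1 : Fin 3) ≠ 2 by decide)]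
    congr 1
    ext i
    fin_cases i <;> rfl
  have e01 : ∀ a c, f ![a, a, c] = 0 := fun a c => by
    have := h01 a a c
    linarith
  have e12 : ∀ a c, f ![c, a, a] = 0 := fun a c => by
    have := h12 c a a
    linarith
  have e02 : ∀ a c, f ![a, c, a] = 0 := fun a c => by
    have := h01 c a a
    rw [e12] at this
    linarith
  have p1 := h12 (v 0) (v 1) (v 2)
  have p2 := h01 (v 0) (v 1) (v 2)
  have p3 : f ![v 1, v 2, v 0] = f ![v 0, v 1, v 2] := by rw [h12, p2, neg_neg]
  have p4 : f ![v 2, v 0, v 1] = f ![v 0, v 1, v 2] := by rw [h01, p1, neg_neg]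
  have p5 : f ![v 2, v 1, v 0] = -f ![v 0, v 1, v 2] := by rw [h01, p3]
  rw [h0]
  fin_cases α <;> fin_cases β <;> fin_cases γ <;> simp [eps, e01, e12, e02, p1, p2, p3, p4, p5] <;> ring

lemma volumeComp_eq (g : LorentzMetric (Fin 3) M) (α β γ : Fin 3) : volumeComp o g e y α β γ =
    o.sign e y * Real.sqrt |(comp2 g.val e y).det| * eps α β γ := by
  rw [volumeComp, form_coordVec, sign]
  change _ / |o.comp e y| * _ = _
  ring

end OrientationForm

/-- The fields in a chart, without connection. -/
def KKFields.base (D : KKFields m M) (e : Chart M (Fin 3)) :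
    LocalFields (Fin 3) (Fin m) where
  g := comp2 D.g.val e
  xi := fun x => D.xi (e.symm x)
  a := 0
  F := fun k => comp2 (D.F k) e

lemma KKFields.twist_eq (D : KKFields m M) (o : OrientationForm M) (k : Fin m) (γ : Fin 3) : D.twist
    o k e γ y = (D.base e).twistForm (o.sign e y) (fun z => D.X (e.symm z)) k γ y := by
  rw [KKFields.twist, LocalFields.twistForm]
  simp only [OrientationForm.volumeComp_eq]
  rfl

lemma KKFields.base_regular (D : KKFields m M) (he : e ∈ 𝒜 (Fin 3) M) (hy : y ∈ e.target) : (D.base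
    e).BaseRegular y where
  g_smooth := D.g.msmooth he hy
  xi_smooth := D.xi_msmooth he hy
  F_smooth := fun k => (D.F_smooth k).msmooth he hy
  g_symm := .of_forall fun y => D.g.comp2_transpose e y
  xi_symm := .of_forall fun _ => D.xi_transpose _
  g_det := D.g.det_comp2_ne_zero he hy
  xi_det := (D.xi_posDef _).det_pos.ne'
  F_antisymm := .of_forall fun _ k => D.F_antisymm k e _

lemma KKFields.X_smooth (D : KKFields m M) (he : e ∈ 𝒜 (Fin 3) M) (hy : y ∈ e.target) : Smooth (fun
    z => D.X (e.symm z)) y := contDiffAt_const.mul ((contDiffAt_det (D.xi_msmooth he hy)).log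
    (D.xi_posDef _).det_pos.ne')

lemma KKFields.eventually_twist_eq (D : KKFields m M) (o : OrientationForm M) (he : e ∈ 𝒜 (Fin 3) M)
    (hy : y ∈ e.target) : ∀ᶠ z in 𝓝 y, ∀ k γ, D.twist o k e γ z = (D.base e).twistForm (o.sign e y)
    (fun z => D.X (e.symm z)) k γ z := by
  filter_upwards [o.eventually_sign_eq he hy] with z hz k γ
  rw [D.twist_eq, hz]

lemma Corresponds.represented (h : Corresponds o D gt u) (he : e ∈ 𝒜 (Fin 3) M) (hy : y ∈ e.target)
    {L : LocalFields (Fin 3) (Fin m)} (hg : L.g = (D.base e).g) (hxi : L.xi = (D.base e).xi) (hF :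
    L.F = (D.base e).F) : L.Represented (fun z => u (e.symm z)) (o.sign e y) y where
  smooth := contMDiffAt_iff_contDiffAt.1 (h.smooth.contMDiffAt.comp y (smooth_symm he hy))
  sign := o.sign_mul_self he hy
  g_det := by rw [hg]; exact D.g.det_comp2_neg he hy
  xi_smooth := by
    rw [hxi]
    filter_upwards [e.open_target.mem_nhds hy] with z hz using D.xi_msmooth he hz
  X_eq := by
    rw [hxi]
    exact .of_forall fun z => h.X_eq _
  xi_eq := by
    rw [hxi]
    exact .of_forall fun z => h.xi_eq _
  twist_eq := by
    filter_upwards [D.eventually_twist_eq o he hy, e.open_target.mem_nhds hy] with z hz hze k γ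
    rw [← h.twist_eq e he z hze, hz]
    have hX : (fun z => (u (e.symm z)).X) = fun z => D.X (e.symm z) := funext fun z => h.X_eq _
    rw [hX]
    simp only [LocalFields.twistForm, hg, hxi, hF]

lemma Corresponds.conf_eq (h : Corresponds o D gt u) (e : Chart M (Fin 3)) : conf (fun z => (u
    (e.symm z)).X) (D.base e).g = comp2 gt.val e := by
  funext y
  ext α β
  rw [conf, comp2, of_apply, h.metric_eq]
  rfl

end

namespace SymmetricSpacetime

theorem vacuum_iff (hD : S.HasFields b D) : S.met.Vacuum ↔ ∀ e ∈ 𝒜 (Fin 3) M, ∀ Ψ, S.IsAdapted b e Ψ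
    → ∀ x t, append x t ∈ Ψ.target → ∀ c d, (S.localFields D e Ψ t).frameRicci x c d = 0 := by
  refine ⟨fun h e he Ψ hΨ x t hx => (hΨ.ricci_eq_zero_iff he hD hx).1 (h Ψ hΨ.mem _ hx), fun h e'
    he' y hy => ?_⟩
  set p := e'.symm y with hp
  have he := chart_mem (I := 𝕀 (Fin 3)) (n := ∞) (S.proj p)
  obtain ⟨Ψ, hΨ, hpΨ⟩ := S.exists_adapted b he (mem_chart_source _ (S.proj p))
  rw [S.met.ricci_eq_zero_change he' hΨ.mem hy hpΨ]
  have hz : append ((rep e' Ψ id y)♭) ((rep e' Ψ id y)♯) ∈ Ψ.target := by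
    rw [append_comp]
    exact Ψ.map_source hpΨ
  have h1 := (hΨ.ricci_eq_zero_iff he hD hz).2 (h _ he Ψ hΨ _ _ hz)
  rwa [append_comp] at h1

lemma exists_adapted_over (b : LieBasis m G) (hS : Surjective S.proj) (he : e ∈ 𝒜 (Fin 3) M) (hy : y
    ∈ e.target) : ∃ Ψ t, S.IsAdapted b e Ψ ∧ append y t ∈ Ψ.target := by
  obtain ⟨p, hp⟩ := hS (e.symm y)
  obtain ⟨Ψ, hΨ, hpΨ⟩ := S.exists_adapted b he (p := p) (by rw [hp]; exact e.map_target hy)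
  refine ⟨Ψ, (Ψ p)♯, hΨ, ?_⟩
  have h1 := hΨ.proj_eq _ (Ψ.map_source hpΨ)
  rw [Ψ.left_inv hpΨ, hp, e.right_inv hy] at h1
  rw [h1, append_comp]
  exact Ψ.map_source hpΨ

theorem twistClosed (hS : Surjective S.proj) (hD : S.HasFields b D) (hV : S.met.Vacuum) :
    D.TwistClosed o := by
  intro e he y hy k α β
  obtain ⟨Ψ, t, hΨ, hyt⟩ := exists_adapted_over b hS he hy
  have hL := (vacuum_iff hD).1 hV e he Ψ hΨ y t hyt
  have hreg := hΨ.regular he hD hyt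
  have hxi : ∀ᶠ z in 𝓝 y, MSmooth (S.localFields D e Ψ t).xi z := by
    filter_upwards [e.open_target.mem_nhds hy] with z hz using D.xi_msmooth he hz
  have h1 := (hreg.mixed_eq_zero_iff (D.X_smooth he hy) (o.sign_mul_self he hy)
    (LocalFields.pd_half_log_det hxi hreg.xi_det (.of_forall fun z => rfl)) (D.g.det_comp2_neg he
    hy) k).1 (fun α => hL _ _) α β
  have h2 := D.eventually_twist_eq o he hy
  rw [pd_congr (h2.mono fun z hz => hz k β), pd_congr (h2.mono fun z hz => hz k α)]
  exact h1

theorem frameRicci_eq_zero_iff_system (hD : S.HasFields b D) (hC : Corresponds o D gt u) (he : e ∈ 𝒜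
    (Fin 3) M) {Ψ : Chart S.P 𝔽 m} (hΨ : S.IsAdapted b e Ψ) {t : ℝ^(Fin m)} (hyt : append y t ∈
    Ψ.target) : (∀ c d, (S.localFields D e Ψ t).frameRicci y c d = 0) ↔ (∀ α β, ricci (comp2 gt.val
    e) α β y = targetInner (u (e.symm y)) (mapPd u e α y) (mapPd u e β y)) ∧ ∀ A, ∑ α, ∑ β, (comp2
    gt.val e y)⁻¹ α β * mapHess gt u e α β A y = 0 := by
  have hye : y ∈ e.target := by
    have := hΨ.base_mem hyt
    rwa [append_base] at this
  rw [(hΨ.regular he hD hyt).frameRicci_eq_zero_iff (hC.represented he hye (L := S.localFields D e Ψ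
    t) rfl rfl rfl)]
  have h1 : conf (fun z => (u (e.symm z)).X) (S.localFields D e Ψ t).g = comp2 gt.val e :=
    hC.conf_eq e
  rw [h1]
  rfl

lemma _root_.KaluzaKlein.EinsteinWaveMap.vacuum (hW : EinsteinWaveMap gt u) (hD : S.HasFields b D)
    (hC : Corresponds o D gt u) : S.met.Vacuum := by
  refine (vacuum_iff hD).2 fun e he Ψ hΨ y t hyt => ?_
  have hye := hΨ.base_mem hyt
  rw [append_base] at hye
  exact (frameRicci_eq_zero_iff_system hD hC he hΨ hyt).2 ⟨hW.einstein e he y hye, hW.wave e he y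
    hye⟩

theorem vacuum_iff_system (hS : Surjective S.proj) (hD : S.HasFields b D) (hC : Corresponds o D gt
    u) : S.met.Vacuum ↔ EinsteinWaveMap gt u := by
  constructor
  · intro hV
    have key : ∀ e ∈ 𝒜 (Fin 3) M, ∀ y ∈ e.target, (∀ α β, ricci (comp2 gt.val e) α β y = targetInner
        (u (e.symm y)) (mapPd u e α y) (mapPd u e β y)) ∧ ∀ A, ∑ α, ∑ β, (comp2 gt.val e y)⁻¹ α β *
        mapHess gt u e α β A y = 0 := fun e he y hy => by
      obtain ⟨Ψ, t, hΨ, hyt⟩ := exists_adapted_over b hS (e := e) he (y := y) hy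
      exact (frameRicci_eq_zero_iff_system hD hC he hΨ hyt).1 ((vacuum_iff hD).1 hV e he Ψ hΨ y t
        hyt)
    exact ⟨fun e he y hy => (key e he y hy).1, fun e he y hy => (key e he y hy).2⟩
  · exact fun hW => hW.vacuum hD hC

end SymmetricSpacetime

section

variable {ι : Type*} [Fintype ι] [DecidableEq ι] {M : Type*} [TopologicalSpace M] [ChartedSpace ℝ^ι
  M] [IsManifold 𝕀 ι ∞ M] {e : Chart M ι} {y : ℝ^ι}

variable {A : Chart M ι → ℝ^ι → Matrix ι ι ℝ}

/-- Smoothness of a 1-form. -/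
def Smooth1 (a : OneForm ι M) : Prop :=
  ∀ e ∈ 𝒜 ι M, ∀ y ∈ e.target, ∀ i, Smooth (comp1 a e i) y

/-- The tensor field with given components in the preferred charts. -/
def ofComp (A : Chart M ι → ℝ^ι → Matrix ι ι ℝ) : Tensor2 ι M := fun x =>
  BilinForm.comp (toBilin' (A (chartAt ℝ^ι x) (chartAt ℝ^ι x x)))
    (tder ι ι (chartAt ℝ^ι x) x).toLinearMap (tder ι ι (chartAt ℝ^ι x) x).toLinearMap

/-- The exterior derivative of a 1-form. -/
def extDer (a : OneForm ι M) : Tensor2 ι M := ofComp (extComp a)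

lemma tder_chart_coordVec {e' : Chart M ι} (he : e ∈ 𝒜 ι M) (he' : e' ∈ 𝒜 ι M) (hy : y ∈ e.target)
    (hy' : e.symm y ∈ e'.source) (i : ι) : tder ι ι e' (e.symm y) (tder ι ι e.symm y (psingle i 1))
    = fun a => jac (rep e e' id) y a i := by
  rw [← tder_comp (smooth_chart he' hy') (smooth_symm he hy), tder_eq_fderiv]
  funext a
  have h := (smooth_change he he' hy hy').differentiableAt (by decide)
  rw [jac, of_apply, pd, (hasFDerivAt_pi'.1 h.hasFDerivAt a).fderiv]
  rfl

lemma comp2_ofComp (he : e ∈ 𝒜 ι M) (hy : y ∈ e.target) (hA : ∀ e' ∈ 𝒜 ι M, e.symm y ∈ e'.source → A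
    e y = (jac (rep e e' id) y)ᵀ * A e' (rep e e' id y) * jac (rep e e' id) y) : comp2 (ofComp A) e
    y = A e y := by
  set χ := chartAt ℝ^ι (e.symm y)
  have hχ : χ ∈ 𝒜 ι M := chart_mem _
  have hs : e.symm y ∈ χ.source := mem_chart_source _ _
  rw [hA χ hχ hs]
  ext i j
  have h := fun i => tder_chart_coordVec he hχ hy hs i
  change toBilin' (A χ (χ (e.symm y))) (tder ι ι χ (e.symm y) (tder ι ι e.symm y (psingle i 1)))
    (tder ι ι χ (e.symm y) (tder ι ι e.symm y (psingle j 1))) = _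
  rw [h, h, toBilin'_apply, mmul]
  simp only [mmul, tr_apply, sum_mul]
  exact sum_comm

lemma ofComp_self (hA : ∀ e y, (A e y)ᵀ = -A e y) (x : M) (v : ℝ^ι) : ofComp A x v v = 0 := by
  set χ := chartAt ℝ^ι x
  set c := tder ι ι χ x v
  have h : ofComp A x v v = ∑ i, ∑ j, c i * A χ (χ x) i j * c j := toBilin'_apply _ c c
  have h2 : ofComp A x v v = -ofComp A x v v := by
    conv_lhs => rw [h, sum_comm]
    rw [h, ← sum_neg]
    refine sum_ext fun i => ?_
    rw [← sum_neg]
    refine sum_ext fun j => ?_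
    rw [show A χ (χ x) j i = -A χ (χ x) i j from congrFun (congrFun (hA χ (χ x)) i) j]
    ring
  linarith

lemma comp2_extDer {a : OneForm ι M} (ha : Smooth1 a) (he : e ∈ 𝒜 ι M) (hy : y ∈ e.target) : comp2
    (extDer a) e y = extComp a e y := comp2_ofComp he hy fun _ he' hs => extComp_change a he he' hy
    hs (ha _ he' _ (OpenPartialHomeomorph.map_source _ hs))

lemma extDer_self (a : OneForm ι M) (x : M) (v : ℝ^ι) : extDer a x v v = 0 := ofComp_self (fun e y
  => by
    ext i j
    simp only [extComp, tr_apply, mneg, of_apply]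
    ring) x v

lemma bilin_ext_coord {T T' : BilinForm ℝ ℝ^ι} (he : e ∈ 𝒜 ι M) (hy : y ∈ e.target) (h : ∀ i j, T
    (tder ι ι e.symm y (psingle i 1)) (tder ι ι e.symm y (psingle j 1)) = T' (tder ι ι e.symm y
    (psingle i 1)) (tder ι ι e.symm y (psingle j 1))) : T = T' := by
  have hb : ∀ v : ι → ℝ, ∃ c : ι → ℝ, v = ∑ i, c i • tder ι ι e.symm y (psingle i 1) := fun v =>
    eq_sum_coordVec he hy v
  refine LinearMap.ext fun v => LinearMap.ext fun w => ?_
  obtain ⟨c, rfl⟩ := hb v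
  obtain ⟨d, rfl⟩ := hb w
  simp only [bsum_l, bsum_r, bsmul_l, bsmul_r, h]

end

namespace SymmetricSpacetime

variable (S b)

/-- The connection, as a linear form on the model space. -/
def conn (k : Fin m) (p : S.P) : ℝ^(𝔽 m) →ₗ[ℝ] ℝ := S.connection b k p

lemma conn_apply (k : Fin m) (p : S.P) (v : ℝ^(𝔽 m)) : S.conn b k p v = ∑ l, (S.gram b p)⁻¹ k l *
    S.bil p (S.kill b l p) v := by
  have h : ∀ v : TangentSpace 𝕀 𝔽 m p, S.connection b k p v = ∑ l, (S.gram b p)⁻¹ k l * S.met.val p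
      (S.killing (b l) p) v := fun v => by
    rw [connection, LinearMap.sum_apply]
    rfl
  exact h v

lemma gram_det (p : S.P) : IsUnit (S.gram b p).det := (S.gram_posDef b p).det_pos.ne'.isUnit

lemma sum_gram_conn (k : Fin m) (p : S.P) (v : ℝ^(𝔽 m)) : ∑ l, S.gram b p k l * S.conn b l p v =
    S.bil p (S.kill b k p) v := by
  have h : (S.gram b p * (S.gram b p)⁻¹) *ᵥ (fun l => S.bil p (S.kill b l p) v) = fun l => S.bil p
      (S.kill b l p) v := by rw [mmul_inv _ (S.gram_det b p), one_mulVec]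
  rw [← mulVec_mulVec] at h
  simp only [conn_apply]
  exact congrFun h k

lemma conn_kill (k l : Fin m) (p : S.P) : S.conn b k p (S.kill b l p) = (1 : Matrix (Fin m) (Fin m)
    ℝ) k l := by
  rw [conn_apply, ← minv_mul _ (S.gram_det b p), mmul]
  rfl

lemma conn_act (a : G) (k : Fin m) (p : S.P) (v : ℝ^(𝔽 m)) : S.conn b k (S.act a p) (tder 𝔽 m 𝔽 m
    (S.act a) p v) = S.conn b k p v := by simp only [conn_apply, gram_act, ← tder_act_kill, bil_act]

/-- The horizontal projection. -/
def hor (p : S.P) : ℝ^(𝔽 m) →ₗ[ℝ] ℝ^(𝔽 m) :=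
  LinearMap.id - ∑ k, (S.conn b k p).smulRight (S.kill b k p)

lemma hor_apply (p : S.P) (v : ℝ^(𝔽 m)) : S.hor b p v = v - ∑ k, S.conn b k p v • S.kill b k p := by
  simp [hor, LinearMap.sum_apply]

lemma bil_kill_hor (k : Fin m) (p : S.P) (v : ℝ^(𝔽 m)) : S.bil p (S.kill b k p) (S.hor b p v) = 0 :=
    by
  rw [hor_apply, map_sub, map_sum]
  simp only [map_smul, smul_eq_mul]
  rw [← sum_gram_conn, sub_eq_zero]
  exact sum_ext fun l => mul_comm _ _

lemma bil_hor_hor (p : S.P) (v w : ℝ^(𝔽 m)) : S.bil p (S.hor b p v) (S.hor b p w) = S.bil p v (S.hor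
    b p w) := by
  conv_lhs => rw [S.hor_apply b p v]
  rw [map_sub, map_sum, LinearMap.sub_apply, LinearMap.sum_apply]
  simp only [map_smul, LinearMap.smul_apply, bil_kill_hor, smul_zero, sum_zero, sub_zero]

lemma hor_kill (k : Fin m) (p : S.P) : S.hor b p (S.kill b k p) = 0 := by
  rw [hor_apply]
  simp [conn_kill, mone]

lemma hor_eq_self {p : S.P} {v : ℝ^(𝔽 m)} (h : ∀ k, S.bil p (S.kill b k p) v = 0) : S.hor b p v = v
    := by simp [hor_apply, conn_apply, h]

lemma tder_proj_hor (p : S.P) (v : ℝ^(𝔽 m)) : tder 𝔽 m (Fin 3) S.proj p (S.hor b p v) = tder 𝔽 m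
    (Fin 3) S.proj p v := by
  rw [hor_apply, map_sub, map_sum]
  simp [tder_proj_kill]

lemma hor_act (a : G) (p : S.P) (v : ℝ^(𝔽 m)) : S.hor b (S.act a p) (tder 𝔽 m 𝔽 m (S.act a) p v) =
    tder 𝔽 m 𝔽 m (S.act a) p (S.hor b p v) := by
  rw [hor_apply, hor_apply, map_sub, map_sum]
  simp only [conn_act, map_smul, tder_act_kill]

/-- The horizontal part of the metric. -/
def horMet : Tensor2 𝔽 m S.P := fun p => (S.bil p).comp (S.hor b p) (S.hor b p)

/-- A tensor field that is invariant and annihilates the Killing vectors. -/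
structure Basic (T : Tensor2 𝔽 m S.P) : Prop where
  inv : ∀ (a : G) (p : S.P) (v w : ℝ^(𝔽 m)),
    T (S.act a p) (tder 𝔽 m 𝔽 m (S.act a) p v)
      (tder 𝔽 m 𝔽 m (S.act a) p w) = T p v w
  left : ∀ p k (v : ℝ^(𝔽 m)), T p (S.kill b k p) v = 0
  right : ∀ p k (v : ℝ^(𝔽 m)), T p v (S.kill b k p) = 0

lemma basic_horMet : S.Basic b (S.horMet b) where
  inv a p v w := by
    change S.bil _ (S.hor b _ _) (S.hor b _ _) = S.bil p _ _
    rw [hor_act, hor_act, bil_act]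
    rfl
  left p k v := by
    change S.bil p (S.hor b p _) (S.hor b p v) = 0
    rw [hor_kill, map_zero, LinearMap.zero_apply]
  right p k v := by
    change S.bil p (S.hor b p v) (S.hor b p _) = 0
    rw [hor_kill, map_zero]

section

/-- The translation of the spacetime by a group element. -/
def actHomeomorph (a : G) : S.P ≃ₜ S.P where
  toFun := S.act a
  invFun := S.act a⁻¹
  left_inv p := by rw [← S.act_mul, inv_mul_cancel, S.act_one]
  right_inv p := by rw [← S.act_mul, mul_inv_cancel, S.act_one]
  continuous_toFun := (S.contMDiff_act a).continuous
  continuous_invFun := (S.contMDiff_act a⁻¹).continuous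

/-- The translation of a chart. -/
def translateChart (a : G) (Ψ : Chart S.P 𝔽 m) :
    Chart S.P 𝔽 m :=
  (S.actHomeomorph a).symm.toOpenPartialHomeomorph.trans Ψ

lemma translateChart_target (a : G) : (S.translateChart a Ψ).target = Ψ.target := by
  simp [translateChart]

lemma translateChart_mem (a : G) (hΨ : Ψ ∈ 𝒜 𝔽 m S.P) : S.translateChart a Ψ ∈ 𝒜 𝔽 m S.P := by
  refine mem_smoothCharts (fun p hp => ?_) fun z hz => ?_
  · rw [translateChart, trans_source] at hp
    exact (smooth_chart hΨ hp.2).comp p (S.contMDiff_act a⁻¹).contMDiffAt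
  · rw [translateChart_target] at hz
    exact ContMDiffAt.comp z (g := S.act a) (f := Ψ.symm) (S.contMDiff_act a).contMDiffAt
      (smooth_symm hΨ hz)

lemma coordV_translateChart (a : G) (hΨ : Ψ ∈ 𝒜 𝔽 m S.P) (hz : z ∈ Ψ.target) (i : 𝔽 m) : S.coordV
    (S.translateChart a Ψ) z i = tder 𝔽 m 𝔽 m (S.act a) (Ψ.symm z) (S.coordV Ψ z i) := tder_comp (g
    := S.act a) (S.contMDiff_act a).contMDiffAt (smooth_symm hΨ hz) _

lemma comp1_connection_translateChart (a : G) (hΨ : Ψ ∈ 𝒜 𝔽 m S.P) (hz : z ∈ Ψ.target) (k : Fin m)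
    (i : 𝔽 m) : comp1 (S.connection b k) (S.translateChart a Ψ) i z = comp1 (S.connection b k) Ψ i z
    := by
  change S.conn b k (S.act a (Ψ.symm z)) (S.coordV (S.translateChart a Ψ) z i) = S.conn b k (Ψ.symm
    z) (S.coordV Ψ z i)
  rw [S.coordV_translateChart a hΨ hz, conn_act]

end

namespace IsAdapted

variable {S b}

lemma comp1_connection_smooth (h : S.IsAdapted b e Ψ) (hz : z ∈ Ψ.target) (k : Fin m) (i : 𝔽 m) :
    Smooth (comp1 (S.connection b k) Ψ i) z := by
  have hzt : append z♭ z♯ ∈ Ψ.target := by rwa [append_comp]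
  have h1 : comp1 (S.connection b k) Ψ i =ᶠ[𝓝 z] fun w => Sum.elim (fun α => S.adA Ψ z♯ w♭ k α) (fun
      l => (1 : Matrix (Fin m) (Fin m) ℝ) k l) (finSumFinEquiv.symm i) := by
    filter_upwards [Ψ.open_target.mem_nhds hz, ev_append_mem (S := S) (Ψ := Ψ) hzt] with w hw hwt
    rw [← h.comp1_connection hw hwt, Equiv.apply_symm_apply]
  refine ContDiffAt.congr_of_eventuallyEq ?_ h1
  cases finSumFinEquiv.symm i with
  | inl α =>
    have h2 : Smooth (fun y => S.adA Ψ z♯ y k α) z♭ := h.msmooth_adA hzt k α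
    exact ContDiffAt.comp z (f := fun w : 𝔽 m → ℝ => w♭) (g := fun y => S.adA Ψ z♯ y k α) h2
      smooth_base.contDiffAt
  | inr l => exact contDiffAt_const

lemma extComp_connection_natAdd (h : S.IsAdapted b e Ψ) (hz : z ∈ Ψ.target) (k l : Fin m) (i : 𝔽 m)
    : extComp (S.connection b k) Ψ z (natAdd 3 l) i = 0 := by
  set t := z♯ with ht
  have hzt : append z♭ t ∈ Ψ.target := by rwa [append_comp]
  have hev : ∀ᶠ w in 𝓝 z, w ∈ Ψ.target ∧ append w♭ t ∈ Ψ.target := Filter.Eventually.and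
    (Ψ.open_target.mem_nhds hz) (ev_append_mem (S := S) (Ψ := Ψ) hzt)
  have h1 : pd i (comp1 (S.connection b k) Ψ (natAdd 3 l)) z = 0 := by
    have h0 : ∀ᶠ w in 𝓝 z, comp1 (S.connection b k) Ψ (natAdd 3 l) w = (1 : Matrix (Fin m) (Fin m)
        ℝ) k l := hev.mono fun w hw => h.comp1_connection hw.1 hw.2 k (inr l)
    rw [pd_congr h0, pd_const]
  have h2 : pd (natAdd 3 l) (comp1 (S.connection b k) Ψ i) z = 0 := by
    obtain ⟨j, rfl⟩ := finSumFinEquiv.surjective i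
    cases j with
    | inl β =>
      have h0 : ∀ᶠ w in 𝓝 z, comp1 (S.connection b k) Ψ (𝔢 (inl β)) w = S.adA Ψ t w♭ k β := hev.mono
          fun w hw => h.comp1_connection hw.1 hw.2 k (inl β)
      rw [pd_congr h0]
      refine (pd_comp (f := fun y => S.adA Ψ t y k β) (τ := fun w => w♭) (diffAt (h.msmooth_adA hzt
        k β)) (smooth_base.differentiable (by decide)).differentiableAt).trans ?_
      refine sum_eq_zero fun γ _ => ?_
      simp only [fcomp_apply, pd_coord]
      rw [if_neg (by rw [Fin.ext_iff]; simp; omega), mul_zero]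
    | inr l' =>
      have h0 : ∀ᶠ w in 𝓝 z, comp1 (S.connection b k) Ψ (𝔢 (inr l')) w = (1 : Matrix (Fin m) (Fin m)
          ℝ) k l' := hev.mono fun w hw => h.comp1_connection hw.1 hw.2 k (inr l')
      rw [pd_congr h0, pd_const]
  rw [extComp, of_apply, h1, h2, sub_zero]

lemma horMet_comp2 (h : S.IsAdapted b e Ψ) (hx : append x t ∈ Ψ.target) (α β : Fin 3) : comp2
    (S.horMet b) Ψ (append x t) (castAdd m α) (castAdd m β) = S.adG Ψ t x α β := by
  set z := append x t with hz
  have hzx : z♭ = x := append_base x t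
  have hzt : append z♭ t ∈ Ψ.target := by rwa [append_base]
  have hN := h.blockMet_eq hx hzt
  have hc : ∀ i j : Fin 3 ⊕ Fin m, S.bil (Ψ.symm z) (S.coordV Ψ z (𝔢 i)) (S.coordV Ψ z (𝔢 j)) =
      S.blockMet Ψ t z♭ i j := fun i j => h.comp2_eq_blockMet hx hzt i j
  change S.bil (Ψ.symm z) (S.hor b _ (S.coordV Ψ z (𝔢 (inl α)))) (S.hor b _ (S.coordV Ψ z (𝔢 (inl
    β)))) = _
  have hk : ∀ k, S.kill b k (Ψ.symm z) = S.coordV Ψ z (𝔢 (inr k)) := fun k => (h.kill_eq z hx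
    k).symm
  have ha : ∀ k, S.conn b k (Ψ.symm z) (S.coordV Ψ z (𝔢 (inl β))) = S.adA Ψ t z♭ k β := fun k =>
      h.comp1_connection hx hzt k (inl β)
  rw [bil_hor_hor, hor_apply, map_sub, map_sum]
  simp only [ha, hk, map_smul, smul_eq_mul, hc]
  rw [hN]
  simp only [fromBlocks_apply₁₁, fromBlocks_apply₁₂, madd, mmul, sum_mul, hzx]
  rw [add_sub_assoc, add_eq_left, sub_eq_zero]
  refine sum_ext fun k => ?_
  rw [mul_sum]
  exact sum_ext fun l => by ring

end IsAdapted

end SymmetricSpacetime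

namespace SymmetricSpacetime

lemma KKFields_ext {D D' : KKFields m M} (hg : D.g.val = D'.g.val) (hxi : D.xi = D'.xi) (hF : D.F =
    D'.F) : D = D' := by
  obtain ⟨⟨g, _, _, _⟩, xi, _, _, F, _, _⟩ := D
  obtain ⟨⟨g', _, _, _⟩, xi', _, _, F', _, _⟩ := D'
  obtain rfl : g = g' := hg
  obtain rfl : xi = xi' := hxi
  obtain rfl : F = F' := hF
  rfl

lemma exists_eq_sum_coordV {Ψ : Chart S.P 𝔽 m} (hΨ : Ψ ∈ 𝒜 𝔽 m S.P) {z : ℝ^(𝔽 m)} (hz : z ∈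
    Ψ.target) (v : ℝ^(𝔽 m)) : ∃ c : 𝔽 m → ℝ, v = ∑ i, c i • S.coordV Ψ z i := eq_sum_coordVec hΨ hz
    v

section

variable {p : S.P} {v w : ℝ^(𝔽 m)} {T : Tensor2 𝔽 m S.P}

lemma exists_adapted_at (b : LieBasis m G) (p : S.P) : ∃ e ∈ 𝒜 (Fin 3) M, ∃ Ψ, S.IsAdapted b e Ψ ∧ ∃
    z ∈ Ψ.target, Ψ.symm z = p := by
  have he := chart_mem (I := 𝕀 (Fin 3)) (n := ∞) (S.proj p)
  obtain ⟨Ψ, hΨ, hp⟩ := S.exists_adapted b he (mem_chart_source _ (S.proj p))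
  exact ⟨_, he, Ψ, hΨ, Ψ p, Ψ.map_source hp, Ψ.left_inv hp⟩

lemma exists_eq_sum_kill (b : LieBasis m G) (hv : tder 𝔽 m (Fin 3) S.proj p v = 0) : ∃ c : Fin m →
    ℝ, v = ∑ k, c k • S.kill b k p := by
  obtain ⟨e, he, Ψ, hΨ, z, hz, rfl⟩ := exists_adapted_at b p
  obtain ⟨c, rfl⟩ := exists_eq_sum_coordV hΨ.mem hz v
  have h1 : ∀ i, tder 𝔽 m (Fin 3) S.proj (Ψ.symm z) (S.coordV Ψ z i) = _ := fun i =>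
    hΨ.tder_proj_coordV he hz i
  rw [map_sum] at hv
  simp only [map_smul, h1] at hv
  rw [Fin.sum_univ_add] at hv
  have h2 : ∀ k : Fin m, (psingle (natAdd 3 k) 1 : ℝ^(𝔽 m)) ∘ castAdd m = 0 := by
    intro k
    ext α
    simp [psingle_apply, Fin.ext_iff]
    omega
  simp only [h2, map_zero, smul_zero, sum_zero, add_zero, IsAdapted.single_castAdd_comp] at hv
  have h3 : (fun α => c (castAdd m α)) = 0 := sum_coordVec_eq_zero he (hΨ.base_mem hz) hv
  refine ⟨fun k => c (natAdd 3 k), ?_⟩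
  rw [Fin.sum_univ_add, sum_eq_zero, zero_add]
  · exact sum_ext fun k => congrArg _ (hΨ.kill_eq z hz k)
  · intro α _
    rw [show c (castAdd m α) = 0 from congrFun h3 α, zero_smul]

lemma smooth_conn (b : LieBasis m G) (k : Fin m) : Smooth1 (S.connection b k) := by
  intro e' he' y hy i
  obtain ⟨e, he, Ψ, hΨ, z, hz, hzy⟩ := exists_adapted_at b (e'.symm y)
  have hs : e'.symm y ∈ Ψ.source := hzy ▸ Ψ.map_target hz
  exact comp1_change_smooth _ he' hΨ.mem hy hs (fun i => hΨ.comp1_connection_smooth (Ψ.map_source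
    hs) k i) i

lemma extDer_connection_kill (b : LieBasis m G) (k l : Fin m) (p : S.P) (v : ℝ^(𝔽 m)) : extDer
    (S.connection b k) p (S.kill b l p) v = 0 := by
  obtain ⟨e, he, Ψ, hΨ, z, hz, rfl⟩ := exists_adapted_at b p
  obtain ⟨c, rfl⟩ := exists_eq_sum_coordV hΨ.mem hz v
  set T : BilinForm ℝ ℝ^(𝔽 m) := extDer (S.connection b k) (Ψ.symm z) with hT
  have h1 : ∀ i, T (S.kill b l (Ψ.symm z)) (S.coordV Ψ z i) = 0 := by
    intro i
    rw [← hΨ.kill_eq z hz]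
    change comp2 (extDer (S.connection b k)) Ψ z (natAdd 3 l) i = 0
    rw [comp2_extDer (smooth_conn b k) hΨ.mem hz, hΨ.extComp_connection_natAdd hz]
  have h2 : T (S.kill b l (Ψ.symm z)) (∑ i, c i • S.coordV Ψ z i) = 0 := by
    rw [bsum_r]
    exact sum_eq_zero fun i _ => by rw [bsmul_r, h1, mul_zero]
  exact h2

lemma basic_extDer (b : LieBasis m G) (k : Fin m) : S.Basic b (extDer (S.connection b k)) where
  inv a p v w := by
    obtain ⟨e, he, Ψ, hΨ, z, hz, rfl⟩ := exists_adapted_at b p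
    set T : BilinForm ℝ ℝ^(𝔽 m) := extDer (S.connection b k) (S.act a (Ψ.symm z)) with hT
    set T' : BilinForm ℝ ℝ^(𝔽 m) := extDer (S.connection b k) (Ψ.symm z) with hT'
    set A := tder 𝔽 m 𝔽 m (S.act a) (Ψ.symm z)
    have h1 : T.comp (A : ℝ^(𝔽 m) →ₗ[ℝ] ℝ^(𝔽 m)) (A : ℝ^(𝔽 m) →ₗ[ℝ] ℝ^(𝔽 m)) = T' := by
      refine bilin_ext_coord hΨ.mem hz fun i j => ?_
      have hz' : z ∈ (S.translateChart a Ψ).target := by rwa [translateChart_target]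
      have hm := S.translateChart_mem a hΨ.mem
      have hv := S.coordV_translateChart a hΨ.mem hz
      have e1 : T (A (S.coordV Ψ z i)) (A (S.coordV Ψ z j)) = comp2 (extDer (S.connection b k))
          (S.translateChart a Ψ) z i j := by
        rw [← hv, ← hv]
        rfl
      have e2 : T' (S.coordV Ψ z i) (S.coordV Ψ z j) = comp2 (extDer (S.connection b k)) Ψ z i j :=
          rfl
      refine e1.trans (Eq.trans ?_ e2.symm)
      rw [comp2_extDer (smooth_conn b k) hm hz', comp2_extDer (smooth_conn b k) hΨ.mem hz, extComp,
        extComp, of_apply, of_apply]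
      have h3 : ∀ j, ∀ᶠ w in 𝓝 z, comp1 (S.connection b k) (S.translateChart a Ψ) j w = comp1
          (S.connection b k) Ψ j w := fun j => by
        filter_upwards [Ψ.open_target.mem_nhds hz] with w hw
        exact S.comp1_connection_translateChart b a hΨ.mem hw k j
      rw [pd_congr (h3 j), pd_congr (h3 i)]
    exact LinearMap.congr_fun (LinearMap.congr_fun h1 v) w
  left p l v := extDer_connection_kill b k l p v
  right p l v := by
    set T : BilinForm ℝ ℝ^(𝔽 m) := extDer (S.connection b k) p
    have h0 : ∀ v, T v v = 0 := fun v => extDer_self _ _ v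
    have h1 : T (S.kill b l p) v = 0 := extDer_connection_kill b k l p v
    have h2 := h0 (v + S.kill b l p)
    simp only [map_add, LinearMap.add_apply, h0, h1, zero_add, add_zero] at h2
    exact h2

/-- A right inverse of the derivative of the projection. -/
def liftAt (p : S.P) : ℝ^(Fin 3) →ₗ[ℝ] ℝ^(𝔽 m) :=
  ((tder 𝔽 m (Fin 3) S.proj p : ℝ^(𝔽 m) →ₗ[ℝ]
    ℝ^(Fin 3)).exists_rightInverse_of_surjective
      (LinearMap.range_eq_top.2 (S.tder_proj_surjective p))).choose

lemma tder_proj_liftAt (p : S.P) (v : ℝ^(Fin 3)) : tder 𝔽 m (Fin 3) S.proj p (liftAt p v) = v :=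
    LinearMap.congr_fun ((tder 𝔽 m (Fin 3) S.proj p : ℝ^(𝔽 m) →ₗ[ℝ] ℝ^(Fin
    3)).exists_rightInverse_of_surjective (LinearMap.range_eq_top.2 (S.tder_proj_surjective
    p))).choose_spec v

/-- The tensor field on the base defined by a basic tensor field. -/
def descend (hS : Surjective S.proj) (T : Tensor2 𝔽 m S.P) :
    Tensor2 (Fin 3) M := fun x =>
  BilinForm.comp (T (surjInv hS x) : BilinForm ℝ ℝ^(𝔽 m))
    (liftAt (surjInv hS x)) (liftAt (surjInv hS x))

lemma Basic.congr (hT : S.Basic b T) {v' w' : ℝ^(𝔽 m)} (hv : tder 𝔽 m (Fin 3) S.proj p v = tder 𝔽 m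
    (Fin 3) S.proj p v') (hw : tder 𝔽 m (Fin 3) S.proj p w = tder 𝔽 m (Fin 3) S.proj p w') : T p v w
    = T p v' w' := by
  set B : BilinForm ℝ ℝ^(𝔽 m) := T p
  have hl : ∀ k v, B (S.kill b k p) v = 0 := fun k v => hT.left p k v
  have hr : ∀ k v, B v (S.kill b k p) = 0 := fun k v => hT.right p k v
  obtain ⟨c, hc⟩ := exists_eq_sum_kill b (v := v - v') (by rw [map_sub, hv, sub_self])
  obtain ⟨d, hd⟩ := exists_eq_sum_kill b (v := w - w') (by rw [map_sub, hw, sub_self])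
  change B v w = B v' w'
  rw [← sub_add_cancel v v', hc, ← sub_add_cancel w w', hd]
  simp only [map_add, LinearMap.add_apply, bsum_l, bsum_r, bsmul_l, bsmul_r, hl, hr, mul_zero,
    sum_zero, zero_add]

lemma pullback_descend (hS : Surjective S.proj) (hT : S.Basic b T) : S.pullback (descend hS T) = T
    := by
  funext p
  refine LinearMap.ext fun v => LinearMap.ext fun w => ?_
  set q := surjInv hS (S.proj p) with hq
  have hqp : S.proj q = S.proj p := Function.surjInv_eq hS _
  obtain ⟨a, ha⟩ := (S.proj_eq_iff p q).1 hqp.symm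
  have key : ∀ v w : 𝔽 m → ℝ, T q (liftAt q (tder 𝔽 m (Fin 3) S.proj p v)) (liftAt q (tder 𝔽 m (Fin
      3) S.proj p w)) = T p v w := fun v w => by
    refine Eq.trans ?_ (hT.inv a p v w)
    rw [← ha]
    refine hT.congr ?_ ?_ <;> rw [tder_proj_liftAt, tder_proj_act]
  exact key v w

lemma comp2_descend (hS : Surjective S.proj) (hT : S.Basic b T) {e : Chart M (Fin 3)} (he : e ∈ 𝒜
    (Fin 3) M) {Ψ : Chart S.P 𝔽 m} (hΨ : S.IsAdapted b e Ψ) {x : ℝ^(Fin 3)} {t : ℝ^(Fin m)} (hx :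
    append x t ∈ Ψ.target) (α β : Fin 3) : comp2 (descend hS T) e x α β = comp2 T Ψ (append x t)
    (castAdd m α) (castAdd m β) := by
  conv_rhs => rw [← pullback_descend hS hT]
  rw [hΨ.pullback_comp2_castAdd he hx, append_base]

lemma HasFields.unique (hS : Surjective S.proj) {D D' : KKFields m M} (h : S.HasFields b D) (h' :
    S.HasFields b D') : D = D' := by
  refine KKFields_ext (tensor2_ext fun e he y hy => ?_) (funext fun x => ?_) (funext fun k =>
    tensor2_ext fun e he y hy => ?_)
  · obtain ⟨Ψ, t, hΨ, hyt⟩ := exists_adapted_over b hS he hy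
    rw [hΨ.comp2_g_eq he h hyt, hΨ.comp2_g_eq he h' hyt]
  · obtain ⟨p, rfl⟩ := hS x
    rw [← h.xi_eq, ← h'.xi_eq]
  · obtain ⟨Ψ, t, hΨ, hyt⟩ := exists_adapted_over b hS he hy
    ext α β
    have h1 := fun T => hΨ.pullback_comp2_castAdd he hyt T α β
    rw [append_base] at h1
    rw [← h1, ← h1, ← (h.F_eq k).extComp_eq hΨ.mem hyt (Set.mem_univ _), ← (h'.F_eq k).extComp_eq
      hΨ.mem hyt (Set.mem_univ _)]

/-- The quotient metric. -/
def quotientMetric (S : SymmetricSpacetime m G M)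
    (b : LieBasis m G)
    (hS : Surjective S.proj) : LorentzMetric (Fin 3) M where
  val := descend hS (S.horMet b)
  symm _ _ _ := S.bil_symm _ _ _
  lorentzian x := by
    obtain ⟨p, rfl⟩ := hS x
    have key : ∀ v w : 𝔽 m → ℝ, descend hS (S.horMet b) (S.proj p)
        (tder 𝔽 m (Fin 3) S.proj p v) (tder 𝔽 m (Fin 3) S.proj p w)
        = S.bil p (S.hor b p v) (S.hor b p w) := fun v w =>
      LinearMap.congr_fun (LinearMap.congr_fun
        (congrFun (pullback_descend hS (S.basic_horMet b)) p) v) w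
    obtain ⟨V, hV, hV'⟩ : ∃ V : 𝔽 m → ℝ, S.bil p V V < 0 ∧
      ∀ w, S.bil p V w = 0 → w ≠ 0 → 0 < S.bil p w w := S.met.lorentzian p
    refine ⟨tder 𝔽 m (Fin 3) S.proj p V, ?_, fun w hw hw0 => ?_⟩
    · rw [key]
      set c := fun k => S.conn b k p V with hc
      have h1 : S.hor b p V = V - ∑ k, c k • S.kill b k p := S.hor_apply b p V
      have h2 : S.bil p V V = S.bil p (S.hor b p V) (S.hor b p V)
          + S.bil p (∑ k, c k • S.kill b k p) (∑ k, c k • S.kill b k p) := by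
        have h3 : V = S.hor b p V + ∑ k, c k • S.kill b k p := by rw [h1, sub_add_cancel]
        have h4 : S.bil p (∑ k, c k • S.kill b k p) (S.hor b p V) = 0 := by
          rw [bsum_l]
          simp only [bsmul_l, bil_kill_hor, mul_zero, sum_zero]
        conv_lhs => rw [h3]
        simp only [map_add, LinearMap.add_apply]
        rw [h4, S.bil_symm p (S.hor b p V) (∑ k, c k • S.kill b k p), h4, add_zero, zero_add]
      have h5 : 0 ≤ S.bil p (∑ k, c k • S.kill b k p) (∑ k, c k • S.kill b k p) := by
        by_cases h : c = 0
        · rw [h]; simp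
        · exact (S.kill_pos b h p).le
      linarith
    · obtain ⟨w, rfl⟩ := S.tder_proj_surjective p w
      rw [key] at hw ⊢
      refine hV' _ (by rwa [bil_hor_hor] at hw) fun h => hw0 ?_
      rw [← S.tder_proj_hor b, h, map_zero]
      rfl
  smooth := by
    refine fun e he α β y hy => ContDiffAt.contDiffWithinAt ?_
    obtain ⟨Ψ, t, hΨ, hyt⟩ := exists_adapted_over b hS he hy
    refine (hΨ.msmooth_adG hyt α β).congr_of_eventuallyEq ?_
    filter_upwards [IsAdapted.eventually_append_mem (S := S) (Ψ := Ψ) hyt] with w hw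
    rw [comp2_descend hS (S.basic_horMet b) he hΨ hw, hΨ.horMet_comp2 hw]

lemma gram_surjInv (b : LieBasis m G) (hS : Surjective S.proj) (p : S.P) : S.gram b (surjInv hS
    (S.proj p)) = S.gram b p := by
  obtain ⟨a, ha⟩ := (S.proj_eq_iff p _).1 (Function.surjInv_eq hS (S.proj p)).symm
  rw [← ha, gram_act]

lemma gram_surjInv_smooth (b : LieBasis m G) (hS : Surjective S.proj) (k l : Fin m) : ContMDiff 𝕀
    (Fin 3) 𝓘(ℝ, ℝ) ∞ fun x => S.gram b (surjInv hS x) k l := by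
  intro x
  set e := chartAt ℝ^(Fin 3) x
  have he : e ∈ 𝒜 (Fin 3) M := chart_mem x
  have hx : x ∈ e.source := mem_chart_source _ x
  obtain ⟨Ψ, t, hΨ, hyt⟩ := exists_adapted_over b hS he (e.map_source hx)
  have h1 : ContMDiffAt 𝕀 (Fin 3) 𝓘(ℝ, ℝ) ∞ (fun x => S.adXi Ψ t (e x) k l) x := ContMDiffAt.comp x
    (g := fun y => S.adXi Ψ t y k l) (hΨ.msmooth_adXi hyt k l).contMDiffAt (smooth_chart he hx)
  refine h1.congr_of_eventuallyEq ?_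
  have hev : ∀ᶠ x' in 𝓝 x, append (e x') t ∈ Ψ.target := (e.continuousAt hx).eventually
    (IsAdapted.eventually_append_mem (S := S) (Ψ := Ψ) hyt)
  filter_upwards [hev, e.open_source.mem_nhds hx] with x' hx' hxs
  have h2 := hΨ.gram_eq hx' (t := t) (by rwa [append_base])
  rw [append_base] at h2
  rw [← h2, ← gram_surjInv b hS (Ψ.symm _), hΨ.proj_symm hx', append_base, e.left_inv hxs]

/-- The curvature of the connection, on the base. -/
def curvature (b : LieBasis m G)
    (hS : Surjective S.proj) (k : Fin m) : Tensor2 (Fin 3) M :=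
  descend hS (extDer (S.connection b k))

lemma curvature_smooth (b : LieBasis m G) (hS : Surjective S.proj) (k : Fin m) : Smooth2 (curvature
    b hS k) := by
  refine fun e he α β y hy => ContDiffAt.contDiffWithinAt ?_
  obtain ⟨Ψ, t, hΨ, hyt⟩ := exists_adapted_over b hS he hy
  have h1 : Smooth (fun y => pd α (fun y => S.adA Ψ t y k β) y - pd β (fun y => S.adA Ψ t y k α) y)
      y := (contDiffAt_pd (hΨ.msmooth_adA hyt k β)).sub (contDiffAt_pd (hΨ.msmooth_adA hyt k α))
  refine h1.congr_of_eventuallyEq ?_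
  filter_upwards [IsAdapted.eventually_append_mem (S := S) (Ψ := Ψ) hyt] with w hw
  have h2 := hΨ.extComp_connection hw (t := t) (by rwa [append_base]) k α β
  rw [append_base] at h2
  rw [curvature, comp2_descend hS (basic_extDer b k) he hΨ hw, comp2_extDer (smooth_conn b k) hΨ.mem
    hw, h2]

lemma isPotentialOn_connection (b : LieBasis m G) (hS : Surjective S.proj) (k : Fin m) :
    IsPotentialOn Set.univ (S.connection b k) (S.pullback (curvature b hS k)) := by
  rw [curvature, pullback_descend hS (basic_extDer b k)]
  refine fun e he => ⟨fun i y hy => (smooth_conn b k e he y hy.1 i).contDiffWithinAt, fun y hy _ i j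
    => ?_⟩
  rw [comp2_extDer (smooth_conn b k) he hy, extComp, of_apply]

lemma quotientMetric_apply (b : LieBasis m G) (hS : Surjective S.proj) (hv : ∀ k, S.bil p (S.kill b
    k p) v = 0) (hw : ∀ k, S.bil p (S.kill b k p) w = 0) : S.bil p v w = S.pullback (quotientMetric
    S b hS).val p v w := by
  have h1 : S.pullback (descend hS (S.horMet b)) p v w = S.bil p (S.hor b p v) (S.hor b p w) :=
    LinearMap.congr_fun (LinearMap.congr_fun (congrFun (pullback_descend hS (S.basic_horMet b)) p)
    v) w
  refine Eq.trans ?_ h1.symm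
  rw [S.hor_eq_self b hv, S.hor_eq_self b hw]

/-- The fields of a spacetime. -/
def quotientFields (b : LieBasis m G)
    (hS : Surjective S.proj) : KKFields m M where
  g := quotientMetric S b hS
  xi x := S.gram b (surjInv hS x)
  xi_smooth := gram_surjInv_smooth b hS
  xi_posDef _ := S.gram_posDef b _
  F := curvature b hS
  F_alt k x v := extDer_self (S.connection b k) (surjInv hS x)
    (liftAt (surjInv hS x) v)
  F_smooth := curvature_smooth b hS

theorem hasFields_quotientFields (b : LieBasis m G) (hS : Surjective S.proj) : S.HasFields b
    (quotientFields b hS) where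
  xi_eq p := (gram_surjInv b hS p).symm
  g_eq _ _ _ hv hw := quotientMetric_apply b hS hv hw
  F_eq := isPotentialOn_connection b hS

theorem existsUnique_hasFields (b : LieBasis m G) (hS : Surjective S.proj) : ∃! D : KKFields m M,
    S.HasFields b D := by
  exact ⟨_, hasFields_quotientFields b hS, fun _ h => h.unique hS (hasFields_quotientFields b hS)⟩

end

end SymmetricSpacetime

section

open MeasureTheory

variable {E : Type} [NormedAddCommGroup E] [NormedSpace ℝ E] [FiniteDimensional ℝ E]

lemma hasFDerivAt_integral {F : Type} [NormedAddCommGroup F] [NormedSpace ℝ F] [CompleteSpace F] {f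
    : E × ℝ → F} (hf : ContDiff ℝ 1 f) (x : E) : HasFDerivAt (fun x => ∫ t in (0 : ℝ)..1, f (x, t))
    (∫ t in (0 : ℝ)..1, (fderiv ℝ f (x, t)).comp (ContinuousLinearMap.inl ℝ E ℝ)) x := by
  have : ProperSpace E := FiniteDimensional.proper ℝ E
  have hc : Continuous fun z : E × ℝ => (fderiv ℝ f z).comp (ContinuousLinearMap.inl ℝ E ℝ) :=
      (hf.continuous_fderiv one_ne_zero).clm_comp continuous_const
  obtain ⟨C, hC⟩ := ((isCompact_closedBall x 1).prod (isCompact_uIcc (a := (0 : ℝ)) (b :=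
    1))).exists_bound_of_continuousOn hc.continuousOn
  have hx : ∀ x, Continuous fun t : ℝ => f (x, t) := fun x => hf.continuous.comp
    (continuous_const.prodMk continuous_id)
  refine (intervalIntegral.hasFDerivAt_integral_of_dominated_of_fderiv_le (𝕜 := ℝ) (μ := volume)
    (bound := fun _ => C) (F' := fun x t => (fderiv ℝ f (x, t)).comp (ContinuousLinearMap.inl ℝ E
    ℝ)) (Metric.closedBall_mem_nhds x one_pos) ?_ ?_ ?_ ?_ ?_ ?_)
  · exact .of_forall fun x => (hx x).aestronglyMeasurable
  · exact (hx x).intervalIntegrable _ _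
  · exact (hc.comp (continuous_const.prodMk continuous_id)).aestronglyMeasurable
  · exact .of_forall fun t ht x' hx' => hC (x', t) ⟨hx', Set.uIoc_subset_uIcc ht⟩
  · exact intervalIntegrable_const
  · refine .of_forall fun t _ x' _ => ?_
    have h1 : HasFDerivAt (fun x : E => (x, t)) (ContinuousLinearMap.inl ℝ E ℝ) x' :=
      hasFDerivAt_prodMk_left x' t
    exact ((hf.differentiable one_ne_zero (x', t)).hasFDerivAt).comp x' h1

lemma contDiff_integral {n : ℕ} : ∀ {F : Type} [NormedAddCommGroup F] [NormedSpace ℝ F]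
    [CompleteSpace F] {f : E × ℝ → F}, ContDiff ℝ ∞ f → ContDiff ℝ n fun x => ∫ t in (0 : ℝ)..1, f
    (x, t) := by
  induction n with
  | zero =>
    intro F _ _ _ f hf
    refine contDiff_zero.2 (continuous_iff_continuousAt.2 fun x => ?_)
    exact (hasFDerivAt_integral (hf.of_le (by exact_mod_cast le_top)) x).continuousAt
  | succ n ih =>
    intro F _ _ _ f hf
    have h1 := hasFDerivAt_integral (hf.of_le (by exact_mod_cast le_top))
    push_cast
    refine contDiff_succ_iff_fderiv.2 ⟨fun x => (h1 x).differentiableAt, fun h => absurd h (by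
      simp), ?_⟩
    rw [show fderiv ℝ (fun x => ∫ t in (0 : ℝ)..1, f (x, t)) = _ from funext fun x => (h1 x).fderiv]
    exact ih (f := fun z => (fderiv ℝ f z).comp (ContinuousLinearMap.inl ℝ E ℝ)) ((hf.fderiv_right
      (m := ∞) (by simp)).clm_comp contDiff_const)

end

section

variable {ι : Type} [Fintype ι] [DecidableEq ι] {c : ℝ^ι} {f : ℝ^ι → ℝ}

/-- The weighted mean of a function over the segments from `c`. -/
def radialMean (c : ℝ^ι) (f : ℝ^ι → ℝ) (x : ℝ^ι) : ℝ :=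
  ∫ t in (0 : ℝ)..1, t * f (c + t • (x - c))

lemma contDiff_radial_integrand (hf : ContDiff ℝ ∞ f) : ContDiff ℝ ∞ fun z : ℝ^ι × ℝ => z.2 * f (c +
    z.2 • (z.1 - c)) := contDiff_snd.mul (hf.comp (contDiff_const.add (contDiff_snd.smul
    (contDiff_fst.sub contDiff_const))))

lemma radialMean_smooth (hf : ContDiff ℝ ∞ f) : ContDiff ℝ ∞ (radialMean c f) := contDiff_infty.2
  fun _ => contDiff_integral (contDiff_radial_integrand hf)

lemma hasFDerivAt_segment (x : ℝ^ι) (t : ℝ) : HasFDerivAt (fun x : ι → ℝ => c + t • (x - c)) (t •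
    ContinuousLinearMap.id ℝ ℝ^ι) x := (((hasFDerivAt_id x).sub_const c).const_smul t).const_add c

lemma pd_radialMean (hf : ContDiff ℝ ∞ f) (i : ι) (x : ℝ^ι) : pd i (radialMean c f) x = ∫ t in (0 :
    ℝ)..1, t ^ 2 * pd i f (c + t • (x - c)) := by
  have h := contDiff_radial_integrand (c := c) hf
  have hc := ((h.continuous_fderiv (by decide)).comp (continuous_const.prodMk continuous_id :
    Continuous fun t : ℝ => (x, t))).clm_comp (continuous_const (y := ContinuousLinearMap.inl ℝ ℝ^ι
    ℝ))
  have h0 : HasFDerivAt (radialMean c f) _ x := hasFDerivAt_integral (h.of_le (by exact_mod_cast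
    le_top)) x
  rw [pd, h0.fderiv]
  refine (ContinuousLinearMap.intervalIntegral_apply (hc.intervalIntegrable 0 1) _).trans ?_
  refine intervalIntegral.integral_congr fun t _ => ?_
  have h1 : HasFDerivAt (fun x : ι → ℝ => (x, t)) (ContinuousLinearMap.inl ℝ ℝ^ι ℝ) x :=
    hasFDerivAt_prodMk_left x t
  have h2 := ((h.differentiable (by decide) (x, t)).hasFDerivAt).comp x h1
  have h3 := (((hf.differentiable (by decide) _).hasFDerivAt).comp x (hasFDerivAt_segment (c := c) x
    t)).const_mul t
  have h4 := h2.unique h3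
  change (((fderiv ℝ _ (x, t)).comp (ContinuousLinearMap.inl ℝ ℝ^ι ℝ)) (psingle i 1)) = _
  rw [h4]
  simp only [_root_.smul_apply, ContinuousLinearMap.comp_apply, ContinuousLinearMap.id_apply,
    map_smul, smul_eq_mul, pd]
  ring

lemma radialMean_euler (hf : ContDiff ℝ ∞ f) (x : ℝ^ι) : ∑ k, (x k - c k) * pd k (radialMean c f) x
    + 2 * radialMean c f x = f x := by
  have hpd : ∀ k, Continuous (pd k f) := fun k => (hf.continuous_fderiv (by decide)).clm_apply
    continuous_const
  have hs : Continuous fun t : ℝ => c + t • (x - c) := by fun_prop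
  have h1 : ∀ t : ℝ, HasDerivAt (fun t : ℝ => t ^ 2 * f (c + t • (x - c))) (∑ k, (x k - c k) * (t ^
      2 * pd k f (c + t • (x - c))) + 2 * (t * f (c + t • (x - c)))) t := by
    intro t
    have e1 : HasDerivAt (fun t : ℝ => c + t • (x - c)) (x - c) t := by
      simpa using ((hasDerivAt_id t).smul_const (x - c)).const_add c
    have e2 := (hf.differentiable (by decide) (c + t • (x - c))).hasFDerivAt.comp_hasDerivAt t e1
    refine ((hasDerivAt_pow 2 t).mul e2).congr_deriv ?_
    rw [fderiv_eq_sum_pd]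
    simp only [Pi.sub_apply, fcomp_apply, mul_sum]
    rw [add_comm]
    congr 1
    · exact sum_ext fun k => by ring
    · norm_num
      ring
  have hc1 : ∀ k, Continuous fun t : ℝ => t ^ 2 * pd k f (c + t • (x - c)) := fun k =>
    (continuous_pow 2).mul ((hpd k).comp hs)
  have hc2 : Continuous fun t : ℝ => t * f (c + t • (x - c)) := continuous_id.mul
    (hf.continuous.comp hs)
  have hi1 : ∀ k ∈ univ, IntervalIntegrable (fun t : ℝ => (x k - c k) * (t ^ 2 * pd k f (c + t • (x
      - c)))) MeasureTheory.volume 0 1 := fun k _ => (continuous_const.mul (hc1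
      k)).intervalIntegrable 0 1
  have hi2 : IntervalIntegrable (fun t : ℝ => 2 * (t * f (c + t • (x - c)))) MeasureTheory.volume 0
      1 := (continuous_const.mul hc2).intervalIntegrable 0 1
  have hi3 : IntervalIntegrable (fun t : ℝ => ∑ k, (x k - c k) * (t ^ 2 * pd k f (c + t • (x - c))))
      MeasureTheory.volume 0 1 := (continuous_finsetSum _ fun k _ => continuous_const.mul (hc1
      k)).intervalIntegrable 0 1
  have h2 := intervalIntegral.integral_eq_sub_of_hasDerivAt (a := 0) (b := 1) (fun t _ => h1 t)
    (hi3.add hi2)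
  rw [intervalIntegral.integral_add hi3 hi2, intervalIntegral.integral_finsetSum hi1] at h2
  simp only [intervalIntegral.integral_const_mul] at h2
  simp only [pd_radialMean hf]
  rw [radialMean, h2]
  simp

lemma exists_contDiff_extension (hf : ∀ᶠ x in 𝓝 c, Smooth f x) : ∃ f' : ℝ^ι → ℝ, ContDiff ℝ ∞ f' ∧
    f' =ᶠ[𝓝 c] f := by
  obtain ⟨r, hr, h⟩ := Metric.eventually_nhds_iff_ball.1 hf
  let χ : ContDiffBump c := ⟨r / 4, r / 2, by linarith, by linarith⟩
  refine ⟨fun x => χ x * f x, contDiff_iff_contDiffAt.2 fun x => ?_, ?_⟩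
  · by_cases hx : x ∈ Metric.ball c r
    · exact χ.contDiff.contDiffAt.mul (h x hx)
    · have h1 : (fun x => χ x * f x) =ᶠ[𝓝 x] fun _ => 0 := by
        have h2 : x ∉ tsupport χ := fun h3 => hx (by
          rw [χ.tsupport_eq] at h3
          exact Metric.closedBall_subset_ball (show r / 2 < r by linarith) h3)
        filter_upwards [(isClosed_tsupport χ).isOpen_compl.mem_nhds h2] with z hz
        rw [image_eq_zero_of_notMem_tsupport hz, zero_mul]
      exact contDiffAt_const.congr_of_eventuallyEq h1
  · filter_upwards [Metric.closedBall_mem_nhds c χ.rIn_pos] with x hx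
    rw [χ.one_of_mem_closedBall hx, one_mul]

theorem exists_curl_eq {c : ℝ^(Fin 3)} {f : Fin 3 → ℝ^(Fin 3) → ℝ} (hf : ∀ i, ∀ᶠ x in 𝓝 c, Smooth (f
    i) x) (hd : ∀ᶠ x in 𝓝 c, ∑ i, pd i (f i) x = 0) : ∃ a : Fin 3 → ℝ^(Fin 3) → ℝ, (∀ i, ContDiff ℝ
    ∞ (a i)) ∧ ∀ᶠ x in 𝓝 c, ∀ i j, pd i (a j) x - pd j (a i) x = skew (fun k => f k x) i j := by
  choose f' hf' he using fun i => exists_contDiff_extension (hf i)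
  set h := fun i => radialMean c (f' i) with hh
  have hhs : ∀ i, ContDiff ℝ ∞ (h i) := fun i => radialMean_smooth (hf' i)
  set a : Fin 3 → ℝ^(Fin 3) → ℝ := ![ fun x => h 1 x * (x 2 - c 2) - h 2 x * (x 1 - c 1), fun x => h
    2 x * (x 0 - c 0) - h 0 x * (x 2 - c 2), fun x => h 0 x * (x 1 - c 1) - h 1 x * (x 0 - c 0)]
    with ha
  have hx : ∀ j : Fin 3, ContDiff ℝ ∞ fun x : Fin 3 → ℝ => x j - c j := fun j => (contDiff_apply ℝ ℝ
    j).sub contDiff_const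
  have hpx : ∀ (i j : Fin 3) x, pd i (fun x : Fin 3 → ℝ => x j - c j) x = if i = j then 1 else 0 := by
    intro i j x
    have : HasFDerivAt (fun x : Fin 3 → ℝ => x j - c j) (ContinuousLinearMap.proj (R := ℝ) (φ := fun
        _ : Fin 3 => ℝ) j) x := (ContinuousLinearMap.proj (R := ℝ) (φ := fun _ : Fin 3 => ℝ)
        j).hasFDerivAt.sub_const _
    rw [pd, this.fderiv]
    simp [psingle_apply, eq_comm]
  have hdiv : ∀ᶠ x in 𝓝 c, ∑ i, pd i (h i) x = 0 := by
    have h1 : ∀ᶠ x in 𝓝 c, ∑ i, pd i (f' i) x = 0 := by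
      filter_upwards [hd, eventually_all.2 fun i => pd_eventuallyEq (i := i) (he i)] with x h1 h2
      rw [← h1]
      exact sum_ext fun i => h2 i
    obtain ⟨r, hr, h2⟩ := Metric.eventually_nhds_iff_ball.1 h1
    filter_upwards [Metric.ball_mem_nhds c hr] with x hx
    have hs : Continuous fun t : ℝ => c + t • (x - c) := by fun_prop
    simp only [hh, pd_radialMean (hf' _)]
    have hpd : ∀ i, Continuous (pd i (f' i)) := fun i => ((hf' i).continuous_fderiv (by
      decide)).clm_apply continuous_const
    have hi : ∀ i ∈ univ, IntervalIntegrable (fun t : ℝ => t ^ 2 * pd i (f' i) (c + t • (x - c)))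
        MeasureTheory.volume 0 1 := fun i _ => ((continuous_pow 2).mul ((hpd i).comp
        hs)).intervalIntegrable 0 1
    rw [← intervalIntegral.integral_finsetSum hi]
    refine (intervalIntegral.integral_congr (g := fun _ => 0) fun t ht => ?_).trans (by simp)
    rw [Set.uIcc_of_le zero_le_one] at ht
    change ∑ i, t ^ 2 * _ = 0
    rw [← mul_sum, h2 _ ?_, mul_zero]
    rw [Metric.mem_ball, dist_eq_norm] at hx ⊢
    rw [add_sub_cancel_left, norm_smul, Real.norm_of_nonneg ht.1]
    nlinarith [norm_nonneg (x - c), ht.2]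
  refine ⟨a, fun i => ?_, ?_⟩
  · fin_cases i <;> exact ((hhs _).mul (hx _)).sub ((hhs _).mul (hx _))
  · filter_upwards [hdiv, eventually_all.2 he] with x hdx hex i j
    have hD : ∀ i, Diff (h i) x := fun i => (hhs i).differentiable (by decide) x
    have hDx : ∀ j : Fin 3, Diff (fun x : Fin 3 → ℝ => x j - c j) x := fun j => (hx
      j).differentiable (by decide) x
    have hp : ∀ i p q r s : Fin 3, pd i (fun x => h p x * (x q - c q) - h r x * (x s - c s)) x = (pd
        i (h p) x * (x q - c q) + h p x * if i = q then 1 else 0) - (pd i (h r) x * (x s - c s) + h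
        r x * if i = s then 1 else 0) := by
      intro i p q r s
      rw [pd_sub ((hD p).fun_mul (hDx q)) ((hD r).fun_mul (hDx s)), pd_mul (hD p) (hDx q), pd_mul
        (hD r) (hDx s), hpx, hpx]
    have heu : ∀ i, ∑ k, (x k - c k) * pd k (h i) x + 2 * h i x = f i x := fun i =>
      (radialMean_euler (hf' i) x).trans (hex i)
    simp only [sum_univ_three] at heu hdx
    have h01 : pd 0 (a 1) x - pd 1 (a 0) x = f 2 x := by
      simp [ha, hp]
      linear_combination heu 2 - (x 2 - c 2) * hdx
    have h12 : pd 1 (a 2) x - pd 2 (a 1) x = f 0 x := by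
      simp [ha, hp]
      linear_combination heu 0 - (x 0 - c 0) * hdx
    have h20 : pd 2 (a 0) x - pd 0 (a 2) x = f 1 x := by
      simp [ha, hp]
      linear_combination heu 1 - (x 1 - c 1) * hdx
    fin_cases i <;> fin_cases j <;> simp [skew, ← h01, ← h12, ← h20]

end

section

lemma skew_adjugate (J : Matrix (Fin 3) (Fin 3) ℝ) (f : ℝ^(Fin 3)) : skew (J.adjugate *ᵥ f) =
    J.transpose * skew f * J := by
  rw [adjugate_fin_three]
  ext α β
  fin_cases α <;> fin_cases β <;> simp [skew, mulVec, dotProduct, mmul, sum_univ_three] <;> ring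

lemma alternatingMap_sum_smul {V : Type*} [AddCommGroup V] [Module ℝ V] (f : V [⋀^Fin 3]→ₗ[ℝ] ℝ) (J
    : Matrix (Fin 3) (Fin 3) ℝ) (v : Fin 3 → V) : f (fun i => ∑ a, J a i • v a) = J.det * f v := by
  have h := (f.compLinearMap (Fintype.linearCombination ℝ v)).eq_smul_basis_det (Pi.basisFun ℝ (Fin
    3))
  have h2 := DFunLike.congr_fun h J.transpose
  simp only [AlternatingMap.compLinearMap_apply, AlternatingMap.smul_apply, smul_eq_mul,
    Pi.basisFun_det_apply, det_transpose] at h2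
  rw [mul_comm, show f v = f fun i => Fintype.linearCombination ℝ v (Pi.basisFun ℝ (Fin 3) i) by
    congr 1
    funext i
    rw [Pi.basisFun_apply, Fintype.linearCombination_apply_single, one_smul]]
  exact h2

lemma OrientationForm.comp_change (o : OrientationForm M) (he : e ∈ 𝒜 (Fin 3) M) (he' : e' ∈ 𝒜 (Fin
    3) M) (hy : y ∈ e.target) (hy' : e.symm y ∈ e'.source) : o.comp e y = (jac (rep e e' id) y).det
    * o.comp e' (rep e e' id y) := by
  have h : ∀ {x x' : M} (_ : x = x') (v : Fin 3 → ℝ^(Fin 3)), o.form x v = o.form x' v := by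
    rintro x _ rfl v
    rfl
  have h1 := fun i => coordVec_change he he' hy hy' i
  set J := jac (rep e e' id) y
  set w : Fin 3 → Fin 3 → ℝ := fun i => coordVec e' (rep e e' id y) i
  have h2 : o.comp e y = o.form (e.symm y) (fun i => (∑ a, J a i • w a : ℝ^(Fin 3))) := congrArg
    (fun v : Fin 3 → Fin 3 → ℝ => o.form (e.symm y) v) (funext h1)
  refine h2.trans ((alternatingMap_sum_smul (o.form (e.symm y)) J w).trans ?_)
  congr 1
  exact h (e'.left_inv hy').symm w

/-- The vector density `f` with `⋆ (e^X F) = dω` for the 2-form `F` dual to `f`. -/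
def twistVec (o : OrientationForm M) (g : LorentzMetric (Fin 3) M) (X w : ℝ^M)
    (e : Chart M (Fin 3)) (y : ℝ^(Fin 3)) : Fin 3 → ℝ :=
  (-(o.sign e y) * exp (X (e.symm y) - (1 / 2) * log (comp2 g.val e y).det))⁻¹ •
    ((comp2 g.val e y)⁻¹ *ᵥ fun γ => pd γ (fun z => w (e.symm z)) y)

variable {X w : ℝ^M}

lemma smooth_comp_symm (hw : ContMDiff 𝕀 (Fin 3) 𝓘(ℝ, ℝ) ∞ w) (he : e ∈ 𝒜 (Fin 3) M) (hy : y ∈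
    e.target) : Smooth (fun z => w (e.symm z)) y := contMDiffAt_iff_contDiffAt.1
    (hw.contMDiffAt.comp y (smooth_symm he hy))

lemma pd_change (hw : ContMDiff 𝕀 (Fin 3) 𝓘(ℝ, ℝ) ∞ w) (he : e ∈ 𝒜 (Fin 3) M) (he' : e' ∈ 𝒜 (Fin 3)
    M) (hy : y ∈ e.target) (hy' : e.symm y ∈ e'.source) : (fun γ => pd γ (fun z => w (e.symm z)) y)
    = (jac (rep e e' id) y)ᵀ *ᵥ fun γ => pd γ (fun z => w (e'.symm z)) (rep e e' id y) := by
  funext γ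
  have h0 : ∀ᶠ z in 𝓝 y, w (e.symm z) = w (e'.symm (rep e e' id z)) := by
    filter_upwards [ev_change hy hy'] with z hz
    rw [show e'.symm (rep e e' id z) = e.symm z from e'.left_inv hz.2]
  rw [pd_congr h0, pd_comp (f := fun z => w (e'.symm z)) (τ := rep e e' id) (diffAt
    (smooth_comp_symm hw he' (e'.map_source hy'))) ((smooth_change he he' hy hy').differentiableAt
    (by decide))]
  exact sum_ext fun a => mul_comm _ _

lemma twistVec_change (hw : ContMDiff 𝕀 (Fin 3) 𝓘(ℝ, ℝ) ∞ w) (he : e ∈ 𝒜 (Fin 3) M) (he' : e' ∈ 𝒜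
    (Fin 3) M) (hy : y ∈ e.target) (hy' : e.symm y ∈ e'.source) : twistVec o g X w e y = (jac (rep e
    e' id) y).adjugate *ᵥ twistVec o g X w e' (rep e e' id y) := by
  set J := jac (rep e e' id) y
  set K := jac (rep e' e id) (rep e e' id y)
  have hKJ : K * J = 1 := jac_change_mul he he' hy hy'
  have hJ0 : J.det ≠ 0 := fun h => by
    have := congrArg det hKJ
    rw [det_mul, h, mul_zero, det_one] at this
    exact zero_ne_one this
  have hKi : K = J⁻¹ := (inv_eq_left_inv hKJ).symm
  have hadj : J.adjugate = J.det • J⁻¹ := by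
    rw [inv_def, Ring.inverse_eq_inv', smul_smul, mul_inv_cancel₀ hJ0, one_smul]
  have hy2 : rep e e' id y ∈ e'.target := e'.map_source hy'
  have hd' := g.det_comp2_neg he' hy2
  have hG := comp2_change g.val he he' hy hy'
  set g' := comp2 g.val e' (rep e e' id y)
  rw [twistVec, twistVec, pd_change hw he he' hy hy', hG, hadj]
  change (-(o.sign e y) * exp (_ - 1 / 2 * log (J.transpose * g' * J).det))⁻¹ • ((J.transpose * g' *
    J)⁻¹ *ᵥ (J.transpose *ᵥ _)) = _
  have hdet : (J.transpose * g' * J).det = J.det ^ 2 * g'.det := by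
    rw [det_mul, det_mul, det_transpose]
    ring
  have hlog : exp (-(1 / 2 * log (J.det ^ 2))) = |J.det|⁻¹ := by
    rw [← sq_abs, Real.log_pow, Real.exp_neg]
    congr 1
    push_cast
    rw [← mul_assoc, one_div, inv_mul_cancel₀ two_ne_zero, one_mul, Real.exp_log (abs_pos.2 hJ0)]
  have hX : e'.symm (rep e e' id y) = e.symm y := e'.left_inv hy'
  have hc : (-(o.sign e y) * exp (X (e.symm y) - 1 / 2 * log (J.transpose * g' * J).det))⁻¹ = J.det
        * (-(o.sign e' (rep e e' id y)) * exp (X (e'.symm (rep e e' id y)) - 1 / 2 * log g'.det))⁻¹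
        := by
    rw [hX, hdet, Real.log_mul (pow_ne_zero 2 hJ0) hd'.ne, OrientationForm.sign,
      OrientationForm.sign, o.comp_change he he' hy hy', abs_mul, show X (e.symm y) - 1 / 2 * (log
      (J.det ^ 2) + log g'.det) = (X (e.symm y) - 1 / 2 * log g'.det) + -(1 / 2 * log (J.det ^ 2))
      by ring, Real.exp_add, hlog]
    have h1 := o.comp_ne_zero he' hy2
    change (-(J.det * _ / (|J.det| * _)) * _)⁻¹ = _
    have h2 := abs_pos.2 h1
    have h3 := abs_pos.2 hJ0
    have h4 := Real.exp_pos (X (e.symm y) - 1 / 2 * log g'.det)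
    field_simp
    rw [sq_abs]
  have hv : ∀ v, (J.transpose * g' * J)⁻¹ *ᵥ (J.transpose *ᵥ v) = J⁻¹ *ᵥ (g'⁻¹ *ᵥ v) := by
    intro v
    rw [Matrix.mul_inv_rev, Matrix.mul_inv_rev, mulVec_mulVec, mmul_assoc, mmul_assoc, minv_mul _
      (by rw [det_transpose]; exact hJ0.isUnit), mmul_one,
      mulVec_mulVec]
  rw [hc, hv, smul_mulVec, mulVec_smul, smul_smul]

lemma twistVec_smooth (hX : ContMDiff 𝕀 (Fin 3) 𝓘(ℝ, ℝ) ∞ X) (hw : ContMDiff 𝕀 (Fin 3) 𝓘(ℝ, ℝ) ∞ w)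
    (he : e ∈ 𝒜 (Fin 3) M) (hy : y ∈ e.target) (μ : Fin 3) : Smooth (fun z => twistVec o g X w e z
    μ) y := by
  have hg := g.msmooth he hy
  have hd := g.det_comp2_ne_zero he hy
  have hs : o.sign e y ≠ 0 := fun h => by simpa [h] using o.sign_mul_self he hy
  have h1 : Smooth (fun z => -(o.sign e y) * exp (X (e.symm z) - (1 / 2) * log (comp2 g.val e
      z).det)) y := contDiffAt_const.mul (((smooth_comp_symm hX he hy).sub (contDiffAt_const.mul
      ((contDiffAt_det hg).log hd))).exp)
  refine ((h1.inv (mul_ne_zero (neg_ne_zero.2 hs) (Real.exp_pos _).ne')).mul (ContDiffAt.sum (s :=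
    univ) fun γ _ => (hg.inv hd μ γ).mul (contDiffAt_pd (i := γ) (smooth_comp_symm hw he
    hy)))).congr_of_eventuallyEq ?_
  filter_upwards [o.eventually_sign_eq he hy] with z hz
  rw [twistVec, hz]
  rfl

/-- A conformal change of a metric. -/
def LorentzMetric.conf (g : LorentzMetric (Fin 3) M) (f : ℝ^M)
    (hf : ContMDiff 𝕀 (Fin 3) 𝓘(ℝ, ℝ) ∞ f) : LorentzMetric (Fin 3) M where
  val x := exp (f x) • g.val x
  symm x v w := congrArg (exp (f x) * ·) (g.symm x v w)
  lorentzian x := by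
    obtain ⟨v, hv, h⟩ := g.lorentzian x
    exact ⟨v, mul_neg_of_pos_of_neg (Real.exp_pos _) hv, fun w hw hw0 => mul_pos (Real.exp_pos _)
      (h w ((mul_eq_zero.1 hw).resolve_left (Real.exp_pos _).ne') hw0)⟩
  smooth e he i j _ hy :=
    ((smooth_comp_symm hf he hy).exp.mul (g.msmooth he hy i j)).contDiffWithinAt

lemma KKFields.twist_eq_factor (D : KKFields m M) (he : e ∈ 𝒜 (Fin 3) M) (hy : y ∈ e.target) (k :
    Fin m) (α : Fin 3) : D.twist o k e α y = (D.base e).factor (o.sign e y) (fun z => D.X (e.symm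
    z)) y * ((D.base e).g y *ᵥ (D.base e).dual k y) α := (D.twist_eq o k α).trans
    (LocalFields.twistForm_eq (L := D.base e) (D.g.comp2_transpose e y) (D.g.det_comp2_neg he hy)
    (fun k => D.F_antisymm k e y) k α)

lemma KKFields.twist_eq_of_dual {D : KKFields m M} {k : Fin m} (he : e ∈ 𝒜 (Fin 3) M) (hy : y ∈
    e.target) (h : (D.base e).dual k y = twistVec o D.g D.X w e y) (α : Fin 3) : D.twist o k e α y =
    pd α (fun z => w (e.symm z)) y := by
  have hfac := LocalFields.factor_ne_zero (L := D.base e) (x := y) (X := fun z => D.X (e.symm z))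
    (o.sign_mul_self he hy)
  have hd := D.g.det_comp2_neg he hy
  rw [D.twist_eq_factor he hy, h]
  have hf : twistVec o D.g D.X w e y = ((D.base e).factor (o.sign e y) (fun z => D.X (e.symm z))
      y)⁻¹ • (((D.base e).g y)⁻¹ *ᵥ fun γ => pd γ (fun z => w (e.symm z)) y) := rfl
  rw [hf, mulVec_smul, mulVec_mulVec, mmul_inv _ (isUnit_iff_ne_zero.2 (show ((D.base e).g y).det ≠
    0 from hd.ne)), one_mulVec, Pi.smul_apply, smul_eq_mul, ← mul_assoc, mul_inv_cancel₀ hfac,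
    one_mul]

lemma KKFields.dual_eq_of_F {D : KKFields m M} {f : Fin m → ℝ^(Fin 3)} (hF : ∀ l, comp2 (D.F l) e y
    = skew (∑ q, (D.xi (e.symm y))⁻¹ l q • f q)) (k : Fin m) : (D.base e).dual k y = f k := by
  have hxu : IsUnit (D.xi (e.symm y)).det := isUnit_iff_ne_zero.2 (D.xi_posDef _).det_pos.ne'
  have h2 : ∀ l, comp2 (D.F l) e y = ∑ q, (D.xi (e.symm y))⁻¹ l q • skew (f q) := fun l => by
    rw [hF]
    ext α β
    fin_cases α <;> fin_cases β <;> simp [skew, msum]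
  have h3 : (D.base e).Flow k y = ∑ l, D.xi (e.symm y) k l • comp2 (D.F l) e y := rfl
  rw [LocalFields.dual, h3]
  simp only [h2, Finset.smul_sum, smul_smul]
  rw [sum_comm]
  simp only [← Finset.sum_smul, ← mmul, mmul_inv _ hxu, mone, ite_smul, one_smul, zero_smul]
  simp [dualVec_skew]

section

lemma target_smooth (hu : ContMDiff 𝕀 (Fin 3) 𝓘(ℝ, Target m) ∞ u) (A : TargetIndex m) : ContMDiff 𝕀
    (Fin 3) 𝓘(ℝ, ℝ) ∞ fun x => u x A := (ContinuousLinearMap.proj (R := ℝ) (φ := fun _ : TargetIndex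
    m => ℝ) A).contMDiff.comp hu

/-- The metric `e^{-2X} g̃`. -/
def baseMetric (gt : LorentzMetric (Fin 3) M)
    (hu : ContMDiff 𝕀 (Fin 3) 𝓘(ℝ, Target m) ∞ u) : LorentzMetric (Fin 3) M :=
  gt.conf (fun x => -(2 * (u x).X)) (contMDiff_const.mul (target_smooth hu _)).neg

/-- The vectors dual to the curvature forms. -/
def curvVec (o : OrientationForm M) (gt : LorentzMetric (Fin 3) M)
    (hu : ContMDiff 𝕀 (Fin 3) 𝓘(ℝ, Target m) ∞ u) (k : Fin m)
    (e : Chart M (Fin 3)) (y : ℝ^(Fin 3)) : Fin 3 → ℝ :=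
  ∑ q, (u (e.symm y)).xi⁻¹ k q •
    twistVec o (baseMetric gt hu) (fun x => (u x).X) (fun x => (u x).omega q) e y

lemma skew_transpose (f : ℝ^(Fin 3)) : (skew f)ᵀ = -skew f := by
  ext α β
  fin_cases α <;> fin_cases β <;> simp [skew]

lemma comp2_curv (hu : ContMDiff 𝕀 (Fin 3) 𝓘(ℝ, Target m) ∞ u) (k : Fin m) (he : e ∈ 𝒜 (Fin 3) M)
    (hy : y ∈ e.target) : comp2 (ofComp fun e y => skew (curvVec o gt hu k e y)) e y = skew (curvVec
    o gt hu k e y) := by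
  refine comp2_ofComp he hy fun e' he' hs => ?_
  rw [← skew_adjugate, curvVec, curvVec, mulVec_sum]
  congr 1
  refine sum_ext fun q => ?_
  rw [mulVec_smul, twistVec_change (w := fun x => (u x).omega q) (target_smooth hu _) he he' hy hs,
    show e'.symm (rep e e' id y) = e.symm y from e'.left_inv hs]

/-- The fields determined by a metric and a map. -/
def fieldsOf (o : OrientationForm M) (gt : LorentzMetric (Fin 3) M)
    (hu : ContMDiff 𝕀 (Fin 3) 𝓘(ℝ, Target m) ∞ u) (hxi : ∀ x, (u x).xi.PosDef) :
    KKFields m M where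
  g := baseMetric gt hu
  xi x := (u x).xi
  xi_smooth k l := target_smooth hu _
  xi_posDef := hxi
  F k := ofComp fun e y => skew (curvVec o gt hu k e y)
  F_alt k x v := ofComp_self (fun _ _ => skew_transpose _) x v
  F_smooth k e he i j y hy := by
    have hxs : MSmooth (fun z => (u (e.symm z)).xi) y := fun k l =>
      smooth_comp_symm (target_smooth hu _) he hy
    have h1 : ∀ μ, Smooth (fun z => curvVec o gt hu k e z μ) y := fun μ => by
      simp only [curvVec, Finset.sum_apply, Pi.smul_apply, smul_eq_mul]
      exact ContDiffAt.sum fun q _ => (hxs.inv (hxi _).det_pos.ne' k q).mul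
        (twistVec_smooth (target_smooth hu _) (target_smooth hu _) he hy μ)
    refine ContDiffAt.contDiffWithinAt (ContDiffAt.congr_of_eventuallyEq (f := fun z =>
      skew (curvVec o gt hu k e z) i j) ?_ ?_)
    · fin_cases i <;> fin_cases j <;>
        first | exact contDiffAt_const | exact h1 _ | exact (h1 _).neg
    · filter_upwards [e.open_target.mem_nhds hy] with z hz
      rw [comp2_curv hu k he hz]

lemma corresponds_fieldsOf (hu : ContMDiff 𝕀 (Fin 3) 𝓘(ℝ, Target m) ∞ u) (hxi : ∀ x, (u
    x).xi.PosDef) (hX : ∀ x, (u x).X = (1 / 2) * log (u x).xi.det) : Corresponds o (fieldsOf o gt hu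
    hxi) gt u where
  smooth := hu
  X_eq := hX
  xi_eq _ := rfl
  metric_eq x := by
    change _ = exp (2 * (u x).X) • (exp (-(2 * (u x).X)) • gt.val x)
    rw [smul_smul, ← Real.exp_add, add_neg_cancel, Real.exp_zero, one_smul]
  twist_eq e he y hy k α := by
    have hXe : (fieldsOf o gt hu hxi).X = fun x => (u x).X := funext fun z => (hX z).symm
    refine KKFields.twist_eq_of_dual (w := fun x => (u x).omega k) he hy ?_ α
    rw [hXe]
    exact KKFields.dual_eq_of_F (f := fun q => twistVec o (baseMetric gt hu) (fun x => (u x).X) (fun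
      x => (u x).omega q) e y) (fun l => comp2_curv hu l he hy) k

lemma Corresponds.dual_eq {D : KKFields m M} (h : Corresponds o D gt u) (he : e ∈ 𝒜 (Fin 3) M) (hy :
    y ∈ e.target) (l : Fin m) (μ : Fin 3) : (D.base e).dual l y μ = ((D.base e).factor (o.sign e y)
    (fun z => D.X (e.symm z)) y)⁻¹ * ∑ γ, ((D.base e).g y)⁻¹ μ γ * pd γ (fun z => (u (e.symm
    z)).omega l) y := by
  refine LocalFields.dual_eq (L := D.base e) (E := fun k γ => pd γ (fun z => (u (e.symm z)).omega k)
    y) (o.sign_mul_self he hy) (D.g.det_comp2_neg he hy) (fun k γ => ?_) l μ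
  rw [← h.twist_eq e he y hy]
  exact D.twist_eq_factor he hy k γ

lemma KKFields.F_eq_sum_skew (D : KKFields m M) (k : Fin m) (α β : Fin 3) : comp2 (D.F k) e y α β =
    ∑ q, (D.xi (e.symm y))⁻¹ k q * skew ((D.base e).dual q y) α β := by
  simp only [← LocalFields.Flow_eq_skew (L := D.base e) (fun k => D.F_antisymm k e y)]
  exact LocalFields.F_eq_sum_Flow (L := D.base e) (D.xi_posDef _).det_pos.ne' k α β

lemma Corresponds.unique {D D' : KKFields m M} (h : Corresponds o D gt u) (h' : Corresponds o D' gt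
    u) : D' = D := by
  have hxi : D'.xi = D.xi := funext fun x => (h'.xi_eq x).symm.trans (h.xi_eq x)
  have hg : D'.g.val = D.g.val := funext fun x => smul_right_injective _ (Real.exp_pos (2 * (u
    x).X)).ne' ((h'.metric_eq x).symm.trans (h.metric_eq x))
  refine SymmetricSpacetime.KKFields_ext hg hxi (funext fun k => tensor2_ext fun e he y hy => ?_)
  have hgm : (D'.base e).g = (D.base e).g := by
    change comp2 D'.g.val e = comp2 D.g.val e
    rw [hg]
  have hX : D'.X = D.X := funext fun x => (h'.X_eq x).symm.trans (h.X_eq x)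
  have hdual : ∀ l, (D'.base e).dual l y = (D.base e).dual l y := fun l => funext fun μ => by
    rw [h.dual_eq he hy, h'.dual_eq he hy, LocalFields.factor, LocalFields.factor, hgm, hX]
  ext α β
  rw [D.F_eq_sum_skew, D'.F_eq_sum_skew, hxi]
  simp only [hdual]

end

end

section

variable {M : Type*} [TopologicalSpace M] {ι : Type*} [Fintype ι] [DecidableEq ι] [ChartedSpace ℝ^ι
  M] [IsManifold 𝕀 ι ∞ M] {e : Chart M ι} {y : ℝ^ι}

/-- The 1-form with given components in a chart. -/
def oneFormOf (e : Chart M ι) (A : ι → ℝ^ι → ℝ) : OneForm ι M := fun x =>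
  ∑ j, A j (e x) • (LinearMap.proj j ∘ₗ (tder ι ι e x).toLinearMap)

lemma comp1_oneFormOf (he : e ∈ 𝒜 ι M) (hy : y ∈ e.target) (A : ι → ℝ^ι → ℝ) (i : ι) : comp1
    (oneFormOf e A) e i y = A i y := by
  have h : tder ι ι e (e.symm y) (tder ι ι e.symm y (psingle i 1)) = psingle i 1 := tder_chart_symm
    he hy _
  have h1 : comp1 (oneFormOf e A) e i y = ∑ j, A j (e (e.symm y)) * tder ι ι e (e.symm y) (tder ι ι
      e.symm y (psingle i 1)) j := by
    change (∑ j, A j (e (e.symm y)) • (LinearMap.proj j ∘ₗ (tder ι ι e (e.symm y)).toLinearMap) :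
      ℝ^ι →ₗ[ℝ] ℝ) (tder ι ι e.symm y (psingle i 1)) = _
    simp only [LinearMap.sum_apply, LinearMap.smul_apply, smul_eq_mul]
    rfl
  rw [h1, h, e.right_inv hy]
  simp [psingle_apply]

end

theorem Corresponds.exists_potential {m : ℕ} {M : Type*} [TopologicalSpace M] [ChartedSpace ℝ^(Fin
    3) M] [IsManifold 𝕀 (Fin 3) ∞ M] {o : OrientationForm M} {D : KKFields m M} {gt : LorentzMetric
    (Fin 3) M} {u : M → Target m} (h : Corresponds o D gt u) (hE : EinsteinWaveMap gt u) (x : M) : ∃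
    U : Set M, IsOpen U ∧ x ∈ U ∧ ∃ a : Fin m → OneForm (Fin 3) M, ∀ k, IsPotentialOn U (a k) (D.F
    k) := by
  set e := chartAt ℝ^(Fin 3) x
  have he : e ∈ 𝒜 (Fin 3) M := chart_mem x
  have hx : x ∈ e.source := mem_chart_source _ x
  set f : Fin m → Fin 3 → ℝ^(Fin 3) → ℝ := fun k μ y => ∑ l, (D.xi (e.symm y))⁻¹ k l * (D.base
    e).dual l y μ with hf
  have hfs : ∀ k μ, ∀ᶠ y in 𝓝 (e x), Smooth (f k μ) y := fun k μ => by
    filter_upwards [e.open_target.mem_nhds (e.map_source hx)] with y hy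
    have hr := D.base_regular he hy
    exact ContDiffAt.sum fun l _ => (hr.xi_smooth.inv hr.xi_det k l).mul (LocalFields.dual_smooth hr
      l μ)
  have hdiv : ∀ k, ∀ᶠ y in 𝓝 (e x), ∑ μ, pd μ (f k μ) y = 0 := fun k => by
    filter_upwards [e.open_target.mem_nhds (e.map_source hx)] with y hy
    have hr := D.base_regular he hy
    have hrep := h.represented he hy (L := D.base e) rfl rfl rfl
    refine (hr.div_dual_eq_zero_iff hrep).2 ((hr.waves_eq_zero_iff hrep).1 ?_).2.2 k
    rw [h.conf_eq e]
    exact hE.wave e he y hy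
  have hF : ∀ k y α β, comp2 (D.F k) e y α β = skew (fun μ => f k μ y) α β := fun k y α β => by
    rw [D.F_eq_sum_skew]
    fin_cases α <;> fin_cases β <;> simp [skew, hf]
  choose A hA hAe using fun k => exists_curl_eq (hfs k) (hdiv k)
  obtain ⟨V, hV, hVo, hxV⟩ := eventually_nhds_iff.1 (eventually_all.2 hAe)
  refine ⟨e.source ∩ e ⁻¹' V, e.isOpen_inter_preimage hVo, ⟨hx, hxV⟩, fun k => oneFormOf e (A k),
    fun k => isPotentialOn_of_local fun x' hx' => ?_⟩
  have hc : ∀ i, ∀ᶠ y in 𝓝 (e x'), comp1 (oneFormOf e (A k)) e i y = A k i y := fun i => by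
    filter_upwards [e.open_target.mem_nhds (e.map_source hx'.1)] with y hy
    exact comp1_oneFormOf he hy _ i
  refine ⟨e, he, hx'.1, fun i => (hA k i).contDiffAt.congr_of_eventuallyEq (hc i), ?_⟩
  ext i j
  rw [hF, ← hV _ hx'.2, extComp, of_apply, pd_congr (hc i), pd_congr (hc j)]

section

variable {n m : ℕ} {N : Type*} [TopologicalSpace N] [ChartedSpace ℝ^(Fin n) N] {G : Type*}
  [TopologicalSpace G] [ChartedSpace ℝ^(Fin m) G] {e : Chart N (Fin n)} {φ : Chart G (Fin m)}

/-- The product of two charts. -/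
def prodChart (e : Chart N (Fin n)) (φ : Chart G (Fin m)) :
    Chart (N × G) (Fin (n + m)) :=
  (e.prod φ).trans (Fin.appendHomeomorph n m).toOpenPartialHomeomorph

lemma prodChart_source : (prodChart e φ).source = e.source ×ˢ φ.source := by simp [prodChart]

lemma mem_prodChart_target {z : Fin (n + m) → ℝ} : z ∈ (prodChart e φ).target ↔ z♭ ∈ e.target ∧ z♯ ∈
    φ.target := by
  simp only [prodChart, trans_target, Homeomorph.toOpenPartialHomeomorph_target, Set.univ_inter,
    OpenPartialHomeomorph.prod_target]
  exact Iff.rfl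

instance prodChartedSpace : ChartedSpace (Fin (n + m) → ℝ) (N × G) where
  atlas := Set.image2 prodChart (atlas ℝ^(Fin n) N) (atlas ℝ^(Fin m) G)
  chartAt p := prodChart (chartAt _ p.1) (chartAt _ p.2)
  mem_chart_source p := by
    rw [prodChart_source]
    exact ⟨mem_chart_source _ _, mem_chart_source _ _⟩
  chart_mem_atlas p := ⟨_, chart_mem_atlas _ _, _, chart_mem_atlas _ _, rfl⟩

variable [IsManifold 𝕀 (Fin n) ∞ N] [IsManifold 𝕀 (Fin m) ∞ G]

instance prodIsManifold : IsManifold 𝕀 (Fin (n + m)) ∞ (N × G) := by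
  refine isManifold_of_contDiffOn _ _ _ ?_
  rintro _ _ ⟨e, he, φ, hφ, rfl⟩ ⟨e', he', φ', hφ', rfl⟩ z hz
  have hz1 : z ∈ (prodChart e φ).target := hz.1.1
  have hz2 : (prodChart e φ).symm z ∈ (prodChart e' φ').source := hz.1.2
  rw [mem_prodChart_target] at hz1
  rw [prodChart_source] at hz2
  have hm := IsManifold.subset_maximalAtlas (I := 𝕀 (Fin n)) (n := ∞) (M := N)
  have hm' := IsManifold.subset_maximalAtlas (I := 𝕀 (Fin m)) (n := ∞) (M := G)
  have h1 := (smooth_change (hm he) (hm he') hz1.1 hz2.1).comp z smooth_base.contDiffAt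
  have h2 := (smooth_change (hm' hφ) (hm' hφ') hz1.2 hz2.2).comp z smooth_fib.contDiffAt
  refine (contDiffAt_pi.2 fun i => ?_).contDiffWithinAt
  refine addCases (fun a => ?_) (fun k => ?_) i
  · refine (contDiffAt_pi.1 h1 a).congr_of_eventuallyEq (.of_forall fun w => ?_)
    exact Fin.append_left _ _ a
  · refine (contDiffAt_pi.1 h2 k).congr_of_eventuallyEq (.of_forall fun w => ?_)
    exact Fin.append_right _ _ k

section

variable {E H Q : Type*} [NormedAddCommGroup E] [NormedSpace ℝ E] [TopologicalSpace H] {I :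
  ModelWithCorners ℝ E H} [TopologicalSpace Q] [ChartedSpace H Q] {q : Q}

lemma contMDiffAt_append {f : Q → ℝ^(Fin n)} {g : Q → ℝ^(Fin m)} (hf : ContMDiffAt I 𝕀 (Fin n) ∞ f
    q) (hg : ContMDiffAt I 𝕀 (Fin m) ∞ g q) : ContMDiffAt I 𝕀 (Fin (n + m)) ∞ (fun x => append (f x)
    (g x)) q := by
  simp only [append_eq_add]
  exact ((inclLeft n m).contMDiff.contMDiffAt.comp q hf).add ((inclRight n
    m).contMDiff.contMDiffAt.comp q hg)

lemma contMDiffAt_prodMk {f : Q → N} {g : Q → G} (hf : ContMDiffAt I 𝕀 (Fin n) ∞ f q)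
    (hg : ContMDiffAt I 𝕀 (Fin m) ∞ g q) :
    ContMDiffAt I 𝕀 (Fin (n + m)) ∞ (fun x => (f x, g x)) q := by
  set e := chartAt ℝ^(Fin n) (f q)
  set φ := chartAt ℝ^(Fin m) (g q)
  have he : e ∈ 𝒜 (Fin n) N := chart_mem _
  have hφ : φ ∈ 𝒜 (Fin m) G := chart_mem _
  have h1 : f q ∈ e.source := mem_chart_source _ _
  have h2 : g q ∈ φ.source := mem_chart_source _ _
  have hχ : prodChart e φ ∈ 𝒜 (Fin (n + m)) (N × G) :=
    chart_mem (I := 𝕀 (Fin (n + m))) (f q, g q)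
  have h3 := contMDiffAt_append ((smooth_chart he h1).comp q hf)
    ((smooth_chart hφ h2).comp q hg)
  have h4 : (prodChart e φ) (f q, g q) ∈ (prodChart e φ).target :=
    (prodChart e φ).map_source (by rw [prodChart_source]; exact ⟨h1, h2⟩)
  refine (ContMDiffAt.comp q (smooth_symm hχ h4) h3).congr_of_eventuallyEq ?_
  filter_upwards [hf.continuousAt.preimage_mem_nhds (e.open_source.mem_nhds h1),
    hg.continuousAt.preimage_mem_nhds (φ.open_source.mem_nhds h2)] with x hx1 hx2
  exact ((prodChart e φ).left_inv (x := (f x, g x))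
    (by rw [prodChart_source]; exact ⟨hx1, hx2⟩)).symm

end

lemma smooth_fst (p : N × G) : ContMDiffAt 𝕀 (Fin (n + m)) 𝕀 (Fin n) ∞ (Prod.fst : N × G → N) p :=
    by
  set e := chartAt ℝ^(Fin n) p.1
  set φ := chartAt ℝ^(Fin m) p.2
  have he : e ∈ 𝒜 (Fin n) N := chart_mem _
  have hp : p ∈ (prodChart e φ).source := mem_chart_source (Fin (n + m) → ℝ) p
  have hχ : prodChart e φ ∈ 𝒜 (Fin (n + m)) (N × G) := chart_mem (I := 𝕀 (Fin (n + m))) p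
  refine (ContMDiffAt.comp p (g := fun z => e.symm z♭) (ContMDiffAt.comp _ (smooth_symm he
    (mem_prodChart_target.1 ((prodChart e φ).map_source hp)).1) smooth_base.contMDiff.contMDiffAt)
    (smooth_chart hχ hp)).congr_of_eventuallyEq ?_
  filter_upwards [(prodChart e φ).open_source.mem_nhds hp] with x hx
  exact (congrArg Prod.fst ((prodChart e φ).left_inv hx)).symm

lemma smooth_snd (p : N × G) : ContMDiffAt 𝕀 (Fin (n + m)) 𝕀 (Fin m) ∞ (Prod.snd : N × G → G) p :=
    by
  set e := chartAt ℝ^(Fin n) p.1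
  set φ := chartAt ℝ^(Fin m) p.2
  have hφ : φ ∈ 𝒜 (Fin m) G := chart_mem _
  have hp : p ∈ (prodChart e φ).source := mem_chart_source (Fin (n + m) → ℝ) p
  have hχ : prodChart e φ ∈ 𝒜 (Fin (n + m)) (N × G) := chart_mem (I := 𝕀 (Fin (n + m))) p
  refine (ContMDiffAt.comp p (g := fun z => φ.symm z♯) (ContMDiffAt.comp _ (smooth_symm hφ
    (mem_prodChart_target.1 ((prodChart e φ).map_source hp)).2) smooth_fib.contMDiff.contMDiffAt)
    (smooth_chart hχ hp)).congr_of_eventuallyEq ?_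
  filter_upwards [(prodChart e φ).open_source.mem_nhds hp] with x hx
  exact (congrArg Prod.snd ((prodChart e φ).left_inv hx)).symm

lemma prodChart_mem (he : e ∈ 𝒜 (Fin n) N) (hφ : φ ∈ 𝒜 (Fin m) G) : prodChart e φ ∈ 𝒜 (Fin (n + m))
    (N × G) := by
  refine mem_smoothCharts (fun p hp => ?_) fun z hz => ?_
  · rw [prodChart_source] at hp
    exact contMDiffAt_append (f := fun p : N × G => e p.1) (g := fun p : N × G => φ p.2)
      (ContMDiffAt.comp p (g := e) (smooth_chart he hp.1) (smooth_fst p)) (ContMDiffAt.comp p (g :=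
      φ) (smooth_chart hφ hp.2) (smooth_snd p))
  · rw [mem_prodChart_target] at hz
    exact contMDiffAt_prodMk (ContMDiffAt.comp z (smooth_symm he hz.1)
        smooth_base.contMDiff.contMDiffAt) (ContMDiffAt.comp z (smooth_symm hφ hz.2)
        smooth_fib.contMDiff.contMDiffAt)

end

lemma pd_comp_castAdd {m : ℕ} {f : ℝ^(Fin 3) → ℝ} {z : ℝ^(𝔽 m)} (hf : Diff f z♭) (i : 𝔽 m) : pd i
    (fun w => f w♭) z = addCases (motive := fun _ => ℝ) (fun α => pd α f z♭) (fun _ => 0) i := by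
  have h := fderiv_fun_comp z hf (smooth_base.differentiable (by decide)).differentiableAt
  rw [pd, h, ContinuousLinearMap.comp_apply, fderiv_comp_castAdd]
  refine addCases (fun α => ?_) (fun k => ?_) i
  · rw [addCases_left, SymmetricSpacetime.IsAdapted.single_castAdd_comp, pd]
  · rw [addCases_right, ← map_zero (fderiv ℝ f z♭)]
    congr 1
    ext α
    simp [psingle_apply, Fin.ext_iff]
    omega

section

variable (b)

/-- The invariant 1-forms on `G` dual to the basis `b`. -/
def maurerCartan (k : Fin m) (h : G) : ℝ^(Fin m) →ₗ[ℝ] ℝ :=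
  LinearMap.comp (b.coord k : ℝ^(Fin m) →ₗ[ℝ] ℝ)
    (tder (Fin m) (Fin m) (fun y : G => y * h⁻¹) h).toLinearMap

lemma contMDiff_mul_const (h : G) : ContMDiff 𝕀 (Fin m) 𝕀 (Fin m) ∞ (fun y : G => y * h) :=
    contMDiff_id.mul contMDiff_const

lemma maurerCartan_translate (k : Fin m) (h : G) (c : ℝ^(Fin m)) : maurerCartan b k h (translate h
    c) = b.coord k c := by
  have h1 := tder_comp (g := fun y : G => y * h⁻¹) (f := fun a : G => a * h) (x := 1)
    (contMDiff_mul_const _).contMDiffAt (contMDiff_mul_const _).contMDiffAt c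
  rw [one_mul, show (fun a : G => a * h * h⁻¹) = fun a => a from funext fun a =>
    mul_inv_cancel_right a h, tder_id] at h1
  exact congrArg (b.coord k) h1.symm

lemma maurerCartan_mul (k : Fin m) (g h : G) (c : ℝ^(Fin m)) : maurerCartan b k (g * h) (tder (Fin
    m) (Fin m) (fun y : G => g * y) h c) = maurerCartan b k h c := by
  have h1 := tder_comp (g := fun y : G => y * (g * h)⁻¹) (f := fun y : G => g * y) (x := h)
    (contMDiff_mul_const _).contMDiffAt (contMDiff_const.mul contMDiff_id).contMDiffAt c
  rw [show (fun y : G => g * y * (g * h)⁻¹) = fun y => y * h⁻¹ from funext fun y => by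
    rw [mul_inv, mul_mul_mul_comm, mul_inv_cancel, one_mul]] at h1
  exact congrArg (b.coord k) h1.symm

end

section

open TopologicalSpace

variable (b) {U : Opens M}

/-- The coordinate vectors of a chart. -/
def chartVec {n : ℕ} {N : Type*} [TopologicalSpace N] [ChartedSpace ℝ^(Fin n) N]
    (e : Chart N (Fin n)) (z : ℝ^(Fin n)) (i : Fin n) : Fin n → ℝ :=
  tder (Fin n) (Fin n) e.symm z (psingle i 1)

/-- The projection of the trivial bundle. -/
def bundleProj (p : U × G) : M := p.1

lemma contMDiff_bundleProj : ContMDiff 𝕀 𝔽 m 𝕀 (Fin 3) ∞ (bundleProj : U × G → M) := fun p =>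
    ContMDiffAt.comp p (contMDiff_subtype_val _) (smooth_fst p)

/-- The derivative of the projection. -/
def dProj (p : U × G) : ℝ^(𝔽 m) →L[ℝ] ℝ^(Fin 3) :=
  tder 𝔽 m (Fin 3) (bundleProj : U × G → M) p

/-- The derivative of the projection to the fibre. -/
def dFibre (p : U × G) : ℝ^(𝔽 m) →L[ℝ] ℝ^(Fin m) :=
  tder 𝔽 m (Fin m) (Prod.snd : U × G → G) p

/-- Product charts of the trivial bundle, with coordinate vectors along the fibres given by the
basis of the Lie algebra. -/
structure IsBundleChart (e : Chart M (Fin 3))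
    (Ψ : Chart (U × G) 𝔽 m) : Prop where
  base_mem : e ∈ 𝒜 (Fin 3) M
  mem : Ψ ∈ 𝒜 𝔽 m (U × G)
  target : ∀ z ∈ Ψ.target, z♭ ∈ e.target
  proj_eq : ∀ z ∈ Ψ.target, bundleProj (Ψ.symm z) = e.symm z♭
  fibre_castAdd : ∀ z ∈ Ψ.target, ∀ α,
    dFibre (Ψ.symm z) (chartVec Ψ z (castAdd m α)) = 0
  fibre_natAdd : ∀ z ∈ Ψ.target, ∀ k,
    dFibre (Ψ.symm z) (chartVec Ψ z (natAdd 3 k)) = translate (Ψ.symm z).2 (b k)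

lemma fderiv_comp_natAdd {n m : ℕ} (z v : Fin (n + m) → ℝ) : fderiv ℝ (fun z : Fin (n + m) → ℝ =>
    z♯) z v = v♯ := by
  have h : HasFDerivAt (fun z : Fin (n + m) → ℝ => z♯) (ContinuousLinearMap.pi fun a =>
      ContinuousLinearMap.proj (natAdd n a)) z := (ContinuousLinearMap.pi (R := ℝ) fun a =>
      ContinuousLinearMap.proj (φ := fun _ => ℝ) (natAdd n a : Fin (n + m))).hasFDerivAt
  rw [h.fderiv]
  rfl

lemma exists_bundleChart (p : U × G) : ∃ e Ψ, IsBundleChart b (U := U) e Ψ ∧ p ∈ Ψ.source := by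
  set e := chartAt ℝ^(Fin 3) (p.1 : M)
  have he : e ∈ 𝒜 (Fin 3) M := chart_mem _
  have hU : Nonempty U := ⟨p.1⟩
  set eU := e.subtypeRestr hU
  have heU : eU ∈ 𝒜 (Fin 3) U := StructureGroupoid.subtypeRestr_mem_maximalAtlas (chart_mem_atlas _
    _) hU
  obtain ⟨φ, hφ, hpφ, hφb⟩ := exists_log_chart b p.2
  have hm := prodChart_mem heU hφ
  have hs : ∀ z ∈ (prodChart eU φ).target, ∀ v, dFibre ((prodChart eU φ).symm z) (tder 𝔽 m 𝔽 m
      (prodChart eU φ).symm z v) = tder (Fin m) (Fin m) φ.symm z♯ v♯ := by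
    intro z hz v
    have h1 := tder_comp (g := (Prod.snd : U × G → G)) (f := (prodChart eU φ).symm) (x := z)
      (smooth_snd _) (smooth_symm hm hz) v
    refine h1.symm.trans ((tder_comp (g := φ.symm) (f := fun z : 𝔽 m → ℝ => z♯) (x := z)
      (smooth_symm hφ (mem_prodChart_target.1 hz).2) smooth_fib.contMDiff.contMDiffAt v).trans ?_)
    rw [tder_eq_fderiv, fderiv_comp_natAdd]
  refine ⟨e, prodChart eU φ, ⟨he, hm, fun z hz => ?_, fun z hz => ?_, fun z hz α => ?_, fun z hz k
    => ?_⟩, ?_⟩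
  · exact e.subtypeRestr_target_subset hU (mem_prodChart_target.1 hz).1
  · exact e.subtypeRestr_symm_apply hU (mem_prodChart_target.1 hz).1
  · refine (hs z hz _).trans ?_
    rw [show (psingle (castAdd m α) 1 : ℝ^(𝔽 m)) ∘ natAdd 3 = 0 by
      ext k
      simp [psingle_apply, Fin.ext_iff]
      omega, map_zero]
  · refine (hs z hz _).trans ?_
    rw [show (psingle (natAdd 3 k) 1 : ℝ^(𝔽 m)) ∘ natAdd 3 = psingle k 1 by
      ext l
      simp [psingle_apply]]
    exact hφb _ (mem_prodChart_target.1 hz).2 k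
  · rw [prodChart_source]
    refine ⟨?_, hpφ⟩
    rw [OpenPartialHomeomorph.subtypeRestr_source]
    exact mem_chart_source _ (p.1 : M)

variable {b} {Ψ : Chart (U × G) 𝔽 m}

lemma IsBundleChart.dProj_coordVec (h : IsBundleChart b e Ψ) (hz : z ∈ Ψ.target) (i : 𝔽 m) : dProj
    (Ψ.symm z) (chartVec Ψ z i) = tder (Fin 3) (Fin 3) e.symm z♭ ((psingle i 1 : ℝ^(𝔽 m)) ∘ castAdd
    m) := by
  have h1 := tder_comp (g := (bundleProj : U × G → M)) (f := Ψ.symm) (x := z)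
    contMDiff_bundleProj.contMDiffAt (smooth_symm h.mem hz) (psingle i 1)
  refine h1.symm.trans ?_
  rw [tder_congr (g := fun z => e.symm z♭) (mem_of_superset (Ψ.open_target.mem_nhds hz) h.proj_eq)]
  refine (tder_comp (g := e.symm) (f := fun z : 𝔽 m → ℝ => z♭) (x := z) (smooth_symm h.base_mem
    (h.target z hz)) smooth_base.contMDiff.contMDiffAt _).trans ?_
  rw [tder_eq_fderiv, fderiv_comp_castAdd]

lemma IsBundleChart.dProj_castAdd (h : IsBundleChart b e Ψ) (hz : z ∈ Ψ.target) (α : Fin 3) : dProj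
    (Ψ.symm z) (chartVec Ψ z (castAdd m α)) = chartVec e z♭ α := by
  refine (h.dProj_coordVec hz _).trans ?_
  rw [SymmetricSpacetime.IsAdapted.single_castAdd_comp]
  rfl

lemma IsBundleChart.dProj_natAdd (h : IsBundleChart b e Ψ) (hz : z ∈ Ψ.target) (k : Fin m) : dProj
    (Ψ.symm z) (chartVec Ψ z (natAdd 3 k)) = 0 := by
  refine (h.dProj_coordVec hz _).trans ?_
  rw [show (psingle (natAdd 3 k) 1 : ℝ^(𝔽 m)) ∘ castAdd m = 0 by
    ext α
    simp [psingle_apply, Fin.ext_iff]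
    omega, map_zero]

variable (b)

/-- The connection `θᵏ + aᵏ`. -/
def bundleConn (a : Fin m → OneForm (Fin 3) M) (k : Fin m) (p : U × G) :
    ℝ^(𝔽 m) →ₗ[ℝ] ℝ :=
  LinearMap.comp (a k (bundleProj p) : ℝ^(Fin 3) →ₗ[ℝ] ℝ) (dProj p).toLinearMap
    + (maurerCartan b k p.2).comp (dFibre p).toLinearMap

/-- The metric of the base, on plain vectors. -/
def baseBil (D : KKFields m M) (x : M) : BilinForm ℝ ℝ^(Fin 3) := D.g.val x

/-- The metric `g + ξₖₗ (θᵏ + aᵏ) (θˡ + aˡ)`. -/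
def bundleBil (D : KKFields m M) (a : Fin m → OneForm (Fin 3) M) (p : U × G) :
    BilinForm ℝ ℝ^(𝔽 m) :=
  (baseBil D (bundleProj p)).compl₁₂ (dProj p).toLinearMap (dProj p).toLinearMap
    + ∑ k, ∑ l, D.xi (bundleProj p) k l • (LinearMap.mul ℝ ℝ).compl₁₂
        (bundleConn b a k p) (bundleConn b a l p)

variable {b} {a : Fin m → OneForm (Fin 3) M}

lemma bundleConn_apply (k : Fin m) (p : U × G) (v : ℝ^(𝔽 m)) : bundleConn b a k p v = a k
    (bundleProj p) (dProj p v) + maurerCartan b k p.2 (dFibre p v) := rfl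

lemma bundleBil_apply (p : U × G) (v w : ℝ^(𝔽 m)) : bundleBil b D a p v w = baseBil D (bundleProj p)
    (dProj p v) (dProj p w) + ∑ k, ∑ l, D.xi (bundleProj p) k l * (bundleConn b a k p v * bundleConn
    b a l p w) := by
  rw [bundleBil, LinearMap.add_apply, LinearMap.add_apply]
  simp only [LinearMap.sum_apply, LinearMap.smul_apply, smul_eq_mul]
  rfl

lemma IsBundleChart.conn_castAdd (h : IsBundleChart b e Ψ) (hz : z ∈ Ψ.target) (k : Fin m) (α : Fin
    3) : bundleConn b a k (Ψ.symm z) (chartVec Ψ z (castAdd m α)) = comp1 (a k) e α z♭ := by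
  rw [bundleConn_apply, h.fibre_castAdd z hz, map_zero, add_zero, h.dProj_castAdd hz]
  exact oneForm_congr (a := a k) (h.proj_eq z hz) _

lemma IsBundleChart.conn_natAdd (h : IsBundleChart b e Ψ) (hz : z ∈ Ψ.target) (k l : Fin m) :
    bundleConn b a k (Ψ.symm z) (chartVec Ψ z (natAdd 3 l)) = if l = k then 1 else 0 := by
  have h0 : (a k (bundleProj (Ψ.symm z)) : ℝ^(Fin 3) →ₗ[ℝ] ℝ) 0 = 0 := map_zero _
  rw [bundleConn_apply, h.dProj_natAdd hz, h.fibre_natAdd z hz]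
  refine (congrArg₂ (· + ·) h0 (maurerCartan_translate b k _ (b l))).trans ?_
  rw [zero_add]
  rw [Module.Basis.coord_apply, Module.Basis.repr_self, Finsupp.single_apply]

lemma bundle_eq_zero {p : U × G} {v : ℝ^(𝔽 m)} (h1 : dProj p v = 0) (h2 : ∀ k, bundleConn b a k p v
    = 0) : v = 0 := by
  obtain ⟨e, Ψ, h, hp⟩ := exists_bundleChart b p
  obtain ⟨z, hz, rfl⟩ : ∃ z ∈ Ψ.target, Ψ.symm z = p := ⟨Ψ p, Ψ.map_source hp, Ψ.left_inv hp⟩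
  obtain ⟨c, hc⟩ : ∃ c : 𝔽 m → ℝ, v = ∑ i, c i • chartVec Ψ z i := eq_sum_coordVec h.mem hz v
  have e1 : ∀ α, dProj (Ψ.symm z) (chartVec Ψ z (castAdd m α)) = _ := fun α => h.dProj_castAdd hz α
  have e2 : ∀ k, dProj (Ψ.symm z) (chartVec Ψ z (natAdd 3 k)) = _ := fun k => h.dProj_natAdd hz k
  have e3 : ∀ k l, bundleConn b a k (Ψ.symm z) (chartVec Ψ z (natAdd 3 l)) = _ := fun k l =>
      h.conn_natAdd hz k l
  rw [hc, map_sum, Fin.sum_univ_add] at h1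
  simp only [map_smul, e1, e2, smul_zero, sum_zero, add_zero] at h1
  have h3 : (fun α => c (castAdd m α)) = 0 := sum_coordVec_eq_zero h.base_mem (h.target z hz) h1
  have h4 : ∀ α, c (castAdd m α) = 0 := fun α => congrFun h3 α
  have h5 : ∀ k, c (natAdd 3 k) = 0 := fun k => by
    have := h2 k
    rw [hc, map_sum, Fin.sum_univ_add] at this
    simpa only [map_smul, e3, h4, zero_smul, map_zero, sum_zero, zero_add, smul_eq_mul, mul_ite,
      mul_one, mul_zero, Finset.sum_ite_eq', mem_univ, if_true] using this
  rw [hc, Fin.sum_univ_add]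
  simp only [h4, h5, zero_smul, sum_zero, add_zero]

lemma exists_horizontal (b : LieBasis m G) (a : Fin m → OneForm (Fin 3) M) (p : U × G) (V : ℝ^(Fin
    3)) : ∃ v : 𝔽 m → ℝ, dProj p v = V ∧ ∀ k, bundleConn b a k p v = 0 := by
  set T : ℝ^(𝔽 m) →ₗ[ℝ] ℝ^(Fin 3) × ℝ^(Fin m) := (dProj p).toLinearMap.prod (LinearMap.pi fun k =>
    bundleConn b a k p) with hT
  have hinj : Function.Injective T := by
    refine (injective_iff_map_eq_zero T).2 fun v hv => ?_
    exact bundle_eq_zero (congrArg Prod.fst hv) fun k => congrFun (congrArg Prod.snd hv) k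
  have hsurj := (LinearMap.injective_iff_surjective_of_finrank_eq_finrank (f := T) (by simp)).1 hinj
  obtain ⟨v, hv⟩ := hsurj (V, 0)
  exact ⟨v, congrArg Prod.fst hv, fun k => congrFun (congrArg Prod.snd hv) k⟩

lemma sum_xi_nonneg (D : KKFields m M) (x : M) (c : ℝ^(Fin m)) : 0 ≤ ∑ k, ∑ l, D.xi x k l * (c k * c
    l) := by
  have h := (D.xi_posDef x).posSemidef.dotProduct_mulVec_nonneg c
  refine h.trans_eq (sum_ext fun k => ?_)
  rw [star_trivial, mulVec, dotProduct, mul_sum]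
  exact sum_ext fun l => by ring

lemma sum_xi_pos (D : KKFields m M) (x : M) {c : ℝ^(Fin m)} (hc : c ≠ 0) : 0 < ∑ k, ∑ l, D.xi x k l
    * (c k * c l) := by
  have h := (D.xi_posDef x).dotProduct_mulVec_pos hc
  refine h.trans_eq (sum_ext fun k => ?_)
  rw [star_trivial, mulVec, dotProduct, mul_sum]
  exact sum_ext fun l => by ring

lemma bundleBil_lorentzian (D : KKFields m M) (a : Fin m → OneForm (Fin 3) M) (p : U × G) : ∃ v,
    bundleBil b D a p v v < 0 ∧ ∀ w, bundleBil b D a p v w = 0 → w ≠ 0 → 0 < bundleBil b D a p w w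
    := by
  obtain ⟨V, hV, hV'⟩ : ∃ V : Fin 3 → ℝ, baseBil D (bundleProj p) V V < 0 ∧ ∀ W : Fin 3 → ℝ, baseBil
    D (bundleProj p) V W = 0 → W ≠ 0 → 0 < baseBil D (bundleProj p) W W := D.g.lorentzian
    (bundleProj p)
  obtain ⟨v, rfl, hv'⟩ := exists_horizontal b a p V
  simp only [bundleBil_apply]
  refine ⟨v, ?_, fun w hw hw0 => ?_⟩
  · simpa only [hv', zero_mul, mul_zero, sum_zero, add_zero] using hV
  · simp only [hv', zero_mul, mul_zero, sum_zero, add_zero] at hw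
    by_cases h0 : dProj p w = 0
    · have hA : (fun k => bundleConn b a k p w) ≠ 0 := fun h => hw0 (bundle_eq_zero h0 fun k =>
        congrFun h k)
      rw [h0, map_zero, zero_add]
      exact sum_xi_pos D _ hA
    · exact add_pos_of_pos_of_nonneg (hV' _ hw h0) (sum_xi_nonneg D _ fun k => bundleConn b a k p w)

end

section

open TopologicalSpace

variable {U : Opens M} {a : Fin m → OneForm (Fin 3) M} {Ψ : Chart (U × G) 𝔽 m}

/-- The components of `θᵏ + aᵏ`. -/
def connComp (a : Fin m → OneForm (Fin 3) M) (e : Chart M (Fin 3)) (k : Fin m)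
    (i : 𝔽 m) (y : ℝ^(Fin 3)) : ℝ :=
  addCases (motive := fun _ => ℝ) (fun α => comp1 (a k) e α y)
    (fun l => if l = k then 1 else 0) i

/-- The components of the pull-back of a tensor field on the base. -/
def baseComp (T : Tensor2 (Fin 3) M) (e : Chart M (Fin 3))
    (i j : 𝔽 m) (y : ℝ^(Fin 3)) : ℝ :=
  addCases (motive := fun _ => ℝ) (fun α => addCases (motive := fun _ => ℝ)
    (fun β => comp2 T e y α β) (fun _ => 0) j) (fun _ => 0) i

lemma IsBundleChart.conn_eq (h : IsBundleChart b e Ψ) (hz : z ∈ Ψ.target) (k : Fin m) (i : 𝔽 m) :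
    bundleConn b a k (Ψ.symm z) (chartVec Ψ z i) = connComp a e k i z♭ := by
  refine addCases (fun α => ?_) (fun l => ?_) i
  · rw [h.conn_castAdd hz, connComp, addCases_left]
  · rw [h.conn_natAdd hz, connComp, addCases_right]

lemma IsBundleChart.base_eq (h : IsBundleChart b e Ψ) (hz : z ∈ Ψ.target) {T : Tensor2 (Fin 3) M} (B
    : BilinForm ℝ ℝ^(Fin 3)) (hB : B = T (bundleProj (Ψ.symm z))) (i j : 𝔽 m) : B (dProj (Ψ.symm z)
    (chartVec Ψ z i)) (dProj (Ψ.symm z) (chartVec Ψ z j)) = baseComp T e i j z♭ := by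
  refine addCases (fun α => ?_) (fun l => ?_) i
  · refine addCases (fun β => ?_) (fun l => ?_) j
    · rw [h.dProj_castAdd hz, h.dProj_castAdd hz, hB, baseComp, addCases_left, addCases_left]
      exact tensor2_congr (h.proj_eq z hz) _ _
    · rw [h.dProj_natAdd hz, map_zero, baseComp, addCases_left, addCases_right]
  · rw [h.dProj_natAdd hz, map_zero, baseComp, addCases_right, LinearMap.zero_apply]

lemma IsBundleChart.base_smooth (h : IsBundleChart b e Ψ) (hz : z ∈ Ψ.target) (ha : ∀ k,
    IsPotentialOn (U : Set M) (a k) (D.F k)) : (∀ k i, Smooth (connComp a e k i) z♭) ∧ ∀ i j : 𝔽 m,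
    Smooth (baseComp D.g.val e i j) z♭ := by
  have hzU : e.symm z♭ ∈ (U : Set M) := h.proj_eq z hz ▸ (Ψ.symm z).1.2
  refine ⟨fun k i => ?_, fun i j => ?_⟩
  · refine addCases (fun α => ?_) (fun l => ?_) i
    · simpa +unfoldPartialApp only [connComp, addCases_left] using (ha k).smoothAt U.isOpen
        h.base_mem (h.target z hz) hzU α
    · simpa +unfoldPartialApp only [connComp, addCases_right] using contDiffAt_const
  · refine addCases (fun α => ?_) (fun l => ?_) i
    · refine addCases (fun β => ?_) (fun l => ?_) j
      · simpa +unfoldPartialApp only [baseComp, addCases_left] using D.g.msmooth h.base_mem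
          (h.target z hz) α β
      · simpa +unfoldPartialApp only [baseComp, addCases_left, addCases_right] using contDiffAt_const
    · simpa +unfoldPartialApp only [baseComp, addCases_right] using contDiffAt_const

variable (b D) in
/-- The metric of the trivial bundle. -/
def bundleMetric (ha : ∀ k, IsPotentialOn (U : Set M) (a k) (D.F k)) :
    LorentzMetric 𝔽 m (U × G) where
  val := bundleBil b D a
  symm p v w := by
    refine (bundleBil_apply p v w).trans (Eq.trans ?_ (bundleBil_apply p w v).symm)
    refine congrArg₂ (· + ·) (D.g.symm _ _ _) ?_
    rw [sum_comm]
    refine sum_ext₂ fun k l => ?_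
    rw [← congrFun (congrFun (D.xi_transpose (bundleProj p)) k) l, tr_apply,
      mul_comm (bundleConn b a l p v)]
  lorentzian := bundleBil_lorentzian D a
  smooth := by
    refine smooth2_of_local fun p => ?_
    obtain ⟨e, Ψ, h, hp⟩ := exists_bundleChart b p
    refine ⟨Ψ, h.mem, hp, fun i j => ?_⟩
    have hz := Ψ.map_source hp
    obtain ⟨h1, h2⟩ := h.base_smooth hz ha
    refine ContDiffAt.congr_of_eventuallyEq (f := fun w => baseComp D.g.val e i j
      w♭ + ∑ k, ∑ l, D.xi (e.symm w♭) k l *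
        (connComp a e k i w♭ * connComp a e l j w♭)) ?_ ?_
    · have hc := (smooth_base (n := 3) (m := m)).contDiffAt (x := Ψ p)
      refine ((h2 i j).comp (Ψ p) hc).add (ContDiffAt.sum fun k _ => ContDiffAt.sum fun l _ => ?_)
      exact ((smooth_comp_symm (D.xi_smooth k l) h.base_mem (h.target _ hz)).comp (Ψ p) hc).mul
        (((h1 k i).comp (Ψ p) hc).mul ((h1 l j).comp (Ψ p) hc))
    · filter_upwards [Ψ.open_target.mem_nhds hz] with w hw
      refine (bundleBil_apply (Ψ.symm w) (chartVec Ψ w i) (chartVec Ψ w j)).trans ?_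
      refine congrArg₂ (· + ·) (h.base_eq hw (T := D.g.val) _ rfl i j) ?_
      simp only [h.conn_eq hw, h.proj_eq w hw]

/-- The action of `G` on the trivial bundle. -/
def bundleAct (g : G) (p : U × G) : U × G := (p.1, g * p.2)

lemma contMDiff_bundleAct : ContMDiff ((𝕀 (Fin m)).prod 𝕀 𝔽 m) 𝕀 𝔽 m ∞ (fun q : G × (U × G) =>
    bundleAct q.1 q.2) := fun q => contMDiffAt_prodMk (ContMDiffAt.comp q (smooth_fst q.2)
    contMDiffAt_snd) (contMDiffAt_fst.mul (ContMDiffAt.comp q (smooth_snd q.2) contMDiffAt_snd))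

lemma contMDiff_bundleAct_left (g : G) : ContMDiff 𝕀 𝔽 m 𝕀 𝔽 m ∞ (bundleAct g : U × G → U × G) :=
    fun p => contMDiffAt_prodMk (smooth_fst p) (contMDiffAt_const.mul (smooth_snd p))

lemma contMDiff_bundleAct_right (p : U × G) : ContMDiff 𝕀 (Fin m) 𝕀 𝔽 m ∞ (fun g : G => bundleAct g
    p) := fun _ => contMDiffAt_prodMk contMDiffAt_const (contMDiffAt_id.mul contMDiffAt_const)

lemma dProj_act (g : G) (p : U × G) (v : ℝ^(𝔽 m)) : dProj (bundleAct g p) (tder 𝔽 m 𝔽 m (bundleAct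
    g) p v) = dProj p v := (tder_comp (g := (bundleProj : U × G → M)) (contMDiff_bundleProj _)
    (contMDiff_bundleAct_left g p) v).symm

lemma dFibre_act (g : G) (p : U × G) (v : ℝ^(𝔽 m)) : dFibre (bundleAct g p) (tder 𝔽 m 𝔽 m (bundleAct
    g) p v) = tder (Fin m) (Fin m) (fun y : G => g * y) p.2 (dFibre p v) := (tder_comp (g :=
    (Prod.snd : U × G → G)) (smooth_snd _) (contMDiff_bundleAct_left g p) v).symm.trans (tder_comp
    (g := fun y : G => g * y) (f := (Prod.snd : U × G → G)) (contMDiff_const.mul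
    contMDiff_id).contMDiffAt (smooth_snd p) v)

lemma bundleConn_act (k : Fin m) (g : G) (p : U × G) (v : ℝ^(𝔽 m)) : bundleConn b a k (bundleAct g
    p) (tder 𝔽 m 𝔽 m (bundleAct g) p v) = bundleConn b a k p v := by
  rw [bundleConn_apply, bundleConn_apply, dProj_act, dFibre_act]
  exact congrArg _ (maurerCartan_mul b k g p.2 _)

/-- The derivative of the orbit map. -/
def bundleKill (c : ℝ^(Fin m)) (p : U × G) : 𝔽 m → ℝ :=
  tder (Fin m) 𝔽 m (fun g : G => bundleAct g p) 1 c

lemma dProj_kill (c : ℝ^(Fin m)) (p : U × G) : dProj (bundleAct 1 p) (bundleKill c p) = 0 :=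
  (tder_comp (g := (bundleProj : U × G → M)) (f := fun g : G => bundleAct g p) (contMDiff_bundleProj
  _) (contMDiff_bundleAct_right p 1) c).symm.trans (DFunLike.congr_fun (tder_const (ι := Fin m) (κ
  := Fin 3) (p.1 : M) (1 : G)) c)

lemma bundleConn_kill (k : Fin m) (c : ℝ^(Fin m)) (p : U × G) : bundleConn b a k (bundleAct 1 p)
    (bundleKill c p) = b.coord k c := by
  have h0 : (a k (bundleProj (bundleAct 1 p)) : ℝ^(Fin 3) →ₗ[ℝ] ℝ) 0 = 0 := map_zero _
  have h1 : dFibre (bundleAct 1 p) (bundleKill c p) = translate p.2 c := (tder_comp (g := (Prod.snd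
    : U × G → G)) (f := fun g : G => bundleAct g p) (smooth_snd _) (contMDiff_bundleAct_right p 1)
    c).symm
  have h2 : maurerCartan b k (1 * p.2) (translate p.2 c) = b.coord k c := by
    rw [one_mul, maurerCartan_translate]
  rw [bundleConn_apply, dProj_kill, h1]
  exact (congrArg₂ (· + ·) h0 h2).trans (zero_add _)

lemma bundleBil_kill (c : ℝ^(Fin m)) (p : U × G) (v : ℝ^(𝔽 m)) : bundleBil b D a (bundleAct 1 p)
    (bundleKill c p) v = ∑ k, ∑ l, D.xi (bundleProj p) k l * (b.coord k c * bundleConn b a l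
    (bundleAct 1 p) v) := by
  rw [bundleBil_apply, dProj_kill, map_zero, LinearMap.zero_apply, zero_add]
  simp only [bundleConn_kill]
  rfl

lemma bundleBil_kill_kill (c c' : ℝ^(Fin m)) (p : U × G) : bundleBil b D a (bundleAct 1 p)
    (bundleKill c p) (bundleKill c' p) = ∑ k, ∑ l, D.xi (bundleProj p) k l * (b.coord k c * b.coord
    l c') := by
  rw [bundleBil_kill]
  simp only [bundleConn_kill]

lemma bundleAct_one (p : U × G) : bundleAct 1 p = p := Prod.ext rfl (one_mul _)

variable [T2Space M] [SecondCountableTopology M] [T2Space G] [SecondCountableTopology G]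

variable (b D) in
/-- The symmetric spacetime over `U` with potentials `a`. -/
def bundleSpacetime (ha : ∀ k, IsPotentialOn (U : Set M) (a k) (D.F k)) :
    SymmetricSpacetime m G M where
  P := U × G
  met := bundleMetric b D ha
  act := bundleAct
  act_one := bundleAct_one
  act_mul g h p := Prod.ext rfl (mul_assoc _ _ _)
  act_free g p h := mul_eq_right.1 (congrArg Prod.snd h)
  act_smooth := contMDiff_bundleAct
  act_isometry g p v w := by
    refine (bundleBil_apply (bundleAct g p) (tder _ _ (bundleAct g) p v)
      (tder _ _ (bundleAct g) p w)).trans (Eq.trans ?_ (bundleBil_apply p v w).symm)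
    refine congrArg₂ (· + ·) ?_ (sum_ext₂ fun k l =>
      congrArg₂ (· * ·) rfl (congrArg₂ (· * ·) (bundleConn_act k g p v) (bundleConn_act l g p w)))
    exact congrArg₂ (fun V W => baseBil D (bundleProj p) V W) (dProj_act g p v) (dProj_act g p w)
  spacelike p c hc := by
    refine lt_of_lt_of_eq (sum_xi_pos D (bundleProj p) (c := fun k => b.coord k c) fun h => hc ?_)
      (bundleBil_kill_kill c c p).symm
    exact b.ext_elem fun k => (congrFun h k).trans (by simp)
  proj := bundleProj
  proj_smooth := contMDiff_bundleProj
  proj_submersion p V := (exists_horizontal b a p V).imp fun v hv => hv.1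
  proj_eq_iff p q := by
    refine ⟨fun h => ⟨q.2 * p.2⁻¹, Prod.ext (Subtype.ext h) (inv_mul_cancel_right _ _)⟩, ?_⟩
    rintro ⟨g, rfl⟩
    rfl

end

section

open TopologicalSpace

variable {U : Opens M} {a : Fin m → OneForm (Fin 3) M}

lemma bundleBil_basis (k : Fin m) (p : U × G) (v : ℝ^(𝔽 m)) : bundleBil b D a p (bundleKill (b k :
    ℝ^(Fin m)) p) v = (D.xi (bundleProj p) *ᵥ fun l => bundleConn b a l p v) k := by
  have h := bundleBil_kill (D := D) (a := a) (b := b) (b k : ℝ^(Fin m)) p v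
  have h1 : ∀ k', b.coord k' (b k : ℝ^(Fin m)) = if k = k' then 1 else 0 := fun k' => by
    refine (b.coord_apply k' (b k)).trans ?_
    rw [Module.Basis.repr_self, Finsupp.single_apply]
  rw [bundleAct_one] at h
  simp only [h1] at h
  simpa [mulVec, dotProduct] using h

variable [T2Space M] [SecondCountableTopology M] [T2Space G] [SecondCountableTopology G] {ha : ∀ k,
  IsPotentialOn (U : Set M) (a k) (D.F k)}

lemma bundleSpacetime_gram (p : (bundleSpacetime b D ha).P) : (bundleSpacetime b D ha).gram b p =
    D.xi ((bundleSpacetime b D ha).proj p) := by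
  ext k l
  refine (bundleBil_basis (D := D) (a := a) (b := b) k p (bundleKill (b l : ℝ^(Fin m)) p)).trans ?_
  have h1 : ∀ k', bundleConn (U := U) b a k' p (bundleKill (b l : ℝ^(Fin m)) p) = if l = k' then 1
      else 0 := fun k' => by
    have h := bundleConn_kill (U := U) (a := a) (b := b) k' (b l : ℝ^(Fin m)) p
    rw [bundleAct_one (U := U) p] at h
    refine h.trans ((b.coord_apply k' (b l)).trans ?_)
    rw [Module.Basis.repr_self, Finsupp.single_apply]
  simp only [h1, mulVec, dotProduct]
  simp
  rfl

lemma bundleSpacetime_connection (k : Fin m) : (bundleSpacetime b D ha).connection b k = bundleConn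
    b a k := by
  funext p
  refine LinearMap.ext fun v => ?_
  have hd : IsUnit (D.xi (bundleProj p)).det := (D.xi_posDef _).det_pos.ne'.isUnit
  have h : ((D.xi (bundleProj p))⁻¹ *ᵥ fun l => bundleBil b D a p (bundleKill (b l : ℝ^(Fin m)) p)
      v) k = bundleConn b a k p v := by
    rw [show (fun l => bundleBil b D a p (bundleKill (b l : ℝ^(Fin m)) p) v) = D.xi (bundleProj p)
      *ᵥ fun l => bundleConn b a l p v from funext fun l => bundleBil_basis l p v, mulVec_mulVec,
      minv_mul _ hd, one_mulVec]
  refine Eq.trans ?_ h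
  rw [SymmetricSpacetime.connection, bundleSpacetime_gram, LinearMap.sum_apply]
  rfl

lemma bundleConn_eq_zero {p : U × G} {v : ℝ^(𝔽 m)} (h : ∀ k, bundleBil b D a p (bundleKill (b k :
    ℝ^(Fin m)) p) v = 0) (k : Fin m) : bundleConn b a k p v = 0 := by
  have hd : (D.xi (bundleProj p)).det ≠ 0 := (D.xi_posDef _).det_pos.ne'
  exact congrFun (eq_zero_of_mulVec_eq_zero hd (funext fun k => (bundleBil_basis k p v).symm.trans
    (h k))) k

/-- The pull-back of a tensor field to the trivial bundle. -/
def bundlePullback (G : Type u) [TopologicalSpace G] [ChartedSpace ℝ^(Fin m) G]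
    (T : Tensor2 (Fin 3) M) : Tensor2 𝔽 m (U × G) := fun p =>
  LinearMap.compl₁₂ (T (bundleProj p) : BilinForm ℝ ℝ^(Fin 3))
    (dProj p).toLinearMap (dProj p).toLinearMap

lemma bundleConn_isPotential (ha : ∀ k, IsPotentialOn (U : Set M) (a k) (D.F k)) (k : Fin m) :
    IsPotentialOn (ι := 𝔽 m) (M := U × G) Set.univ (bundleConn b a k) (bundlePullback G (D.F k)) :=
    by
  refine isPotentialOn_of_local fun p _ => ?_
  obtain ⟨e, Ψ, h, hp⟩ := exists_bundleChart b p
  have hz := Ψ.map_source hp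
  have hc : ∀ i, ∀ᶠ w in 𝓝 (Ψ p), comp1 (bundleConn b a k) Ψ i w = connComp a e k i w♭ := fun i =>
      by filter_upwards [Ψ.open_target.mem_nhds hz] with w hw using h.conn_eq hw k i
  have hs := fun i => (h.base_smooth hz ha).1 k i
  refine ⟨Ψ, h.mem, hp, fun i => ContDiffAt.congr_of_eventuallyEq (f := fun w => connComp a e k i
    w♭) (ContDiffAt.comp (g := connComp a e k i) (Ψ p) (hs i) smooth_base.contDiffAt) (hc i), ?_⟩
  have hU : e.symm (Ψ p)♭ ∈ (U : Set M) := h.proj_eq _ hz ▸ (Ψ.symm (Ψ p)).1.2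
  have hF := (ha k).extComp_eq h.base_mem (h.target _ hz) hU
  ext i j
  change pd i _ _ - pd j _ _ = _
  rw [pd_congr (hc i), pd_congr (hc j), pd_comp_castAdd (diffAt (hs i)), pd_comp_castAdd (diffAt (hs
    j))]
  refine Eq.trans ?_ (h.base_eq hz (T := D.F k) _ rfl i j).symm
  rw [baseComp, ← hF]
  simp +unfoldPartialApp only [connComp]
  refine addCases (fun α => ?_) (fun l => ?_) i <;> refine addCases (fun β => ?_) (fun l => ?_) j
    <;> simp only [addCases_left, addCases_right, pd_const, sub_zero, extComp, of_apply]

lemma bundleSpacetime_hasFields : (bundleSpacetime b D ha).HasFields b D where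
  xi_eq := bundleSpacetime_gram
  g_eq p v w hv _ := by
    refine (bundleBil_apply p v w).trans ?_
    simp only [bundleConn_eq_zero hv, zero_mul, mul_zero, sum_zero, add_zero]
    rfl
  F_eq k := by
    rw [bundleSpacetime_connection]
    exact bundleConn_isPotential ha k

theorem exists_vacuum_spacetime {o : OrientationForm M} {gt : LorentzMetric (Fin 3) M} {u : M →
    Target m} (b : LieBasis m G) (hC : Corresponds o D gt u) (hW : EinsteinWaveMap gt u) {V : Set M}
    (hV : IsOpen V) (ha : ∀ k, IsPotentialOn V (a k) (D.F k)) : ∃ S : SymmetricSpacetime m G M,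
    Set.range S.proj = V ∧ S.HasFields b D ∧ S.met.Vacuum := by
  have ha' : ∀ k, IsPotentialOn ((⟨V, hV⟩ : Opens M) : Set M) (a k) (D.F k) := ha
  refine ⟨bundleSpacetime b D ha', ?_, bundleSpacetime_hasFields, hW.vacuum
    bundleSpacetime_hasFields hC⟩
  ext x
  exact ⟨fun ⟨p, hp⟩ => hp ▸ p.1.2, fun hx => ⟨(⟨x, hx⟩, 1), rfl⟩⟩

end

end KaluzaKlein

end

theorem mainTheorem3 (m : ℕ)
    (G : Type u) [CommGroup G] [TopologicalSpace G] [ChartedSpace (Fin m → ℝ) G]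
    [LieGroup 𝓘(ℝ, Fin m → ℝ) ∞ G] [T2Space G] [SecondCountableTopology G]
    (b : Module.Basis (Fin m) ℝ (TangentSpace 𝓘(ℝ, Fin m → ℝ) (1 : G)))
    (M : Type u) [TopologicalSpace M] [T2Space M] [SecondCountableTopology M]
    [ChartedSpace (Fin 3 → ℝ) M] [IsManifold 𝓘(ℝ, Fin 3 → ℝ) ∞ M]
    (o : KaluzaKlein.OrientationForm M) :
    -- from the `d`-dimensional spacetime to the three-dimensional system
    (∀ S : KaluzaKlein.SymmetricSpacetime m G M, Function.Surjective S.proj →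
      ∃! D : KaluzaKlein.KKFields m M, S.HasFields b D) ∧
    (∀ (S : KaluzaKlein.SymmetricSpacetime m G M) (D : KaluzaKlein.KKFields m M),
      Function.Surjective S.proj → S.HasFields b D →
      (S.met.Vacuum → D.TwistClosed o) ∧
      ∀ (gt : KaluzaKlein.LorentzMetric (Fin 3) M) (u : M → KaluzaKlein.Target m),
        KaluzaKlein.Corresponds o D gt u →
        (S.met.Vacuum ↔ KaluzaKlein.EinsteinWaveMap gt u)) ∧
    -- from the three-dimensional system to the `d`-dimensional spacetime
    (∀ (gt : KaluzaKlein.LorentzMetric (Fin 3) M) (u : M → KaluzaKlein.Target m),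
      ContMDiff 𝓘(ℝ, Fin 3 → ℝ) 𝓘(ℝ, KaluzaKlein.Target m) ∞ u →
      (∀ x, (u x).xi.PosDef) →
      (∀ x, (u x).X = (1 / 2) * Real.log (u x).xi.det) →
      KaluzaKlein.EinsteinWaveMap gt u →
      ∃ D : KaluzaKlein.KKFields m M, KaluzaKlein.Corresponds o D gt u ∧
        (∀ D' : KaluzaKlein.KKFields m M, KaluzaKlein.Corresponds o D' gt u → D' = D) ∧
        (∀ x : M, ∃ U : Set M, IsOpen U ∧ x ∈ U ∧
          ∃ a : Fin m → KaluzaKlein.OneForm (Fin 3) M,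
            ∀ k, KaluzaKlein.IsPotentialOn U (a k) (D.F k)) ∧
        (∀ U : Set M, IsOpen U → ∀ a : Fin m → KaluzaKlein.OneForm (Fin 3) M,
          (∀ k, KaluzaKlein.IsPotentialOn U (a k) (D.F k)) →
          ∃ S : KaluzaKlein.SymmetricSpacetime m G M,
            Set.range S.proj = U ∧ S.HasFields b D ∧ S.met.Vacuum)) := by
  refine ⟨fun S hS => KaluzaKlein.SymmetricSpacetime.existsUnique_hasFields b hS,
    fun S D hS hD => ⟨fun hV => KaluzaKlein.SymmetricSpacetime.twistClosed hS hD hV,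
      fun gt u hC => KaluzaKlein.SymmetricSpacetime.vacuum_iff_system hS hD hC⟩,
    fun gt u hu hxi hX hW => ?_⟩
  have hC := KaluzaKlein.corresponds_fieldsOf (o := o) (gt := gt) hu hxi hX
  exact ⟨_, hC, fun D' h' => hC.unique h',
    hC.exists_potential hW,
    fun U hU a ha => KaluzaKlein.exists_vacuum_spacetime b hC hW hU ha⟩
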